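/- **Model.** A program runs on a deterministic unit-cost random-access machine whose words are natural numbers, with addition, truncated subtraction and comparison. Its private memory consists of a constant number of registers; its outsourced memory is an unbounded array of cells. It is *data-oblivious* if its sequence of accesses (reads and writes, with their addresses) to the outsourced memory depends only on the public size parameters, and not on the initial contents of the memory. Let $\mbox{o-sort}:\mathbb N\to\mathbb N$ be a function such that some data-oblivious program sorts $N$ items (a key, with a word attached to it) in at most $\mbox{o-sort}(N)$ steps for every $N\ge 1$, and suppose, as is usual for such time bounds, that $\mbox{o-sort}(a)+\mbox{o-sort}(b)\le \mbox{o-sort}(a+b)$ for all $a,b\ge 1$. **Cuckoo hashing.** Given $n$ distinct items $x_1,\dots,x_n$ (positive integers) with hash values $h_1(x_i),h_2(x_i)\in\{0,\dots,m-1\}$, a two-table cuckoo hashing scheme with a stash of size $s$ consists of two tables $T_1,T_2$ of $m$ cells each and a stash of $s$ cells. It holds each item exactly once, $x_i$ being at $T_1[h_1(x_i)]$, at $T_2[h_2(x_i)]$ or in the stash, at most one item per cell, and all the other cells are empty. A stash of size $s$ is *sufficient* for given hash values if such a scheme exists. **Theorem.** Fix $0<\varepsilon<1$ and an integer $K$.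 There are a single program and a constant $C$ such that for all $n\ge1$, all $m$ with $n\le(1-\varepsilon)m$ and $m\le Kn$ (so that the tables have size $O(n)$), and all $s\ge 0$ the following holds. 1. On public parameters $(n,m,s)$, the program is data-oblivious and halts within $C\cdot\mbox{o-sort}(n+s)$ steps, whatever the contents of the memory. 2. Let the $n$ pairs of hash values be independent and uniformly distributed in $\{0,\dots,m-1\}^2$. With very high probability, the hash values are such that, for every $s$ for which a stash of size $s$ is sufficient and for all $n$ distinct items with these hash values, the program outputs a two-table cuckoo hashing scheme for them with a stash of size $s$. Here "with very high probability" means that for every integer $\alpha\ge0$ there is a constant $D$ such that the probability of failure is at most $D/n^{\alpha}$ for all such $n$ and $m$. -/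

import Mathlib

/-! ## Random-access machine with a constant-size private memory

The machine is a random-access machine whose instructions have unit cost. Its *private* memory consists
of the registers named in the program text (finitely many, independently of the input), its
*outsourced* memory is an unbounded array of words. Only accesses to the outsourced memory are visible.
Words are natural numbers and the available arithmetic is addition, truncated subtraction and
comparison. Programs are written with structured control flow. -/

/-- Programs; arguments of type `ℕ` are names of registers, except for the value `k` of `const`. -/
inductive Cmd : Type
  /-- do nothing -/
  | skip : Cmd
  /-- `r_d := k` -/
  | const (d k : ℕ) : Cmd
  /-- `r_d := r_a` -/
  | copy (d a : ℕ) : Cmd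
  /-- `r_d := r_a + r_b` -/
  | add (d a b : ℕ) : Cmd
  /-- `r_d := r_a - r_b`, truncated at zero -/
  | sub (d a b : ℕ) : Cmd
  /-- `r_d := M[r_a]` -/
  | load (d a : ℕ) : Cmd
  /-- `M[r_a] := r_v` -/
  | store (a v : ℕ) : Cmd
  /-- sequential composition -/
  | seq (c₁ c₂ : Cmd) : Cmd
  /-- if `r_a < r_b` then `c₁` else `c₂` -/
  | cond (a b : ℕ) (c₁ c₂ : Cmd) : Cmd
  /-- while `r_a < r_b` do `c` -/
  | loop (a b : ℕ) (c : Cmd) : Cmd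

/-- A configuration: contents of the private registers and of the outsourced memory. -/
structure Config : Type where
  reg : ℕ → ℕ
  mem : ℕ → ℕ

/-- The configuration after writing `v` to register `d`. -/
def Config.setReg (σ : Config) (d v : ℕ) : Config :=
  { reg := Function.update σ.reg d v, mem := σ.mem }

/-- The configuration after writing `v` to the memory cell with address `a`. -/
def Config.setMem (σ : Config) (a v : ℕ) : Config :=
  { reg := σ.reg, mem := Function.update σ.mem a v }

/-- What an observer of the outsourced memory sees of a single access. -/
inductive Access : Type
  | read (addr : ℕ) : Access
  | write (addr : ℕ) : Access

/-- `Exec c σ τ t σ'`: started in `σ`, the program `c` halts in `σ'` after exactly `t` steps, and `τ` is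
the sequence of its accesses to the outsourced memory. -/
inductive Exec : Cmd → Config → List Access → ℕ → Config → Prop
  | skip (σ : Config) : Exec Cmd.skip σ [] 1 σ
  | const (σ : Config) (d k : ℕ) : Exec (Cmd.const d k) σ [] 1 (σ.setReg d k)
  | copy (σ : Config) (d a : ℕ) : Exec (Cmd.copy d a) σ [] 1 (σ.setReg d (σ.reg a))
  | add (σ : Config) (d a b : ℕ) :
      Exec (Cmd.add d a b) σ [] 1 (σ.setReg d (σ.reg a + σ.reg b))
  | sub (σ : Config) (d a b : ℕ) :
      Exec (Cmd.sub d a b) σ [] 1 (σ.setReg d (σ.reg a - σ.reg b))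
  | load (σ : Config) (d a : ℕ) :
      Exec (Cmd.load d a) σ [Access.read (σ.reg a)] 1 (σ.setReg d (σ.mem (σ.reg a)))
  | store (σ : Config) (a v : ℕ) :
      Exec (Cmd.store a v) σ [Access.write (σ.reg a)] 1 (σ.setMem (σ.reg a) (σ.reg v))
  | seq {σ σ₁ σ₂ : Config} {c₁ c₂ : Cmd} {τ₁ τ₂ : List Access} {t₁ t₂ : ℕ}
      (h₁ : Exec c₁ σ τ₁ t₁ σ₁) (h₂ : Exec c₂ σ₁ τ₂ t₂ σ₂) :
      Exec (Cmd.seq c₁ c₂) σ (τ₁ ++ τ₂) (t₁ + t₂) σ₂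
  | cond_true {σ σ₁ : Config} {a b : ℕ} {c₁ c₂ : Cmd} {τ : List Access} {t : ℕ}
      (hab : σ.reg a < σ.reg b) (h : Exec c₁ σ τ t σ₁) :
      Exec (Cmd.cond a b c₁ c₂) σ τ (t + 1) σ₁
  | cond_false {σ σ₁ : Config} {a b : ℕ} {c₁ c₂ : Cmd} {τ : List Access} {t : ℕ}
      (hab : ¬ σ.reg a < σ.reg b) (h : Exec c₂ σ τ t σ₁) :
      Exec (Cmd.cond a b c₁ c₂) σ τ (t + 1) σ₁
  | loop_done {σ : Config} {a b : ℕ} {c : Cmd} (hab : ¬ σ.reg a < σ.reg b) :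
      Exec (Cmd.loop a b c) σ [] 1 σ
  | loop_step {σ σ₁ σ₂ : Config} {a b : ℕ} {c : Cmd} {τ₁ τ₂ : List Access} {t₁ t₂ : ℕ}
      (hab : σ.reg a < σ.reg b) (h₁ : Exec c σ τ₁ t₁ σ₁)
      (h₂ : Exec (Cmd.loop a b c) σ₁ τ₂ t₂ σ₂) :
      Exec (Cmd.loop a b c) σ (τ₁ ++ τ₂) (t₁ + t₂ + 1) σ₂

/-- On the class `S` of initial configurations (those that agree in the public size parameters), the
program `c` halts within `t` steps and is data-oblivious: its access sequence is the same for all of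
them. (The machine is deterministic, so that equality of the distributions of the access sequence is
equality of access sequences.) -/
def ObliviousWithin (c : Cmd) (S : Set Config) (t : ℕ) : Prop :=
  ∃ τ : List Access, ∀ σ ∈ S, ∃ t' ≤ t, ∃ σ' : Config, Exec c σ τ t' σ'

/-! ## Data-oblivious sorting -/

/-- Configurations with public size parameter `N` (in register 0); nothing is assumed about the
contents of the memory and of the other registers. -/
def sortConfigs (N : ℕ) : Set Config := {σ | σ.reg 0 = N}

/-- `P` is a data-oblivious program that sorts `N` items in time at most `T N`, for all `N ≥ 1`.
Item `i < N` consists of a key, in cell `i`, and a word that travels with the key, in cell `N + i`. -/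
def IsObliviousSort (P : Cmd) (T : ℕ → ℕ) : Prop :=
  ∀ N : ℕ, 1 ≤ N →
    ObliviousWithin P (sortConfigs N) (T N) ∧
    ∀ σ ∈ sortConfigs N, ∃ τ t σ', Exec P σ τ t σ' ∧
      (∀ i j : Fin N, i ≤ j → σ'.mem i ≤ σ'.mem j) ∧
      ∃ π : Equiv.Perm (Fin N), ∀ i : Fin N,
        σ'.mem i = σ.mem (π i) ∧ σ'.mem (N + i) = σ.mem (N + π i)

/-! ## Two-table cuckoo hashing with a stash -/

/-- The cells of a scheme with two tables of `m` cells each and a stash of size `s`. -/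
inductive Cell (m s : ℕ) : Type
  | table₁ (j : Fin m) : Cell m s
  | table₂ (j : Fin m) : Cell m s
  | stash (k : Fin s) : Cell m s

/-- Hash values of `n` items: `(h i).1` is the value of the first hash function at item `i` and
`(h i).2` the value of the second one. -/
abbrev HashValues (n m : ℕ) : Type := Fin n → Fin m × Fin m

/-- `loc` assigns to each of the `n` items its own cell, which is one of the two cells given by the
hash values of the item, or a cell of the stash. -/
def IsPlacement {n m s : ℕ} (h : HashValues n m) (loc : Fin n → Cell m s) : Prop :=
  Function.Injective loc ∧
    ∀ i : Fin n, loc i = Cell.table₁ (h i).1 ∨ loc i = Cell.table₂ (h i).2 ∨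
      ∃ k : Fin s, loc i = Cell.stash k

/-- A stash of size `s` is sufficient for the given hash values. -/
def StashSuffices {n m : ℕ} (h : HashValues n m) (s : ℕ) : Prop :=
  ∃ loc : Fin n → Cell m s, IsPlacement h loc

/-- `contents` is a cuckoo hashing scheme that stores the items `x` (positive numbers): it holds every
item exactly once, at an admissible cell, and all the other cells are empty (hold `0`). -/
def IsCuckooScheme {n m s : ℕ} (x : Fin n → ℕ) (h : HashValues n m) (contents : Cell m s → ℕ) :
    Prop :=
  ∃ loc : Fin n → Cell m s, IsPlacement h loc ∧ (∀ i, contents (loc i) = x i) ∧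
    ∀ c, c ∉ Set.range loc → contents c = 0

/-- Standard layout of a scheme in memory: first table, second table, stash. -/
def Cell.addr {m s : ℕ} : Cell m s → ℕ
  | Cell.table₁ j => j
  | Cell.table₂ j => m + j
  | Cell.stash k => 2 * m + k

/-- Configurations with public size parameters `n`, `m`, `s` (in registers 0, 1, 2). -/
def cuckooConfigs (n m s : ℕ) : Set Config := {σ | σ.reg 0 = n ∧ σ.reg 1 = m ∧ σ.reg 2 = s}

/-- `σ` holds the items `x` in the cells `0, …, n - 1`, followed by their first and by their second
hash values. -/
def HoldsInput {n m : ℕ} (σ : Config) (x : Fin n → ℕ) (h : HashValues n m) : Prop :=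
  ∀ i : Fin n, σ.mem i = x i ∧ σ.mem (n + i) = (h i).1 ∧ σ.mem (2 * n + i) = (h i).2

/-- For the hash values `h`, the program `Q` constructs a cuckoo hashing scheme with a stash of size `s`
whenever this size is sufficient: for every `s` and all `n` distinct items with these hash values. -/
def ConstructsScheme (Q : Cmd) {n m : ℕ} (h : HashValues n m) : Prop :=
  ∀ s : ℕ, StashSuffices h s →
    ∀ x : Fin n → ℕ, Function.Injective x → (∀ i, 0 < x i) →
      ∀ σ ∈ cuckooConfigs n m s, HoldsInput σ x h →
        ∃ τ t σ', Exec Q σ τ t σ' ∧ IsCuckooScheme x h (fun c : Cell m s => σ'.mem c.addr)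

/-- Probability of an event under the uniform distribution on a finite set. -/
noncomputable def uniformProb {Ω : Type*} [Fintype Ω] (E : Set Ω) : ℝ :=
  (E.ncard : ℝ) / (Fintype.card Ω : ℝ)

set_option linter.constructorNameAsVariable false

namespace ObliviousCuckoo

/-! ### Elementary facts about the machine -/

theorem _root_.Exec.one_le {c : Cmd} {σ σ' : Config} {τ : List Access} {t : ℕ} (h : Exec c σ τ t σ') :
    1 ≤ t := by
  induction h <;> omega

/-! ### A small language on top of the machine -/

/-- Names of public variables. -/
inductive PV : Type
  | n | m | s | base | N | i | j | p | q | L | a | b | h | c | o | z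
  deriving DecidableEq

/-- Names of secret variables. -/
inductive SV : Type
  | t | x | y | f | g | k | w | r | u | v | o | q | d | e | ch | cnt
  deriving DecidableEq

/-- Names of arrays in the outsourced memory. -/
inductive AV : Type
  | P | X | H₁ | H₂ | T | F₁ | F₂ | R
  deriving DecidableEq

def PV.idx : PV → ℕ
  | n => 0 | m => 1 | s => 2 | base => 3 | N => 4 | i => 5 | j => 6 | p => 7 | q => 8 | L => 9
  | a => 10 | b => 11 | h => 12 | c => 13 | o => 14 | z => 15

def SV.idx : SV → ℕ
  | t => 16 | x => 17 | y => 18 | f => 19 | g => 20 | k => 21 | w => 22 | r => 23 | u => 24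
  | v => 25 | o => 26 | q => 27 | d => 28 | e => 29 | ch => 30 | cnt => 31

def AV.idx : AV → ℕ
  | P => 0 | X => 1 | H₁ => 2 | H₂ => 3 | T => 4 | F₁ => 5 | F₂ => 6 | R => 7

theorem PV.idx_injective : Function.Injective PV.idx := by
  intro a b h; cases a <;> cases b <;> first | rfl | (simp [PV.idx] at h)

theorem SV.idx_injective : Function.Injective SV.idx := by
  intro a b h; cases a <;> cases b <;> first | rfl | (simp [SV.idx] at h)

theorem AV.idx_injective : Function.Injective AV.idx := by
  intro a b h; cases a <;> cases b <;> first | rfl | (simp [AV.idx] at h)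

theorem PV.idx_lt (v : PV) : v.idx < 16 := by cases v <;> simp [PV.idx]

theorem SV.le_idx (v : SV) : 16 ≤ v.idx := by cases v <;> simp [SV.idx]

theorem SV.idx_lt (v : SV) : v.idx < 32 := by cases v <;> simp [SV.idx]

theorem AV.idx_lt (v : AV) : v.idx < 8 := by cases v <;> simp [AV.idx]

/-- Public expressions: a constant plus a sum of public variables. -/
structure PE : Type where
  k : ℕ
  ps : List PV

/-- Secret expressions: a constant plus a sum of public and of secret variables. -/
structure SE : Type where
  k : ℕ
  ps : List PV
  ss : List SV

def PE.ev (p : PV → ℕ) (e : PE) : ℕ := e.k + (e.ps.map p).sum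

def SE.ev (p : PV → ℕ) (s : SV → ℕ) (e : SE) : ℕ := e.k + ((e.ps.map p).sum + (e.ss.map s).sum)

/-- Computations on secret variables, without access to the outsourced memory. -/
inductive SC : Type
  | skip : SC
  | set (d : SV) (e : SE) : SC
  | sub (d : SV) (e₁ e₂ : SE) : SC
  | seq (c₁ c₂ : SC) : SC
  | ite (e₁ e₂ : SE) (c₁ c₂ : SC) : SC

/-- Oblivious programs: control flow and addresses depend on public variables only. -/
inductive HL : Type
  | pset (d : PV) (e : PE) : HL
  | psub (d : PV) (e₁ e₂ : PE) : HL
  | sc (c : SC) : HL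
  | load (d : SV) (A : AV) (e : PE) : HL
  | store (A : AV) (e : PE) (v : SE) : HL
  | rload (d : SV) (e : PE) : HL
  | rstore (e : PE) (v : SE) : HL
  | sort (N : PV) : HL
  | seq (c₁ c₂ : HL) : HL
  | pif (e₁ e₂ : PE) (c₁ c₂ : HL) : HL
  | loop (k N : PV) (c : HL) : HL

/-- States of oblivious programs: the raw memory consists of the cells below `base`, the arrays are
interleaved above it. -/
structure St : Type where
  base : ℕ
  pub : PV → ℕ
  sec : SV → ℕ
  preg : ℕ → ℕ
  raw : ℕ → ℕ
  arr : AV → ℕ → ℕ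

namespace St

def setp (σ : St) (d : PV) (v : ℕ) : St := { σ with pub := Function.update σ.pub d v }
def sets (σ : St) (d : SV) (v : ℕ) : St := { σ with sec := Function.update σ.sec d v }
def setr (σ : St) (a v : ℕ) : St := { σ with raw := Function.update σ.raw a v }
def seta (σ : St) (A : AV) (a v : ℕ) : St :=
  { σ with arr := fun A' a' => if A' = A ∧ a' = a then v else σ.arr A' a' }

variable (σ : St) (d d' : PV) (x x' : SV) (A A' : AV) (a a' v : ℕ)

@[simp] theorem setp_pub : (σ.setp d v).pub d' = if d' = d then v else σ.pub d' := by
  simp [setp, Function.update_apply]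
@[simp] theorem setp_sec : (σ.setp d v).sec = σ.sec := rfl
@[simp] theorem setp_raw : (σ.setp d v).raw = σ.raw := rfl
@[simp] theorem setp_arr : (σ.setp d v).arr = σ.arr := rfl
@[simp] theorem setp_base : (σ.setp d v).base = σ.base := rfl
@[simp] theorem sets_sec : (σ.sets x v).sec x' = if x' = x then v else σ.sec x' := by
  simp [sets, Function.update_apply]
@[simp] theorem sets_pub : (σ.sets x v).pub = σ.pub := rfl
@[simp] theorem sets_raw : (σ.sets x v).raw = σ.raw := rfl
@[simp] theorem sets_arr : (σ.sets x v).arr = σ.arr := rfl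
@[simp] theorem sets_base : (σ.sets x v).base = σ.base := rfl
@[simp] theorem setr_raw : (σ.setr a v).raw a' = if a' = a then v else σ.raw a' := by
  simp [setr, Function.update_apply]
@[simp] theorem setr_pub : (σ.setr a v).pub = σ.pub := rfl
@[simp] theorem setr_sec : (σ.setr a v).sec = σ.sec := rfl
@[simp] theorem setr_arr : (σ.setr a v).arr = σ.arr := rfl
@[simp] theorem setr_base : (σ.setr a v).base = σ.base := rfl
@[simp] theorem seta_arr :
    (σ.seta A a v).arr A' a' = if A' = A ∧ a' = a then v else σ.arr A' a' := rfl
@[simp] theorem seta_pub : (σ.seta A a v).pub = σ.pub := rfl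
@[simp] theorem seta_sec : (σ.seta A a v).sec = σ.sec := rfl
@[simp] theorem seta_raw : (σ.seta A a v).raw = σ.raw := rfl
@[simp] theorem seta_base : (σ.seta A a v).base = σ.base := rfl

end St

open Classical in
/-- The final configuration of a halting program. -/
noncomputable def finalConfig (P : Cmd) (v : Config) : Config :=
  if h : ∃ v' τ t, Exec P v τ t v' then h.choose else v

/-- The effect of a call of the sorting program on the first array. -/
noncomputable def St.sort (P : Cmd) (σ : St) (N : ℕ) : St :=
  if 0 < N then
    let r := finalConfig P { reg := Function.update σ.preg 0 N, mem := σ.arr AV.P }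
    { σ with preg := r.reg, arr := Function.update σ.arr AV.P r.mem }
  else σ

@[simp] theorem St.sort_pub (P : Cmd) (σ : St) (N : ℕ) : (σ.sort P N).pub = σ.pub := by
  unfold St.sort; split_ifs <;> rfl
@[simp] theorem St.sort_sec (P : Cmd) (σ : St) (N : ℕ) : (σ.sort P N).sec = σ.sec := by
  unfold St.sort; split_ifs <;> rfl
@[simp] theorem St.sort_raw (P : Cmd) (σ : St) (N : ℕ) : (σ.sort P N).raw = σ.raw := by
  unfold St.sort; split_ifs <;> rfl
@[simp] theorem St.sort_base (P : Cmd) (σ : St) (N : ℕ) : (σ.sort P N).base = σ.base := by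
  unfold St.sort; split_ifs <;> rfl
theorem St.sort_arr (P : Cmd) (σ : St) (N : ℕ) (A : AV) (hA : A ≠ AV.P) :
    (σ.sort P N).arr A = σ.arr A := by
  unfold St.sort; split_ifs
  · simp [Function.update_of_ne hA]
  · rfl

def SC.run (p : PV → ℕ) : SC → (SV → ℕ) → SV → ℕ
  | skip, s => s
  | set d e, s => Function.update s d (e.ev p s)
  | sub d e₁ e₂, s => Function.update s d (e₁.ev p s - e₂.ev p s)
  | seq c₁ c₂, s => c₂.run p (c₁.run p s)
  | ite e₁ e₂ c₁ c₂, s => if e₁.ev p s < e₂.ev p s then c₁.run p s else c₂.run p s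

namespace HL

noncomputable def run (P : Cmd) : HL → St → St
  | pset d e, σ => σ.setp d (e.ev σ.pub)
  | psub d e₁ e₂, σ => σ.setp d (e₁.ev σ.pub - e₂.ev σ.pub)
  | sc c, σ => { σ with sec := c.run σ.pub σ.sec }
  | load d A e, σ => σ.sets d (σ.arr A (e.ev σ.pub))
  | store A e v, σ => σ.seta A (e.ev σ.pub) (v.ev σ.pub σ.sec)
  | rload d e, σ => if e.ev σ.pub < σ.base then σ.sets d (σ.raw (e.ev σ.pub)) else σ
  | rstore e v, σ =>
      if e.ev σ.pub < σ.base then σ.setr (e.ev σ.pub) (v.ev σ.pub σ.sec) else σ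
  | sort N, σ => σ.sort P (σ.pub N)
  | seq c₁ c₂, σ => c₂.run P (c₁.run P σ)
  | pif e₁ e₂ c₁ c₂, σ => if e₁.ev σ.pub < e₂.ev σ.pub then c₁.run P σ else c₂.run P σ
  | loop k N c, σ =>
      (fun σ => (c.run P σ).setp k ((c.run P σ).pub k + 1))^[σ.pub N] (σ.setp k 0)

/-- The effect on the public variables. -/
def prun : HL → (PV → ℕ) → PV → ℕ
  | pset d e, p => Function.update p d (e.ev p)
  | psub d e₁ e₂, p => Function.update p d (e₁.ev p - e₂.ev p)
  | sc _, p => p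
  | load _ _ _, p => p
  | store _ _ _, p => p
  | rload _ _, p => p
  | rstore _ _, p => p
  | sort _, p => p
  | seq c₁ c₂, p => c₂.prun (c₁.prun p)
  | pif e₁ e₂ c₁ c₂, p => if e₁.ev p < e₂.ev p then c₁.prun p else c₂.prun p
  | loop k N c, p =>
      (fun p => Function.update (c.prun p) k (c.prun p k + 1))^[p N] (Function.update p k 0)

theorem run_pub (P : Cmd) (c : HL) (σ : St) : (c.run P σ).pub = c.prun σ.pub := by
  induction c generalizing σ with
  | rload d e => simp only [run, prun]; split_ifs <;> rfl
  | rstore e v => simp only [run, prun]; split_ifs <;> rfl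
  | sort N => simp [run, prun]
  | seq c₁ c₂ h₁ h₂ => simp [run, prun, h₁, h₂]
  | pif e₁ e₂ c₁ c₂ h₁ h₂ => simp only [run, prun]; split_ifs <;> simp [h₁, h₂]
  | loop k N c h =>
    simp only [run, prun]
    generalize σ.pub N = d
    have : ∀ σ : St, ((fun σ => (c.run P σ).setp k ((c.run P σ).pub k + 1))^[d] σ).pub =
        (fun p => Function.update (c.prun p) k (c.prun p k + 1))^[d] σ.pub := by
      induction d with
      | zero => simp
      | succ d ih =>
        intro σ
        rw [Function.iterate_succ_apply, Function.iterate_succ_apply, ih]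
        simp only [St.setp, h]
    exact this (σ.setp k 0)
  | _ => rfl

theorem run_base (P : Cmd) (c : HL) (σ : St) : (c.run P σ).base = σ.base := by
  induction c generalizing σ with
  | rload d e => simp only [run]; split_ifs <;> rfl
  | rstore e v => simp only [run]; split_ifs <;> rfl
  | sort N => simp [run]
  | seq c₁ c₂ h₁ h₂ => simp [run, h₁, h₂]
  | pif e₁ e₂ c₁ c₂ h₁ h₂ => simp only [run]; split_ifs <;> simp [h₁, h₂]
  | loop k N c h =>
    simp only [run]
    generalize σ.pub N = d
    have : ∀ σ : St,
        ((fun σ => (c.run P σ).setp k ((c.run P σ).pub k + 1))^[d] σ).base = σ.base := by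
      induction d with
      | zero => simp
      | succ d ih => intro σ; simp [ih, h]
    simpa using this (σ.setp k 0)
  | _ => rfl

/-- Public variables that a program may modify. -/
def pmods : HL → List PV
  | pset d _ => [d]
  | psub d _ _ => [d]
  | seq c₁ c₂ => c₁.pmods ++ c₂.pmods
  | pif _ _ c₁ c₂ => c₁.pmods ++ c₂.pmods
  | loop k _ c => k :: c.pmods
  | _ => []

theorem prun_of_notMem (c : HL) (p : PV → ℕ) (v : PV) (hv : v ∉ c.pmods) : c.prun p v = p v := by
  induction c generalizing p with
  | pset d e => simp [pmods] at hv; simp [prun, hv]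
  | psub d e₁ e₂ => simp [pmods] at hv; simp [prun, hv]
  | seq c₁ c₂ h₁ h₂ => simp [pmods] at hv; simp [prun, h₁, h₂, hv]
  | pif e₁ e₂ c₁ c₂ h₁ h₂ =>
    simp [pmods] at hv; simp only [prun]; split_ifs <;> simp [h₁, h₂, hv]
  | loop k N c h =>
    simp [pmods] at hv
    simp only [prun]
    generalize p N = d
    have : ∀ p : PV → ℕ,
        (fun p => Function.update (c.prun p) k (c.prun p k + 1))^[d] p v = p v := by
      induction d with
      | zero => simp
      | succ d ih => intro p; simp [ih, h, hv]
    simp [this, hv]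
  | _ => rfl

/-- Loop counters and loop bounds are not modified by the loop body. -/
def Wf : HL → Prop
  | seq c₁ c₂ => c₁.Wf ∧ c₂.Wf
  | pif _ _ c₁ c₂ => c₁.Wf ∧ c₂.Wf
  | loop k N c => c.Wf ∧ k ≠ N ∧ k ∉ c.pmods ∧ N ∉ c.pmods
  | _ => True

/-- Secret variables that a program may modify. -/
def _root_.ObliviousCuckoo.SC.mods : SC → List SV
  | .skip => []
  | .set d _ => [d]
  | .sub d _ _ => [d]
  | .seq c₁ c₂ => c₁.mods ++ c₂.mods
  | .ite _ _ c₁ c₂ => c₁.mods ++ c₂.mods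

theorem _root_.ObliviousCuckoo.SC.run_of_notMem (c : SC) (p : PV → ℕ) (s : SV → ℕ) (v : SV)
    (hv : v ∉ c.mods) : c.run p s v = s v := by
  induction c generalizing s with
  | skip => rfl
  | set d e => simp [SC.mods] at hv; simp [SC.run, hv]
  | sub d e₁ e₂ => simp [SC.mods] at hv; simp [SC.run, hv]
  | seq c₁ c₂ h₁ h₂ => simp [SC.mods] at hv; simp [SC.run, h₁, h₂, hv]
  | ite e₁ e₂ c₁ c₂ h₁ h₂ =>
    simp [SC.mods] at hv; simp only [SC.run]; split_ifs <;> simp [h₁, h₂, hv]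

def smods : HL → List SV
  | sc c => c.mods
  | load d _ _ => [d]
  | rload d _ => [d]
  | seq c₁ c₂ => c₁.smods ++ c₂.smods
  | pif _ _ c₁ c₂ => c₁.smods ++ c₂.smods
  | loop _ _ c => c.smods
  | _ => []

/-- Arrays that a program may modify. -/
def amods : HL → List AV
  | store A _ _ => [A]
  | sort _ => [AV.P]
  | seq c₁ c₂ => c₁.amods ++ c₂.amods
  | pif _ _ c₁ c₂ => c₁.amods ++ c₂.amods
  | loop _ _ c => c.amods
  | _ => []

/-- The program does not write to the raw memory. -/
def KeepsRaw : HL → Prop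
  | rstore _ _ => False
  | seq c₁ c₂ => c₁.KeepsRaw ∧ c₂.KeepsRaw
  | pif _ _ c₁ c₂ => c₁.KeepsRaw ∧ c₂.KeepsRaw
  | loop _ _ c => c.KeepsRaw
  | _ => True

theorem iterate_frame {β : Type*} (g : St → St) (F : St → β) (h : ∀ σ, F (g σ) = F σ) (d : ℕ)
    (σ : St) : F (g^[d] σ) = F σ := by
  induction d generalizing σ with
  | zero => rfl
  | succ d ih => simp [ih, h]

theorem run_sec_of_notMem (P : Cmd) (c : HL) (σ : St) (v : SV) (hv : v ∉ c.smods) :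
    (c.run P σ).sec v = σ.sec v := by
  induction c generalizing σ with
  | sc c => exact SC.run_of_notMem c _ _ v hv
  | load d A e => simp [smods] at hv; simp [run, hv]
  | rload d e => simp [smods] at hv; simp only [run]; split_ifs <;> simp [hv]
  | rstore e v => simp only [run]; split_ifs <;> rfl
  | sort N => simp [run]
  | seq c₁ c₂ h₁ h₂ => simp [smods] at hv; simp [run, h₁, h₂, hv]
  | pif e₁ e₂ c₁ c₂ h₁ h₂ =>
    simp [smods] at hv; simp only [run]; split_ifs <;> simp [h₁, h₂, hv]
  | loop k N c h =>
    simp [smods] at hv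
    simp only [run]
    rw [iterate_frame _ (fun σ => σ.sec v) (by intro σ; simp [h σ hv])]
    rfl
  | _ => rfl

theorem run_arr_of_notMem (P : Cmd) (c : HL) (σ : St) (A : AV) (hv : A ∉ c.amods) :
    (c.run P σ).arr A = σ.arr A := by
  induction c generalizing σ with
  | store A e v => simp [amods] at hv; funext a; simp [run, hv]
  | rload d e => simp only [run]; split_ifs <;> rfl
  | rstore e v => simp only [run]; split_ifs <;> rfl
  | sort N => simp [amods] at hv; simp [run, St.sort_arr, hv]
  | seq c₁ c₂ h₁ h₂ => simp [amods] at hv; simp [run, h₁, h₂, hv]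
  | pif e₁ e₂ c₁ c₂ h₁ h₂ =>
    simp [amods] at hv; simp only [run]; split_ifs <;> simp [h₁, h₂, hv]
  | loop k N c h =>
    simp [amods] at hv
    simp only [run]
    rw [iterate_frame _ (fun σ => σ.arr A) (by intro σ; simp [h σ hv])]
    rfl
  | _ => rfl

theorem run_raw (P : Cmd) (c : HL) (σ : St) (hv : c.KeepsRaw) :
    (c.run P σ).raw = σ.raw := by
  induction c generalizing σ with
  | rload d e => simp only [run]; split_ifs <;> rfl
  | rstore e v => exact hv.elim
  | sort N => simp [run]
  | seq c₁ c₂ h₁ h₂ => simp [KeepsRaw] at hv; simp [run, h₁, h₂, hv]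
  | pif e₁ e₂ c₁ c₂ h₁ h₂ =>
    simp [KeepsRaw] at hv; simp only [run]; split_ifs <;> simp [h₁, h₂, hv]
  | loop k N c h =>
    simp only [run]
    rw [iterate_frame _ (fun σ => σ.raw) (by intro σ; simp [h σ hv])]
    rfl
  | _ => rfl

/-- Induction over the passes of a loop. -/
theorem loop_induction (P : Cmd) {k N : PV} {c : HL} (hwf : (loop k N c).Wf) (σ : St)
    (I : ℕ → St → Prop) (h0 : I 0 (σ.setp k 0))
    (hstep : ∀ i < σ.pub N, ∀ σ', I i σ' → σ'.pub k = i →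
      (∀ v, v ≠ k → v ∉ c.pmods → σ'.pub v = σ.pub v) →
      I (i + 1) ((c.run P σ').setp k (i + 1))) :
    I (σ.pub N) ((loop k N c).run P σ) := by
  obtain ⟨-, hkN, hk, hN⟩ := hwf
  have key : ∀ d ≤ σ.pub N,
      let σ' := (fun σ => (c.run P σ).setp k ((c.run P σ).pub k + 1))^[d] (σ.setp k 0)
      I d σ' ∧ σ'.pub k = d ∧ (∀ v, v ≠ k → v ∉ c.pmods → σ'.pub v = σ.pub v) := by
    intro d
    induction d with
    | zero => intro _; refine ⟨h0, by simp, ?_⟩; intro v hv _; simp [hv]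
    | succ d ih =>
      intro hd
      obtain ⟨h1, h2, h3⟩ := ih (by omega)
      rw [Function.iterate_succ_apply']
      set σ' := (fun σ => (c.run P σ).setp k ((c.run P σ).pub k + 1))^[d] (σ.setp k 0)
      have hk' : (c.run P σ').pub k = d := by rw [run_pub, prun_of_notMem _ _ _ hk, h2]
      refine ⟨?_, ?_, ?_⟩
      · simpa [hk'] using hstep d (by omega) σ' h1 h2 h3
      · simp [hk']
      · intro v hv hv'; simp [hv, run_pub, prun_of_notMem _ _ _ hv', h3 v hv hv']
  exact (key _ le_rfl).1

end HL

end ObliviousCuckoo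

namespace ObliviousCuckoo

/-! ### Compilation -/

/-- Registers of the compiled program: variables, two temporaries, the base address, and the registers
of the sorting program. -/
def tmp₁ : ℕ := 32
def tmp₂ : ℕ := 33
def baseReg : ℕ := 34
def sortReg (r : ℕ) : ℕ := 40 + r

/-- `r_t := r_t + ∑ r` -/
def addRegs (t : ℕ) : List ℕ → Cmd
  | [] => Cmd.skip
  | r :: rs => Cmd.seq (Cmd.add t t r) (addRegs t rs)

/-- `r_t := k + ∑ r` -/
def evalTo (t k : ℕ) (rs : List ℕ) : Cmd := Cmd.seq (Cmd.const t k) (addRegs t rs)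

def PE.regs (e : PE) : List ℕ := e.ps.map PV.idx
def SE.regs (e : SE) : List ℕ := e.ps.map PV.idx ++ e.ss.map SV.idx

def PE.to (e : PE) (t : ℕ) : Cmd := evalTo t e.k e.regs
def SE.to (e : SE) (t : ℕ) : Cmd := evalTo t e.k e.regs

def PE.cost (e : PE) : ℕ := e.ps.length + 2
def SE.cost (e : SE) : ℕ := e.ps.length + e.ss.length + 2

def SC.compile : SC → Cmd
  | skip => Cmd.skip
  | set d e => Cmd.seq (e.to tmp₁) (Cmd.copy d.idx tmp₁)
  | sub d e₁ e₂ => Cmd.seq (e₁.to tmp₁) (Cmd.seq (e₂.to tmp₂) (Cmd.sub d.idx tmp₁ tmp₂))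
  | seq c₁ c₂ => Cmd.seq c₁.compile c₂.compile
  | ite e₁ e₂ c₁ c₂ =>
      Cmd.seq (e₁.to tmp₁) (Cmd.seq (e₂.to tmp₂) (Cmd.cond tmp₁ tmp₂ c₁.compile c₂.compile))

def SC.cost : SC → ℕ
  | skip => 1
  | set _ e => e.cost + 1
  | sub _ e₁ e₂ => e₁.cost + e₂.cost + 1
  | seq c₁ c₂ => c₁.cost + c₂.cost
  | ite e₁ e₂ c₁ c₂ => e₁.cost + e₂.cost + 1 + max c₁.cost c₂.cost

/-- The address of cell `a` of array `j`. -/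
def addr (base j a : ℕ) : ℕ := base + 8 * a + j

theorem addr_inj {base j j' a a' : ℕ} (hj : j < 8) (hj' : j' < 8) :
    addr base j a = addr base j' a' ↔ j = j' ∧ a = a' := by unfold addr; omega

/-- `r_{tmp₁} :=` address of cell `r_{tmp₁}` of array `j` -/
def toAddr (j : ℕ) : Cmd :=
  Cmd.seq (Cmd.add tmp₁ tmp₁ tmp₁) (Cmd.seq (Cmd.add tmp₁ tmp₁ tmp₁)
    (Cmd.seq (Cmd.add tmp₁ tmp₁ tmp₁) (Cmd.seq (Cmd.add tmp₁ tmp₁ baseReg)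
      (Cmd.seq (Cmd.const tmp₂ j) (Cmd.add tmp₁ tmp₁ tmp₂)))))

/-- The sorting program, working on array `0`. -/
def embed : Cmd → Cmd
  | .skip => .skip
  | .const d k => .const (sortReg d) k
  | .copy d a => .copy (sortReg d) (sortReg a)
  | .add d a b => .add (sortReg d) (sortReg a) (sortReg b)
  | .sub d a b => .sub (sortReg d) (sortReg a) (sortReg b)
  | .load d a => .seq (.copy tmp₁ (sortReg a)) (.seq (toAddr 0) (.load (sortReg d) tmp₁))
  | .store a v => .seq (.copy tmp₁ (sortReg a)) (.seq (toAddr 0) (.store tmp₁ (sortReg v)))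
  | .seq c₁ c₂ => .seq (embed c₁) (embed c₂)
  | .cond a b c₁ c₂ => .cond (sortReg a) (sortReg b) (embed c₁) (embed c₂)
  | .loop a b c => .loop (sortReg a) (sortReg b) (embed c)

namespace HL

def compile (P : Cmd) : HL → Cmd
  | pset d e => .seq (e.to tmp₁) (.copy d.idx tmp₁)
  | psub d e₁ e₂ => .seq (e₁.to tmp₁) (.seq (e₂.to tmp₂) (.sub d.idx tmp₁ tmp₂))
  | sc c => c.compile
  | load d A e => .seq (e.to tmp₁) (.seq (toAddr A.idx) (.load d.idx tmp₁))
  | store A e v => .seq (e.to tmp₁) (.seq (toAddr A.idx) (.seq (v.to tmp₂) (.store tmp₁ tmp₂)))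
  | rload d e => .seq (e.to tmp₁) (.cond tmp₁ baseReg (.load d.idx tmp₁) .skip)
  | rstore e v =>
      .seq (e.to tmp₁) (.seq (v.to tmp₂) (.cond tmp₁ baseReg (.store tmp₁ tmp₂) .skip))
  | sort N =>
      .seq (.const tmp₁ 0)
        (.cond tmp₁ N.idx (.seq (.copy (sortReg 0) N.idx) (embed P)) .skip)
  | seq c₁ c₂ => .seq (c₁.compile P) (c₂.compile P)
  | pif e₁ e₂ c₁ c₂ =>
      .seq (e₁.to tmp₁) (.seq (e₂.to tmp₂)
        (.cond tmp₁ tmp₂ (c₁.compile P) (c₂.compile P)))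
  | loop k N c =>
      .seq (.const k.idx 0) (.loop k.idx N.idx
        (.seq (c.compile P) (.seq (.const tmp₁ 1) (.add k.idx k.idx tmp₁))))

/-- Sum of a cost along an iteration. -/
def iterCost {α : Type*} (f : α → ℕ) (g : α → α) : ℕ → α → ℕ
  | 0, _ => 0
  | d + 1, p => f p + iterCost f g d (g p)

/-- Concatenation of traces along an iteration. -/
def iterTrace {α : Type*} (f : α → List Access) (g : α → α) : ℕ → α → List Access
  | 0, _ => []
  | d + 1, p => f p ++ iterTrace f g d (g p)

/-- A bound for the number of steps, given a bound `T` for the sorting program. -/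
def cost (T : ℕ → ℕ) : HL → (PV → ℕ) → ℕ
  | pset _ e, _ => e.cost + 1
  | psub _ e₁ e₂, _ => e₁.cost + e₂.cost + 1
  | sc c, _ => c.cost
  | load _ _ e, _ => e.cost + 7
  | store _ e v, _ => e.cost + v.cost + 7
  | rload _ e, _ => e.cost + 2
  | rstore e v, _ => e.cost + v.cost + 2
  | sort N, p => 8 * T (p N) + 3
  | seq c₁ c₂, p => c₁.cost T p + c₂.cost T (c₁.prun p)
  | pif e₁ e₂ c₁ c₂, p =>
      e₁.cost + e₂.cost + 1 + if e₁.ev p < e₂.ev p then c₁.cost T p else c₂.cost T p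
  | loop k N c, p =>
      2 + iterCost (fun p => c.cost T p + 3)
        (fun p => Function.update (c.prun p) k (c.prun p k + 1)) (p N) (Function.update p k 0)

/-- The sequence of accesses, given the one of the sorting program. -/
def trace (B : ℕ) (τ : ℕ → List Access) : HL → (PV → ℕ) → List Access
  | load _ A e, p => [.read (addr B A.idx (e.ev p))]
  | store A e _, p => [.write (addr B A.idx (e.ev p))]
  | rload _ e, p => if e.ev p < B then [.read (e.ev p)] else []
  | rstore e _, p => if e.ev p < B then [.write (e.ev p)] else []
  | sort N, p => if 0 < p N then τ (p N) else []
  | seq c₁ c₂, p => c₁.trace B τ p ++ c₂.trace B τ (c₁.prun p)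
  | pif e₁ e₂ c₁ c₂, p => if e₁.ev p < e₂.ev p then c₁.trace B τ p else c₂.trace B τ p
  | loop k N c, p =>
      iterTrace (c.trace B τ)
        (fun p => Function.update (c.prun p) k (c.prun p k + 1)) (p N) (Function.update p k 0)
  | _, _ => []

end HL

/-! ### Correctness of the compilation -/

/-- The configuration `κ` represents the state `σ`. -/
structure Rep (κ : Config) (σ : St) : Prop where
  pub : ∀ v, κ.reg (PV.idx v) = σ.pub v
  sec : ∀ v, κ.reg (SV.idx v) = σ.sec v
  base : κ.reg baseReg = σ.base
  preg : ∀ r, κ.reg (sortReg r) = σ.preg r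
  raw : ∀ a < σ.base, κ.mem a = σ.raw a
  arr : ∀ A a, κ.mem (addr σ.base (AV.idx A) a) = σ.arr A a

theorem _root_.Exec.cast {c : Cmd} {κ κ₁ κ₂ : Config} {τ τ' : List Access} {t t' : ℕ}
    (h : Exec c κ τ t κ₁) (hτ : τ = τ') (ht : t = t') (hκ : κ₁ = κ₂) : Exec c κ τ' t' κ₂ := by
  subst hτ ht hκ; exact h

theorem exec_addRegs (t : ℕ) (rs : List ℕ) (h : t ∉ rs) (κ : Config) :
    Exec (addRegs t rs) κ [] (rs.length + 1) (κ.setReg t (κ.reg t + (rs.map κ.reg).sum)) := by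
  induction rs generalizing κ with
  | nil => simpa [addRegs, Config.setReg] using Exec.skip κ
  | cons r rs ih =>
    simp only [List.mem_cons, not_or] at h
    have h2 := ih h.2 (κ.setReg t (κ.reg t + κ.reg r))
    have h1 := Exec.seq (Exec.add κ t t r) h2
    refine h1.cast rfl ?_ ?_
    · simp; omega
    · have : List.map (κ.setReg t (κ.reg t + κ.reg r)).reg rs = rs.map κ.reg := by
        apply List.map_congr_left
        intro a ha
        simp [Config.setReg, Function.update_apply]
        rintro rfl; exact absurd ha h.2
      rw [this]
      simp [Config.setReg, add_assoc]

theorem exec_evalTo (t k : ℕ) (rs : List ℕ) (h : t ∉ rs) (κ : Config) :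
    Exec (evalTo t k rs) κ [] (rs.length + 2) (κ.setReg t (k + (rs.map κ.reg).sum)) := by
  have h2 := Exec.seq (Exec.const κ t k) (exec_addRegs t rs h (κ.setReg t k))
  refine h2.cast rfl ?_ ?_
  · omega
  · have : List.map (κ.setReg t k).reg rs = rs.map κ.reg := by
      apply List.map_congr_left
      intro a ha
      simp [Config.setReg, Function.update_apply]
      rintro rfl; exact absurd ha h
    rw [this]
    simp [Config.setReg]

theorem exec_PE (e : PE) (t : ℕ) (ht : 16 ≤ t) {κ : Config} {p : PV → ℕ}
    (h : ∀ v, κ.reg (PV.idx v) = p v) : Exec (e.to t) κ [] e.cost (κ.setReg t (e.ev p)) := by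
  have h1 := exec_evalTo t e.k e.regs (by
    simp only [PE.regs, List.mem_map, not_exists, not_and]
    rintro v - rfl
    have := v.idx_lt; omega) κ
  refine h1.cast rfl ?_ ?_
  · simp [PE.cost, PE.regs]
  · simp [PE.ev, PE.regs, Function.comp_def, h]

theorem exec_SE (e : SE) (t : ℕ) (ht : 32 ≤ t) {κ : Config} {p : PV → ℕ} {s : SV → ℕ}
    (h : ∀ v, κ.reg (PV.idx v) = p v) (h' : ∀ v, κ.reg (SV.idx v) = s v) :
    Exec (e.to t) κ [] e.cost (κ.setReg t (e.ev p s)) := by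
  have h1 := exec_evalTo t e.k e.regs (by
    simp only [SE.regs, List.mem_append, List.mem_map]
    rintro (⟨v, -, rfl⟩ | ⟨v, -, rfl⟩)
    · have := v.idx_lt; omega
    · have := v.idx_lt; omega) κ
  refine h1.cast rfl ?_ ?_
  · simp [SE.cost, SE.regs]
  · simp [SE.ev, SE.regs, Function.comp_def, h, h']

theorem PV.idx_ne_SV (v : PV) (x : SV) : v.idx ≠ x.idx := by
  have := v.idx_lt; have := x.le_idx; omega

namespace Rep

variable {κ : Config} {σ : St}

theorem setTmp (h : Rep κ σ) (t v : ℕ) (ht : t = tmp₁ ∨ t = tmp₂) : Rep (κ.setReg t v) σ := by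
  have ht' : t = 32 ∨ t = 33 := ht
  refine ⟨fun x => ?_, fun x => ?_, ?_, fun r => ?_, h.raw, h.arr⟩
  · rw [← h.pub]; have := x.idx_lt; exact Function.update_of_ne (by omega) _ _
  · rw [← h.sec]; have := x.idx_lt; exact Function.update_of_ne (by omega) _ _
  · rw [← h.base]; exact Function.update_of_ne (by unfold baseReg; omega) _ _
  · rw [← h.preg]; exact Function.update_of_ne (by unfold sortReg; omega) _ _

theorem setp (h : Rep κ σ) (d : PV) (v : ℕ) : Rep (κ.setReg d.idx v) (σ.setp d v) := by
  have hd := d.idx_lt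
  refine ⟨fun x => ?_, fun x => ?_, ?_, fun r => ?_, h.raw, h.arr⟩
  · simp [Config.setReg, Function.update_apply, PV.idx_injective.eq_iff, h.pub]
  · rw [St.setp_sec, ← h.sec]; exact Function.update_of_ne (d.idx_ne_SV x).symm _ _
  · rw [St.setp_base, ← h.base]; exact Function.update_of_ne (by unfold baseReg; omega) _ _
  · rw [show (σ.setp d v).preg = σ.preg from rfl, ← h.preg]
    exact Function.update_of_ne (by unfold sortReg; omega) _ _

theorem sets (h : Rep κ σ) (d : SV) (v : ℕ) : Rep (κ.setReg d.idx v) (σ.sets d v) := by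
  have hd := d.idx_lt
  refine ⟨fun x => ?_, fun x => ?_, ?_, fun r => ?_, h.raw, h.arr⟩
  · rw [St.sets_pub, ← h.pub]; exact Function.update_of_ne (x.idx_ne_SV d) _ _
  · simp [Config.setReg, Function.update_apply, SV.idx_injective.eq_iff, h.sec]
  · rw [St.sets_base, ← h.base]; exact Function.update_of_ne (by unfold baseReg; omega) _ _
  · rw [show (σ.sets d v).preg = σ.preg from rfl, ← h.preg]
    exact Function.update_of_ne (by unfold sortReg; omega) _ _

theorem seta (h : Rep κ σ) (A : AV) (a v : ℕ) :
    Rep (κ.setMem (addr σ.base A.idx a) v) (σ.seta A a v) := by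
  refine ⟨h.pub, h.sec, h.base, h.preg, fun x hx => ?_, fun A' a' => ?_⟩
  · rw [St.seta_raw, ← h.raw x hx]
    refine Function.update_of_ne ?_ _ _
    simp only [St.seta_base] at hx
    unfold addr; omega
  · simp [Config.setMem, Function.update_apply, addr_inj A'.idx_lt A.idx_lt,
      AV.idx_injective.eq_iff, h.arr]

theorem setr (h : Rep κ σ) (a v : ℕ) (ha : a < σ.base) :
    Rep (κ.setMem a v) (σ.setr a v) := by
  refine ⟨h.pub, h.sec, h.base, h.preg, fun x hx => ?_, fun A' a' => ?_⟩
  · simp only [St.setr_base] at hx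
    simp [Config.setMem, Function.update_apply, h.raw x hx]
  · rw [St.setr_arr, ← h.arr, St.setr_base]
    refine Function.update_of_ne ?_ _ _
    unfold addr; omega

end Rep

theorem exec_SC (c : SC) {κ : Config} {σ : St} (h : Rep κ σ) :
    ∃ t ≤ c.cost, ∃ κ', Exec c.compile κ [] t κ' ∧ Rep κ' { σ with sec := c.run σ.pub σ.sec } := by
  induction c generalizing κ σ with
  | skip => exact ⟨1, le_rfl, κ, Exec.skip κ, h⟩
  | set d e =>
    refine ⟨_, le_rfl, _, Exec.seq (exec_SE e tmp₁ (by simp [tmp₁]) h.pub h.sec)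
      (Exec.copy _ d.idx tmp₁), ?_⟩
    have := (h.setTmp tmp₁ (e.ev σ.pub σ.sec) (.inl rfl)).sets d (e.ev σ.pub σ.sec)
    simpa [Config.setReg, SC.run, St.sets] using this
  | sub d e₁ e₂ =>
    have h1 := h.setTmp tmp₁ (e₁.ev σ.pub σ.sec) (.inl rfl)
    have h2 := h1.setTmp tmp₂ (e₂.ev σ.pub σ.sec) (.inr rfl)
    refine ⟨_, le_of_eq ?_, _, Exec.seq (exec_SE e₁ tmp₁ (by simp [tmp₁]) h.pub h.sec)
      (Exec.seq (exec_SE e₂ tmp₂ (by simp [tmp₂]) h1.pub h1.sec) (Exec.sub _ d.idx tmp₁ tmp₂)), ?_⟩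
    · simp [SC.cost, add_assoc]
    · have := h2.sets d (e₁.ev σ.pub σ.sec - e₂.ev σ.pub σ.sec)
      simpa [Config.setReg, tmp₁, tmp₂, SC.run, St.sets] using this
  | seq c₁ c₂ ih₁ ih₂ =>
    obtain ⟨t₁, ht₁, κ₁, e₁, h₁⟩ := ih₁ h
    obtain ⟨t₂, ht₂, κ₂, e₂, h₂⟩ := ih₂ h₁
    exact ⟨_, add_le_add ht₁ ht₂, κ₂, Exec.seq e₁ e₂, h₂⟩
  | ite e₁ e₂ c₁ c₂ ih₁ ih₂ =>
    have h1 := h.setTmp tmp₁ (e₁.ev σ.pub σ.sec) (.inl rfl)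
    have h2 := h1.setTmp tmp₂ (e₂.ev σ.pub σ.sec) (.inr rfl)
    have x1 := exec_SE e₁ tmp₁ (by simp [tmp₁]) h.pub h.sec
    have x2 := exec_SE e₂ tmp₂ (by simp [tmp₂]) h1.pub h1.sec
    by_cases hlt : e₁.ev σ.pub σ.sec < e₂.ev σ.pub σ.sec
    · obtain ⟨t, ht, κ', x, h'⟩ := ih₁ h2
      refine ⟨_, ?_, κ', Exec.seq x1 (Exec.seq x2 (Exec.cond_true ?_ x)), ?_⟩
      · simp only [SC.cost]; have := le_max_left c₁.cost c₂.cost; omega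
      · simpa [Config.setReg, tmp₁, tmp₂] using hlt
      · simpa [SC.run, hlt] using h'
    · obtain ⟨t, ht, κ', x, h'⟩ := ih₂ h2
      refine ⟨_, ?_, κ', Exec.seq x1 (Exec.seq x2 (Exec.cond_false ?_ x)), ?_⟩
      · simp only [SC.cost]; have := le_max_right c₁.cost c₂.cost; omega
      · simpa [Config.setReg, tmp₁, tmp₂] using hlt
      · simpa [SC.run, hlt] using h'

theorem exec_toAddr (j : ℕ) (κ : Config) :
    ∃ κ', Exec (toAddr j) κ [] 6 κ' ∧ κ'.reg tmp₁ = addr (κ.reg baseReg) j (κ.reg tmp₁) ∧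
      (∀ r, r ≠ tmp₁ → r ≠ tmp₂ → κ'.reg r = κ.reg r) ∧ κ'.mem = κ.mem := by
  refine ⟨_, Exec.seq (Exec.add _ _ _ _) (Exec.seq (Exec.add _ _ _ _) (Exec.seq (Exec.add _ _ _ _)
    (Exec.seq (Exec.add _ _ _ _) (Exec.seq (Exec.const _ _ _) (Exec.add _ _ _ _))))), ?_, ?_, ?_⟩
  · simp [Config.setReg, tmp₁, tmp₂, baseReg, addr]; ring
  · intro r h1 h2; simp [Config.setReg, h1, h2]
  · rfl

theorem Rep.of_eq {κ κ' : Config} {σ : St} (h : Rep κ σ)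
    (hr : ∀ r, r ≠ tmp₁ → r ≠ tmp₂ → κ'.reg r = κ.reg r) (hm : κ'.mem = κ.mem) : Rep κ' σ := by
  simp only [tmp₁, tmp₂] at hr
  refine ⟨fun v => ?_, fun v => ?_, ?_, fun r => ?_, ?_, ?_⟩
  · have := v.idx_lt; rw [hr _ (by omega) (by omega), h.pub]
  · have := v.idx_lt; rw [hr _ (by omega) (by omega), h.sec]
  · rw [hr _ (by simp [baseReg]) (by simp [baseReg]), h.base]
  · rw [hr _ (by unfold sortReg; omega) (by unfold sortReg; omega), h.preg]
  · rw [hm]; exact h.raw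
  · rw [hm]; exact h.arr

/-- How an access of the sorting program appears in the compiled program. -/
def embedAccess (B : ℕ) : Access → Access
  | .read a => .read (addr B 0 a)
  | .write a => .write (addr B 0 a)

/-- `κ` contains the configuration `v` of the sorting program. -/
structure SortRep (κ : Config) (v : Config) (B : ℕ) : Prop where
  base : κ.reg baseReg = B
  reg : ∀ r, κ.reg (sortReg r) = v.reg r
  mem : ∀ a, κ.mem (addr B 0 a) = v.mem a

/-- What the embedded sorting program does not change. -/
structure SortFrame (κ κ' : Config) (B : ℕ) : Prop where
  reg : ∀ r < 32, κ'.reg r = κ.reg r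
  mem : ∀ x, (∀ a, x ≠ addr B 0 a) → κ'.mem x = κ.mem x

theorem SortFrame.trans {κ κ' κ'' : Config} {B : ℕ} (h : SortFrame κ κ' B)
    (h' : SortFrame κ' κ'' B) : SortFrame κ κ'' B :=
  ⟨fun r hr => (h'.reg r hr).trans (h.reg r hr), fun x hx => (h'.mem x hx).trans (h.mem x hx)⟩

theorem SortRep.setReg {κ v : Config} {B : ℕ} (h : SortRep κ v B) (d x : ℕ) :
    SortRep (κ.setReg (sortReg d) x) (v.setReg d x) B ∧
      SortFrame κ (κ.setReg (sortReg d) x) B := by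
  refine ⟨⟨?_, fun r => ?_, h.mem⟩, fun r hr => ?_, fun x _ => rfl⟩
  · rw [← h.base]; exact Function.update_of_ne (by unfold baseReg sortReg; omega) _ _
  · have : sortReg r = sortReg d ↔ r = d := by unfold sortReg; omega
    simp [Config.setReg, Function.update_apply, this, h.reg]
  · exact Function.update_of_ne (by unfold sortReg; omega) _ _

theorem exec_sortAddr {κ v : Config} {B : ℕ} (h : SortRep κ v B) (a : ℕ) :
    ∃ κ', Exec (toAddr 0) (κ.setReg tmp₁ (κ.reg (sortReg a))) [] 6 κ' ∧ SortRep κ' v B ∧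
      SortFrame κ κ' B ∧ κ'.reg tmp₁ = addr B 0 (v.reg a) ∧ κ'.mem = κ.mem := by
  obtain ⟨κ', x, h1, h2, h3⟩ := exec_toAddr 0 (κ.setReg tmp₁ (κ.reg (sortReg a)))
  have hr : ∀ r, r ≠ tmp₁ → r ≠ tmp₂ → κ'.reg r = κ.reg r := by
    intro r hr1 hr2; rw [h2 r hr1 hr2]; exact Function.update_of_ne hr1 _ _
  refine ⟨κ', x, ⟨?_, fun r => ?_, ?_⟩, ⟨fun r hr' => ?_, ?_⟩, ?_, h3⟩
  · rw [hr _ (by simp [baseReg, tmp₁]) (by simp [baseReg, tmp₂]), h.base]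
  · rw [hr _ (by unfold sortReg tmp₁; omega) (by unfold sortReg tmp₂; omega), h.reg]
  · rw [h3]; exact h.mem
  · exact hr r (by unfold tmp₁; omega) (by unfold tmp₂; omega)
  · rw [h3]; exact fun _ _ => rfl
  · rw [h1]; simp [Config.setReg, ← h.base, ← h.reg, baseReg, tmp₁]

theorem exec_embed {P : Cmd} {v v' : Config} {τ : List Access} {t : ℕ} (h : Exec P v τ t v')
    {κ : Config} {B : ℕ} (hκ : SortRep κ v B) :
    ∃ t' ≤ 8 * t, ∃ κ', Exec (embed P) κ (τ.map (embedAccess B)) t' κ' ∧ SortRep κ' v' B ∧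
      SortFrame κ κ' B := by
  induction h generalizing κ with
  | skip σ => exact ⟨1, by omega, κ, Exec.skip κ, hκ, fun _ _ => rfl, fun _ _ => rfl⟩
  | const σ d k =>
    exact ⟨1, by omega, _, Exec.const κ _ k, hκ.setReg d k⟩
  | copy σ d a =>
    refine ⟨1, by omega, _, Exec.copy κ _ _, ?_⟩
    rw [hκ.reg]; exact hκ.setReg d _
  | add σ d a b =>
    refine ⟨1, by omega, _, Exec.add κ _ _ _, ?_⟩
    rw [hκ.reg, hκ.reg]; exact hκ.setReg d _
  | sub σ d a b =>
    refine ⟨1, by omega, _, Exec.sub κ _ _ _, ?_⟩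
    rw [hκ.reg, hκ.reg]; exact hκ.setReg d _
  | load σ d a =>
    obtain ⟨κ', x, h1, h2, h3, h4⟩ := exec_sortAddr hκ a
    have x := Exec.seq (Exec.copy κ tmp₁ (sortReg a)) (Exec.seq x (Exec.load κ' (sortReg d) tmp₁))
    refine ⟨_, ?_, _, x.cast ?_ rfl rfl, ?_⟩
    · omega
    · simp [embedAccess, h3]
    · rw [h3, h1.mem]
      exact ⟨(h1.setReg d _).1, h2.trans (h1.setReg d _).2⟩
  | store σ a v =>
    obtain ⟨κ', x, h1, h2, h3, h4⟩ := exec_sortAddr hκ a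
    have x := Exec.seq (Exec.copy κ tmp₁ (sortReg a)) (Exec.seq x (Exec.store κ' tmp₁ (sortReg v)))
    refine ⟨_, ?_, _, x.cast ?_ rfl rfl, ?_, ?_⟩
    · omega
    · simp [embedAccess, h3]
    · refine ⟨h1.base, h1.reg, fun b => ?_⟩
      rw [h3, h1.reg]
      have : addr B 0 b = addr B 0 (σ.reg a) ↔ b = σ.reg a := by unfold addr; omega
      simp [Config.setMem, Function.update_apply, this, h1.mem]
    · refine h2.trans ⟨fun _ _ => rfl, fun y hy => ?_⟩
      rw [h3]
      exact Function.update_of_ne (hy _) _ _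
  | seq _ _ ih₁ ih₂ =>
    obtain ⟨t₁, ht₁, κ₁, x₁, r₁, f₁⟩ := ih₁ hκ
    obtain ⟨t₂, ht₂, κ₂, x₂, r₂, f₂⟩ := ih₂ r₁
    refine ⟨t₁ + t₂, by omega, κ₂, ?_, r₂, f₁.trans f₂⟩
    rw [List.map_append]; exact Exec.seq x₁ x₂
  | cond_true hab _ ih =>
    obtain ⟨t₁, ht₁, κ₁, x₁, r₁, f₁⟩ := ih hκ
    exact ⟨t₁ + 1, by omega, κ₁, Exec.cond_true (by simpa [hκ.reg] using hab) x₁, r₁, f₁⟩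
  | cond_false hab _ ih =>
    obtain ⟨t₁, ht₁, κ₁, x₁, r₁, f₁⟩ := ih hκ
    exact ⟨t₁ + 1, by omega, κ₁, Exec.cond_false (by simpa [hκ.reg] using hab) x₁, r₁, f₁⟩
  | loop_done hab =>
    exact ⟨1, by omega, κ, Exec.loop_done (by simpa [hκ.reg] using hab), hκ, fun _ _ => rfl,
      fun _ _ => rfl⟩
  | loop_step hab _ _ ih₁ ih₂ =>
    obtain ⟨t₁, ht₁, κ₁, x₁, r₁, f₁⟩ := ih₁ hκ
    obtain ⟨t₂, ht₂, κ₂, x₂, r₂, f₂⟩ := ih₂ r₁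
    refine ⟨t₁ + t₂ + 1, by omega, κ₂, ?_, r₂, f₁.trans f₂⟩
    rw [List.map_append]; exact Exec.loop_step (by simpa [hκ.reg] using hab) x₁ x₂

end ObliviousCuckoo

namespace ObliviousCuckoo

/-- The machine is deterministic. -/
theorem _root_.Exec.deterministic {c : Cmd} {κ κ₁ κ₂ : Config} {τ₁ τ₂ : List Access} {t₁ t₂ : ℕ}
    (h₁ : Exec c κ τ₁ t₁ κ₁) (h₂ : Exec c κ τ₂ t₂ κ₂) : τ₁ = τ₂ ∧ t₁ = t₂ ∧ κ₁ = κ₂ := by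
  induction h₁ generalizing τ₂ t₂ κ₂ with
  | seq _ _ ih₁ ih₂ =>
    cases h₂ with
    | seq x y =>
      obtain ⟨rfl, rfl, rfl⟩ := ih₁ x
      obtain ⟨rfl, rfl, rfl⟩ := ih₂ y
      exact ⟨rfl, rfl, rfl⟩
  | cond_true hab _ ih =>
    cases h₂ with
    | cond_true _ x => obtain ⟨rfl, rfl, rfl⟩ := ih x; exact ⟨rfl, rfl, rfl⟩
    | cond_false h _ => exact absurd hab h
  | cond_false hab _ ih =>
    cases h₂ with
    | cond_false _ x => obtain ⟨rfl, rfl, rfl⟩ := ih x; exact ⟨rfl, rfl, rfl⟩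
    | cond_true h _ => exact absurd h hab
  | loop_done hab =>
    cases h₂ with
    | loop_done _ => exact ⟨rfl, rfl, rfl⟩
    | loop_step h _ _ => exact absurd h hab
  | loop_step hab _ _ ih₁ ih₂ =>
    cases h₂ with
    | loop_done h => exact absurd hab h
    | loop_step _ x y =>
      obtain ⟨rfl, rfl, rfl⟩ := ih₁ x
      obtain ⟨rfl, rfl, rfl⟩ := ih₂ y
      exact ⟨rfl, rfl, rfl⟩
  | _ => cases h₂; exact ⟨rfl, rfl, rfl⟩

theorem finalConfig_eq {P : Cmd} {v v' : Config} {τ : List Access} {t : ℕ}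
    (h : Exec P v τ t v') : finalConfig P v = v' := by
  have hex : ∃ v' τ t, Exec P v τ t v' := ⟨v', τ, t, h⟩
  unfold finalConfig
  rw [dif_pos hex]
  obtain ⟨τ', t', h'⟩ := hex.choose_spec
  exact (h'.deterministic h).2.2

/-- `τ` are the access sequences of `P`, and `T` bounds its number of steps. -/
def SortsWithin (P : Cmd) (T : ℕ → ℕ) (τ : ℕ → List Access) : Prop :=
  ∀ N, 1 ≤ N → ∀ σ ∈ sortConfigs N, ∃ t ≤ T N, ∃ σ', Exec P σ (τ N) t σ'

theorem exists_sortsWithin {P : Cmd} {T : ℕ → ℕ} (hP : IsObliviousSort P T) :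
    ∃ τ, SortsWithin P T τ := by
  choose τ hτ using fun (N : ℕ) (hN : 1 ≤ N) => (hP N hN).1
  exact ⟨fun N => if h : 1 ≤ N then τ N h else [], fun N hN σ hσ => by
    simpa [hN] using hτ N hN σ hσ⟩

theorem Rep.sort {P : Cmd} {T : ℕ → ℕ} {τ : ℕ → List Access} (hP : SortsWithin P T τ)
    {κ : Config} {σ : St} (h : Rep κ σ) (N : PV) (hN : 0 < σ.pub N) :
    ∃ t ≤ 8 * T (σ.pub N) + 1, ∃ κ',
      Exec (.seq (.copy (sortReg 0) N.idx) (embed P)) κ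
        ((τ (σ.pub N)).map (embedAccess σ.base)) t κ' ∧ Rep κ' (σ.sort P (σ.pub N)) := by
  set v : Config := { reg := Function.update σ.preg 0 (σ.pub N), mem := σ.arr AV.P } with hv
  obtain ⟨t, ht, v', hx⟩ := hP (σ.pub N) hN v (by simp [sortConfigs, hv])
  have hr : SortRep (κ.setReg (sortReg 0) (κ.reg N.idx)) v σ.base := by
    have h0 : SortRep κ { reg := σ.preg, mem := σ.arr AV.P } σ.base :=
      ⟨h.base, h.preg, fun a => h.arr AV.P a⟩
    rw [h.pub]
    exact (h0.setReg 0 (σ.pub N)).1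
  obtain ⟨t', ht', κ', hx', hr', hf⟩ := exec_embed hx hr
  have hreg : ∀ r < 32, κ'.reg r = κ.reg r := by
    intro r hr
    rw [hf.reg r hr]
    exact Function.update_of_ne (by unfold sortReg; omega) _ _
  refine ⟨1 + t', by omega, κ', (Exec.seq (Exec.copy _ _ _) hx').cast (by simp) rfl rfl, ?_⟩
  have hs : σ.sort P (σ.pub N) =
      { σ with preg := v'.reg, arr := Function.update σ.arr AV.P v'.mem } := by
    unfold St.sort
    rw [if_pos hN, finalConfig_eq hx]
  rw [hs]
  refine ⟨fun x => ?_, fun x => ?_, hr'.base, hr'.reg, fun a ha => ?_, fun A a => ?_⟩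
  · rw [hreg _ (by have := x.idx_lt; omega), h.pub]
  · rw [hreg _ x.idx_lt, h.sec]
  · simp only at ha ⊢
    rw [hf.mem a (by intro b; unfold addr; omega), ← h.raw a ha]; rfl
  · by_cases hA : A = AV.P
    · subst hA; simpa [AV.idx] using hr'.mem a
    · simp only [Function.update_of_ne hA]
      rw [hf.mem _ ?_, ← h.arr]
      · rfl
      · intro b hb
        rw [addr_inj A.idx_lt (by omega)] at hb
        exact hA (AV.idx_injective hb.1)

theorem exec_HL {P : Cmd} {T : ℕ → ℕ} {τ : ℕ → List Access} (hP : SortsWithin P T τ) (c : HL)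
    (hwf : c.Wf) {κ : Config} {σ : St} (h : Rep κ σ) :
    ∃ t ≤ c.cost T σ.pub, ∃ κ',
      Exec (c.compile P) κ
        (c.trace σ.base (fun N => (τ N).map (embedAccess σ.base)) σ.pub) t κ' ∧
      Rep κ' (c.run P σ) := by
  induction c generalizing κ σ with
  | pset d e =>
    refine ⟨_, le_rfl, _, Exec.seq (exec_PE e tmp₁ (by simp [tmp₁]) h.pub)
      (Exec.copy _ d.idx tmp₁), ?_⟩
    have := (h.setTmp tmp₁ (e.ev σ.pub) (.inl rfl)).setp d (e.ev σ.pub)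
    simpa [Config.setReg, HL.run] using this
  | psub d e₁ e₂ =>
    have h1 := h.setTmp tmp₁ (e₁.ev σ.pub) (.inl rfl)
    have h2 := h1.setTmp tmp₂ (e₂.ev σ.pub) (.inr rfl)
    refine ⟨_, le_of_eq ?_, _, Exec.seq (exec_PE e₁ tmp₁ (by simp [tmp₁]) h.pub)
      (Exec.seq (exec_PE e₂ tmp₂ (by simp [tmp₂]) h1.pub) (Exec.sub _ d.idx tmp₁ tmp₂)), ?_⟩
    · simp [HL.cost, add_assoc]
    · have := h2.setp d (e₁.ev σ.pub - e₂.ev σ.pub)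
      simpa [Config.setReg, tmp₁, tmp₂, HL.run] using this
  | sc c =>
    obtain ⟨t, ht, κ', x, h'⟩ := exec_SC c h
    exact ⟨t, ht, κ', x, h'⟩
  | load d A e =>
    have h1 := h.setTmp tmp₁ (e.ev σ.pub) (.inl rfl)
    obtain ⟨κ', x, ha, hr, hm⟩ := exec_toAddr A.idx (κ.setReg tmp₁ (e.ev σ.pub))
    have h2 := h1.of_eq hr hm
    have ha' : κ'.reg tmp₁ = addr σ.base A.idx (e.ev σ.pub) := by
      rw [ha, h1.base]; simp [Config.setReg]
    refine ⟨_, le_of_eq ?_, _, (Exec.seq (exec_PE e tmp₁ (by simp [tmp₁]) h.pub)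
      (Exec.seq x (Exec.load _ d.idx tmp₁))).cast ?_ rfl rfl, ?_⟩
    · simp [HL.cost]
    · simp [HL.trace, ha']
    · rw [ha', h2.arr]; exact h2.sets d _
  | store A e v =>
    have h1 := h.setTmp tmp₁ (e.ev σ.pub) (.inl rfl)
    obtain ⟨κ', x, ha, hr, hm⟩ := exec_toAddr A.idx (κ.setReg tmp₁ (e.ev σ.pub))
    have h2 := h1.of_eq hr hm
    have ha' : κ'.reg tmp₁ = addr σ.base A.idx (e.ev σ.pub) := by
      rw [ha, h1.base]; simp [Config.setReg]
    have h3 := h2.setTmp tmp₂ (v.ev σ.pub σ.sec) (.inr rfl)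
    have e1 : (κ'.setReg tmp₂ (v.ev σ.pub σ.sec)).reg tmp₁ = addr σ.base A.idx (e.ev σ.pub) := by
      rw [← ha']; simp [Config.setReg, tmp₁, tmp₂]
    have e2 : (κ'.setReg tmp₂ (v.ev σ.pub σ.sec)).reg tmp₂ = v.ev σ.pub σ.sec := by
      simp [Config.setReg]
    refine ⟨_, le_of_eq ?_, _, (Exec.seq (exec_PE e tmp₁ (by simp [tmp₁]) h.pub)
      (Exec.seq x (Exec.seq (exec_SE v tmp₂ (by simp [tmp₂]) h2.pub h2.sec)
        (Exec.store _ tmp₁ tmp₂)))).cast ?_ rfl rfl, ?_⟩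
    · simp [HL.cost]; ring
    · simp [HL.trace, e1]
    · rw [e1, e2]; exact h3.seta A _ _
  | rload d e =>
    have h1 := h.setTmp tmp₁ (e.ev σ.pub) (.inl rfl)
    have x1 := exec_PE e tmp₁ (by simp [tmp₁]) h.pub
    have e1 : (κ.setReg tmp₁ (e.ev σ.pub)).reg tmp₁ = e.ev σ.pub := by simp [Config.setReg]
    by_cases hlt : e.ev σ.pub < σ.base
    · have hlt' : (κ.setReg tmp₁ (e.ev σ.pub)).reg tmp₁ <
          (κ.setReg tmp₁ (e.ev σ.pub)).reg baseReg := by rw [e1, h1.base]; exact hlt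
      refine ⟨_, le_of_eq ?_, _, (Exec.seq x1 (Exec.cond_true hlt' (Exec.load _ d.idx tmp₁))).cast
        ?_ rfl rfl, ?_⟩
      · simp [HL.cost]
      · simp [HL.trace, hlt, e1]
      · rw [e1, h1.raw _ hlt]; simp only [HL.run, if_pos hlt]; exact h1.sets d _
    · have hlt' : ¬ (κ.setReg tmp₁ (e.ev σ.pub)).reg tmp₁ <
          (κ.setReg tmp₁ (e.ev σ.pub)).reg baseReg := by rw [e1, h1.base]; exact hlt
      refine ⟨_, le_of_eq ?_, _, (Exec.seq x1 (Exec.cond_false hlt' (Exec.skip _))).cast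
        ?_ rfl rfl, ?_⟩
      · simp [HL.cost]
      · simp [HL.trace, hlt]
      · simp only [HL.run, if_neg hlt]; exact h1
  | rstore e v =>
    have h1 := h.setTmp tmp₁ (e.ev σ.pub) (.inl rfl)
    have x1 := exec_PE e tmp₁ (by simp [tmp₁]) h.pub
    have h2 := h1.setTmp tmp₂ (v.ev σ.pub σ.sec) (.inr rfl)
    have x2 := exec_SE v tmp₂ (by simp [tmp₂]) h1.pub h1.sec
    set κ₂ := (κ.setReg tmp₁ (e.ev σ.pub)).setReg tmp₂ (v.ev σ.pub σ.sec) with hκ₂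
    have e1 : κ₂.reg tmp₁ = e.ev σ.pub := by simp [hκ₂, Config.setReg, tmp₁, tmp₂]
    have e2 : κ₂.reg tmp₂ = v.ev σ.pub σ.sec := by simp [hκ₂, Config.setReg]
    by_cases hlt : e.ev σ.pub < σ.base
    · have hlt' : κ₂.reg tmp₁ < κ₂.reg baseReg := by rw [e1, h2.base]; exact hlt
      refine ⟨_, le_of_eq ?_, _, (Exec.seq x1 (Exec.seq x2 (Exec.cond_true hlt'
        (Exec.store _ tmp₁ tmp₂)))).cast ?_ rfl rfl, ?_⟩
      · simp [HL.cost, add_assoc]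
      · simp [HL.trace, hlt, e1]
      · rw [e1, e2]; simp only [HL.run, if_pos hlt]; exact h2.setr _ _ hlt
    · have hlt' : ¬ κ₂.reg tmp₁ < κ₂.reg baseReg := by rw [e1, h2.base]; exact hlt
      refine ⟨_, le_of_eq ?_, _, (Exec.seq x1 (Exec.seq x2 (Exec.cond_false hlt'
        (Exec.skip _)))).cast ?_ rfl rfl, ?_⟩
      · simp [HL.cost, add_assoc]
      · simp [HL.trace, hlt]
      · simp only [HL.run, if_neg hlt]; exact h2
  | sort N =>
    have h1 := h.setTmp tmp₁ 0 (.inl rfl)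
    have e1 : (κ.setReg tmp₁ 0).reg tmp₁ = 0 := by simp [Config.setReg]
    by_cases hN : 0 < σ.pub N
    · obtain ⟨t, ht, κ', x, h'⟩ := h1.sort hP N hN
      refine ⟨_, ?_, κ', (Exec.seq (Exec.const _ _ _) (Exec.cond_true ?_ x)).cast ?_ rfl rfl, h'⟩
      · simp only [HL.cost]; omega
      · rw [e1, h1.pub]; exact hN
      · simp [HL.trace, hN]
    · refine ⟨_, ?_, _, (Exec.seq (Exec.const _ _ _) (Exec.cond_false ?_ (Exec.skip _))).cast
        ?_ rfl rfl, ?_⟩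
      · simp only [HL.cost]; omega
      · rw [e1, h1.pub]; exact hN
      · simp [HL.trace, hN]
      · simpa [HL.run, St.sort, hN] using h1
  | seq c₁ c₂ ih₁ ih₂ =>
    obtain ⟨t₁, ht₁, κ₁, e₁, h₁⟩ := ih₁ hwf.1 h
    obtain ⟨t₂, ht₂, κ₂, e₂, h₂⟩ := ih₂ hwf.2 h₁
    rw [HL.run_base, HL.run_pub] at e₂
    rw [HL.run_pub] at ht₂
    exact ⟨_, add_le_add ht₁ ht₂, κ₂, Exec.seq e₁ e₂, h₂⟩
  | pif e₁ e₂ c₁ c₂ ih₁ ih₂ =>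
    have h1 := h.setTmp tmp₁ (e₁.ev σ.pub) (.inl rfl)
    have h2 := h1.setTmp tmp₂ (e₂.ev σ.pub) (.inr rfl)
    have x1 := exec_PE e₁ tmp₁ (by simp [tmp₁]) h.pub
    have x2 := exec_PE e₂ tmp₂ (by simp [tmp₂]) h1.pub
    by_cases hlt : e₁.ev σ.pub < e₂.ev σ.pub
    · obtain ⟨t, ht, κ', x, h'⟩ := ih₁ hwf.1 h2
      refine ⟨_, ?_, κ', (Exec.seq x1 (Exec.seq x2 (Exec.cond_true ?_ x))).cast ?_ rfl rfl, ?_⟩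
      · simp only [HL.cost, if_pos hlt]; omega
      · simpa [Config.setReg, tmp₁, tmp₂] using hlt
      · simp [HL.trace, hlt]
      · simpa [HL.run, hlt] using h'
    · obtain ⟨t, ht, κ', x, h'⟩ := ih₂ hwf.2 h2
      refine ⟨_, ?_, κ', (Exec.seq x1 (Exec.seq x2 (Exec.cond_false ?_ x))).cast ?_ rfl rfl, ?_⟩
      · simp only [HL.cost, if_neg hlt]; omega
      · simpa [Config.setReg, tmp₁, tmp₂] using hlt
      · simp [HL.trace, hlt]
      · simpa [HL.run, hlt] using h'
  | loop k N c ih =>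
    obtain ⟨hc, hkN, hk, hN⟩ := hwf
    have key : ∀ d : ℕ, ∀ (κ : Config) (σ : St), Rep κ σ → σ.pub N = σ.pub k + d →
        ∃ t ≤ 1 + HL.iterCost (fun p => c.cost T p + 3)
            (fun p => Function.update (c.prun p) k (c.prun p k + 1)) d σ.pub, ∃ κ',
          Exec (.loop k.idx N.idx
            (.seq (c.compile P) (.seq (.const tmp₁ 1) (.add k.idx k.idx tmp₁)))) κ
            (HL.iterTrace (c.trace σ.base (fun N => (τ N).map (embedAccess σ.base)))
              (fun p => Function.update (c.prun p) k (c.prun p k + 1)) d σ.pub) t κ' ∧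
          Rep κ' ((fun σ => (c.run P σ).setp k ((c.run P σ).pub k + 1))^[d] σ) := by
      intro d
      induction d with
      | zero =>
        intro κ σ h hd
        refine ⟨1, by simp [HL.iterCost], κ, Exec.loop_done ?_, h⟩
        rw [h.pub, h.pub]; omega
      | succ d ihd =>
        intro κ σ h hd
        obtain ⟨t₁, ht₁, κ₁, x₁, h₁⟩ := ih hc h
        have h₂ := h₁.setTmp tmp₁ 1 (.inl rfl)
        have h₃ := h₂.setp k ((c.run P σ).pub k + 1)
        have x₃ := Exec.add (κ₁.setReg tmp₁ 1) k.idx k.idx tmp₁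
        have e₃ : (κ₁.setReg tmp₁ 1).reg k.idx + (κ₁.setReg tmp₁ 1).reg tmp₁ =
            (c.run P σ).pub k + 1 := by
          rw [h₂.pub]; simp [Config.setReg]
        rw [e₃] at x₃
        obtain ⟨t₂, ht₂, κ₂, x₂, h₄⟩ := ihd _ _ h₃ (by
          simp only [St.setp_pub, if_neg hkN.symm, if_true, HL.run_pub,
            HL.prun_of_notMem _ _ _ hk, HL.prun_of_notMem _ _ _ hN]
          omega)
        have hpub : ((c.run P σ).setp k ((c.run P σ).pub k + 1)).pub =
            Function.update (c.prun σ.pub) k (c.prun σ.pub k + 1) := by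
          simp only [St.setp, HL.run_pub]
        have hbase : ((c.run P σ).setp k ((c.run P σ).pub k + 1)).base = σ.base := by
          simp only [St.setp, HL.run_base]
        rw [hpub, hbase] at x₂
        rw [hpub] at ht₂
        refine ⟨_, ?_, κ₂, (Exec.loop_step ?_ (Exec.seq x₁ (Exec.seq (Exec.const _ _ _) x₃))
          x₂).cast ?_ rfl rfl, ?_⟩
        · simp only [HL.iterCost]; omega
        · rw [h.pub, h.pub]; omega
        · simp [HL.iterTrace]
        · rw [Function.iterate_succ_apply]; exact h₄
    obtain ⟨t, ht, κ', x, h'⟩ := key (σ.pub N) _ _ (h.setp k 0) (by simp [hkN.symm])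
    refine ⟨1 + t, ?_, κ', (Exec.seq (Exec.const _ _ _) x).cast ?_ rfl rfl, ?_⟩
    · simp only [HL.cost]
      have : (σ.setp k 0).pub = Function.update σ.pub k 0 := rfl
      rw [this] at ht; omega
    · rfl
    · exact h'

/-! ### Complete programs -/

/-- Set all public variables except for the parameters to zero, and compute the base address. -/
def zeroRegs : List ℕ → Cmd
  | [] => Cmd.skip
  | r :: rs => Cmd.seq (Cmd.const r 0) (zeroRegs rs)

theorem exec_zeroRegs (rs : List ℕ) (κ : Config) :
    ∃ κ', Exec (zeroRegs rs) κ [] (rs.length + 1) κ' ∧ κ'.mem = κ.mem ∧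
      ∀ r, κ'.reg r = if r ∈ rs then 0 else κ.reg r := by
  induction rs generalizing κ with
  | nil => exact ⟨κ, Exec.skip κ, rfl, by simp⟩
  | cons r rs ih =>
    obtain ⟨κ', x, h1, h2⟩ := ih (κ.setReg r 0)
    refine ⟨κ', (Exec.seq (Exec.const κ r 0) x).cast rfl (by simp; omega) rfl, h1, fun r' => ?_⟩
    rw [h2]
    by_cases h : r' ∈ rs
    · simp [h]
    · by_cases h' : r' = r <;> simp [h, h', Config.setReg]

def HL.program (P : Cmd) (c : HL) : Cmd :=
  Cmd.seq (zeroRegs [3, 4, 5, 6, 7, 8, 9, 10, 11, 12, 13, 14, 15])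
    (Cmd.seq (evalTo baseReg 0 [0, 0, 0, 1, 1, 2]) (c.compile P))

/-- The initial values of the public variables. -/
def initPub (n m s : ℕ) : PV → ℕ
  | .n => n
  | .m => m
  | .s => s
  | _ => 0

theorem exec_program {P : Cmd} {T : ℕ → ℕ} {τ : ℕ → List Access} (hP : SortsWithin P T τ) (c : HL)
    (hwf : c.Wf) (n m s : ℕ) : ∃ τ', ∀ κ ∈ cuckooConfigs n m s, ∃ σ : St,
      σ.base = 3 * n + 2 * m + s ∧ σ.pub = initPub n m s ∧ σ.raw = κ.mem ∧
      ∃ t ≤ c.cost T (initPub n m s) + 22, ∃ κ', Exec (c.program P) κ τ' t κ' ∧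
        Rep κ' (c.run P σ) := by
  refine ⟨c.trace (3 * n + 2 * m + s)
    (fun N => (τ N).map (embedAccess (3 * n + 2 * m + s))) (initPub n m s), ?_⟩
  rintro κ ⟨hn, hm, hs⟩
  obtain ⟨κ₁, x₁, hm₁, hr₁⟩ := exec_zeroRegs [3, 4, 5, 6, 7, 8, 9, 10, 11, 12, 13, 14, 15] κ
  have x₂ := exec_evalTo baseReg 0 [0, 0, 0, 1, 1, 2] (by simp [baseReg]) κ₁
  have hb : 0 + (List.map κ₁.reg [0, 0, 0, 1, 1, 2]).sum = 3 * n + 2 * m + s := by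
    simp [hr₁, hn, hm, hs]; ring
  rw [hb] at x₂
  set κ₂ := κ₁.setReg baseReg (3 * n + 2 * m + s) with hκ₂
  let σ : St :=
    { base := 3 * n + 2 * m + s
      pub := initPub n m s
      sec := fun v => κ₂.reg v.idx
      preg := fun r => κ₂.reg (sortReg r)
      raw := κ.mem
      arr := fun A a => κ.mem (addr (3 * n + 2 * m + s) A.idx a) }
  have hrep : Rep κ₂ σ := by
    have hm₂ : κ₂.mem = κ.mem := hm₁
    refine ⟨fun v => ?_, fun v => rfl, ?_, fun r => rfl, fun a _ => ?_, fun A a => ?_⟩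
    · have := v.idx_lt
      have : κ₂.reg v.idx = κ₁.reg v.idx := Function.update_of_ne (by unfold baseReg; omega) _ _
      rw [this, hr₁]
      cases v <;> simp [PV.idx, σ, initPub, hn, hm, hs]
    · simp [hκ₂, Config.setReg, σ]
    · rw [hm₂]
    · rw [hm₂]
  obtain ⟨t, ht, κ', x, h'⟩ := exec_HL hP c hwf hrep
  refine ⟨σ, rfl, rfl, rfl, _, ?_, κ', (Exec.seq x₁ (Exec.seq x₂ x)).cast ?_ rfl rfl, h'⟩
  · have : σ.pub = initPub n m s := rfl
    rw [this] at ht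
    simp only [List.length_cons, List.length_nil]
    omega
  · simp [σ]

end ObliviousCuckoo

namespace ObliviousCuckoo

/-! ### Effect of the sorting program -/

theorem monotone_perm_eq {N : ℕ} (f : Fin N → Fin N) (hf : Function.Injective f)
    (hm : Monotone f) (i : Fin N) : f i = i := by
  have hs : StrictMono f := hm.strictMono_of_injective hf
  have hb : Function.Bijective f := Finite.injective_iff_bijective.mp hf
  let e : Fin N ≃o Fin N := hs.orderIsoOfSurjective f hb.2
  have : e = OrderIso.refl _ := Subsingleton.elim _ _
  calc f i = e i := rfl
    _ = i := by rw [this]; rfl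

theorem sort_spec {P : Cmd} {T : ℕ → ℕ} (hP : IsObliviousSort P T) (σ : St) (N : ℕ) :
    ∃ π : Equiv.Perm (Fin N), (∀ i : Fin N, (σ.sort P N).arr .P i = σ.arr .P (π i) ∧
        (σ.sort P N).arr .P (N + i) = σ.arr .P (N + π i)) ∧
      ∀ i j : Fin N, i ≤ j → (σ.sort P N).arr .P i ≤ (σ.sort P N).arr .P j := by
  rcases Nat.eq_zero_or_pos N with rfl | hN
  · exact ⟨1, fun i => i.elim0, fun i => i.elim0⟩
  · set v : Config := { reg := Function.update σ.preg 0 N, mem := σ.arr AV.P } with hv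
    obtain ⟨τ, t, v', hx, hs, π, hπ⟩ := (hP N hN).2 v (by simp [sortConfigs, hv])
    have hs' : (σ.sort P N).arr .P = v'.mem := by
      unfold St.sort
      rw [if_pos hN, finalConfig_eq hx]; simp
    rw [hs']
    exact ⟨π, hπ, hs⟩

theorem sort_permutes {P : Cmd} {T : ℕ → ℕ} (hP : IsObliviousSort P T) (σ : St) (N : ℕ)
    (hlt : ∀ i < N, σ.arr .P i < N)
    (hinj : ∀ i < N, ∀ j < N, σ.arr .P i = σ.arr .P j → i = j) (i : ℕ) (hi : i < N) :
    (σ.sort P N).arr .P (N + σ.arr .P i) = σ.arr .P (N + i) := by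
  obtain ⟨π, hπ, hs⟩ := sort_spec hP σ N
  let f : Fin N → Fin N := fun j => ⟨σ.arr .P (π j), hlt _ (π j).2⟩
  have hf : Function.Injective f := by
    intro a b hab
    have := hinj _ (π a).2 _ (π b).2 (by simpa [f] using hab)
    exact π.injective (Fin.ext this)
  have hm : Monotone f := by
    intro a b hab
    have := hs a b hab
    rw [(hπ a).1, (hπ b).1] at this
    exact this
  have h1 := monotone_perm_eq f hf hm (π.symm ⟨i, hi⟩)
  have h2 : σ.arr .P i = (π.symm ⟨i, hi⟩ : Fin N) := by
    have := congrArg Fin.val h1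
    simpa [f] using this
  rw [h2, (hπ _).2]
  simp

namespace SC

def block : List SC → SC
  | [] => skip
  | c :: cs => seq c (block cs)

variable (p : PV → ℕ) (s : SV → ℕ) (v d : SV) (e₁ e₂ : SE) (c₁ c₂ : SC) (cs : List SC)

@[simp] theorem run_skip : skip.run p s = s := rfl
@[simp] theorem run_set : (set d e₁).run p s v = if v = d then e₁.ev p s else s v := by
  simp [run, Function.update_apply]
@[simp] theorem run_sub :
    (sub d e₁ e₂).run p s v = if v = d then e₁.ev p s - e₂.ev p s else s v := by
  simp [run, Function.update_apply]
@[simp] theorem run_ite : (ite e₁ e₂ c₁ c₂).run p s v =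
    if e₁.ev p s < e₂.ev p s then c₁.run p s v else c₂.run p s v := by
  simp only [run]; split_ifs <;> rfl
@[simp] theorem run_block_nil : (block []).run p s = s := rfl
@[simp] theorem run_block_cons :
    (block (c₁ :: cs)).run p s = (block cs).run p (c₁.run p s) := rfl

end SC

namespace HL

def block : List HL → HL
  | [] => sc SC.skip
  | c :: cs => seq c (block cs)

@[simp] theorem run_block_nil (P : Cmd) (σ : St) : (block []).run P σ = σ := rfl
@[simp] theorem run_block_cons (P : Cmd) (c : HL) (cs : List HL) (σ : St) :
    (block (c :: cs)).run P σ = (block cs).run P (c.run P σ) := rfl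

end HL

/-! ### Permuting an array by ranks -/

/-- Use `R` as keys and `A` as words. -/
def permLoad (A : AV) : HL :=
  .block [.load .r .R ⟨0, [.i]⟩, .load .x A ⟨0, [.i]⟩,
    .store .P ⟨0, [.i]⟩ ⟨0, [], [.r]⟩, .store .P ⟨0, [.N, .i]⟩ ⟨0, [], [.x]⟩]

/-- Copy a word to `A`. -/
def wordTo (A : AV) : HL :=
  .block [.load .x .P ⟨0, [.N, .i]⟩, .store A ⟨0, [.i]⟩ ⟨0, [], [.x]⟩]

/-- Permute the first `N` entries of `A` by the ranks in `R`. -/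
def permField (A : AV) : HL :=
  .block [.loop .i .N (permLoad A), .sort .N, .loop .i .N (wordTo A)]

theorem permLoad_spec (P : Cmd) (A : AV) (hA : A ≠ .P) (σ : St) :
    (∀ a < σ.pub .N, ((HL.loop .i .N (permLoad A)).run P σ).arr .P a = σ.arr .R a ∧
      ((HL.loop .i .N (permLoad A)).run P σ).arr .P (σ.pub .N + a) = σ.arr A a) := by
  refine (HL.loop_induction P (k := .i) (N := .N) (c := permLoad A)
    (by simp [HL.Wf, HL.block, HL.pmods, permLoad]) σ
    (fun i σ' => (∀ a < i, σ'.arr .P a = σ.arr .R a ∧ σ'.arr .P (σ.pub .N + a) = σ.arr A a) ∧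
      σ'.arr .R = σ.arr .R ∧ σ'.arr A = σ.arr A) (by simp) ?_).1
  rintro i hi σ' ⟨h1, h2, h3⟩ hk hp
  have hN' : σ'.pub .N = σ.pub .N := hp _ (by simp) (by simp [permLoad, HL.block, HL.pmods])
  refine ⟨fun a ha => ?_, ?_, ?_⟩
  · simp [permLoad, HL.run, PE.ev, SE.ev, hk, hN', h2, h3]
    grind
  · funext a; simp [permLoad, HL.run, PE.ev, SE.ev, hk, hN', h2, h3]
  · funext a; simp [permLoad, HL.run, PE.ev, SE.ev, hk, hN', h2, h3, hA]

theorem wordTo_spec (P : Cmd) (A : AV) (hA : A ≠ .P) (σ : St) (a : ℕ) :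
    ((HL.loop .i .N (wordTo A)).run P σ).arr A a =
      if a < σ.pub .N then σ.arr .P (σ.pub .N + a) else σ.arr A a := by
  refine (HL.loop_induction P (k := .i) (N := .N) (c := wordTo A)
    (by simp [HL.Wf, HL.block, HL.pmods, wordTo]) σ
    (fun i σ' => (∀ a, σ'.arr A a = if a < i then σ.arr .P (σ.pub .N + a) else σ.arr A a) ∧
      σ'.arr .P = σ.arr .P) (by simp) ?_).1 a
  rintro i hi σ' ⟨h1, h2⟩ hk hp
  have hN' : σ'.pub .N = σ.pub .N := hp _ (by simp) (by simp [wordTo, HL.block, HL.pmods])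
  refine ⟨fun a => ?_, ?_⟩
  · simp [wordTo, HL.run, PE.ev, SE.ev, hk, hN', h2, h1]
    grind
  · funext a; simp [wordTo, HL.run, PE.ev, SE.ev, hk, hN', h2, hA.symm]

theorem permField_spec {P : Cmd} {T : ℕ → ℕ} (hP : IsObliviousSort P T) (A : AV) (hA : A ≠ .P)
    (σ : St) (hlt : ∀ i < σ.pub .N, σ.arr .R i < σ.pub .N)
    (hinj : ∀ i < σ.pub .N, ∀ j < σ.pub .N, σ.arr .R i = σ.arr .R j → i = j) :
    (∀ i < σ.pub .N, ((permField A).run P σ).arr A (σ.arr .R i) = σ.arr A i) ∧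
    (∀ i, σ.pub .N ≤ i → ((permField A).run P σ).arr A i = σ.arr A i) := by
  unfold permField
  simp only [HL.run_block_cons, HL.run_block_nil]
  have h1 := permLoad_spec P A hA σ
  set σ₁ := HL.run P (.loop .i .N (permLoad A)) σ with hσ₁
  have hN₁ : σ₁.pub .N = σ.pub .N := by
    rw [hσ₁, HL.run_pub, HL.prun_of_notMem _ _ _ (by simp [permLoad, HL.block, HL.pmods])]
  have hA₁ : σ₁.arr A = σ.arr A :=
    HL.run_arr_of_notMem P _ σ A (by simp [permLoad, HL.block, HL.amods, hA])
  have h2 := sort_permutes hP σ₁ (σ.pub .N)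
    (fun i hi => by rw [(h1 i hi).1]; exact hlt i hi)
    (fun i hi j hj => by rw [(h1 i hi).1, (h1 j hj).1]; exact hinj i hi j hj)
  have hrun : HL.run P (.sort .N) σ₁ = σ₁.sort P (σ.pub .N) := by simp only [HL.run, hN₁]
  rw [hrun]
  refine ⟨fun i hi => ?_, fun i hi => ?_⟩
  · rw [wordTo_spec P A hA, St.sort_pub, hN₁, if_pos (hlt i hi), ← (h1 i hi).1, h2 i hi,
      (h1 i hi).2]
  · rw [wordTo_spec P A hA, St.sort_pub, hN₁, if_neg (by omega), St.sort_arr P σ₁ _ A hA, hA₁]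

/-! ### Ranks: unassigned records first -/

def rankBody : HL :=
  .block [.load .t .T ⟨0, [.i]⟩,
    .sc (.ite ⟨0, [], [.t]⟩ ⟨1, [], []⟩
      (.block [.set .r ⟨0, [], [.f]⟩, .set .f ⟨1, [], [.f]⟩])
      (.block [.set .g ⟨1, [], [.g]⟩, .sub .r ⟨0, [.N], []⟩ ⟨0, [], [.g]⟩])),
    .store .R ⟨0, [.i]⟩ ⟨0, [], [.r]⟩]

def rank : HL :=
  .block [.sc (.set .f ⟨0, [], []⟩), .sc (.set .g ⟨0, [], []⟩), .loop .i .N rankBody]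

/-- Number of zeros among the first `i` values. -/
def zeros (t : ℕ → ℕ) (i : ℕ) : ℕ := ((Finset.range i).filter (fun a => t a = 0)).card

theorem zeros_le (t : ℕ → ℕ) (i : ℕ) : zeros t i ≤ i := by
  simpa [zeros] using Finset.card_filter_le (Finset.range i) (fun a => t a = 0)

theorem zeros_succ (t : ℕ → ℕ) (i : ℕ) :
    zeros t (i + 1) = zeros t i + if t i = 0 then 1 else 0 := by
  unfold zeros
  rw [Finset.range_add_one, Finset.filter_insert]
  split_ifs
  · rw [Finset.card_insert_of_notMem (by simp)]
  · rfl

theorem zeros_mono (t : ℕ → ℕ) {i j : ℕ} (h : i ≤ j) : zeros t i ≤ zeros t j :=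
  Finset.card_le_card (Finset.filter_subset_filter _ (by simpa using h))

/-- The rank of position `a` when the zeros among the first `N` values are moved to the front. -/
def rankOf (t : ℕ → ℕ) (N a : ℕ) : ℕ :=
  if t a = 0 then zeros t a else N - 1 - (a - zeros t a)

theorem rankOf_lt_zeros {t : ℕ → ℕ} {N a : ℕ} (ha : a < N) (h : t a = 0) :
    rankOf t N a < zeros t N := by
  have h1 := zeros_succ t a
  have h2 := zeros_mono t (show a + 1 ≤ N by omega)
  simp only [h, if_true] at h1
  simp only [rankOf, h, if_true]; omega

theorem sub_zeros_mono (t : ℕ → ℕ) {i j : ℕ} (h : i ≤ j) : i - zeros t i ≤ j - zeros t j := by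
  induction j, h using Nat.le_induction with
  | base => exact le_rfl
  | succ j hj ih =>
    have := zeros_succ t j
    have := zeros_le t j
    split_ifs at * <;> omega

theorem zeros_le_rankOf {t : ℕ → ℕ} {N a : ℕ} (ha : a < N) (h : t a ≠ 0) :
    zeros t N ≤ rankOf t N a := by
  have h1 := zeros_succ t a
  have h2 := sub_zeros_mono t (show a + 1 ≤ N by omega)
  have h3 := zeros_le t a
  have h4 := zeros_le t N
  simp only [h, if_false] at h1
  simp only [rankOf, h, if_false]; omega

theorem rankOf_lt {t : ℕ → ℕ} {N a : ℕ} (ha : a < N) : rankOf t N a < N := by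
  by_cases h : t a = 0
  · exact (rankOf_lt_zeros ha h).trans_le (zeros_le t N)
  · simp only [rankOf, h, if_false]; omega

theorem rankOf_ne {t : ℕ → ℕ} {N a b : ℕ} (hab : a < b) (hb : b < N) :
    rankOf t N a ≠ rankOf t N b := by
  by_cases h : t a = 0 <;> by_cases h' : t b = 0
  · have h1 := zeros_succ t a
    have h2 := zeros_mono t (show a + 1 ≤ b by omega)
    simp only [h, if_true] at h1
    simp only [rankOf, h, h', if_true]; omega
  · have := rankOf_lt_zeros (hab.trans hb) h
    have := zeros_le_rankOf hb h'
    omega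
  · have := rankOf_lt_zeros hb h'
    have := zeros_le_rankOf (hab.trans hb) h
    omega
  · have h1 := zeros_succ t a
    have h2 := sub_zeros_mono t (show a + 1 ≤ b by omega)
    have h3 := zeros_le t a
    have h4 := zeros_le t b
    simp only [h, if_false] at h1
    simp only [rankOf, h, h', if_false]; omega

theorem rankOf_inj {t : ℕ → ℕ} {N a b : ℕ} (ha : a < N) (hb : b < N)
    (h : rankOf t N a = rankOf t N b) : a = b := by
  rcases lt_trichotomy a b with hab | hab | hab
  · exact absurd h (rankOf_ne hab hb)
  · exact hab
  · exact absurd h.symm (rankOf_ne hab ha)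

theorem rank_spec (P : Cmd) (σ : St) :
    ∀ a < σ.pub .N, (rank.run P σ).arr .R a = rankOf (σ.arr .T) (σ.pub .N) a := by
  unfold rank
  simp only [HL.run_block_cons, HL.run_block_nil]
  set σ₀ := HL.run P (.sc (.set .g ⟨0, [], []⟩)) (HL.run P (.sc (.set .f ⟨0, [], []⟩)) σ) with hσ₀
  have hf : σ₀.sec .f = 0 := by simp [hσ₀, HL.run, SC.run, SE.ev]
  have hg : σ₀.sec .g = 0 := by simp [hσ₀, HL.run, SC.run, SE.ev]
  have hT : σ₀.arr = σ.arr := rfl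
  have hp : σ₀.pub = σ.pub := rfl
  rw [← hT, ← hp]
  clear_value σ₀
  refine (HL.loop_induction P (k := .i) (N := .N) (c := rankBody)
    (by simp [HL.Wf, HL.block, HL.pmods, rankBody]) σ₀
    (fun i σ' => (∀ a < i, σ'.arr .R a = rankOf (σ₀.arr .T) (σ₀.pub .N) a) ∧
      σ'.arr .T = σ₀.arr .T ∧ σ'.sec .f = zeros (σ₀.arr .T) i ∧
      σ'.sec .g = i - zeros (σ₀.arr .T) i) (by simp [hf, hg, zeros]) ?_).1
  rintro i hi σ' ⟨h1, h2, h3, h4⟩ hk hp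
  have hN' : σ'.pub .N = σ₀.pub .N := hp _ (by simp) (by simp [rankBody, HL.block, HL.pmods])
  have hz := zeros_succ (σ₀.arr .T) i
  have hl := zeros_le (σ₀.arr .T) i
  refine ⟨fun a ha => ?_, ?_, ?_, ?_⟩
  · simp [rankBody, HL.run, PE.ev, SE.ev, hk, hN', h2, h3, h4]
    rcases Nat.lt_succ_iff_lt_or_eq.mp ha with ha | rfl
    · rw [if_neg (by omega), h1 a ha]
    · rw [if_pos rfl]
      unfold rankOf
      split_ifs
      · rfl
      · omega
  · funext a; simp [rankBody, HL.run, PE.ev, SE.ev, hk, hN', h2]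
  · simp [rankBody, HL.run, PE.ev, SE.ev, hk, hN', h2, hz]
    split_ifs <;> simp [h3]; omega
  · simp [rankBody, HL.run, PE.ev, SE.ev, hk, hN', h2, hz]
    split_ifs <;> simp [h4]; omega

end ObliviousCuckoo

namespace ObliviousCuckoo

/-! ### Finding the records whose hash value is unique -/

/-- Keys: the hash value for unassigned records, and `m` for the other ones; words: positions. -/
def keyBody (H : AV) : HL :=
  .block [.load .t .T ⟨0, [.i]⟩, .load .k H ⟨0, [.i]⟩,
    .sc (.ite ⟨0, [], [.t]⟩ ⟨1, [], []⟩ .skip (.set .k ⟨0, [.m], []⟩)),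
    .store .P ⟨0, [.i]⟩ ⟨0, [], [.k]⟩, .store .P ⟨0, [.N, .i]⟩ ⟨0, [.i], []⟩]

/-- Compare a key with its two neighbours. -/
def flagBody : HL :=
  .block [.load .k .P ⟨0, [.i]⟩, .load .y .P ⟨1, [.i]⟩, .load .w .P ⟨0, [.N, .i]⟩,
    .sc (.block [.set .f ⟨1, [], []⟩,
      .ite ⟨0, [], [.r]⟩ ⟨1, [], [.k]⟩ .skip
        (.ite ⟨1, [], [.k]⟩ ⟨0, [], [.r]⟩ .skip (.set .f ⟨0, [], []⟩)),
      .ite ⟨1, [.i], []⟩ ⟨0, [.N], []⟩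
        (.ite ⟨0, [], [.y]⟩ ⟨0, [], [.k]⟩ .skip
          (.ite ⟨0, [], [.k]⟩ ⟨0, [], [.y]⟩ .skip (.set .f ⟨0, [], []⟩))) .skip,
      .set .r ⟨1, [], [.k]⟩]),
    .store .P ⟨0, [.i]⟩ ⟨0, [], [.w]⟩, .store .P ⟨0, [.N, .i]⟩ ⟨0, [], [.f]⟩]

def uniq (H F : AV) : HL :=
  .block [.loop .i .N (keyBody H), .sort .N, .sc (.set .r ⟨0, [], []⟩), .loop .i .N flagBody,
    .sort .N, .loop .i .N (wordTo F)]

/-- The sorting key of position `a`. -/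
def keyOf (σ : St) (H : AV) (a : ℕ) : ℕ := if σ.arr .T a = 0 then σ.arr H a else σ.pub .m

theorem keyBody_spec (P : Cmd) (H : AV) (hH : H ≠ .P) (σ : St) :
    (∀ a < σ.pub .N, ((HL.loop .i .N (keyBody H)).run P σ).arr .P a = keyOf σ H a ∧
      ((HL.loop .i .N (keyBody H)).run P σ).arr .P (σ.pub .N + a) = a) := by
  refine (HL.loop_induction P (k := .i) (N := .N) (c := keyBody H)
    (by simp [HL.Wf, HL.block, HL.pmods, keyBody]) σ
    (fun i σ' => (∀ a < i, σ'.arr .P a = keyOf σ H a ∧ σ'.arr .P (σ.pub .N + a) = a) ∧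
      σ'.arr .T = σ.arr .T ∧ σ'.arr H = σ.arr H) (by simp) ?_).1
  rintro i hi σ' ⟨h1, h2, h3⟩ hk hp
  have hN' : σ'.pub .N = σ.pub .N := hp _ (by simp) (by simp [keyBody, HL.block, HL.pmods])
  have hm' : σ'.pub .m = σ.pub .m := hp _ (by simp) (by simp [keyBody, HL.block, HL.pmods])
  refine ⟨fun a ha => ?_, ?_, ?_⟩
  · simp [keyBody, HL.run, PE.ev, SE.ev, hk, hN', h2, h3, hm', keyOf]
    grind [keyOf]
  · funext a; simp [keyBody, HL.run, PE.ev, SE.ev, hk, hN', h2, h3]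
  · funext a; simp [keyBody, HL.run, PE.ev, SE.ev, hk, hN', h2, h3, hH]

/-- `1` if the key at position `p` differs from its neighbours. -/
def flagOf (K : ℕ → ℕ) (N p : ℕ) : ℕ :=
  if (0 < p ∧ K (p - 1) = K p) ∨ (p + 1 < N ∧ K (p + 1) = K p) then 0 else 1

theorem flagBody_spec (P : Cmd) (σ : St) (hr : σ.sec .r = 0) :
    (∀ a < σ.pub .N,
      ((HL.loop .i .N flagBody).run P σ).arr .P a = σ.arr .P (σ.pub .N + a) ∧
      ((HL.loop .i .N flagBody).run P σ).arr .P (σ.pub .N + a) =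
        flagOf (σ.arr .P) (σ.pub .N) a) := by
  refine (HL.loop_induction P (k := .i) (N := .N) (c := flagBody)
    (by simp [HL.Wf, HL.block, HL.pmods, flagBody]) σ
    (fun i σ' => (∀ a < i, σ'.arr .P a = σ.arr .P (σ.pub .N + a) ∧
        σ'.arr .P (σ.pub .N + a) = flagOf (σ.arr .P) (σ.pub .N) a) ∧
      (∀ a, i ≤ a → a < σ.pub .N → σ'.arr .P a = σ.arr .P a ∧
        σ'.arr .P (σ.pub .N + a) = σ.arr .P (σ.pub .N + a)) ∧
      σ'.sec .r = if i = 0 then 0 else σ.arr .P (i - 1) + 1) (by simp [hr]) ?_).1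
  rintro i hi σ' ⟨h1, h2, h3⟩ hk hp
  have hN' : σ'.pub .N = σ.pub .N := hp _ (by simp) (by simp [flagBody, HL.block, HL.pmods])
  obtain ⟨h4, h5⟩ := h2 i le_rfl hi
  have h6 : i + 1 < σ.pub .N → σ'.arr .P (i + 1) = σ.arr .P (i + 1) :=
    fun h => (h2 (i + 1) (by omega) h).1
  refine ⟨fun a ha => ?_, fun a ha ha' => ?_, ?_⟩
  · rcases Nat.lt_succ_iff_lt_or_eq.mp ha with ha | rfl
    · have : ¬ a = σ.pub .N + i := by omega
      simp [flagBody, HL.run, PE.ev, SE.ev, hk, hN', this, ha.ne, h1 a ha]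
      omega
    · constructor
      · simp [flagBody, HL.run, PE.ev, SE.ev, hk, hN', h5]
        omega
      · simp [flagBody, HL.run, PE.ev, SE.ev, hk, hN', h4, h3, flagOf,
          add_comm 1]
        grind
  · have h7 : ¬ a = σ.pub .N + i := by omega
    have h8 : ¬ a = i := by omega
    have h9 := h2 a (by omega) ha'
    simp [flagBody, HL.run, PE.ev, SE.ev, hk, hN', h7, h8, h9]
    omega
  · simp [flagBody, HL.run, PE.ev, SE.ev, hk, h4, add_comm]

open Classical in
theorem uniq_spec {P : Cmd} {T : ℕ → ℕ} (hP : IsObliviousSort P T) (H F : AV) (hH : H ≠ .P)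
    (hF : F ≠ .P) (σ : St) (i : ℕ) (hi : i < σ.pub .N) :
    ((uniq H F).run P σ).arr F i =
      if ∃ j < σ.pub .N, j ≠ i ∧ keyOf σ H j = keyOf σ H i then 0 else 1 := by
  unfold uniq
  simp only [HL.run_block_cons, HL.run_block_nil]
  have h1 := keyBody_spec P H hH σ
  set σ₁ := HL.run P (.loop .i .N (keyBody H)) σ with hσ₁
  set N := σ.pub .N with hN
  have hN₁ : σ₁.pub .N = N := by
    rw [hσ₁, HL.run_pub, HL.prun_of_notMem _ _ _ (by simp [keyBody, HL.block, HL.pmods])]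
  have hrun : HL.run P (.sort .N) σ₁ = σ₁.sort P N := by simp only [HL.run, hN₁]
  rw [hrun]
  obtain ⟨π, hπ, hs⟩ := sort_spec hP σ₁ N
  set σ₂ := HL.run P (.sc (.set .r ⟨0, [], []⟩)) (σ₁.sort P N) with hσ₂
  have ha₂ : σ₂.arr = (σ₁.sort P N).arr := rfl
  have hN₂ : σ₂.pub .N = N := by simp [hσ₂, HL.run, hN₁]
  rw [← ha₂] at hπ hs
  have h2 := flagBody_spec P σ₂ (by simp [hσ₂, HL.run, SE.ev])
  clear_value σ₂
  set σ₃ := HL.run P (.loop .i .N flagBody) σ₂ with hσ₃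
  have hN₃ : σ₃.pub .N = N := by
    rw [hσ₃, HL.run_pub, HL.prun_of_notMem _ _ _ (by simp [flagBody, HL.block, HL.pmods]), hN₂]
  have hrun' : HL.run P (.sort .N) σ₃ = σ₃.sort P N := by simp only [HL.run, hN₃]
  rw [hrun', wordTo_spec P F hF, St.sort_pub, hN₃, if_pos hi]
  rw [hN₂] at h2
  have hkey : ∀ p : Fin N, σ₂.arr .P p = keyOf σ H (π p) := fun p => by
    rw [(hπ p).1, (h1 _ (π p).2).1]
  have hpos : ∀ p : Fin N, σ₃.arr .P p = π p := fun p => by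
    rw [(h2 p p.2).1, (hπ p).2, (h1 _ (π p).2).2]
  have h3 := sort_permutes hP σ₃ N
    (fun p hp => by rw [hpos ⟨p, hp⟩]; exact (π ⟨p, hp⟩).2)
    (fun p hp q hq h => by
      rw [hpos ⟨p, hp⟩, hpos ⟨q, hq⟩] at h
      simpa using π.injective (Fin.ext h))
  obtain ⟨p, hp⟩ : ∃ p : Fin N, π p = ⟨i, hi⟩ := π.surjective _
  have h4 := h3 p p.2
  rw [hpos, hp] at h4
  rw [h4, (h2 p p.2).2]
  unfold flagOf
  congr 1
  rw [eq_iff_iff]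
  have hkp : σ₂.arr .P p = keyOf σ H i := by rw [hkey, hp]
  constructor
  · rintro (⟨h0, h⟩ | ⟨h0, h⟩)
    · refine ⟨π ⟨p - 1, by omega⟩, (π _).2, ?_, ?_⟩
      · intro h'
        have : π ⟨p - 1, by omega⟩ = π p := by rw [hp]; exact Fin.ext h'
        have := congrArg Fin.val (π.injective this)
        simp at this; omega
      · rw [← hkey, ← hkp]; exact h
    · refine ⟨π ⟨p + 1, by omega⟩, (π _).2, ?_, ?_⟩
      · intro h'
        have : π ⟨p + 1, by omega⟩ = π p := by rw [hp]; exact Fin.ext h'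
        have := congrArg Fin.val (π.injective this)
        simp at this
      · rw [← hkey, ← hkp]; exact h
  · rintro ⟨j, hj, hji, h⟩
    obtain ⟨q, hq⟩ : ∃ q : Fin N, π q = ⟨j, hj⟩ := π.surjective _
    have hkq : σ₂.arr .P q = keyOf σ H j := by rw [hkey, hq]
    rcases lt_trichotomy q.val p.val with hqp | hqp | hqp
    · left
      refine ⟨by omega, ?_⟩
      have a1 := hs q ⟨p - 1, by omega⟩ (by rw [Fin.le_def]; simp; omega)
      have a2 := hs ⟨p - 1, by omega⟩ p (by rw [Fin.le_def]; simp)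
      simp only at a1 a2
      omega
    · have : q = p := Fin.ext hqp
      rw [this, hp] at hq
      simp at hq; omega
    · right
      refine ⟨by omega, ?_⟩
      have a1 := hs ⟨p + 1, by omega⟩ q (by rw [Fin.le_def]; simp; omega)
      have a2 := hs p ⟨p + 1, by omega⟩ (by rw [Fin.le_def]; simp)
      simp only at a1 a2
      omega

end ObliviousCuckoo

namespace ObliviousCuckoo

/-! ### A round of peeling -/

/-- Assign a record whose first or second hash value is unique to the corresponding cell. -/
def decideBody : HL :=
  .block [.load .t .T ⟨0, [.i]⟩, .load .x .H₁ ⟨0, [.i]⟩, .load .y .H₂ ⟨0, [.i]⟩,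
    .load .f .F₁ ⟨0, [.i]⟩, .load .g .F₂ ⟨0, [.i]⟩,
    .sc (.ite ⟨0, [], [.t]⟩ ⟨1, [], []⟩
      (.ite ⟨0, [], []⟩ ⟨0, [], [.f]⟩ (.set .t ⟨1, [], [.x]⟩)
        (.ite ⟨0, [], []⟩ ⟨0, [], [.g]⟩ (.set .t ⟨1, [.m], [.y]⟩) .skip)) .skip),
    .store .T ⟨0, [.i]⟩ ⟨0, [], [.t]⟩]

def compact : HL :=
  .block [rank, permField .X, permField .H₁, permField .H₂, permField .T]

def round : HL :=
  .block [uniq .H₁ .F₁, uniq .H₂ .F₂, .loop .i .N decideBody, compact]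

theorem decideBody_spec (P : Cmd) (σ : St) (a : ℕ) :
    ((HL.loop .i .N decideBody).run P σ).arr .T a =
      if a < σ.pub .N then
        if σ.arr .T a = 0 then
          if 0 < σ.arr .F₁ a then 1 + σ.arr .H₁ a
          else if 0 < σ.arr .F₂ a then 1 + σ.pub .m + σ.arr .H₂ a else 0
        else σ.arr .T a
      else σ.arr .T a := by
  refine (HL.loop_induction P (k := .i) (N := .N) (c := decideBody)
    (by simp [HL.Wf, HL.block, HL.pmods, decideBody]) σ
    (fun i σ' => (∀ a, σ'.arr .T a = if a < i then
        if σ.arr .T a = 0 then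
          if 0 < σ.arr .F₁ a then 1 + σ.arr .H₁ a
          else if 0 < σ.arr .F₂ a then 1 + σ.pub .m + σ.arr .H₂ a else 0
        else σ.arr .T a
      else σ.arr .T a) ∧ σ'.arr .H₁ = σ.arr .H₁ ∧ σ'.arr .H₂ = σ.arr .H₂ ∧
      σ'.arr .F₁ = σ.arr .F₁ ∧ σ'.arr .F₂ = σ.arr .F₂) (by simp) ?_).1 a
  rintro i hi σ' ⟨h1, h2, h3, h4, h5⟩ hk hp
  have hm' : σ'.pub .m = σ.pub .m := hp _ (by simp) (by simp [decideBody, HL.block, HL.pmods])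
  have h6 : σ'.arr .T i = σ.arr .T i := by rw [h1, if_neg (by omega)]
  refine ⟨fun a => ?_, ?_, ?_, ?_, ?_⟩
  · simp [decideBody, HL.run, PE.ev, SE.ev, hk, h2, h3, h4, h5, hm', h6]
    rcases lt_trichotomy a i with ha | rfl | ha
    · simp only [ha.ne, if_false, h1 a, ha, if_true, show a ≤ i by omega]
    · simp; grind
    · simp only [ha.ne', if_false, h1 a, if_neg (show ¬ a < i by omega),
        if_neg (show ¬ a ≤ i by omega)]
  all_goals (funext a; simp [decideBody, HL.run, PE.ev, SE.ev, hk, h2, h3, h4, h5])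

variable {n m : ℕ}

/-- The records in the memory are the items `x` with their hash values `h` and their assignment `tg`;
`pos` is the position of an item. -/
structure Holds (σ : St) (x : Fin n → ℕ) (h : HashValues n m) (tg : Fin n → ℕ)
    (pos : Fin n → ℕ) : Prop where
  pub_n : σ.pub .n = n
  pub_m : σ.pub .m = m
  lt : ∀ e, pos e < n
  inj : Function.Injective pos
  surj : ∀ a < n, ∃ e, pos e = a
  X : ∀ e, σ.arr .X (pos e) = x e
  H₁ : ∀ e, σ.arr .H₁ (pos e) = (h e).1
  H₂ : ∀ e, σ.arr .H₂ (pos e) = (h e).2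
  T : ∀ e, σ.arr .T (pos e) = tg e

/-- Only `e` among the unassigned items has the first hash value of `e`. -/
def Alone₁ (h : HashValues n m) (tg : Fin n → ℕ) (e : Fin n) : Prop :=
  ∀ e', e' ≠ e → tg e' = 0 → (h e').1 ≠ (h e).1

/-- Only `e` among the unassigned items has the second hash value of `e`. -/
def Alone₂ (h : HashValues n m) (tg : Fin n → ℕ) (e : Fin n) : Prop :=
  ∀ e', e' ≠ e → tg e' = 0 → (h e').2 ≠ (h e).2

open Classical in
/-- One round of peeling: items that are alone at one of their cells are assigned to it. -/
noncomputable def peel (h : HashValues n m) (tg : Fin n → ℕ) (e : Fin n) : ℕ :=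
  if tg e = 0 then
    if Alone₁ h tg e then 1 + (h e).1 else if Alone₂ h tg e then 1 + m + (h e).2 else 0
  else tg e

theorem Holds.of_arr {σ σ' : St} {x : Fin n → ℕ} {h : HashValues n m} {tg pos : Fin n → ℕ}
    (H : Holds σ x h tg pos) (hn : σ'.pub .n = σ.pub .n) (hm : σ'.pub .m = σ.pub .m)
    (hX : σ'.arr .X = σ.arr .X) (h₁ : σ'.arr .H₁ = σ.arr .H₁) (h₂ : σ'.arr .H₂ = σ.arr .H₂)
    (hT : σ'.arr .T = σ.arr .T) : Holds σ' x h tg pos :=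
  ⟨hn ▸ H.pub_n, hm ▸ H.pub_m, H.lt, H.inj, H.surj, hX ▸ H.X, h₁ ▸ H.H₁, h₂ ▸ H.H₂, hT ▸ H.T⟩

theorem Holds.zeros_le {σ : St} {x : Fin n → ℕ} {h : HashValues n m} {tg pos : Fin n → ℕ}
    (H : Holds σ x h tg pos) {N : ℕ} (hN : N ≤ n) :
    zeros (σ.arr .T) N ≤ (Finset.univ.filter (fun e => tg e = 0)).card := by
  unfold zeros
  refine (Finset.card_le_card (t := (Finset.univ.filter (fun e => tg e = 0)).image pos) ?_).trans
    Finset.card_image_le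
  intro a ha
  simp only [Finset.mem_filter, Finset.mem_range] at ha
  obtain ⟨e, rfl⟩ := H.surj a (by omega)
  simp only [Finset.mem_image, Finset.mem_filter, Finset.mem_univ, true_and]
  exact ⟨e, by rw [← H.T]; exact ha.2, rfl⟩

theorem compact_spec {P : Cmd} {T : ℕ → ℕ} (hP : IsObliviousSort P T) {σ : St} {x : Fin n → ℕ}
    {h : HashValues n m} {tg pos : Fin n → ℕ} (H : Holds σ x h tg pos)
    (hN : σ.pub .N ≤ n) (hpos : ∀ e, tg e = 0 → pos e < σ.pub .N) :
    ∃ pos', Holds (compact.run P σ) x h tg pos' ∧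
      ∀ e, tg e = 0 → pos' e < (Finset.univ.filter (fun e => tg e = 0)).card := by
  set N := σ.pub .N with hNdef
  set R := rankOf (σ.arr .T) N with hR
  let pos' : Fin n → ℕ := fun e => if pos e < N then R (pos e) else pos e
  have hRlt : ∀ a < N, R a < N := fun a ha => rankOf_lt ha
  have hlt : ∀ e, pos' e < n := fun e => by
    simp only [pos']; split_ifs with h1
    · exact (hRlt _ h1).trans_le hN
    · exact H.lt e
  have hinj : Function.Injective pos' := by
    intro e e' hee
    simp only [pos'] at hee
    apply H.inj
    split_ifs at hee with h1 h2 h2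
    · exact rankOf_inj h1 h2 hee
    · have := hRlt _ h1; omega
    · have := hRlt _ h2; omega
    · exact hee
  have hsurj : ∀ a < n, ∃ e, pos' e = a := by
    intro a ha
    have hb : Function.Bijective (fun e : Fin n => (⟨pos' e, hlt e⟩ : Fin n)) :=
      Finite.injective_iff_bijective.mp (fun e e' hee => hinj (congrArg Fin.val hee))
    obtain ⟨e, he⟩ := hb.2 ⟨a, ha⟩
    exact ⟨e, congrArg Fin.val he⟩
  have step : ∀ (A : AV) (σ' : St), A ≠ .P → σ'.pub .N = N →
      (∀ a < N, σ'.arr .R a = R a) →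
      ∀ e, ((permField A).run P σ').arr A (pos' e) = σ'.arr A (pos e) := by
    intro A σ' hA hN' hR' e
    have hspec := permField_spec hP A hA σ' (by
        rw [hN']; intro i hi; rw [hR' i hi]; exact hRlt i hi) (by
        rw [hN']; intro i hi j hj; rw [hR' i hi, hR' j hj]; exact rankOf_inj hi hj)
    rw [hN'] at hspec
    simp only [pos']
    split_ifs with h1
    · rw [← hR' _ h1, hspec.1 _ h1]
    · exact hspec.2 _ (by omega)
  have frameN : ∀ (A : AV) (σ' : St), ((permField A).run P σ').pub .N = σ'.pub .N := fun A σ' => by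
    rw [HL.run_pub, HL.prun_of_notMem _ _ _
      (by simp [permField, permLoad, wordTo, HL.block, HL.pmods])]
  have frameA : ∀ (A B : AV) (σ' : St), B ≠ A → B ≠ .P →
      ((permField A).run P σ').arr B = σ'.arr B := fun A B σ' h1 h2 =>
    HL.run_arr_of_notMem P _ σ' B
      (by simp [permField, permLoad, wordTo, HL.block, HL.amods, h1, h2])
  have hrank := rank_spec P σ
  have frank : ∀ B, B ≠ AV.R → (rank.run P σ).arr B = σ.arr B := fun B hB =>
    HL.run_arr_of_notMem P _ σ B (by simp [rank, rankBody, HL.block, HL.amods, hB])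
  have hpub : ∀ v, v ≠ PV.i → (compact.run P σ).pub v = σ.pub v := fun v hv => by
    rw [HL.run_pub, HL.prun_of_notMem _ _ _
      (by simp [compact, rank, rankBody, permField, permLoad, wordTo, HL.block, HL.pmods, hv])]
  refine ⟨pos', ⟨?_, ?_, hlt, hinj, hsurj, ?_, ?_, ?_, ?_⟩, ?_⟩
  · rw [hpub _ (by simp), H.pub_n]
  · rw [hpub _ (by simp), H.pub_m]
  all_goals
    have r0 : (rank.run P σ).pub .N = N := by
      rw [HL.run_pub, HL.prun_of_notMem _ _ _ (by simp [rank, rankBody, HL.block, HL.pmods])]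
    try unfold compact
    try simp only [HL.run_block_cons, HL.run_block_nil]
  · intro e
    simp only [frameA _ _ _ (show AV.X ≠ AV.T by simp) (by simp),
      frameA _ _ _ (show AV.X ≠ AV.H₁ by simp) (by simp),
      frameA _ _ _ (show AV.X ≠ AV.H₂ by simp) (by simp)]
    rw [step .X _ (by simp) r0 hrank, frank _ (by simp), H.X]
  · intro e
    simp only [frameA _ _ _ (show AV.H₁ ≠ AV.T by simp) (by simp),
      frameA _ _ _ (show AV.H₁ ≠ AV.H₂ by simp) (by simp)]
    rw [step .H₁ _ (by simp) (by simp only [frameN, r0])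
      (by simpa only [frameA _ AV.R _ (show AV.R ≠ AV.X by simp) (by simp)] using hrank),
      frameA _ _ _ (by simp) (by simp), frank _ (by simp), H.H₁]
  · intro e
    rw [frameA _ _ _ (show AV.H₂ ≠ AV.T by simp) (by simp),
      step .H₂ _ (by simp) (by simp only [frameN, r0])
      (by simpa only [frameA _ AV.R _ (show AV.R ≠ AV.X by simp) (by simp),
        frameA _ AV.R _ (show AV.R ≠ AV.H₁ by simp) (by simp)] using hrank),
      frameA _ _ _ (by simp) (by simp), frameA _ _ _ (by simp) (by simp), frank _ (by simp), H.H₂]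
  · intro e
    rw [step .T _ (by simp) (by simp only [frameN, r0])
      (by simpa only [frameA _ AV.R _ (show AV.R ≠ AV.X by simp) (by simp),
        frameA _ AV.R _ (show AV.R ≠ AV.H₁ by simp) (by simp),
        frameA _ AV.R _ (show AV.R ≠ AV.H₂ by simp) (by simp)] using hrank),
      frameA _ _ _ (by simp) (by simp), frameA _ _ _ (by simp) (by simp),
      frameA _ _ _ (by simp) (by simp), frank _ (by simp), H.T]
  · intro e he
    have h1 := hpos e he
    simp only [pos', if_pos h1]
    exact (rankOf_lt_zeros h1 (by rw [H.T]; exact he)).trans_le (H.zeros_le hN)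

theorem uniq_holds {P : Cmd} {T : ℕ → ℕ} (hP : IsObliviousSort P T) {σ : St} {x : Fin n → ℕ}
    {h : HashValues n m} {tg pos : Fin n → ℕ} (H : Holds σ x h tg pos)
    (hN : σ.pub .N ≤ n) (hpos : ∀ e, tg e = 0 → pos e < σ.pub .N) (A F : AV) (hA : A ≠ .P)
    (hF : F ≠ .P) (g : Fin n → ℕ) (hg : ∀ e, g e < m) (hAg : ∀ e, σ.arr A (pos e) = g e)
    (e : Fin n) (he : tg e = 0) :
    0 < ((uniq A F).run P σ).arr F (pos e) ↔ ∀ e', e' ≠ e → tg e' = 0 → g e' ≠ g e := by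
  have hke : keyOf σ A (pos e) = g e := by simp [keyOf, H.T, he, hAg]
  rw [uniq_spec hP A F hA hF σ _ (hpos e he)]
  have key : (∃ j < σ.pub .N, j ≠ pos e ∧ keyOf σ A j = keyOf σ A (pos e)) ↔
      ∃ e', e' ≠ e ∧ tg e' = 0 ∧ g e' = g e := by
    constructor
    · rintro ⟨j, hj, hje, hk⟩
      obtain ⟨e', rfl⟩ := H.surj j (by omega)
      have he' : tg e' = 0 := by
        by_contra hne
        rw [hke] at hk
        simp only [keyOf, H.T, hne, if_false, H.pub_m] at hk
        have := hg e; omega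
      refine ⟨e', fun h => hje (by rw [h]), he', ?_⟩
      rw [hke] at hk
      simpa [keyOf, H.T, he', hAg] using hk
    · rintro ⟨e', hne, he', hg'⟩
      refine ⟨pos e', hpos e' he', fun h => hne (H.inj h), ?_⟩
      rw [hke]; simp [keyOf, H.T, he', hAg, hg']
  simp only [key]
  split_ifs with h1
  · simp only [lt_self_iff_false, false_iff]
    obtain ⟨e', h2, h3, h4⟩ := h1
    exact fun h5 => h5 e' h2 h3 h4
  · simp only [Nat.lt_one_iff, true_iff]
    exact fun e' h2 h3 h4 => h1 ⟨e', h2, h3, h4⟩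

theorem uniq_frame (P : Cmd) (A F : AV) (σ : St) :
    (∀ v, v ≠ PV.i → ((uniq A F).run P σ).pub v = σ.pub v) ∧
    ∀ B, B ≠ AV.P → B ≠ F → ((uniq A F).run P σ).arr B = σ.arr B := by
  refine ⟨fun v hv => ?_, fun B h1 h2 => HL.run_arr_of_notMem P _ σ B ?_⟩
  · rw [HL.run_pub, HL.prun_of_notMem _ _ _
      (by simp [uniq, keyBody, flagBody, wordTo, HL.block, HL.pmods, hv])]
  · simp [uniq, keyBody, flagBody, wordTo, HL.block, HL.amods, h1, h2]

theorem decide_holds {P : Cmd} {σ : St} {x : Fin n → ℕ}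
    {h : HashValues n m} {tg pos : Fin n → ℕ} (H : Holds σ x h tg pos)
    (hpos : ∀ e, tg e = 0 → pos e < σ.pub .N)
    (h₁ : ∀ e, tg e = 0 → (0 < σ.arr .F₁ (pos e) ↔ Alone₁ h tg e))
    (h₂ : ∀ e, tg e = 0 → (0 < σ.arr .F₂ (pos e) ↔ Alone₂ h tg e)) :
    Holds ((HL.loop .i .N decideBody).run P σ) x h (peel h tg) pos := by
  have hp : ∀ v, v ≠ PV.i → ((HL.loop .i .N decideBody).run P σ).pub v = σ.pub v := fun v hv => by
    rw [HL.run_pub, HL.prun_of_notMem _ _ _ (by simp [decideBody, HL.block, HL.pmods, hv])]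
  have ha : ∀ A, A ≠ AV.T → ((HL.loop .i .N decideBody).run P σ).arr A = σ.arr A := fun A h1 =>
    HL.run_arr_of_notMem P _ σ A (by simp [decideBody, HL.block, HL.amods, h1])
  refine ⟨by rw [hp _ (by simp), H.pub_n], by rw [hp _ (by simp), H.pub_m], H.lt, H.inj, H.surj,
    fun e => ?_, fun e => ?_, fun e => ?_, fun e => ?_⟩
  · rw [ha _ (by simp), H.X]
  · rw [ha _ (by simp), H.H₁]
  · rw [ha _ (by simp), H.H₂]
  · rw [decideBody_spec, H.T, H.H₁, H.H₂, H.pub_m]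
    by_cases he : tg e = 0
    · rw [if_pos (hpos e he), if_pos he]
      have i₁ := h₁ e he
      have i₂ := h₂ e he
      simp only [peel, he, if_true]
      by_cases c₁ : Alone₁ h tg e <;> by_cases c₂ : Alone₂ h tg e <;> simp_all
    · simp [peel, he]

theorem round_spec {P : Cmd} {T : ℕ → ℕ} (hP : IsObliviousSort P T) {σ : St} {x : Fin n → ℕ}
    {h : HashValues n m} {tg pos : Fin n → ℕ} (H : Holds σ x h tg pos)
    (hN : σ.pub .N ≤ n) (hpos : ∀ e, tg e = 0 → pos e < σ.pub .N) :
    ∃ pos', Holds (round.run P σ) x h (peel h tg) pos' ∧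
      ∀ e, peel h tg e = 0 →
        pos' e < (Finset.univ.filter (fun e => peel h tg e = 0)).card := by
  unfold round
  simp only [HL.run_block_cons, HL.run_block_nil]
  obtain ⟨p₁, a₁⟩ := uniq_frame P .H₁ .F₁ σ
  have u₁ := uniq_holds hP H hN hpos .H₁ .F₁ (by simp) (by simp) (fun e => (h e).1)
    (fun e => (h e).1.2) H.H₁
  generalize (uniq .H₁ .F₁).run P σ = σ₁ at *
  have H₁ : Holds σ₁ x h tg pos := H.of_arr (p₁ _ (by simp)) (p₁ _ (by simp))
    (a₁ _ (by simp) (by simp)) (a₁ _ (by simp) (by simp)) (a₁ _ (by simp) (by simp))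
    (a₁ _ (by simp) (by simp))
  rw [← p₁ _ (by simp)] at hN
  simp only [← p₁ .N (by simp)] at hpos
  obtain ⟨p₂, a₂⟩ := uniq_frame P .H₂ .F₂ σ₁
  have u₂ := uniq_holds hP H₁ hN hpos .H₂ .F₂ (by simp) (by simp) (fun e => (h e).2)
    (fun e => (h e).2.2) H₁.H₂
  generalize (uniq .H₂ .F₂).run P σ₁ = σ₂ at *
  have H₂ : Holds σ₂ x h tg pos := H₁.of_arr (p₂ _ (by simp)) (p₂ _ (by simp))
    (a₂ _ (by simp) (by simp)) (a₂ _ (by simp) (by simp)) (a₂ _ (by simp) (by simp))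
    (a₂ _ (by simp) (by simp))
  rw [← p₂ _ (by simp)] at hN
  simp only [← p₂ .N (by simp)] at hpos
  have H₃ := decide_holds (P := P) H₂ hpos
    (fun e he => by
      rw [a₂ _ (by simp) (by simp), u₁ e he]; simp only [Alone₁, ne_eq, Fin.val_inj])
    (fun e he => by rw [u₂ e he]; simp only [Alone₂, ne_eq, Fin.val_inj])
  have hp : ((HL.loop .i .N decideBody).run P σ₂).pub .N = σ₂.pub .N := by
    rw [HL.run_pub, HL.prun_of_notMem _ _ _ (by simp [decideBody, HL.block, HL.pmods])]
  rw [← hp] at hN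
  simp only [← hp] at hpos
  exact compact_spec hP H₃ hN fun e he => hpos e (by
    by_contra hne
    simp [peel, hne] at he)

theorem round_frame (P : Cmd) (σ : St) :
    (∀ v, v ≠ PV.i → (round.run P σ).pub v = σ.pub v) ∧ (round.run P σ).raw = σ.raw := by
  refine ⟨fun v hv => ?_, HL.run_raw P _ σ ?_⟩
  · rw [HL.run_pub, HL.prun_of_notMem _ _ _
      (by simp [round, uniq, keyBody, flagBody, decideBody, compact, rank, rankBody, permField,
        permLoad, wordTo, HL.block, HL.pmods, hv])]
  · simp [round, uniq, keyBody, flagBody, decideBody, compact, rank, rankBody, permField,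
        permLoad, wordTo, HL.block, HL.KeepsRaw]

end ObliviousCuckoo

namespace ObliviousCuckoo

/-! ### Optimality of greedy assignments -/

variable {n m : ℕ}

/-- Codes of the two cells of an item; `0` stands for "unassigned", and the `k`-th cell of the stash
has code `1 + 2 * m + k`. -/
def code₁ (h : HashValues n m) (e : Fin n) : ℕ := 1 + (h e).1

def code₂ (h : HashValues n m) (e : Fin n) : ℕ := 1 + m + (h e).2

theorem code₁_le (h : HashValues n m) (e : Fin n) : code₁ h e ≤ m := by
  have := (h e).1.2; unfold code₁; omega

theorem lt_code₂ (h : HashValues n m) (e : Fin n) : m < code₂ h e := by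
  unfold code₂; omega

theorem code₂_le (h : HashValues n m) (e : Fin n) : code₂ h e ≤ 2 * m := by
  have := (h e).2.2; unfold code₂; omega

theorem code₁_pos (h : HashValues n m) (e : Fin n) : 0 < code₁ h e := by
  unfold code₁; omega

theorem code₁_ne_code₂ (h : HashValues n m) (e e' : Fin n) : code₁ h e ≠ code₂ h e' := by
  have := code₁_le h e; have := lt_code₂ h e'; omega

/-- A partial assignment with `cnt` items in the stash. -/
structure Valid (h : HashValues n m) (tg : Fin n → ℕ) (cnt : ℕ) : Prop where
  code : ∀ e, tg e = 0 ∨ tg e = code₁ h e ∨ tg e = code₂ h e ∨ (2 * m < tg e ∧ tg e ≤ 2 * m + cnt)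
  inj : ∀ e e', tg e = tg e' → tg e ≠ 0 → e = e'
  card : (Finset.univ.filter (fun e => 2 * m < tg e)).card = cnt

/-- The assignment can be extended to one with at most `s` items in the stash. -/
def Ext (h : HashValues n m) (s : ℕ) (tg : Fin n → ℕ) : Prop :=
  ∃ φ : Fin n → ℕ, (∀ e, φ e = 0 ∨ φ e = code₁ h e ∨ φ e = code₂ h e) ∧
    (∀ e e', φ e = φ e' → φ e ≠ 0 → e = e') ∧
    (Finset.univ.filter (fun e => φ e = 0)).card ≤ s ∧
    ∀ e, tg e ≠ 0 → φ e = if 2 * m < tg e then 0 else tg e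

def Occ (tg : Fin n → ℕ) (v : ℕ) : Prop := ∃ e, tg e = v

theorem Alone₁.code {h : HashValues n m} {tg : Fin n → ℕ} {e : Fin n} (H : Alone₁ h tg e)
    (e' : Fin n) (hne : e' ≠ e) (he' : tg e' = 0) :
    code₁ h e ≠ code₁ h e' ∧ code₁ h e ≠ code₂ h e' := by
  refine ⟨fun hc => H e' hne he' (Fin.ext ?_), code₁_ne_code₂ h e e'⟩
  unfold code₁ at hc; omega

theorem Alone₂.code {h : HashValues n m} {tg : Fin n → ℕ} {e : Fin n} (H : Alone₂ h tg e)
    (e' : Fin n) (hne : e' ≠ e) (he' : tg e' = 0) :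
    code₂ h e ≠ code₁ h e' ∧ code₂ h e ≠ code₂ h e' := by
  refine ⟨(code₁_ne_code₂ h e' e).symm, fun hc => H e' hne he' (Fin.ext ?_)⟩
  unfold code₂ at hc; omega

theorem Ext.take {h : HashValues n m} {s : ℕ} {tg : Fin n → ℕ} (H : Ext h s tg) {e : Fin n}
    (he : tg e = 0) {v w : ℕ} (hvw : (v = code₁ h e ∧ w = code₂ h e) ∨
      (v = code₂ h e ∧ w = code₁ h e)) (hv : ¬ Occ tg v)
    (hw : Occ tg w ∨ ∀ e', e' ≠ e → tg e' = 0 → v ≠ code₁ h e' ∧ v ≠ code₂ h e') :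
    Ext h s (Function.update tg e v) := by
  obtain ⟨φ, h1, h2, h3, h4⟩ := H
  have b1 := code₁_le h e
  have b2 := lt_code₂ h e
  have b3 := code₂_le h e
  have b4 := code₁_pos h e
  have hv0 : v ≠ 0 := by omega
  have hv2 : ¬ 2 * m < v := by omega
  have hvφ : ∀ g, φ g = v → tg g = 0 := by
    intro g hg
    by_contra hne
    have := h4 g hne
    rw [hg] at this
    split_ifs at this
    · exact hv0 this
    · exact hv ⟨g, this.symm⟩
  refine ⟨fun x => if x = e then v else if φ x = v then 0 else φ x, ?_, ?_, ?_, ?_⟩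
  · intro x
    dsimp only
    split_ifs with hx hx'
    · subst hx; omega
    · exact .inl rfl
    · exact h1 x
  · intro x y
    dsimp only
    have := h2 x y
    split_ifs <;> grind
  · by_cases hg : ∃ g, g ≠ e ∧ φ g = v
    · obtain ⟨g, hge, hg⟩ := hg
      have hg0 := hvφ g hg
      have ho : Occ tg w := by
        refine hw.resolve_right (fun H => ?_)
        have := H g hge hg0
        rcases h1 g with h | h | h <;> omega
      obtain ⟨f, hf⟩ := ho
      have hfw : φ f = w := by
        rw [h4 f (by omega), if_neg (by omega), hf]
      have hφe : φ e = 0 := by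
        have c1 : φ e ≠ v := fun h => hge (h2 g e (by rw [hg, h]) (by omega))
        have c2 : φ e ≠ w := by
          intro h
          have := h2 f e (by rw [hfw, h]) (by omega)
          subst this; omega
        rcases h1 e with h | h | h <;> omega
      refine le_trans ?_ h3
      have hsub : Finset.univ.filter (fun x => (if x = e then v else if φ x = v then 0 else φ x) = 0)
          ⊆ insert g ((Finset.univ.filter (fun x => φ x = 0)).erase e) := by
        intro x
        simp only [Finset.mem_filter, Finset.mem_univ, true_and, Finset.mem_insert,
          Finset.mem_erase]
        split_ifs with c1 c2
        · intro h; exact absurd h hv0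
        · intro _; left; exact h2 x g (by rw [c2, hg]) (by omega)
        · intro h; exact .inr ⟨c1, h⟩
      refine (Finset.card_le_card hsub).trans ((Finset.card_insert_le _ _).trans ?_)
      rw [Finset.card_erase_add_one]
      simpa using hφe
    · push Not at hg
      refine le_trans (Finset.card_le_card ?_) h3
      intro x
      simp only [Finset.mem_filter, Finset.mem_univ, true_and]
      split_ifs with c1 c2
      · intro h; exact absurd h hv0
      · exact absurd c2 (hg x c1)
      · exact id
  · intro x
    by_cases hx : x = e
    · subst hx; simp [hv2]
    · simp only [Function.update_of_ne hx, if_neg hx]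
      intro h
      rw [if_neg (fun hc => h (hvφ x hc)), h4 x h]

theorem Ext.stash {h : HashValues n m} {s : ℕ} {tg : Fin n → ℕ} (H : Ext h s tg) {e : Fin n}
    (he : tg e = 0) (h₁ : Occ tg (code₁ h e)) (h₂ : Occ tg (code₂ h e)) {v : ℕ} (hv : 2 * m < v) :
    Ext h s (Function.update tg e v) := by
  obtain ⟨φ, h1, h2, h3, h4⟩ := H
  refine ⟨φ, h1, h2, h3, fun x hx => ?_⟩
  have b1 := code₁_le h e
  have b2 := lt_code₂ h e
  have b3 := code₂_le h e
  have b4 := code₁_pos h e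
  by_cases hxe : x = e
  · subst hxe
    simp only [Function.update_self, if_pos hv]
    obtain ⟨f, hf⟩ := h₁
    obtain ⟨g, hg⟩ := h₂
    have c1 := h4 f (by omega)
    have c2 := h4 g (by omega)
    rw [if_neg (by omega)] at c1 c2
    rcases h1 x with h | h | h
    · exact h
    · have := h2 f x (by omega) (by omega); subst this; omega
    · have := h2 g x (by omega) (by omega); subst this; omega
  · rw [Function.update_of_ne hxe] at hx ⊢
    exact h4 x hx

theorem exists_cover {ι : Type*} [DecidableEq ι] (F : Finset ι) (c₁ c₂ : ι → ℕ)
    (h₁ : ∀ e ∈ F, ∃ e' ∈ F, e' ≠ e ∧ c₁ e' = c₁ e)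
    (h₂ : ∀ e ∈ F, ∃ e' ∈ F, e' ≠ e ∧ c₂ e' = c₂ e) (e₀ : ι) (he₀ : e₀ ∈ F) :
    ∃ ψ : ℕ → ι, (∀ v ∈ F.image c₁ ∪ F.image c₂, ψ v ∈ F ∧ (c₁ (ψ v) = v ∨ c₂ (ψ v) = v)) ∧
      (∀ v ∈ F.image c₁ ∪ F.image c₂, ∀ w ∈ F.image c₁ ∪ F.image c₂, ψ v = ψ w → v = w) ∧
      ψ (c₁ e₀) = e₀ := by
  classical
  set V := (F.image c₁ ∪ F.image c₂).erase (c₁ e₀) with hV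
  let t : V → Finset ι := fun v => (F.erase e₀).filter (fun f => c₁ f = v ∨ c₂ f = v)
  have hall : ∀ X : Finset V, X.card ≤ (X.biUnion t).card := by
    intro X
    set X' : Finset ℕ := X.map (Function.Embedding.subtype _) with hX'
    have hX'V : ∀ v ∈ X', v ∈ V := by
      intro v hv
      simp only [hX', Finset.mem_map, Function.Embedding.subtype_apply] at hv
      obtain ⟨a, -, rfl⟩ := hv
      exact a.2
    set S := F.filter (fun f => c₁ f ∈ X' ∨ c₂ f ∈ X') with hS
    have hbi : S.erase e₀ ⊆ X.biUnion t := by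
      intro f hf
      simp only [hS, Finset.mem_erase, Finset.mem_filter] at hf
      simp only [Finset.mem_biUnion, t, Finset.mem_filter, Finset.mem_erase]
      rcases hf.2.2 with h | h
      all_goals
        simp only [hX', Finset.mem_map, Function.Embedding.subtype_apply] at h
        obtain ⟨a, ha, hae⟩ := h
      · exact ⟨a, ha, ⟨hf.1, hf.2.1⟩, .inl hae.symm⟩
      · exact ⟨a, ha, ⟨hf.1, hf.2.1⟩, .inr hae.symm⟩
    refine le_trans ?_ (Finset.card_le_card hbi)
    have hcard : X.card = X'.card := by simp [hX']
    rw [hcard]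
    have d1 : 2 * X'.card ≤ ∑ v ∈ X', (F.filter (fun f => c₁ f = v ∨ c₂ f = v)).card := by
      rw [mul_comm, ← smul_eq_mul]
      refine Finset.card_nsmul_le_sum _ _ _ (fun v hv => ?_)
      have hvV := hX'V v hv
      simp only [hV, Finset.mem_erase, Finset.mem_union, Finset.mem_image] at hvV
      rcases hvV.2 with ⟨f, hf, hfv⟩ | ⟨f, hf, hfv⟩
      · obtain ⟨f', hf', hne, hff⟩ := h₁ f hf
        exact Finset.one_lt_card.mpr ⟨f, by simp [hf, hfv], f', by simp [hf', hff, hfv], hne.symm⟩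
      · obtain ⟨f', hf', hne, hff⟩ := h₂ f hf
        exact Finset.one_lt_card.mpr ⟨f, by simp [hf, hfv], f', by simp [hf', hff, hfv], hne.symm⟩
    have d2 : ∑ v ∈ X', (F.filter (fun f => c₁ f = v ∨ c₂ f = v)).card =
        ∑ f ∈ F, (X'.filter (fun v => c₁ f = v ∨ c₂ f = v)).card := by
      simpa [Finset.bipartiteAbove, Finset.bipartiteBelow] using
        Finset.sum_card_bipartiteAbove_eq_sum_card_bipartiteBelow (s := X') (t := F)
          (fun v f => c₁ f = v ∨ c₂ f = v)
    have d3 : ∑ f ∈ F, (X'.filter (fun v => c₁ f = v ∨ c₂ f = v)).card ≤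
        ∑ f ∈ S, (if f = e₀ then 1 else 2) := by
      rw [hS, Finset.sum_filter]
      refine Finset.sum_le_sum (fun f hf => ?_)
      have hsub : X'.filter (fun v => c₁ f = v ∨ c₂ f = v) ⊆ {c₁ f, c₂ f} := by
        intro v; simp; tauto
      split_ifs with hc1 hc2
      · subst hc2
        have : X'.filter (fun v => c₁ f = v ∨ c₂ f = v) ⊆ {c₂ f} := by
          intro v
          simp only [Finset.mem_filter, Finset.mem_singleton]
          rintro ⟨hv, rfl | rfl⟩
          · exact absurd rfl (Finset.ne_of_mem_erase (hX'V _ hv))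
          · rfl
        simpa using Finset.card_le_card this
      · exact (Finset.card_le_card hsub).trans Finset.card_le_two
      · rw [Finset.card_eq_zero.mpr]
        push Not at hc1
        rw [Finset.filter_eq_empty_iff]
        rintro v hv (rfl | rfl)
        · exact hc1.1 hv
        · exact hc1.2 hv
    by_cases heS : e₀ ∈ S
    · rw [← Finset.add_sum_erase _ _ heS] at d3
      have : ∑ f ∈ S.erase e₀, (if f = e₀ then 1 else 2) = 2 * (S.erase e₀).card := by
        rw [Finset.sum_congr rfl (g := fun _ => 2)]
        · simp [mul_comm]
        · intro f hf; simp [(Finset.mem_erase.mp hf).1]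
      rw [this] at d3
      simp at d3
      simp only [← d2] at d3
      omega
    · have : ∑ f ∈ S, (if f = e₀ then 1 else 2) = 2 * S.card := by
        rw [Finset.sum_congr rfl (g := fun _ => 2)]
        · simp [mul_comm]
        · intro f hf; rw [if_neg (fun hfe => heS (by rw [← hfe]; exact hf))]
      rw [this] at d3
      rw [Finset.erase_eq_of_notMem heS]
      simp only [← d2] at d3
      omega
  obtain ⟨g, hg1, hg2⟩ := (Finset.all_card_le_biUnion_card_iff_exists_injective t).mp hall
  have hg : ∀ v (hv : v ∈ V), g ⟨v, hv⟩ ∈ F ∧ g ⟨v, hv⟩ ≠ e₀ ∧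
      (c₁ (g ⟨v, hv⟩) = v ∨ c₂ (g ⟨v, hv⟩) = v) := fun v hv => by
    have := hg2 ⟨v, hv⟩
    simp only [t, Finset.mem_filter, Finset.mem_erase] at this
    exact ⟨this.1.2, this.1.1, this.2⟩
  refine ⟨fun v => if hv : v ∈ V then g ⟨v, hv⟩ else e₀, fun v hv => ?_, fun v hv w hw => ?_, ?_⟩
  · dsimp only
    split_ifs with h
    · exact ⟨(hg v h).1, (hg v h).2.2⟩
    · have : v = c₁ e₀ := by
        by_contra hne; exact h (Finset.mem_erase.mpr ⟨hne, hv⟩)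
      exact ⟨he₀, .inl this.symm⟩
  · have aux : ∀ u ∈ F.image c₁ ∪ F.image c₂, u ∉ V → u = c₁ e₀ := fun u hu h => by
      by_contra hne; exact h (Finset.mem_erase.mpr ⟨hne, hu⟩)
    dsimp only
    split_ifs with a b b
    · intro h; simpa using hg1 h
    · intro h; exact absurd h (hg v a).2.1
    · intro h; exact absurd h.symm (hg w b).2.1
    · intro _; rw [aux v hv a, aux w hw b]
  · simp [hV]

theorem Ext.break {h : HashValues n m} {s : ℕ} {tg : Fin n → ℕ} (H : Ext h s tg) {e : Fin n}
    (he : tg e = 0)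
    (hall : ∀ e', tg e' = 0 → ¬ Occ tg (code₁ h e') ∧ ¬ Occ tg (code₂ h e') ∧
      ¬ Alone₁ h tg e' ∧ ¬ Alone₂ h tg e') :
    Ext h s (Function.update tg e (code₁ h e)) := by
  classical
  obtain ⟨φ, h1, h2, h3, h4⟩ := H
  set F := Finset.univ.filter (fun e => tg e = 0) with hF
  have memF : ∀ x, x ∈ F ↔ tg x = 0 := fun x => by simp [hF]
  obtain ⟨ψ, p1, p2, p3⟩ := exists_cover F (code₁ h) (code₂ h)
    (fun x hx => by
      have := (hall x ((memF x).mp hx)).2.2.1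
      unfold Alone₁ at this
      push Not at this
      obtain ⟨y, a, b, c⟩ := this
      exact ⟨y, (memF y).mpr b, a, by simp [code₁, c]⟩)
    (fun x hx => by
      have := (hall x ((memF x).mp hx)).2.2.2
      unfold Alone₂ at this
      push Not at this
      obtain ⟨y, a, b, c⟩ := this
      exact ⟨y, (memF y).mpr b, a, by simp [code₂, c]⟩) e ((memF e).mpr he)
  set V := F.image (code₁ h) ∪ F.image (code₂ h) with hV
  have hV0 : ∀ v ∈ V, v ≠ 0 := by
    intro v hv
    simp only [hV, Finset.mem_union, Finset.mem_image] at hv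
    rcases hv with ⟨x, -, rfl⟩ | ⟨x, -, rfl⟩
    · have := code₁_pos h x; omega
    · have := lt_code₂ h x; omega
  have hVocc : ∀ v ∈ V, ¬ Occ tg v := by
    intro v hv
    simp only [hV, Finset.mem_union, Finset.mem_image] at hv
    rcases hv with ⟨x, hx, rfl⟩ | ⟨x, hx, rfl⟩
    · exact (hall x ((memF x).mp hx)).1
    · exact (hall x ((memF x).mp hx)).2.1
  have hφV : ∀ x, tg x ≠ 0 → φ x ∉ V := by
    intro x hx hv
    have := h4 x hx
    split_ifs at this
    · exact hV0 _ hv this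
    · exact hVocc _ hv ⟨x, this.symm⟩
  let φ' : Fin n → ℕ := fun x =>
    if tg x = 0 then if hx : ∃ v ∈ V, ψ v = x then hx.choose else 0 else φ x
  have q1 : ∀ v ∈ V, φ' (ψ v) = v := by
    intro v hv
    have hex : ∃ w ∈ V, ψ w = ψ v := ⟨v, hv, rfl⟩
    simp only [φ', if_pos ((memF _).mp (p1 v hv).1), dif_pos hex]
    exact p2 _ hex.choose_spec.1 _ hv hex.choose_spec.2
  have q2 : ∀ x, tg x = 0 → φ' x ≠ 0 → φ' x ∈ V ∧ ψ (φ' x) = x := by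
    intro x hx hne
    by_cases hex : ∃ v ∈ V, ψ v = x
    · obtain ⟨v, hv, rfl⟩ := hex
      rw [q1 v hv]; exact ⟨hv, rfl⟩
    · simp [φ', hx, dif_neg hex] at hne
  have q3 : ∀ x, tg x ≠ 0 → φ' x = φ x := fun x hx => by simp [φ', hx]
  refine ⟨φ', fun x => ?_, fun x y hxy hx0 => ?_, ?_, fun x hx => ?_⟩
  · by_cases hx : tg x = 0
    · by_cases h0 : φ' x = 0
      · exact .inl h0
      · obtain ⟨a, b⟩ := q2 x hx h0
        have := (p1 _ a).2
        rw [b] at this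
        exact .inr (this.imp Eq.symm Eq.symm)
    · rw [q3 x hx]; exact h1 x
  · by_cases hx : tg x = 0 <;> by_cases hy : tg y = 0
    · rw [← (q2 x hx hx0).2, ← (q2 y hy (hxy ▸ hx0)).2, hxy]
    · have := (q2 x hx hx0).1
      rw [hxy, q3 y hy] at this
      exact absurd this (hφV y hy)
    · have := (q2 y hy (hxy ▸ hx0)).1
      rw [← hxy, q3 x hx] at this
      exact absurd this (hφV x hx)
    · rw [q3 x hx] at hxy hx0
      rw [q3 y hy] at hxy
      exact h2 x y hxy hx0
  · refine le_trans ?_ h3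
    have key : (F.filter (fun x => φ x ≠ 0)).card ≤ (F.filter (fun x => φ' x ≠ 0)).card := by
      have k1 : (F.filter (fun x => φ x ≠ 0)).card ≤ V.card := by
        refine Finset.card_le_card_of_injOn φ (fun x hx => ?_) (fun x hx y hy hxy => ?_)
        · simp only [Finset.coe_filter, Set.mem_ofPred_eq] at hx
          simp only [hV, Finset.coe_union, Finset.coe_image, Set.mem_union, Set.mem_image,
            Finset.mem_coe]
          rcases h1 x with h | h | h
          · exact absurd h hx.2
          · exact .inl ⟨x, hx.1, h.symm⟩
          · exact .inr ⟨x, hx.1, h.symm⟩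
        · simp only [Finset.coe_filter, Set.mem_ofPred_eq] at hx
          exact h2 x y hxy hx.2
      refine k1.trans (Finset.card_le_card_of_injOn ψ (fun v hv => ?_) (fun v hv w hw => p2 v hv w hw))
      simp only [Finset.coe_filter, Set.mem_ofPred_eq]
      exact ⟨(p1 v hv).1, by rw [q1 v hv]; exact hV0 v hv⟩
    have split : ∀ χ : Fin n → ℕ, (Finset.univ.filter (fun x => χ x = 0)).card +
        (F.filter (fun x => χ x ≠ 0)).card =
        ((Finset.univ.filter (fun x => tg x ≠ 0)).filter (fun x => χ x = 0)).card + F.card := by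
      intro χ
      have s1 := Finset.card_filter_add_card_filter_not (s := F) (fun x => χ x = 0)
      have s2 := Finset.card_filter_add_card_filter_not
        (s := Finset.univ.filter (fun x => χ x = 0)) (fun x => tg x = 0)
      have s3 : (Finset.univ.filter (fun x => χ x = 0)).filter (fun x => tg x = 0) =
          F.filter (fun x => χ x = 0) := by
        ext x; simp [hF, and_comm]
      have s4 : (Finset.univ.filter (fun x => χ x = 0)).filter (fun x => ¬ tg x = 0) =
          (Finset.univ.filter (fun x => tg x ≠ 0)).filter (fun x => χ x = 0) := by
        ext x; simp [and_comm]
      rw [s3, s4] at s2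
      simp only [ne_eq] at s1 s2 ⊢
      omega
    have e1 := split φ
    have e2 := split φ'
    have e3 : (Finset.univ.filter (fun x => tg x ≠ 0)).filter (fun x => φ' x = 0) =
        (Finset.univ.filter (fun x => tg x ≠ 0)).filter (fun x => φ x = 0) := by
      refine Finset.filter_congr (fun x hx => ?_)
      rw [q3 x (by simpa using hx)]
    rw [e3] at e2
    omega
  · by_cases hxe : x = e
    · subst hxe
      have b1 := code₁_le h x
      simp only [Function.update_self]
      rw [if_neg (by omega)]
      have := q1 (code₁ h x) (by
        simp only [hV, Finset.mem_union, Finset.mem_image]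
        exact .inl ⟨x, (memF x).mpr he, rfl⟩)
      rwa [p3] at this
    · rw [Function.update_of_ne hxe] at hx ⊢
      rw [q3 x hx, h4 x hx]

end ObliviousCuckoo

namespace ObliviousCuckoo

variable {n m : ℕ}

theorem Valid.take {h : HashValues n m} {tg : Fin n → ℕ} {cnt : ℕ} (H : Valid h tg cnt) {e : Fin n}
    {v : ℕ} (hv : v = code₁ h e ∨ v = code₂ h e) (hocc : ¬ Occ tg v) (he : tg e = 0) :
    Valid h (Function.update tg e v) cnt := by
  have b1 := code₁_le h e
  have b2 := code₂_le h e
  refine ⟨fun x => ?_, fun x y => ?_, ?_⟩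
  · by_cases hx : x = e
    · subst hx; simp only [Function.update_self]; tauto
    · rw [Function.update_of_ne hx]; exact H.code x
  · simp only [Function.update_apply]
    have := H.inj x y
    have o1 : tg x ≠ v := fun h => hocc ⟨x, h⟩
    have o2 : tg y ≠ v := fun h => hocc ⟨y, h⟩
    split_ifs <;> grind
  · rw [← H.card]
    congr 1
    refine Finset.filter_congr (fun x _ => ?_)
    by_cases hx : x = e
    · subst hx; simp only [Function.update_self]; omega
    · rw [Function.update_of_ne hx]

theorem Valid.stash {h : HashValues n m} {tg : Fin n → ℕ} {cnt : ℕ} (H : Valid h tg cnt) {e : Fin n}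
    (he : tg e = 0) : Valid h (Function.update tg e (1 + 2 * m + cnt)) (cnt + 1) := by
  have hlt : ∀ x, tg x ≤ 2 * m + cnt := fun x => by
    have b1 := code₁_le h x
    have b2 := code₂_le h x
    rcases H.code x with h | h | h | h <;> omega
  refine ⟨fun x => ?_, fun x y => ?_, ?_⟩
  · by_cases hx : x = e
    · subst hx; simp only [Function.update_self]; omega
    · rw [Function.update_of_ne hx]
      rcases H.code x with h | h | h | h <;> [exact .inl h; exact .inr (.inl h);
        exact .inr (.inr (.inl h)); (refine .inr (.inr (.inr ?_)); omega)]
  · simp only [Function.update_apply]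
    have := H.inj x y
    have o1 := hlt x
    have o2 := hlt y
    split_ifs <;> grind
  · have : Finset.univ.filter (fun x => 2 * m < Function.update tg e (1 + 2 * m + cnt) x) =
        insert e (Finset.univ.filter (fun x => 2 * m < tg x)) := by
      ext x
      by_cases hx : x = e
      · subst hx; simp; omega
      · simp [hx]
    rw [this, Finset.card_insert_of_notMem (by simp [he]), H.card]

/-- No cell of an unassigned item is occupied. -/
def Free (h : HashValues n m) (tg : Fin n → ℕ) : Prop :=
  ∀ e, tg e = 0 → ¬ Occ tg (code₁ h e) ∧ ¬ Occ tg (code₂ h e)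

theorem peel_cases (h : HashValues n m) (tg : Fin n → ℕ) (e : Fin n) :
    (tg e ≠ 0 ∧ peel h tg e = tg e) ∨
    (tg e = 0 ∧ Alone₁ h tg e ∧ peel h tg e = code₁ h e) ∨
    (tg e = 0 ∧ Alone₂ h tg e ∧ peel h tg e = code₂ h e) ∨
    (tg e = 0 ∧ ¬ Alone₁ h tg e ∧ ¬ Alone₂ h tg e ∧ peel h tg e = 0) := by
  unfold peel code₁ code₂
  split_ifs <;> simp_all

theorem free_peel {h : HashValues n m} {tg : Fin n → ℕ} (H : Free h tg) : Free h (peel h tg) := by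
  have key : ∀ e v, peel h tg e = 0 → (v = code₁ h e ∨ v = code₂ h e) → ¬ Occ (peel h tg) v := by
    rintro e v he hv ⟨g, hg⟩
    obtain ⟨he0, -⟩ | ⟨-, -, he0⟩ | ⟨-, -, he0⟩ | ⟨he0, -⟩ := peel_cases h tg e
    · simp_all [peel]
    · have := code₁_pos h e; omega
    · have := lt_code₂ h e; omega
    have hge : g ≠ e := by
      rintro rfl
      have := code₁_pos h g
      have := lt_code₂ h g
      omega
    have hf := H e he0
    rcases peel_cases h tg g with ⟨h1, h2⟩ | ⟨h1, h2, h3⟩ | ⟨h1, h2, h3⟩ | ⟨h1, -, -, h3⟩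
    · rcases hv with rfl | rfl
      · exact hf.1 ⟨g, by omega⟩
      · exact hf.2 ⟨g, by omega⟩
    · have := h2.code e hge.symm he0
      omega
    · have := h2.code e hge.symm he0
      omega
    · have := code₁_pos h e
      have := lt_code₂ h e
      omega
  exact fun e he => ⟨key e _ he (.inl rfl), key e _ he (.inr rfl)⟩

theorem peel_preserves {h : HashValues n m} {tg : Fin n → ℕ} {cnt s : ℕ} (hF : Free h tg)
    (hV : Valid h tg cnt) :
    Valid h (peel h tg) cnt ∧ (Ext h s tg → Ext h s (peel h tg)) := by
  classical
  let f : Finset (Fin n) → Fin n → ℕ := fun S e => if e ∈ S then peel h tg e else tg e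
  have key : ∀ S, Valid h (f S) cnt ∧ (Ext h s tg → Ext h s (f S)) := by
    intro S
    induction S using Finset.induction with
    | empty => simpa [f] using hV
    | insert e S he ih =>
      have hfe : f S e = tg e := by simp [f, he]
      have hup : f (insert e S) = Function.update (f S) e (peel h tg e) := by
        funext x
        by_cases hx : x = e
        · subst hx; simp [f]
        · simp [f, hx]
      have hzero : ∀ x, f S x = 0 → tg x = 0 := by
        intro x hx
        by_contra hne
        simp only [f] at hx
        split_ifs at hx
        · simp [peel, hne] at hx
        · exact hne hx
      have hocc : ∀ v, v ≠ 0 → ¬ Occ tg v →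
          (∀ x, x ≠ e → tg x = 0 → v ≠ code₁ h x ∧ v ≠ code₂ h x) → ¬ Occ (f S) v := by
        rintro v hv ho ha ⟨x, hx⟩
        by_cases hxS : x ∈ S
        · have hxe : x ≠ e := by rintro rfl; exact he hxS
          simp only [f, hxS, if_true] at hx
          rcases peel_cases h tg x with ⟨h1, h2⟩ | ⟨h1, h2, h3⟩ | ⟨h1, h2, h3⟩ | ⟨h1, -, -, h3⟩
          · exact ho ⟨x, by omega⟩
          · have := ha x hxe h1; omega
          · have := ha x hxe h1; omega
          · omega
        · simp only [f, hxS, if_false] at hx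
          exact ho ⟨x, hx⟩
      rw [hup]
      have b1 := code₁_pos h e
      have b2 := lt_code₂ h e
      rcases peel_cases h tg e with ⟨h1, h2⟩ | ⟨h1, h2, h3⟩ | ⟨h1, h2, h3⟩ | ⟨h1, -, -, h3⟩
      · rw [h2, ← hfe, Function.update_eq_self]; exact ih
      · rw [h3]
        have ho := hocc (code₁ h e) (by omega) (hF e h1).1 (fun x hx h0 => h2.code x hx h0)
        exact ⟨ih.1.take (.inl rfl) ho (by rw [hfe, h1]),
          fun hE => (ih.2 hE).take (by rw [hfe, h1]) (.inl ⟨rfl, rfl⟩) ho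
            (.inr fun x hx h0 => h2.code x hx (hzero x h0))⟩
      · rw [h3]
        have ho := hocc (code₂ h e) (by omega) (hF e h1).2 (fun x hx h0 => h2.code x hx h0)
        exact ⟨ih.1.take (.inr rfl) ho (by rw [hfe, h1]),
          fun hE => (ih.2 hE).take (by rw [hfe, h1]) (.inr ⟨rfl, rfl⟩) ho
            (.inr fun x hx h0 => h2.code x hx (hzero x h0))⟩
      · rw [h3, ← h1, ← hfe, Function.update_eq_self]; exact ih
  simpa [f] using key Finset.univ

theorem valid_zero (h : HashValues n m) : Valid h (fun _ => 0) 0 :=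
  ⟨fun _ => .inl rfl, fun _ _ _ h => absurd rfl h, by simp⟩

theorem free_zero (h : HashValues n m) : Free h (fun _ => 0) := by
  intro e _
  have := code₁_pos h e
  have := lt_code₂ h e
  exact ⟨fun ⟨_, ho⟩ => by dsimp only at ho; omega, fun ⟨_, ho⟩ => by dsimp only at ho; omega⟩

theorem ext_zero {h : HashValues n m} {s : ℕ} (H : StashSuffices h s) : Ext h s (fun _ => 0) := by
  classical
  obtain ⟨loc, hinj, hloc⟩ := H
  let cc : Cell m s → ℕ := fun c => match c with
    | .table₁ j => 1 + j
    | .table₂ j => 1 + m + j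
    | .stash _ => 0
  have hcc : ∀ c d, cc c = cc d → cc c ≠ 0 → c = d := by
    rintro (⟨j, hj⟩ | ⟨j, hj⟩ | j) (⟨k, hk⟩ | ⟨k, hk⟩ | k) <;> simp [cc] <;> omega
  refine ⟨fun e => cc (loc e), fun e => ?_, fun e e' h1 h2 => hinj (hcc _ _ h1 h2), ?_,
    fun e h => absurd rfl h⟩
  · rcases hloc e with h | h | ⟨k, h⟩ <;> simp [cc, h, code₁, code₂]
  · have : ∀ e, cc (loc e) = 0 → ∃ k : Fin s, loc e = .stash k := by
      intro e he
      rcases hloc e with h | h | h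
      · rw [h] at he; simp [cc] at he
      · rw [h] at he; simp [cc] at he
      · exact h
    have := Finset.card_le_card_of_injOn (s := Finset.univ.filter (fun e => cc (loc e) = 0))
      (t := (Finset.univ : Finset (Fin s)).image Fin.val)
      (fun e => if he : cc (loc e) = 0 then ((this e he).choose : ℕ) else 0) ?_ ?_
    · refine this.trans (Finset.card_image_le.trans (by simp))
    · intro e he
      simp only [Finset.coe_filter, Finset.mem_univ, true_and, Set.mem_ofPred_eq] at he
      simp [he]
    · intro e he e' he' hee
      simp only [Finset.coe_filter, Finset.mem_univ, true_and, Set.mem_ofPred_eq] at he he'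
      simp only [he, he', dif_pos] at hee
      apply hinj
      rw [(this e he).choose_spec, (this e' he').choose_spec, Fin.ext hee]

/-- A complete assignment describes an optimal scheme. -/
theorem isCuckooScheme_of_valid {h : HashValues n m} {tg : Fin n → ℕ} {cnt s : ℕ}
    (hV : Valid h tg cnt) (hE : Ext h s tg) (hall : ∀ e, tg e ≠ 0) {x : Fin n → ℕ}
    {M : ℕ → ℕ} (hx : ∀ e, tg e ≤ 2 * m + s → M (tg e - 1) = x e)
    (h0 : ∀ a < 2 * m + s, (∀ e, tg e ≠ a + 1) → M a = 0) :
    IsCuckooScheme x h (fun c : Cell m s => M c.addr) := by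
  classical
  have hcnt : cnt ≤ s := by
    obtain ⟨φ, -, -, h3, h4⟩ := hE
    refine le_trans ?_ h3
    rw [← hV.card]
    refine Finset.card_le_card (fun e => ?_)
    simp only [Finset.mem_filter, Finset.mem_univ, true_and]
    intro he
    rw [h4 e (hall e), if_pos he]
  have hle : ∀ e, tg e ≤ 2 * m + s := fun e => by
    have b1 := code₁_le h e
    have b2 := code₂_le h e
    rcases hV.code e with h | h | h | h <;> omega
  have hex : ∀ e, ∃ c : Cell m s, c.addr + 1 = tg e ∧ (c = .table₁ (h e).1 ∨ c = .table₂ (h e).2 ∨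
      ∃ k, c = .stash k) := by
    intro e
    rcases hV.code e with h1 | h1 | h1 | h1
    · exact absurd h1 (hall e)
    · exact ⟨_, by simp [Cell.addr, h1, code₁, add_comm], .inl rfl⟩
    · exact ⟨_, by simp [Cell.addr, h1, code₂]; omega, .inr (.inl rfl)⟩
    · exact ⟨.stash ⟨tg e - 1 - 2 * m, by omega⟩, by simp [Cell.addr]; omega, .inr (.inr ⟨_, rfl⟩)⟩
  choose loc l1 l2 using hex
  have haddr : ∀ c : Cell m s, c.addr < 2 * m + s := by
    rintro (⟨j, hj⟩ | ⟨j, hj⟩ | ⟨j, hj⟩) <;> simp [Cell.addr] <;> omega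
  have haddr_inj : ∀ c d : Cell m s, c.addr = d.addr → c = d := by
    rintro (⟨j, hj⟩ | ⟨j, hj⟩ | ⟨j, hj⟩) (⟨k, hk⟩ | ⟨k, hk⟩ | ⟨k, hk⟩) <;> simp [Cell.addr] <;> omega
  refine ⟨loc, ⟨fun e e' hee => hV.inj e e' (by rw [← l1, ← l1, hee]) (hall e), l2⟩,
    fun e => ?_, fun c hc => h0 _ (haddr c) (fun e he => hc ⟨e, haddr_inj _ _ ?_⟩)⟩
  · have := hx e (hle e)
    rwa [← l1 e, Nat.add_sub_cancel] at this
  · have := l1 e; omega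

end ObliviousCuckoo

namespace ObliviousCuckoo

/-! ### Greedy assignment of a small number of records -/

/-- Compare the `i`-th record with the `j`-th one. -/
def compareBody : HL :=
  .block [.load .w .T ⟨0, [.j]⟩, .load .f .H₁ ⟨0, [.j]⟩, .load .g .H₂ ⟨0, [.j]⟩,
    .sc (.block [
      .ite ⟨0, [], [.w]⟩ ⟨0, [], [.u]⟩ .skip (.ite ⟨0, [], [.u]⟩ ⟨0, [], [.w]⟩ .skip
        (.set .o ⟨1, [], []⟩)),
      .ite ⟨0, [], [.w]⟩ ⟨0, [], [.v]⟩ .skip (.ite ⟨0, [], [.v]⟩ ⟨0, [], [.w]⟩ .skip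
        (.set .q ⟨1, [], []⟩)),
      .ite ⟨0, [], [.w]⟩ ⟨1, [], []⟩
        (.block [
          .ite ⟨0, [], [.f]⟩ ⟨0, [], [.x]⟩ .skip (.ite ⟨0, [], [.x]⟩ ⟨0, [], [.f]⟩ .skip
            (.ite ⟨0, [.j], []⟩ ⟨0, [.i], []⟩ (.set .d ⟨1, [], []⟩)
              (.ite ⟨0, [.i], []⟩ ⟨0, [.j], []⟩ (.set .d ⟨1, [], []⟩) .skip))),
          .ite ⟨0, [], [.g]⟩ ⟨0, [], [.y]⟩ .skip (.ite ⟨0, [], [.y]⟩ ⟨0, [], [.g]⟩ .skip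
            (.ite ⟨0, [.j], []⟩ ⟨0, [.i], []⟩ (.set .e ⟨1, [], []⟩)
              (.ite ⟨0, [.i], []⟩ ⟨0, [.j], []⟩ (.set .e ⟨1, [], []⟩) .skip)))])
        .skip])]

theorem compare_spec (P : Cmd) (σ : St) (ho : σ.sec .o = 0) (hq : σ.sec .q = 0)
    (hd : σ.sec .d = 0) (he : σ.sec .e = 0) :
    let σ' := (HL.loop .j .N compareBody).run P σ
    (0 < σ'.sec .o ↔ ∃ j < σ.pub .N, σ.arr .T j = σ.sec .u) ∧
    (0 < σ'.sec .q ↔ ∃ j < σ.pub .N, σ.arr .T j = σ.sec .v) ∧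
    (0 < σ'.sec .d ↔ ∃ j < σ.pub .N, σ.arr .T j = 0 ∧ σ.arr .H₁ j = σ.sec .x ∧ j ≠ σ.pub .i) ∧
    (0 < σ'.sec .e ↔ ∃ j < σ.pub .N, σ.arr .T j = 0 ∧ σ.arr .H₂ j = σ.sec .y ∧ j ≠ σ.pub .i) := by
  refine (HL.loop_induction P (k := .j) (N := .N) (c := compareBody)
    (by simp [HL.Wf, HL.block, HL.pmods, compareBody]) σ
    (fun i σ' => ((0 < σ'.sec .o ↔ ∃ j < i, σ.arr .T j = σ.sec .u) ∧
    (0 < σ'.sec .q ↔ ∃ j < i, σ.arr .T j = σ.sec .v) ∧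
    (0 < σ'.sec .d ↔ ∃ j < i, σ.arr .T j = 0 ∧ σ.arr .H₁ j = σ.sec .x ∧ j ≠ σ.pub .i) ∧
    (0 < σ'.sec .e ↔ ∃ j < i, σ.arr .T j = 0 ∧ σ.arr .H₂ j = σ.sec .y ∧ j ≠ σ.pub .i)) ∧
    (σ'.sec .u = σ.sec .u ∧ σ'.sec .v = σ.sec .v ∧ σ'.sec .x = σ.sec .x ∧ σ'.sec .y = σ.sec .y) ∧
    σ'.arr = σ.arr) (by simp [ho, hq, hd, he]) ?_).1
  rintro j hj σ' ⟨⟨h1, h2, h3, h4⟩, ⟨h5, h6, h7, h8⟩, h9⟩ hk hp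
  have hi : σ'.pub .i = σ.pub .i := hp _ (by simp) (by simp [compareBody, HL.block, HL.pmods])
  simp only [Nat.lt_succ_iff_lt_or_eq, or_and_right, exists_or, exists_eq_left]
  refine ⟨⟨?_, ?_, ?_, ?_⟩, ⟨?_, ?_, ?_, ?_⟩, ?_⟩
  · rw [← h1]
    simp [compareBody, HL.run, PE.ev, SE.ev, hk, h5, h6, h7, h8, h9, hi]
    split_ifs <;> simp <;> omega
  · rw [← h2]
    simp [compareBody, HL.run, PE.ev, SE.ev, hk, h5, h6, h7, h8, h9, hi]
    split_ifs <;> simp <;> omega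
  · rw [← h3]
    simp [compareBody, HL.run, PE.ev, SE.ev, hk, h5, h6, h7, h8, h9, hi]
    split_ifs <;> simp <;> omega
  · rw [← h4]
    simp [compareBody, HL.run, PE.ev, SE.ev, hk, h5, h6, h7, h8, h9, hi]
    split_ifs <;> simp <;> omega
  · simp [compareBody, HL.run, PE.ev, SE.ev, h5]
  · simp [compareBody, HL.run, PE.ev, SE.ev, h6]
  · simp [compareBody, HL.run, PE.ev, SE.ev, h7]
  · simp [compareBody, HL.run, PE.ev, SE.ev, h8]
  · simp [compareBody, HL.run, PE.ev, h9]

/-- Load the `i`-th record. -/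
def greedyLoad : HL :=
  .block [.load .t .T ⟨0, [.i]⟩, .load .x .H₁ ⟨0, [.i]⟩, .load .y .H₂ ⟨0, [.i]⟩,
    .sc (.block [.set .u ⟨1, [], [.x]⟩, .set .v ⟨1, [.m], [.y]⟩, .set .o ⟨0, [], []⟩,
      .set .q ⟨0, [], []⟩, .set .d ⟨0, [], []⟩, .set .e ⟨0, [], []⟩])]

/-- Assign the `i`-th record if this is optimal. -/
def greedyDecide : HL :=
  .block [
    .sc (.ite ⟨0, [], [.t]⟩ ⟨1, [], []⟩
      (.ite ⟨0, [], []⟩ ⟨0, [], [.o]⟩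
        (.ite ⟨0, [], []⟩ ⟨0, [], [.q]⟩
          (.block [.set .t ⟨1, [.m, .m], [.cnt]⟩, .set .cnt ⟨1, [], [.cnt]⟩, .set .ch ⟨1, [], []⟩])
          (.block [.set .t ⟨0, [], [.v]⟩, .set .ch ⟨1, [], []⟩]))
        (.ite ⟨0, [], []⟩ ⟨0, [], [.q]⟩
          (.block [.set .t ⟨0, [], [.u]⟩, .set .ch ⟨1, [], []⟩])
          (.ite ⟨0, [], []⟩ ⟨0, [], [.d]⟩
            (.ite ⟨0, [], []⟩ ⟨0, [], [.e]⟩ .skip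
              (.block [.set .t ⟨0, [], [.v]⟩, .set .ch ⟨1, [], []⟩]))
            (.block [.set .t ⟨0, [], [.u]⟩, .set .ch ⟨1, [], []⟩])))) .skip),
    .store .T ⟨0, [.i]⟩ ⟨0, [], [.t]⟩]

def greedyBody : HL := .block [greedyLoad, .loop .j .N compareBody, greedyDecide]

/-- Assign the `i`-th record to its first cell if nothing has changed. -/
def breakBody : HL :=
  .block [.load .t .T ⟨0, [.i]⟩, .load .x .H₁ ⟨0, [.i]⟩,
    .sc (.ite ⟨0, [], [.t]⟩ ⟨1, [], []⟩ (.ite ⟨0, [], [.ch]⟩ ⟨1, [], []⟩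
      (.block [.set .t ⟨1, [], [.x]⟩, .set .ch ⟨1, [], []⟩]) .skip) .skip),
    .store .T ⟨0, [.i]⟩ ⟨0, [], [.t]⟩]

def greedyPass : HL :=
  .block [.sc (.set .ch ⟨0, [], []⟩), .loop .i .N greedyBody, .loop .i .N breakBody]

def greedy : HL := .block [.sc (.set .cnt ⟨0, [], []⟩), .loop .z .N greedyPass]

variable {n m : ℕ}

/-- Nothing is known to be optimal for the item `e`. -/
def Stuck (h : HashValues n m) (tg : Fin n → ℕ) (e : Fin n) : Prop :=
  tg e = 0 → ¬ Occ tg (code₁ h e) ∧ ¬ Occ tg (code₂ h e) ∧ ¬ Alone₁ h tg e ∧ ¬ Alone₂ h tg e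

/-- The situation of the greedy algorithm: unassigned items and items at their cells are among the
first `N` ones. -/
structure Prefix (h : HashValues n m) (tg pos : Fin n → ℕ) (N : ℕ) : Prop where
  lt : ∀ e, tg e = 0 → pos e < N
  occ : ∀ e, tg e = 0 → ∀ g, tg g = code₁ h e ∨ tg g = code₂ h e → pos g < N

theorem Prefix.update {h : HashValues n m} {tg pos : Fin n → ℕ} {N : ℕ} (H : Prefix h tg pos N)
    {e : Fin n} (he : tg e = 0) (v : ℕ) : Prefix h (Function.update tg e v) pos N := by
  have key : ∀ x, Function.update tg e v x = 0 → tg x = 0 := fun x hx => by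
    by_cases hxe : x = e
    · rw [hxe, he]
    · rwa [Function.update_of_ne hxe] at hx
  refine ⟨fun x hx => H.lt x (key x hx), fun x hx g hg => ?_⟩
  by_cases hge : g = e
  · rw [hge]; exact H.lt e he
  · rw [Function.update_of_ne hge] at hg
    exact H.occ x (key x hx) g hg

theorem Holds.setT {σ σ' : St} {x : Fin n → ℕ} {h : HashValues n m} {tg pos : Fin n → ℕ}
    (H : Holds σ x h tg pos) (hn : σ'.pub .n = σ.pub .n) (hm : σ'.pub .m = σ.pub .m)
    (hX : σ'.arr .X = σ.arr .X) (h₁ : σ'.arr .H₁ = σ.arr .H₁) (h₂ : σ'.arr .H₂ = σ.arr .H₂)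
    (e : Fin n) (v : ℕ)
    (hT : ∀ a, σ'.arr .T a = if a = pos e then v else σ.arr .T a) :
    Holds σ' x h (Function.update tg e v) pos :=
  ⟨hn ▸ H.pub_n, hm ▸ H.pub_m, H.lt, H.inj, H.surj, hX ▸ H.X, h₁ ▸ H.H₁, h₂ ▸ H.H₂, fun e' => by
    rw [hT, Function.update_apply]
    simp only [H.inj.eq_iff, H.T]⟩

theorem greedyBody_frame (P : Cmd) (σ : St) :
    (∀ v, v ≠ .j → (greedyBody.run P σ).pub v = σ.pub v) ∧
    ∀ A, A ≠ .T → (greedyBody.run P σ).arr A = σ.arr A := by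
  refine ⟨fun v hv => ?_, fun A hA => HL.run_arr_of_notMem P _ σ A ?_⟩
  · rw [HL.run_pub, HL.prun_of_notMem _ _ _
      (by simp [greedyBody, greedyLoad, greedyDecide, compareBody, HL.block, HL.pmods, hv])]
  · simp [greedyBody, greedyLoad, greedyDecide, compareBody, HL.block, HL.amods, hA]

theorem greedyBody_spec {P : Cmd} {σ : St} {x : Fin n → ℕ}
    {h : HashValues n m} {tg pos : Fin n → ℕ} {s : ℕ} (H : Holds σ x h tg pos)
    (hN : σ.pub .N ≤ n) (hpos : Prefix h tg pos (σ.pub .N)) (hV : Valid h tg (σ.sec .cnt))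
    (e : Fin n) (he : pos e = σ.pub .i) :
    ∃ tg', Holds (greedyBody.run P σ) x h tg' pos ∧ Prefix h tg' pos (σ.pub .N) ∧
      Valid h tg' ((greedyBody.run P σ).sec .cnt) ∧ (Ext h s tg → Ext h s tg') ∧
      ((tg' = tg ∧ (greedyBody.run P σ).sec .ch = σ.sec .ch ∧ Stuck h tg e) ∨
        (tg e = 0 ∧ tg' e ≠ 0 ∧ 0 < (greedyBody.run P σ).sec .ch ∧ ∀ e', e' ≠ e → tg' e' = tg e')) := by
  obtain ⟨fp, fa⟩ := greedyBody_frame P σ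
  have hT := H.T e
  have hH₁ := H.H₁ e
  have hH₂ := H.H₂ e
  set σ₁ := greedyLoad.run P σ with hσ₁
  have l1 : σ₁.arr = σ.arr := by simp [hσ₁, greedyLoad, HL.run]
  have l2 : σ₁.pub = σ.pub := by simp [hσ₁, greedyLoad, HL.run]
  have l3 : σ₁.sec .u = code₁ h e := by
    simp [hσ₁, greedyLoad, HL.run, PE.ev, SE.ev, ← he, hH₁, code₁]
  have l4 : σ₁.sec .v = code₂ h e := by
    simp [hσ₁, greedyLoad, HL.run, PE.ev, SE.ev, ← he, hH₂, code₂, H.pub_m]; omega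
  have l5 : σ₁.sec .x = (h e).1 := by simp [hσ₁, greedyLoad, HL.run, PE.ev, ← he, hH₁]
  have l6 : σ₁.sec .y = (h e).2 := by simp [hσ₁, greedyLoad, HL.run, PE.ev, ← he, hH₂]
  have l7 : σ₁.sec .t = tg e := by simp [hσ₁, greedyLoad, HL.run, PE.ev, ← he, hT]
  have l8 : σ₁.sec .cnt = σ.sec .cnt := by simp [hσ₁, greedyLoad, HL.run]
  have l9 : σ₁.sec .ch = σ.sec .ch := by simp [hσ₁, greedyLoad, HL.run]
  obtain ⟨c1, c2, c3, c4⟩ := compare_spec P σ₁ (by simp [hσ₁, greedyLoad, HL.run, SE.ev])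
    (by simp [hσ₁, greedyLoad, HL.run, SE.ev]) (by simp [hσ₁, greedyLoad, HL.run, SE.ev])
    (by simp [hσ₁, greedyLoad, HL.run, SE.ev])
  have hrun : greedyBody.run P σ = greedyDecide.run P ((HL.loop .j .N compareBody).run P σ₁) := by
    simp [greedyBody, hσ₁]
  rw [hrun] at fp fa ⊢
  have s1 : ∀ v ∈ [SV.u, .v, .t, .cnt, .ch],
      ((HL.loop .j .N compareBody).run P σ₁).sec v = σ₁.sec v := fun v hv =>
    HL.run_sec_of_notMem P _ _ v (by
      simp at hv
      rcases hv with rfl | rfl | rfl | rfl | rfl <;>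
        simp [compareBody, HL.block, HL.smods, SC.block, SC.mods])
  have s2 : ∀ A, ((HL.loop .j .N compareBody).run P σ₁).arr A = σ₁.arr A := fun A =>
    HL.run_arr_of_notMem P _ _ A (by simp [compareBody, HL.block, HL.amods])
  have s3 : ∀ v, v ≠ .j → ((HL.loop .j .N compareBody).run P σ₁).pub v = σ₁.pub v := fun v hv => by
    rw [HL.run_pub, HL.prun_of_notMem _ _ _ (by simp [compareBody, HL.block, HL.pmods, hv])]
  generalize (HL.loop .j .N compareBody).run P σ₁ = σ₂ at *
  have ru := s1 .u (by simp)
  have rv := s1 .v (by simp)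
  have rt := s1 .t (by simp)
  have rcnt := s1 .cnt (by simp)
  have rch := s1 .ch (by simp)
  rw [l3] at ru c1
  rw [l4] at rv c2
  rw [l5, l1, l2] at c3
  rw [l6, l1, l2] at c4
  rw [l1, l2] at c1 c2
  rw [l7] at rt
  rw [l8] at rcnt
  rw [l9] at rch
  have ri : σ₂.pub .i = σ.pub .i := by rw [s3 _ (by simp), l2]
  have rm : σ₂.pub .m = m := by rw [s3 _ (by simp), l2, H.pub_m]
  have rT : ∀ a, σ₂.arr .T a = σ.arr .T a := fun a => by rw [s2, l1]
  have keep : ∀ tg' t', ((greedyDecide.run P σ₂).sec .t = t') → (tg' = Function.update tg e t') →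
      Holds (greedyDecide.run P σ₂) x h tg' pos := by
    rintro _ _ rfl rfl
    refine H.setT (fp _ (by simp)) (fp _ (by simp)) (fa _ (by simp)) (fa _ (by simp))
      (fa _ (by simp)) e _ (fun a => ?_)
    simp [greedyDecide, HL.run, PE.ev, SE.ev, ri, he, rT]
  by_cases h0 : tg e = 0
  swap
  · have hid : tg = Function.update tg e (tg e) := by simp
    refine ⟨tg, keep tg (tg e) ?_ hid, hpos, ?_, id, .inl ⟨rfl, ?_, fun h => absurd h h0⟩⟩
    · simp [greedyDecide, HL.run, SE.ev, rt, h0]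
    · simpa [greedyDecide, HL.run, SE.ev, rt, h0, rcnt] using hV
    · simp [greedyDecide, HL.run, SE.ev, rt, h0, rch]
  have o1 : 0 < σ₂.sec .o ↔ Occ tg (code₁ h e) := by
    rw [c1]
    constructor
    · rintro ⟨j, hj, hj'⟩
      obtain ⟨g, rfl⟩ := H.surj j (by omega)
      exact ⟨g, by rw [← H.T, hj']⟩
    · rintro ⟨g, hg⟩
      exact ⟨pos g, hpos.occ e h0 g (.inl hg), by rw [H.T, hg]⟩
  have o2 : 0 < σ₂.sec .q ↔ Occ tg (code₂ h e) := by
    rw [c2]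
    constructor
    · rintro ⟨j, hj, hj'⟩
      obtain ⟨g, rfl⟩ := H.surj j (by omega)
      exact ⟨g, by rw [← H.T, hj']⟩
    · rintro ⟨g, hg⟩
      exact ⟨pos g, hpos.occ e h0 g (.inr hg), by rw [H.T, hg]⟩
  have a1 : 0 < σ₂.sec .d ↔ ¬ Alone₁ h tg e := by
    rw [c3]
    unfold Alone₁
    push Not
    constructor
    · rintro ⟨j, hj, hj', hj2, hj3⟩
      obtain ⟨g, rfl⟩ := H.surj j (by omega)
      exact ⟨g, fun hge => hj3 (by rw [hge, he]), by rw [← H.T, hj'], by rw [H.H₁] at hj2; exact Fin.ext hj2⟩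
    · rintro ⟨g, hg, hg0, hg2⟩
      exact ⟨pos g, hpos.lt g hg0, by rw [H.T, hg0], by rw [H.H₁, hg2],
        fun hh => hg (H.inj (by rw [hh, he]))⟩
  have a2 : 0 < σ₂.sec .e ↔ ¬ Alone₂ h tg e := by
    rw [c4]
    unfold Alone₂
    push Not
    constructor
    · rintro ⟨j, hj, hj', hj2, hj3⟩
      obtain ⟨g, rfl⟩ := H.surj j (by omega)
      exact ⟨g, fun hge => hj3 (by rw [hge, he]), by rw [← H.T, hj'], by rw [H.H₂] at hj2; exact Fin.ext hj2⟩
    · rintro ⟨g, hg, hg0, hg2⟩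
      exact ⟨pos g, hpos.lt g hg0, by rw [H.T, hg0], by rw [H.H₂, hg2],
        fun hh => hg (H.inj (by rw [hh, he]))⟩
  have b1 := code₁_pos h e
  have b2 := lt_code₂ h e
  have fin : ∀ v cnt', v ≠ 0 → (greedyDecide.run P σ₂).sec .t = v →
      (greedyDecide.run P σ₂).sec .cnt = cnt' → (greedyDecide.run P σ₂).sec .ch = 1 →
      Valid h (Function.update tg e v) cnt' → (Ext h s tg → Ext h s (Function.update tg e v)) →
      ∃ tg', Holds (greedyDecide.run P σ₂) x h tg' pos ∧ Prefix h tg' pos (σ.pub .N) ∧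
      Valid h tg' ((greedyDecide.run P σ₂).sec .cnt) ∧ (Ext h s tg → Ext h s tg') ∧
      ((tg' = tg ∧ (greedyDecide.run P σ₂).sec .ch = σ.sec .ch ∧ Stuck h tg e) ∨
        (tg e = 0 ∧ tg' e ≠ 0 ∧ 0 < (greedyDecide.run P σ₂).sec .ch ∧
          ∀ e', e' ≠ e → tg' e' = tg e')) := by
    intro v cnt' hv ht hc hch hval hext
    exact ⟨_, keep _ v ht rfl, hpos.update h0 v, by rw [hc]; exact hval, hext,
      .inr ⟨h0, by simpa using hv, by omega, fun e' he' => Function.update_of_ne he' _ _⟩⟩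
  by_cases k1 : Occ tg (code₁ h e)
  · have m1 := o1.mpr k1
    by_cases k2 : Occ tg (code₂ h e)
    · have m2 := o2.mpr k2
      refine fin (1 + 2 * m + σ.sec .cnt) (σ.sec .cnt + 1) (by omega) ?_ ?_ ?_ (hV.stash h0)
        (fun hE => hE.stash h0 k1 k2 (by omega))
      · simp [greedyDecide, HL.run, SE.ev, rt, h0, m1, m2, rm, rcnt]; omega
      · simp [greedyDecide, HL.run, SE.ev, rt, h0, m1, m2, rcnt, add_comm]
      · simp [greedyDecide, HL.run, SE.ev, rt, h0, m1, m2]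
    · have m2 : ¬ 0 < σ₂.sec .q := fun hq => k2 (o2.mp hq)
      refine fin (code₂ h e) (σ.sec .cnt) (by omega) ?_ ?_ ?_ (hV.take (.inr rfl) k2 h0)
        (fun hE => hE.take h0 (.inr ⟨rfl, rfl⟩) k2 (.inl k1))
      · simp [greedyDecide, HL.run, SE.ev, rt, h0, m1, m2, rv]
      · simp [greedyDecide, HL.run, SE.ev, rt, h0, m1, m2, rcnt]
      · simp [greedyDecide, HL.run, SE.ev, rt, h0, m1, m2]
  have m1 : ¬ 0 < σ₂.sec .o := fun hq => k1 (o1.mp hq)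
  by_cases k2 : Occ tg (code₂ h e)
  · have m2 := o2.mpr k2
    refine fin (code₁ h e) (σ.sec .cnt) (by omega) ?_ ?_ ?_ (hV.take (.inl rfl) k1 h0)
        (fun hE => hE.take h0 (.inl ⟨rfl, rfl⟩) k1 (.inl k2))
    · simp [greedyDecide, HL.run, SE.ev, rt, h0, m1, m2, ru]
    · simp [greedyDecide, HL.run, SE.ev, rt, h0, m1, m2, rcnt]
    · simp [greedyDecide, HL.run, SE.ev, rt, h0, m1, m2]
  have m2 : ¬ 0 < σ₂.sec .q := fun hq => k2 (o2.mp hq)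
  by_cases k3 : Alone₁ h tg e
  · have m3 : ¬ 0 < σ₂.sec .d := fun hq => a1.mp hq k3
    refine fin (code₁ h e) (σ.sec .cnt) (by omega) ?_ ?_ ?_ (hV.take (.inl rfl) k1 h0)
        (fun hE => hE.take h0 (.inl ⟨rfl, rfl⟩) k1 (.inr fun x hx h0 => k3.code x hx h0))
    · simp [greedyDecide, HL.run, SE.ev, rt, h0, m1, m2, m3, ru]
    · simp [greedyDecide, HL.run, SE.ev, rt, h0, m1, m2, m3, rcnt]
    · simp [greedyDecide, HL.run, SE.ev, rt, h0, m1, m2, m3]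
  have m3 : 0 < σ₂.sec .d := a1.mpr k3
  by_cases k4 : Alone₂ h tg e
  · have m4 : ¬ 0 < σ₂.sec .e := fun hq => a2.mp hq k4
    refine fin (code₂ h e) (σ.sec .cnt) (by omega) ?_ ?_ ?_ (hV.take (.inr rfl) k2 h0)
        (fun hE => hE.take h0 (.inr ⟨rfl, rfl⟩) k2 (.inr fun x hx h0 => k4.code x hx h0))
    · simp [greedyDecide, HL.run, SE.ev, rt, h0, m1, m2, m3, m4, rv]
    · simp [greedyDecide, HL.run, SE.ev, rt, h0, m1, m2, m3, m4, rcnt]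
    · simp [greedyDecide, HL.run, SE.ev, rt, h0, m1, m2, m3, m4]
  have m4 : 0 < σ₂.sec .e := a2.mpr k4
  have hid : tg = Function.update tg e (tg e) := by simp
  refine ⟨tg, keep tg (tg e) ?_ hid, hpos, ?_, id, .inl ⟨rfl, ?_, fun _ => ⟨k1, k2, k3, k4⟩⟩⟩
  · simp [greedyDecide, HL.run, SE.ev, rt, h0, m1, m2, m3, m4]
  · simpa [greedyDecide, HL.run, SE.ev, rt, h0, rcnt, m1, m2, m3, m4] using hV
  · simp [greedyDecide, HL.run, SE.ev, rt, h0, rch, m1, m2, m3, m4]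

end ObliviousCuckoo

namespace ObliviousCuckoo

variable {n m : ℕ}

theorem Holds.setp {σ : St} {x : Fin n → ℕ} {h : HashValues n m} {tg pos : Fin n → ℕ}
    (H : Holds σ x h tg pos) {d : PV} (hn : d ≠ .n) (hm : d ≠ .m) (v : ℕ) :
    Holds (σ.setp d v) x h tg pos :=
  H.of_arr (by simp [hn.symm]) (by simp [hm.symm]) rfl rfl rfl rfl

theorem breakBody_frame (P : Cmd) (σ : St) :
    (∀ v, (breakBody.run P σ).pub v = σ.pub v) ∧
    (∀ A, A ≠ .T → (breakBody.run P σ).arr A = σ.arr A) ∧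
    (breakBody.run P σ).sec .cnt = σ.sec .cnt := by
  refine ⟨fun v => ?_, fun A hA => HL.run_arr_of_notMem P _ σ A ?_,
    HL.run_sec_of_notMem P _ σ _ ?_⟩
  · rw [HL.run_pub, HL.prun_of_notMem _ _ _ (by simp [breakBody, HL.block, HL.pmods])]
  · simp [breakBody, HL.block, HL.amods, hA]
  · simp [breakBody, HL.block, HL.smods, SC.mods, SC.block]

theorem breakBody_spec {P : Cmd} {σ : St} {x : Fin n → ℕ}
    {h : HashValues n m} {tg pos : Fin n → ℕ} (H : Holds σ x h tg pos) (e : Fin n)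
    (he : pos e = σ.pub .i) :
    Holds (breakBody.run P σ) x h
      (if tg e = 0 ∧ σ.sec .ch = 0 then Function.update tg e (code₁ h e) else tg) pos ∧
    (breakBody.run P σ).sec .ch = if tg e = 0 ∧ σ.sec .ch = 0 then 1 else σ.sec .ch := by
  obtain ⟨f1, f2, -⟩ := breakBody_frame P σ
  have hT := H.T e
  have hH₁ := H.H₁ e
  have hid : tg = Function.update tg e (tg e) := by simp
  by_cases h0 : tg e = 0 <;> by_cases h1 : σ.sec .ch = 0
  · rw [if_pos ⟨h0, h1⟩, if_pos ⟨h0, h1⟩]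
    refine ⟨H.setT (f1 _) (f1 _) (f2 _ (by simp)) (f2 _ (by simp)) (f2 _ (by simp)) e _
      (fun a => ?_), ?_⟩
    · simp [breakBody, HL.run, PE.ev, SE.ev, h0, h1, ← he, hT, hH₁, code₁]
    · simp [breakBody, HL.run, PE.ev, SE.ev, h0, h1, ← he, hT]
  all_goals
    rw [if_neg (by tauto), if_neg (by tauto)]
    refine ⟨?_, ?_⟩
    · rw [hid]
      refine H.setT (f1 _) (f1 _) (f2 _ (by simp)) (f2 _ (by simp)) (f2 _ (by simp)) e _
        (fun a => ?_)
      simp [breakBody, HL.run, PE.ev, SE.ev, h0, h1, ← he, hT]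
    · simp [breakBody, HL.run, PE.ev, SE.ev, h0, h1, ← he, hT]

theorem greedyLoop_spec {P : Cmd} {σ : St} {x : Fin n → ℕ}
    {h : HashValues n m} {tg pos : Fin n → ℕ} {s : ℕ} (H : Holds σ x h tg pos)
    (hN : σ.pub .N ≤ n) (hpos : Prefix h tg pos (σ.pub .N)) (hV : Valid h tg (σ.sec .cnt))
    (hch : σ.sec .ch = 0) :
    let σ' := (HL.loop .i .N greedyBody).run P σ
    ∃ tg', Holds σ' x h tg' pos ∧ Prefix h tg' pos (σ.pub .N) ∧
      Valid h tg' (σ'.sec .cnt) ∧ (Ext h s tg → Ext h s tg') ∧ (∀ e, tg e ≠ 0 → tg' e ≠ 0) ∧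
      ((σ'.sec .ch = 0 ∧ tg' = tg ∧ ∀ e, pos e < σ.pub .N → Stuck h tg e) ∨
        (0 < σ'.sec .ch ∧ ∃ e, tg e = 0 ∧ tg' e ≠ 0)) := by
  refine HL.loop_induction P (k := .i) (N := .N) (c := greedyBody)
    (by simp [HL.Wf, HL.block, HL.pmods, greedyBody, greedyLoad, compareBody, greedyDecide]) σ
    (fun i σ' => ∃ tg', Holds σ' x h tg' pos ∧ Prefix h tg' pos (σ.pub .N) ∧
      Valid h tg' (σ'.sec .cnt) ∧ (Ext h s tg → Ext h s tg') ∧ (∀ e, tg e ≠ 0 → tg' e ≠ 0) ∧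
      ((σ'.sec .ch = 0 ∧ tg' = tg ∧ ∀ e, pos e < i → Stuck h tg e) ∨
        (0 < σ'.sec .ch ∧ ∃ e, tg e = 0 ∧ tg' e ≠ 0))) ?_ ?_
  · exact ⟨tg, H.setp (by simp) (by simp) _, hpos, hV, id, fun _ h => h,
      .inl ⟨hch, rfl, fun e he => absurd he (by omega)⟩⟩
  · rintro i hi σ' ⟨tg', h1, h2, h3, h4, h5, h6⟩ hk hp
    have hN' : σ'.pub .N = σ.pub .N := hp _ (by simp)
      (by simp [HL.block, HL.pmods, greedyBody, greedyLoad, compareBody, greedyDecide])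
    obtain ⟨e, he⟩ := h1.surj i (by omega)
    rw [← hN'] at h2
    obtain ⟨tg'', g1, g2, g3, g4, g5⟩ := greedyBody_spec (P := P) (s := s) h1 (by omega) h2 h3 e
      (by rw [he, hk])
    rw [hN'] at g2
    refine ⟨tg'', g1.setp (by simp) (by simp) _, g2, g3, g4 ∘ h4, ?_, ?_⟩
    · intro y hy
      rcases g5 with ⟨rfl, -⟩ | ⟨-, a, -, b⟩
      · exact h5 y hy
      · by_cases hye : y = e
        · rw [hye]; exact a
        · rw [b y hye]; exact h5 y hy
    · simp only [St.setp_sec]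
      rcases g5 with ⟨rfl, a, b⟩ | ⟨a, b, c, d⟩
      · rcases h6 with ⟨r1, rfl, r2⟩ | ⟨r1, r2⟩
        · refine .inl ⟨by omega, rfl, fun y hy => ?_⟩
          rcases Nat.lt_succ_iff_lt_or_eq.mp hy with hy | hy
          · exact r2 y hy
          · have : y = e := h1.inj (by omega)
            rw [this]; exact b
        · exact .inr ⟨by omega, r2⟩
      · refine .inr ⟨c, e, ?_, b⟩
        by_contra hne
        exact h5 e hne a

theorem breakLoop_spec {P : Cmd} {σ : St} {x : Fin n → ℕ}
    {h : HashValues n m} {tg pos : Fin n → ℕ} (H : Holds σ x h tg pos)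
    (hN : σ.pub .N ≤ n) :
    let σ' := (HL.loop .i .N breakBody).run P σ
    σ'.sec .cnt = σ.sec .cnt ∧ ∃ tg', Holds σ' x h tg' pos ∧
      ((tg' = tg ∧ σ'.sec .ch = σ.sec .ch ∧
          (σ.sec .ch = 0 → ∀ e, pos e < σ.pub .N → tg e ≠ 0)) ∨
        (σ.sec .ch = 0 ∧ 0 < σ'.sec .ch ∧
          ∃ e, tg e = 0 ∧ tg' = Function.update tg e (code₁ h e))) := by
  refine HL.loop_induction P (k := .i) (N := .N) (c := breakBody)
    (by simp [HL.Wf, HL.block, HL.pmods, breakBody]) σ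
    (fun i σ' => σ'.sec .cnt = σ.sec .cnt ∧ ∃ tg', Holds σ' x h tg' pos ∧
      ((tg' = tg ∧ σ'.sec .ch = σ.sec .ch ∧
          (σ.sec .ch = 0 → ∀ e, pos e < i → tg e ≠ 0)) ∨
        (σ.sec .ch = 0 ∧ 0 < σ'.sec .ch ∧
          ∃ e, tg e = 0 ∧ tg' = Function.update tg e (code₁ h e)))) ?_ ?_
  · exact ⟨rfl, tg, H.setp (by simp) (by simp) _,
      .inl ⟨rfl, rfl, fun _ e he => absurd he (by omega)⟩⟩
  · rintro i hi σ' ⟨h0, tg', h1, h2⟩ hk hp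
    obtain ⟨e, he⟩ := h1.surj i (by omega)
    obtain ⟨g1, g2⟩ := breakBody_spec (P := P) h1 e (by rw [he, hk])
    refine ⟨by simp [(breakBody_frame P σ').2.2, h0], _, g1.setp (by simp) (by simp) _, ?_⟩
    simp only [St.setp_sec]
    rw [g2]
    rcases h2 with ⟨rfl, a, b⟩ | ⟨a, b, y, c, d⟩
    · split_ifs with hc
      · exact .inr ⟨by omega, by omega, e, hc.1, rfl⟩
      · refine .inl ⟨rfl, a, fun hz y hy => ?_⟩
        rcases Nat.lt_succ_iff_lt_or_eq.mp hy with hy | hy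
        · exact b hz y hy
        · have : y = e := h1.inj (by omega)
          rw [this]; intro h0; exact hc ⟨h0, by omega⟩
    · rw [if_neg (by omega), if_neg (by omega)]
      exact .inr ⟨a, b, y, c, d⟩

theorem greedyPass_spec {P : Cmd} {σ : St} {x : Fin n → ℕ}
    {h : HashValues n m} {tg pos : Fin n → ℕ} {s : ℕ} (H : Holds σ x h tg pos)
    (hN : σ.pub .N ≤ n) (hpos : Prefix h tg pos (σ.pub .N)) (hV : Valid h tg (σ.sec .cnt)) :
    let σ' := greedyPass.run P σ
    ∃ tg', Holds σ' x h tg' pos ∧ Prefix h tg' pos (σ.pub .N) ∧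
      Valid h tg' (σ'.sec .cnt) ∧ (Ext h s tg → Ext h s tg') ∧ (∀ e, tg e ≠ 0 → tg' e ≠ 0) ∧
      ((∀ e, tg' e ≠ 0) ∨ ∃ e, tg e = 0 ∧ tg' e ≠ 0) := by
  dsimp only
  unfold greedyPass
  simp only [HL.run_block_cons, HL.run_block_nil]
  set σ₀ := HL.run P (.sc (.set .ch ⟨0, [], []⟩)) σ with hσ₀
  have a1 : σ₀.arr = σ.arr := rfl
  have a2 : σ₀.pub = σ.pub := rfl
  have a3 : σ₀.sec .ch = 0 := by simp [hσ₀, HL.run, SC.run, SE.ev]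
  have a4 : σ₀.sec .cnt = σ.sec .cnt := by simp [hσ₀, HL.run, SC.run]
  clear_value σ₀
  have H₀ : Holds σ₀ x h tg pos :=
    H.of_arr (by rw [a2]) (by rw [a2]) (by rw [a1]) (by rw [a1]) (by rw [a1]) (by rw [a1])
  rw [← a4] at hV
  rw [← a2] at hN hpos ⊢
  obtain ⟨tg₁, h1, h2, h3, h4, h5, h6⟩ := greedyLoop_spec (P := P) (s := s) H₀ hN hpos hV a3
  have hp : ((HL.loop .i .N greedyBody).run P σ₀).pub .N = σ₀.pub .N := by
    rw [HL.run_pub, HL.prun_of_notMem _ _ _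
      (by simp [HL.block, HL.pmods, greedyBody, greedyLoad, compareBody, greedyDecide])]
  generalize (HL.loop .i .N greedyBody).run P σ₀ = σ₁ at *
  obtain ⟨g0, tg₂, g1, g2⟩ := breakLoop_spec (P := P) h1 (by omega)
  rw [hp] at g2
  rcases g2 with ⟨rfl, b1, b2⟩ | ⟨b1, b2, e, b3, rfl⟩
  · refine ⟨tg₂, g1, h2, by rw [g0]; exact h3, h4, h5, ?_⟩
    rcases h6 with ⟨c1, rfl, -⟩ | ⟨-, c2⟩
    · exact .inl fun e he => b2 c1 e (h2.lt e he) he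
    · exact .inr c2
  · obtain ⟨-, rfl, c3⟩ := h6.resolve_right (by omega)
    have c4 := c3 e (h2.lt e b3) b3
    have b4 := code₁_pos h e
    refine ⟨_, g1, h2.update b3 _, by rw [g0]; exact h3.take (.inl rfl) c4.1 b3,
      fun hE => hE.break b3 (fun y hy => c3 y (h2.lt y hy) hy), fun y hy => ?_,
      .inr ⟨e, b3, by simp; omega⟩⟩
    by_cases hye : y = e
    · rw [hye]; simp; omega
    · rwa [Function.update_of_ne hye]

theorem greedy_spec {P : Cmd} {σ : St} {x : Fin n → ℕ}
    {h : HashValues n m} {tg pos : Fin n → ℕ} {s : ℕ} (H : Holds σ x h tg pos)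
    (hN : σ.pub .N ≤ n) (hpos : ∀ e, tg e = 0 → pos e < σ.pub .N) (hV : Valid h tg 0)
    (hF : Free h tg) :
    ∃ tg' cnt, Holds (greedy.run P σ) x h tg' pos ∧ Valid h tg' cnt ∧ (Ext h s tg → Ext h s tg') ∧
      ∀ e, tg' e ≠ 0 := by
  classical
  unfold greedy
  simp only [HL.run_block_cons, HL.run_block_nil]
  set σ₀ := HL.run P (.sc (.set .cnt ⟨0, [], []⟩)) σ with hσ₀
  have a1 : σ₀.arr = σ.arr := rfl
  have a2 : σ₀.pub = σ.pub := rfl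
  have a3 : σ₀.sec .cnt = 0 := by simp [hσ₀, HL.run, SC.run, SE.ev]
  clear_value σ₀
  have H₀ : Holds σ₀ x h tg pos :=
    H.of_arr (by rw [a2]) (by rw [a2]) (by rw [a1]) (by rw [a1]) (by rw [a1]) (by rw [a1])
  rw [← a3] at hV
  rw [← a2] at hN hpos
  have hpre : Prefix h tg pos (σ₀.pub .N) := ⟨hpos, fun e he g hg => by
    rcases hg with hg | hg
    · exact absurd ⟨g, hg⟩ (hF e he).1
    · exact absurd ⟨g, hg⟩ (hF e he).2⟩
  have hcard : (Finset.univ.filter (fun e => tg e = 0)).card ≤ σ₀.pub .N := by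
    have := Finset.card_le_card_of_injOn (s := Finset.univ.filter (fun e => tg e = 0))
      (t := Finset.range (σ₀.pub .N)) pos (fun e he => by simpa using hpos e (by simpa using he))
      (fun e _ e' _ h => H.inj h)
    simpa using this
  obtain ⟨tg', h1, h2, h3, h4, h5⟩ := HL.loop_induction P (k := .z) (N := .N) (c := greedyPass)
    (by simp [HL.Wf, HL.block, HL.pmods, greedyPass, breakBody, greedyBody, greedyLoad, compareBody,
      greedyDecide]) σ₀
    (fun i σ' => ∃ tg', Holds σ' x h tg' pos ∧ Prefix h tg' pos (σ₀.pub .N) ∧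
      Valid h tg' (σ'.sec .cnt) ∧ (Ext h s tg → Ext h s tg') ∧
      (Finset.univ.filter (fun e => tg' e = 0)).card ≤ σ₀.pub .N - i)
    ⟨tg, H₀.setp (by simp) (by simp) _, hpre, hV, id, by omega⟩ (by
      rintro i hi σ' ⟨tg', h1, h2, h3, h4, h5⟩ hk hp
      have hN' : σ'.pub .N = σ₀.pub .N := hp _ (by simp)
        (by simp [HL.block, HL.pmods, greedyPass, breakBody, greedyBody, greedyLoad, compareBody,
          greedyDecide])
      rw [← hN'] at h2
      obtain ⟨tg'', g1, g2, g3, g4, g5, g6⟩ := greedyPass_spec (P := P) (s := s) h1 (by omega) h2 h3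
      rw [hN'] at g2
      refine ⟨tg'', g1.setp (by simp) (by simp) _, g2, g3, g4 ∘ h4, ?_⟩
      rcases g6 with g6 | ⟨e, c1, c2⟩
      · rw [Finset.filter_eq_empty_iff.mpr (fun e _ => g6 e)]; simp
      · have : (Finset.univ.filter (fun e => tg'' e = 0)).card <
            (Finset.univ.filter (fun e => tg' e = 0)).card := by
          refine Finset.card_lt_card (Finset.ssubset_iff_of_subset (fun y => ?_) |>.mpr
            ⟨e, by simpa using c1, by simpa using c2⟩)
          simp only [Finset.mem_filter, Finset.mem_univ, true_and]
          intro hy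
          by_contra hne
          exact g5 y hne hy
        omega)
  refine ⟨tg', _, h1, h3, h4, fun e he => ?_⟩
  simp only [Nat.sub_self, Nat.le_zero, Finset.card_eq_zero, Finset.filter_eq_empty_iff] at h5
  exact h5 (Finset.mem_univ e) he

theorem greedy_frame (P : Cmd) (σ : St) :
    (∀ v, v ∉ [PV.i, .j, .z] → (greedy.run P σ).pub v = σ.pub v) ∧
      (greedy.run P σ).raw = σ.raw := by
  refine ⟨fun v hv => ?_, HL.run_raw P _ σ ?_⟩
  · simp at hv
    rw [HL.run_pub, HL.prun_of_notMem _ _ _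
      (by simp [greedy, HL.block, HL.pmods, greedyPass, breakBody, greedyBody, greedyLoad,
        compareBody, greedyDecide, hv])]
  · simp [greedy, HL.block, HL.KeepsRaw, greedyPass, breakBody, greedyBody, greedyLoad,
        compareBody, greedyDecide]

end ObliviousCuckoo

namespace ObliviousCuckoo

/-! ### Moving items to a block of cells -/

/-- The combinatorial core: after sorting, the item for the `j`-th cell stands directly in front of
this cell; a second sorting step brings the cells to the front. -/
theorem route_correct {a b : ℕ} {k w : ℕ → ℕ} (hk : ∀ i < a, k i % 2 = 0)
    (hw : ∀ i < a, 0 < w i)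
    (hinj : ∀ i < a, ∀ i' < a, k i < 2 * b → k i = k i' → i = i')
    {K₀ W₀ K₁ W₁ K₂ W₂ K₃ W₃ : ℕ → ℕ}
    (hK₀ : ∀ i < a, K₀ i = k i) (hW₀ : ∀ i < a, W₀ i = w i)
    (hKc : ∀ j < b, K₀ (a + j) = 2 * j + 1) (hWc : ∀ j < b, W₀ (a + j) = 0)
    (π : Equiv.Perm (Fin (a + b))) (hπ : ∀ i : Fin (a + b), K₁ i = K₀ (π i) ∧ W₁ i = W₀ (π i))
    (hs₁ : ∀ i j : Fin (a + b), i ≤ j → K₁ i ≤ K₁ j)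
    (hK₂ : ∀ i < a + b, K₂ i = if W₁ i = 0 then K₁ i else 2 * b + 2)
    (hW₂ : ∀ i < a + b, W₁ i = 0 → W₂ i = if i = 0 then 0 else W₁ (i - 1))
    (ρ : Equiv.Perm (Fin (a + b))) (hρ : ∀ i : Fin (a + b), K₃ i = K₂ (ρ i) ∧ W₃ i = W₂ (ρ i))
    (hs₃ : ∀ i j : Fin (a + b), i ≤ j → K₃ i ≤ K₃ j) (j : ℕ) (hj : j < b) :
    (∀ i < a, k i = 2 * j → W₃ j = w i) ∧ ((∀ i < a, k i ≠ 2 * j) → W₃ j = 0) := by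
  have cell : ∀ j < b, ∃ p : Fin (a + b), (π p : ℕ) = a + j := fun j hj =>
    ⟨π.symm ⟨a + j, by omega⟩, by simp⟩
  have : Nonempty (Fin (a + b)) := ⟨⟨j, by omega⟩⟩
  choose! p hp using cell
  have hitem : ∀ q : Fin (a + b), (π q : ℕ) < a → K₁ q = k (π q) ∧ W₁ q = w (π q) ∧ W₁ q ≠ 0 :=
    fun q hq => by
      have := hw _ hq
      rw [(hπ q).1, (hπ q).2, hK₀ _ hq, hW₀ _ hq]
      exact ⟨rfl, rfl, by omega⟩
  have hcell : ∀ q : Fin (a + b), a ≤ (π q : ℕ) → ∃ j < b, q = p j ∧ K₁ q = 2 * j + 1 ∧ W₁ q = 0 :=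
    fun q hq => by
      have hlt := (π q).2
      have he : (π q : ℕ) = a + (π q - a) := by omega
      refine ⟨π q - a, by omega, π.injective (Fin.ext ?_), ?_, ?_⟩
      · rw [hp _ (by omega)]; exact he
      · rw [(hπ q).1, he, hKc _ (by omega)]; omega
      · rw [(hπ q).2, he, hWc _ (by omega)]
  have hp1 : ∀ j < b, K₁ (p j) = 2 * j + 1 ∧ W₁ (p j) = 0 := fun j hj => by
    rw [(hπ _).1, (hπ _).2, hp j hj, hKc j hj, hWc j hj]; exact ⟨rfl, rfl⟩
  have hlt : ∀ q q' : Fin (a + b), K₁ q < K₁ q' → q < q' := fun q q' h => by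
    by_contra hge
    have := hs₁ q' q (not_lt.mp hge)
    omega
  -- the value found by the cell
  have hval : (∀ i < a, k i = 2 * j → W₂ (p j) = w i) ∧
      ((∀ i < a, k i ≠ 2 * j) → W₂ (p j) = 0) := by
    obtain ⟨c1, c2⟩ := hp1 j hj
    rw [hW₂ _ (p j).2 c2]
    constructor
    · intro i hi hki
      obtain ⟨q, hq⟩ : ∃ q, π q = ⟨i, by omega⟩ := π.surjective _
      have hq' : (π q : ℕ) = i := by rw [hq]
      obtain ⟨d1, d2, -⟩ := hitem q (by omega)
      rw [hq'] at d1 d2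
      have hqp := hlt q (p j) (by omega)
      have hqp' : (q : ℕ) < p j := hqp
      rw [if_neg (by omega)]
      set r : Fin (a + b) := ⟨p j - 1, by omega⟩ with hr
      have e1 := hs₁ q r (by rw [Fin.le_def]; simp [hr]; omega)
      have e2 := hs₁ r (p j) (by rw [Fin.le_def]; simp [hr])
      have hrW : W₁ (p j - 1) = W₁ r := rfl
      rw [hrW]
      rcases lt_or_ge (π r : ℕ) a with hra | hra
      · obtain ⟨f1, f2, -⟩ := hitem r hra
        have := hk _ hra
        have := hinj _ hra i hi (by omega) (by omega)
        rw [f2, this]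
      · obtain ⟨j', hj', f1, f2, -⟩ := hcell r hra
        have : j' = j := by omega
        subst this
        have := congrArg Fin.val f1
        simp [hr] at this; omega
    · intro hno
      split_ifs with h0
      · rfl
      set r : Fin (a + b) := ⟨p j - 1, by omega⟩ with hr
      have e2 := hs₁ r (p j) (by rw [Fin.le_def]; simp [hr])
      have hrW : W₁ (p j - 1) = W₁ r := rfl
      rw [hrW]
      rcases lt_or_ge (π r : ℕ) a with hra | hra
      · obtain ⟨f1, f2, -⟩ := hitem r hra
        have g1 := hk _ hra
        have g2 := hno _ hra
        have hj' : k (π r) / 2 < b := by omega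
        have h1 := hlt (p (k (π r) / 2)) (p j) (by rw [(hp1 _ hj').1]; omega)
        have h2 := hlt r (p (k (π r) / 2)) (by rw [(hp1 _ hj').1]; omega)
        rw [Fin.lt_def] at h1 h2
        have hrv : (r : ℕ) = p j - 1 := rfl
        omega
      · obtain ⟨j', hj', f1, f2, f3⟩ := hcell r hra
        exact f3
  -- the position of the cell after the second sorting step
  let u : ℕ → Fin (a + b) := fun j => ρ.symm (p j)
  have hu : ∀ j < b, K₃ (u j) = 2 * j + 1 := fun j hj => by
    rw [(hρ _).1, hK₂ _ (Fin.is_lt _)]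
    simp only [u, Equiv.apply_symm_apply]
    rw [if_pos (hp1 j hj).2, (hp1 j hj).1]
  have hult : ∀ q q' : Fin (a + b), K₃ q < K₃ q' → q < q' := fun q q' h => by
    by_contra hge
    have := hs₃ q' q (not_lt.mp hge)
    omega
  have hdown : ∀ q : Fin (a + b), q < u j → ∃ j' < j, q = u j' := by
    intro q hq
    have h1 := hs₃ q (u j) hq.le
    rw [hu j hj, (hρ q).1, hK₂ _ (Fin.is_lt _)] at h1
    have h2 : W₁ (ρ q) = 0 := by
      by_contra hne
      rw [if_neg hne] at h1; omega
    rcases lt_or_ge (π (ρ q) : ℕ) a with hra | hra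
    · exact absurd h2 (hitem _ hra).2.2
    · obtain ⟨j', hj', f1, f2, f3⟩ := hcell _ hra
      rw [if_pos h2, f2] at h1
      have hqu : q = u j' := by simp only [u]; rw [← f1]; simp
      refine ⟨j', ?_, hqu⟩
      rcases Nat.lt_or_ge j' j with h | h
      · exact h
      · have : j' = j := by omega
        rw [this] at hqu
        exact absurd hqu hq.ne
  have huj : (u j : ℕ) = j := by
    apply le_antisymm
    · have := Finset.card_le_card_of_surjOn (s := Finset.range j) (t := Finset.range (u j))
        (fun j' => (u j' : ℕ)) (fun q hq => by
          simp only [Finset.coe_range, Set.mem_Iio] at hq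
          obtain ⟨j', h1, h2⟩ := hdown ⟨q, by omega⟩ hq
          exact ⟨j', by simpa using h1, (congrArg Fin.val h2).symm⟩)
      simpa using this
    · have := Finset.card_le_card_of_injOn (s := Finset.range j) (t := Finset.range (u j))
        (fun j' => (u j' : ℕ)) (fun j' hj' => by
          simp only [Finset.coe_range, Set.mem_Iio] at hj' ⊢
          exact hult (u j') (u j) (by rw [hu j hj, hu j' (by omega)]; omega))
        (fun x hx y hy hxy => by
          simp only [Finset.coe_range, Set.mem_Iio] at hx hy
          have h1 := hu x (by omega)
          have h2 := hu y (by omega)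
          simp only at hxy
          rw [hxy] at h1
          omega)
      simpa using this
  have hW : W₃ j = W₂ (p j) := by
    have := (hρ (u j)).2
    rw [huj] at this
    rw [this]; simp [u]
  rw [hW]
  exact hval

/-- Key `2 * l` if the item belongs to the `l`-th cell of the current block of cells. -/
def itemBody : HL :=
  .block [.load .t .T ⟨0, [.o, .i]⟩, .load .x .X ⟨0, [.o, .i]⟩,
    .sc (.block [.set .k ⟨0, [.b, .b], []⟩,
      .ite ⟨0, [.c], []⟩ ⟨0, [], [.t]⟩ (.ite ⟨0, [], [.t]⟩ ⟨1, [.c, .b], []⟩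
        (.block [.sub .t ⟨0, [], [.t]⟩ ⟨1, [.c], []⟩, .set .k ⟨0, [], [.t, .t]⟩]) .skip) .skip]),
    .store .P ⟨0, [.i]⟩ ⟨0, [], [.k]⟩, .store .P ⟨0, [.N, .i]⟩ ⟨0, [], [.x]⟩]

def cellBody : HL :=
  .block [.store .P ⟨0, [.a, .i]⟩ ⟨1, [.i, .i], []⟩, .store .P ⟨0, [.N, .a, .i]⟩ ⟨0, [], []⟩]

/-- Cells copy the word of the entry in front of them; items get a large key. -/
def scanBody : HL :=
  .block [.load .k .P ⟨0, [.i]⟩, .load .w .P ⟨0, [.N, .i]⟩,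
    .sc (.ite ⟨0, [], [.w]⟩ ⟨1, [], []⟩
      (.block [.set .w ⟨0, [], [.r]⟩, .set .r ⟨0, [], []⟩])
      (.block [.set .r ⟨0, [], [.w]⟩, .set .k ⟨2, [.b, .b], []⟩])),
    .store .P ⟨0, [.i]⟩ ⟨0, [], [.k]⟩, .store .P ⟨0, [.N, .i]⟩ ⟨0, [], [.w]⟩]

def writeBody : HL :=
  .block [.load .w .P ⟨0, [.N, .i]⟩, .rload .t ⟨0, [.c, .i]⟩,
    .sc (.ite ⟨0, [], []⟩ ⟨0, [], [.w]⟩ (.set .t ⟨0, [], [.w]⟩) .skip),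
    .rstore ⟨0, [.c, .i]⟩ ⟨0, [], [.t]⟩]

def routeBlock : HL :=
  .block [.loop .i .a itemBody, .loop .i .b cellBody, .sort .N, .sc (.set .r ⟨0, [], []⟩),
    .loop .i .N scanBody, .sort .N, .loop .i .b writeBody]

/-- The key of the item with code `t` for the block of `b` cells that starts at `c`. -/
def routeKey (b c t : ℕ) : ℕ := if c < t ∧ t < c + b + 1 then 2 * (t - (c + 1)) else 2 * b

theorem itemBody_spec (P : Cmd) (σ : St) (haN : σ.pub .a ≤ σ.pub .N) (i : ℕ) (hi : i < σ.pub .a) :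
    ((HL.loop .i .a itemBody).run P σ).arr .P i =
        routeKey (σ.pub .b) (σ.pub .c) (σ.arr .T (σ.pub .o + i)) ∧
      ((HL.loop .i .a itemBody).run P σ).arr .P (σ.pub .N + i) = σ.arr .X (σ.pub .o + i) := by
  refine (HL.loop_induction P (k := .i) (N := .a) (c := itemBody)
    (by simp [HL.Wf, HL.block, HL.pmods, itemBody]) σ
    (fun i σ' => (∀ j < i, σ'.arr .P j =
        routeKey (σ.pub .b) (σ.pub .c) (σ.arr .T (σ.pub .o + j)) ∧
      σ'.arr .P (σ.pub .N + j) = σ.arr .X (σ.pub .o + j)) ∧ σ'.arr .T = σ.arr .T ∧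
      σ'.arr .X = σ.arr .X) (by simp) ?_).1 i hi
  rintro i hi σ' ⟨h1, h2, h3⟩ hk hp
  have hp' : ∀ v, v ≠ .i → σ'.pub v = σ.pub v := fun v hv => hp v hv
    (by simp [itemBody, HL.block, HL.pmods])
  refine ⟨fun j hj => ?_, ?_, ?_⟩
  · have e1 : ¬ j = σ.pub .N + i := by omega
    rcases Nat.lt_succ_iff_lt_or_eq.mp hj with hj | rfl
    · simp [itemBody, HL.run, PE.ev, SE.ev, hk, hp', e1, hj.ne, h1 j hj]
      omega
    · have e2 : ¬ σ.pub .N + j = j := by omega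
      simp [itemBody, HL.run, PE.ev, SE.ev, hk, hp', h2, h3, routeKey]
      split_ifs <;> omega
  · funext a; simp [itemBody, HL.run, PE.ev, SE.ev, hk, hp', h2]
  · funext a; simp [itemBody, HL.run, PE.ev, SE.ev, hk, hp', h3]

theorem cellBody_spec (P : Cmd) (σ : St) (haN : σ.pub .a + σ.pub .b = σ.pub .N) :
    (∀ j < σ.pub .b, ((HL.loop .i .b cellBody).run P σ).arr .P (σ.pub .a + j) = 2 * j + 1 ∧
      ((HL.loop .i .b cellBody).run P σ).arr .P (σ.pub .N + (σ.pub .a + j)) = 0) ∧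
    ∀ i < σ.pub .a, ((HL.loop .i .b cellBody).run P σ).arr .P i = σ.arr .P i ∧
      ((HL.loop .i .b cellBody).run P σ).arr .P (σ.pub .N + i) = σ.arr .P (σ.pub .N + i) := by
  refine (HL.loop_induction P (k := .i) (N := .b) (c := cellBody)
    (by simp [HL.Wf, HL.block, HL.pmods, cellBody]) σ
    (fun i σ' => (∀ j < i, σ'.arr .P (σ.pub .a + j) = 2 * j + 1 ∧
      σ'.arr .P (σ.pub .N + (σ.pub .a + j)) = 0) ∧
      ∀ j < σ.pub .a, σ'.arr .P j = σ.arr .P j ∧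
        σ'.arr .P (σ.pub .N + j) = σ.arr .P (σ.pub .N + j)) (by simp) ?_)
  rintro i hi σ' ⟨h1, h2⟩ hk hp
  have hp' : ∀ v, v ≠ .i → σ'.pub v = σ.pub v := fun v hv => hp v hv
    (by simp [cellBody, HL.block, HL.pmods])
  refine ⟨fun j hj => ?_, fun j hj => ?_⟩
  · rcases Nat.lt_succ_iff_lt_or_eq.mp hj with hj | rfl
    · have := h1 j hj
      simp [cellBody, HL.run, PE.ev, SE.ev, hk, hp', this]
      grind
    · simp [cellBody, HL.run, PE.ev, SE.ev, hk, hp']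
      grind
  · have := h2 j hj
    simp [cellBody, HL.run, PE.ev, SE.ev, hk, hp', this]
    grind

theorem scanBody_spec (P : Cmd) (σ : St) (hr : σ.sec .r = 0) (i : ℕ) (hi : i < σ.pub .N) :
    (((HL.loop .i .N scanBody).run P σ).arr .P i =
        if σ.arr .P (σ.pub .N + i) = 0 then σ.arr .P i else 2 * σ.pub .b + 2) ∧
      (σ.arr .P (σ.pub .N + i) = 0 → ((HL.loop .i .N scanBody).run P σ).arr .P (σ.pub .N + i) =
        if i = 0 then 0 else σ.arr .P (σ.pub .N + (i - 1))) := by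
  refine (HL.loop_induction P (k := .i) (N := .N) (c := scanBody)
    (by simp [HL.Wf, HL.block, HL.pmods, scanBody]) σ
    (fun i σ' => (∀ j < i, (σ'.arr .P j =
        if σ.arr .P (σ.pub .N + j) = 0 then σ.arr .P j else 2 * σ.pub .b + 2) ∧
      (σ.arr .P (σ.pub .N + j) = 0 → σ'.arr .P (σ.pub .N + j) =
        if j = 0 then 0 else σ.arr .P (σ.pub .N + (j - 1)))) ∧
      (∀ j, i ≤ j → j < σ.pub .N → σ'.arr .P j = σ.arr .P j ∧
        σ'.arr .P (σ.pub .N + j) = σ.arr .P (σ.pub .N + j)) ∧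
      σ'.sec .r = if i = 0 then 0 else σ.arr .P (σ.pub .N + (i - 1))) (by simp [hr]) ?_).1 i hi
  rintro i hi σ' ⟨h1, h2, h3⟩ hk hp
  have hp' : ∀ v, v ≠ .i → σ'.pub v = σ.pub v := fun v hv => hp v hv
    (by simp [scanBody, HL.block, HL.pmods])
  obtain ⟨h4, h5⟩ := h2 i le_rfl hi
  refine ⟨fun j hj => ?_, fun j hj hj' => ?_, ?_⟩
  · have e1 : ¬ j = σ.pub .N + i := by omega
    rcases Nat.lt_succ_iff_lt_or_eq.mp hj with hj | rfl
    · have e2 : ¬ σ.pub .N + j = i := by omega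
      have := h1 j hj
      simp [scanBody, HL.run, PE.ev, SE.ev, hk, hp', e1, e2, hj.ne]
      exact this
    · have e2 : ¬ σ.pub .N + j = j := by omega
      simp [scanBody, HL.run, PE.ev, SE.ev, hk, hp', h4, h5, h3]
      constructor
      · split_ifs <;> omega
      · intro h; simp [h]
  · have e1 : ¬ j = σ.pub .N + i := by omega
    have e2 : ¬ σ.pub .N + j = i := by omega
    have := h2 j (by omega) hj'
    have e3 : j ≠ i := by omega
    simp [scanBody, HL.run, PE.ev, SE.ev, hk, hp', e1, e2, e3]
    exact this
  · simp [scanBody, HL.run, PE.ev, SE.ev, hk, hp', h5]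
    intro h; exact h.symm

theorem writeBody_spec (P : Cmd) (σ : St) (a : ℕ) :
    ((HL.loop .i .b writeBody).run P σ).raw a =
      if σ.pub .c ≤ a ∧ a < σ.pub .c + σ.pub .b ∧ a < σ.base ∧
          0 < σ.arr .P (σ.pub .N + (a - σ.pub .c)) then
        σ.arr .P (σ.pub .N + (a - σ.pub .c)) else σ.raw a := by
  refine (HL.loop_induction P (k := .i) (N := .b) (c := writeBody)
    (by simp [HL.Wf, HL.block, HL.pmods, writeBody]) σ
    (fun i σ' => (∀ a, σ'.raw a = if σ.pub .c ≤ a ∧ a < σ.pub .c + i ∧ a < σ.base ∧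
          0 < σ.arr .P (σ.pub .N + (a - σ.pub .c)) then
        σ.arr .P (σ.pub .N + (a - σ.pub .c)) else σ.raw a) ∧ σ'.base = σ.base ∧
        σ'.arr = σ.arr) ⟨fun a => ?_, by simp⟩ ?_).1 a
  · rw [if_neg (by omega)]; simp
  rintro i hi σ' ⟨h1, h2, h3⟩ hk hp
  have hp' : ∀ v, v ≠ .i → σ'.pub v = σ.pub v := fun v hv => hp v hv
    (by simp [writeBody, HL.block, HL.pmods])
  have h4 := h1 (σ.pub .c + i)
  rw [if_neg (by omega)] at h4
  refine ⟨fun a => ?_, ?_, ?_⟩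
  · have h5 := h1 a
    by_cases ha : a = σ.pub .c + i
    · subst ha
      by_cases hb : σ.pub .c + i < σ.base
      · simp [writeBody, HL.run, PE.ev, SE.ev, hk, hp', h2, h3, hb, h4]
      · simp [writeBody, HL.run, PE.ev, hk, hp', h2, h3, hb, h4]
    · have e : (a < σ.pub .c + (i + 1)) ↔ a < σ.pub .c + i := by omega
      simp only [e]
      rw [← h5]
      by_cases hb : σ.pub .c + i < σ.base
      · simp [writeBody, HL.run, PE.ev, SE.ev, hk, hp', h2, h3, hb, ha]
      · simp [writeBody, HL.run, PE.ev, hk, hp', h2, h3, hb]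
  · rw [St.setp_base, HL.run_base, h2]
  · rw [St.setp_arr, ← h3]
    funext A
    exact HL.run_arr_of_notMem P _ σ' A (by simp [writeBody, HL.block, HL.amods])

end ObliviousCuckoo

namespace ObliviousCuckoo

variable {n m : ℕ}

theorem routeBlock_frame (P : Cmd) (σ : St) :
    (∀ v, v ≠ .i → (routeBlock.run P σ).pub v = σ.pub v) ∧
    (∀ A, A ≠ .P → (routeBlock.run P σ).arr A = σ.arr A) := by
  refine ⟨fun v hv => ?_, fun A hA => HL.run_arr_of_notMem P _ σ A ?_⟩
  · rw [HL.run_pub, HL.prun_of_notMem _ _ _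
      (by simp [routeBlock, itemBody, cellBody, scanBody, writeBody, HL.block, HL.pmods, hv])]
  · simp [routeBlock, itemBody, cellBody, scanBody, writeBody, HL.block, HL.amods, hA]

theorem routeBlock_spec {P : Cmd} {T : ℕ → ℕ} (hP : IsObliviousSort P T) {σ : St} {x : Fin n → ℕ}
    {h : HashValues n m} {tg pos : Fin n → ℕ} (H : Holds σ x h tg pos) (hx : ∀ e, 0 < x e)
    (htg : Function.Injective tg) (hN : σ.pub .a + σ.pub .b = σ.pub .N)
    (ho : σ.pub .o + σ.pub .a ≤ n) :
    (∀ e, σ.pub .o ≤ pos e → pos e < σ.pub .o + σ.pub .a → σ.pub .c < tg e →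
      tg e ≤ σ.pub .c + σ.pub .b → tg e ≤ σ.base → (routeBlock.run P σ).raw (tg e - 1) = x e) ∧
    ∀ l, (∀ e, σ.pub .o ≤ pos e → pos e < σ.pub .o + σ.pub .a → σ.pub .c < tg e →
      tg e ≤ σ.pub .c + σ.pub .b → tg e ≠ l + 1) → (routeBlock.run P σ).raw l = σ.raw l := by
  unfold routeBlock
  simp only [HL.run_block_cons, HL.run_block_nil]
  set a := σ.pub .a with ha
  set b := σ.pub .b with hb
  set c := σ.pub .c with hc
  set o := σ.pub .o with ho'
  have i1 := itemBody_spec P σ (by omega)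
  have p1 : ∀ v, v ≠ .i → ((HL.loop .i .a itemBody).run P σ).pub v = σ.pub v := fun v hv => by
    rw [HL.run_pub, HL.prun_of_notMem _ _ _ (by simp [itemBody, HL.block, HL.pmods, hv])]
  have r1 : ((HL.loop .i .a itemBody).run P σ).raw = σ.raw :=
    HL.run_raw P _ σ (by simp [itemBody, HL.block, HL.KeepsRaw])
  have e1 := HL.run_base P (HL.loop .i .a itemBody) σ
  generalize (HL.loop .i .a itemBody).run P σ = σ₁ at *
  obtain ⟨i2, i2'⟩ := cellBody_spec P σ₁ (by rw [p1 _ (by simp), p1 _ (by simp), p1 _ (by simp), hN])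
  have p2 : ∀ v, v ≠ .i → ((HL.loop .i .b cellBody).run P σ₁).pub v = σ₁.pub v := fun v hv => by
    rw [HL.run_pub, HL.prun_of_notMem _ _ _ (by simp [cellBody, HL.block, HL.pmods, hv])]
  have r2 : ((HL.loop .i .b cellBody).run P σ₁).raw = σ₁.raw :=
    HL.run_raw P _ _ (by simp [cellBody, HL.block, HL.KeepsRaw])
  have e2 := HL.run_base P (HL.loop .i .b cellBody) σ₁
  generalize (HL.loop .i .b cellBody).run P σ₁ = σ₂ at *
  rw [p1 _ (by simp), p1 _ (by simp), p1 _ (by simp), ← ha, ← hb, ← hN] at i2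
  rw [p1 _ (by simp), p1 _ (by simp), ← ha, ← hN] at i2'
  rw [← hb, ← hc, ← ho', ← ha, ← hN] at i1
  have hs1 : HL.run P (.sort .N) σ₂ = σ₂.sort P (a + b) := by
    simp only [HL.run]; rw [p2 _ (by simp), p1 _ (by simp), hN]
  rw [hs1]
  obtain ⟨π, hπ, s1⟩ := sort_spec hP σ₂ (a + b)
  set σ₃ := HL.run P (.sc (.set .r ⟨0, [], []⟩)) (σ₂.sort P (a + b)) with hσ₃
  have a3 : σ₃.arr = (σ₂.sort P (a + b)).arr := rfl
  have p3 : ∀ v, v ≠ .i → σ₃.pub v = σ.pub v := fun v hv => by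
    simp only [hσ₃, HL.run, St.sort_pub]; rw [p2 _ hv, p1 _ hv]
  have r3 : σ₃.raw = σ.raw := by simp only [hσ₃, HL.run, St.sort_raw]; rw [r2, r1]
  have e3 : σ₃.base = σ.base := by simp only [hσ₃, HL.run, St.sort_base]; rw [e2, e1]
  rw [← a3] at hπ s1
  have i3 := scanBody_spec P σ₃ (by simp [hσ₃, HL.run, SE.ev])
  rw [p3 _ (by simp), p3 _ (by simp), ← hN, ← hb] at i3
  clear_value σ₃
  have p4 : ∀ v, v ≠ .i → ((HL.loop .i .N scanBody).run P σ₃).pub v = σ.pub v := fun v hv => by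
    rw [HL.run_pub, HL.prun_of_notMem _ _ _ (by simp [scanBody, HL.block, HL.pmods, hv]), p3 v hv]
  have r4 : ((HL.loop .i .N scanBody).run P σ₃).raw = σ.raw :=
    (HL.run_raw P _ _ (by simp [scanBody, HL.block, HL.KeepsRaw])).trans r3
  have e4 := HL.run_base P (HL.loop .i .N scanBody) σ₃
  generalize (HL.loop .i .N scanBody).run P σ₃ = σ₄ at *
  have hs2 : HL.run P (.sort .N) σ₄ = σ₄.sort P (a + b) := by
    simp only [HL.run]; rw [p4 _ (by simp), hN]
  rw [hs2]
  obtain ⟨ρ, hρ, s2⟩ := sort_spec hP σ₄ (a + b)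
  have hit : ∀ i < a, ∃ e, pos e = o + i ∧ σ.arr .T (o + i) = tg e ∧ σ.arr .X (o + i) = x e := by
    intro i hi
    obtain ⟨e, he⟩ := H.surj (o + i) (by omega)
    exact ⟨e, he, by rw [← he, H.T], by rw [← he, H.X]⟩
  have main := route_correct (a := a) (b := b) (k := fun i => routeKey b c (σ.arr .T (o + i)))
    (w := fun i => σ.arr .X (o + i))
    (fun i _ => by unfold routeKey; split_ifs <;> omega)
    (fun i hi => by obtain ⟨e, -, -, h2⟩ := hit i hi; simp only [h2, hx])
    (fun i hi i' hi' h1 h2 => by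
      obtain ⟨e, he, g1, -⟩ := hit i hi
      obtain ⟨e', he', g1', -⟩ := hit i' hi'
      have : tg e = tg e' := by
        simp only [g1, g1'] at h1 h2
        unfold routeKey at h1 h2
        split_ifs at h1 h2 <;> omega
      have := htg this
      subst this; omega)
    (K₀ := σ₂.arr .P) (W₀ := fun i => σ₂.arr .P (a + b + i))
    (fun i hi => by rw [(i2' i hi).1, (i1 i hi).1])
    (fun i hi => by simp only [(i2' i hi).2, (i1 i hi).2])
    (fun j hj => (i2 j hj).1) (fun j hj => (i2 j hj).2)
    (K₁ := σ₃.arr .P) (W₁ := fun i => σ₃.arr .P (a + b + i))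
    (K₃ := (σ₄.sort P (a + b)).arr .P) (W₃ := fun i => (σ₄.sort P (a + b)).arr .P (a + b + i))
    π hπ s1
    (K₂ := σ₄.arr .P) (W₂ := fun i => σ₄.arr .P (a + b + i)) (fun i hi => (i3 i hi).1)
    (fun i hi => (i3 i hi).2) ρ hρ s2
  have hw := fun l => writeBody_spec P (σ₄.sort P (a + b)) l
  simp only [St.sort_pub, St.sort_raw, St.sort_base] at hw
  rw [p4 _ (by simp), p4 _ (by simp), p4 _ (by simp), ← hc, ← hb, ← hN, e4, e3, r4] at hw
  constructor
  · intro e k1 k2 k3 k4 k5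
    obtain ⟨e', h1, h2, h3⟩ := hit (pos e - o) (by omega)
    have : e' = e := H.inj (by omega)
    subst this
    have := (main (tg e' - 1 - c) (by omega)).1 (pos e' - o) (by omega) (by
      simp only [h2, routeKey]; rw [if_pos (by omega)]; omega)
    simp only [h3] at this
    rw [hw, if_pos]
    · exact this
    · refine ⟨by omega, by omega, by omega, ?_⟩
      rw [this]; exact hx e'
  · intro l hl
    rw [hw]
    split_ifs with hcond
    · have := (main (l - c) (by omega)).2 (by
        intro i hi
        obtain ⟨e, h1, h2, h3⟩ := hit i hi
        have := hl e (by omega) (by omega)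
        simp only [h2, routeKey]
        split_ifs <;> omega)
      omega
    · rfl

/-! ### The complete program -/

/-- Loop induction for the public variables. -/
theorem HL.loop_prun_induction {k N : PV} {c : HL} (hwf : (loop k N c).Wf) (p : PV → ℕ)
    (I : ℕ → (PV → ℕ) → Prop) (h0 : I 0 (Function.update p k 0))
    (hstep : ∀ i < p N, ∀ p', I i p' → p' k = i → (∀ v, v ≠ k → v ∉ c.pmods → p' v = p v) →
      I (i + 1) (Function.update (c.prun p') k (i + 1))) :
    I (p N) ((loop k N c).prun p) := by
  have := loop_induction .skip hwf ⟨0, p, fun _ => 0, fun _ => 0, fun _ => 0, fun _ _ => 0⟩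
    (fun i σ' => I i σ'.pub) h0 (fun i hi σ' h1 h2 h3 => by
      have := hstep i hi σ'.pub h1 h2 h3
      rw [← HL.run_pub .skip c σ'] at this
      exact this)
  rwa [HL.run_pub] at this

/-- `h := src / 2` -/
def halve (src : PV) : HL :=
  .block [.pset .h ⟨0, []⟩,
    .loop .i src (.pif ⟨1, [.h, .h]⟩ ⟨0, [src]⟩ (.pset .h ⟨1, [.h]⟩) (.sc .skip))]

theorem halve_prun (src : PV) (h₁ : src ≠ .h) (h₂ : src ≠ .i) (p : PV → ℕ) :
    (halve src).prun p .h = p src / 2 := by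
  set p₀ := Function.update p .h 0 with hp₀
  have hs : p₀ src = p src := by simp [hp₀, h₁]
  have key := HL.loop_prun_induction (k := .i) (N := src)
    (c := .pif ⟨1, [.h, .h]⟩ ⟨0, [src]⟩ (.pset .h ⟨1, [.h]⟩) (.sc .skip))
    (by simp [HL.Wf, HL.pmods, h₁, h₂.symm]) p₀ (fun i p' => p' .h = min i (p src / 2))
    (by simp [hp₀]) (by
      intro i hi p' h3 h4 h5
      have h6 : p' src = p src := by rw [h5 src h₂ (by simp [HL.pmods, h₁]), hs]
      rw [hs] at hi
      simp only [HL.prun, PE.ev]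
      simp
      split_ifs with hc
      · simp; omega
      · omega)
  rw [hs] at key
  have hr : (halve src).prun p = (HL.loop .i src (.pif ⟨1, [.h, .h]⟩ ⟨0, [src]⟩
      (.pset .h ⟨1, [.h]⟩) (.sc .skip))).prun p₀ := by
    simp [halve, HL.block, HL.prun, PE.ev, hp₀]
  rw [hr, key]
  omega

theorem halve_frame (src v : PV) (h₁ : v ≠ .h) (h₂ : v ≠ .i) (p : PV → ℕ) :
    (halve src).prun p v = p v :=
  HL.prun_of_notMem _ _ _ (by simp [halve, HL.block, HL.pmods, h₁, h₂])

/-- Copy the input. -/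
def copyBody : HL :=
  .block [.rload .t ⟨0, [.i]⟩, .store .X ⟨0, [.i]⟩ ⟨0, [], [.t]⟩,
    .rload .t ⟨0, [.n, .i]⟩, .store .H₁ ⟨0, [.i]⟩ ⟨0, [], [.t]⟩,
    .rload .t ⟨0, [.n, .n, .i]⟩, .store .H₂ ⟨0, [.i]⟩ ⟨0, [], [.t]⟩,
    .store .T ⟨0, [.i]⟩ ⟨0, [], []⟩]

theorem copy_spec (P : Cmd) (σ : St) (hb : 3 * σ.pub .n ≤ σ.base) (i : ℕ) (hi : i < σ.pub .n) :
    let σ' := (HL.loop .i .n copyBody).run P σ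
    σ'.arr .X i = σ.raw i ∧ σ'.arr .H₁ i = σ.raw (σ.pub .n + i) ∧
      σ'.arr .H₂ i = σ.raw (2 * σ.pub .n + i) ∧ σ'.arr .T i = 0 := by
  refine (HL.loop_induction P (k := .i) (N := .n) (c := copyBody)
    (by simp [HL.Wf, HL.block, HL.pmods, copyBody]) σ
    (fun i σ' => (∀ j < i, σ'.arr .X j = σ.raw j ∧ σ'.arr .H₁ j = σ.raw (σ.pub .n + j) ∧
      σ'.arr .H₂ j = σ.raw (2 * σ.pub .n + j) ∧ σ'.arr .T j = 0) ∧ σ'.raw = σ.raw ∧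
      σ'.base = σ.base) (by simp) ?_).1 i hi
  rintro i hi σ' ⟨h1, h2, h3⟩ hk hp
  have hn' : σ'.pub .n = σ.pub .n := hp _ (by simp) (by simp [copyBody, HL.block, HL.pmods])
  have b1 : i < σ.base := by omega
  have b2 : σ.pub .n + i < σ.base := by omega
  have b3 : σ.pub .n + (σ.pub .n + i) < σ.base := by omega
  refine ⟨fun j hj => ?_, ?_, ?_⟩
  · rcases Nat.lt_succ_iff_lt_or_eq.mp hj with hj | rfl
    · have := h1 j hj
      simp [copyBody, HL.run, PE.ev, SE.ev, hk, hn', h3, b1, b2, b3, hj.ne, this]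
    · simp [copyBody, HL.run, PE.ev, SE.ev, hk, hn', h2, h3, b1, b2, b3]
      congr 1; omega
  · funext a; simp [copyBody, HL.run, PE.ev, SE.ev, hk, hn', h3, b1, b2, b3, h2]
  · rw [St.setp_base, HL.run_base, h3]

/-- `L` becomes the integer part of the fourth root of `n`, up to a factor of two. -/
def rootBody : HL :=
  .pif ⟨0, [.p, .p, .p, .p, .p, .p, .p, .p, .p, .p, .p, .p, .p, .p, .p, .p]⟩ ⟨1, [.n]⟩
    (.block [.pset .p ⟨0, [.p, .p, .p, .p, .p, .p, .p, .p, .p, .p, .p, .p, .p, .p, .p, .p]⟩,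
      .pset .L ⟨0, [.L, .L]⟩]) (.sc .skip)

def root : HL := .block [.pset .p ⟨1, []⟩, .pset .L ⟨1, []⟩, .loop .o .n rootBody]

theorem root_prun (p : PV → ℕ) (hn : 1 ≤ p .n) :
    (root.prun p .L) ^ 4 ≤ p .n ∧ p .n < 16 * (root.prun p .L) ^ 4 ∧ 1 ≤ root.prun p .L := by
  set p₀ := Function.update (Function.update p .p 1) .L 1 with hp₀
  have hs : p₀ .n = p .n := by simp [hp₀]
  have key := HL.loop_prun_induction (k := .o) (N := .n) (c := rootBody)
    (by simp [HL.Wf, HL.pmods, HL.block, rootBody]) p₀ (fun i p' => p' .p = p' .L ^ 4 ∧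
      p' .p ≤ p .n ∧ 1 ≤ p' .L ∧ (p .n < 16 * p' .p ∨ p' .p = 16 ^ i))
    (by simp [hp₀, hn]) (by
      rintro i hi p' ⟨h1, h2, h3, h4⟩ h5 h6
      have h7 : p' .n = p .n := by rw [h6 _ (by simp) (by simp [rootBody, HL.block, HL.pmods]), hs]
      simp only [rootBody, HL.block, HL.prun, PE.ev]
      simp
      split_ifs with hc
      · simp
        refine ⟨?_, by omega, by omega, ?_⟩
        · rw [show p' .L + p' .L = 2 * p' .L by ring, mul_pow, ← h1]; ring
        · rcases h4 with h4 | h4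
          · omega
          · right
            have h16 : (16 : ℕ) ^ (i + 1) = 16 * 16 ^ i := pow_succ' 16 i
            rw [h16, ← h4]; ring
      · refine ⟨h1, h2, h3, ?_⟩
        omega)
  rw [hs] at key
  have hr : root.prun p = (HL.loop .o .n rootBody).prun p₀ := by
    simp [root, HL.block, HL.prun, PE.ev, hp₀]
  rw [← hr] at key
  obtain ⟨h1, h2, h3, h4⟩ := key
  refine ⟨by omega, ?_, h3⟩
  rcases h4 with h4 | h4
  · omega
  · have : p .n < 16 ^ p .n := Nat.lt_pow_self (by norm_num)
    omega

def rounds : ℕ → HL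
  | 0 => .sc .skip
  | c + 1 => .seq round (rounds c)

/-- Halve the number of records if there are many of them. -/
def shrinkBody (c : ℕ) : HL :=
  .pif ⟨0, [.L]⟩ ⟨0, [.N]⟩ (.block [rounds c, halve .N, .pset .N ⟨0, [.h]⟩]) (.sc .skip)

def zeroBody : HL := .rstore ⟨0, [.i]⟩ ⟨0, [], []⟩

/-- Move all items to the next block of cells. -/
def outBody : HL :=
  .pif ⟨0, [.c]⟩ ⟨0, [.z]⟩
    (.block [.pset .o ⟨0, []⟩, routeBlock, .pset .o ⟨0, [.h]⟩, routeBlock, .pset .c ⟨0, [.c, .b]⟩])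
    (.sc .skip)

def outPrepare : HL :=
  .block [halve .n, .psub .a ⟨0, [.n]⟩ ⟨0, [.h]⟩, .pset .b ⟨0, [.h]⟩,
    .pif ⟨0, [.b]⟩ ⟨1, []⟩ (.pset .b ⟨1, []⟩) (.sc .skip), .pset .N ⟨0, [.a, .b]⟩,
    .pset .z ⟨0, [.m, .m, .s]⟩]

def output : HL :=
  .block [outPrepare, .loop .i .z zeroBody, .pset .c ⟨0, []⟩, .loop .q .z outBody]

def mainProgram (c : ℕ) : HL :=
  .block [.loop .i .n copyBody, root, .pset .N ⟨0, [.n]⟩, .loop .o .n (shrinkBody c), greedy, output]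

end ObliviousCuckoo

namespace ObliviousCuckoo

variable {n m : ℕ}

theorem rounds_frame (P : Cmd) (c : ℕ) (σ : St) :
    (∀ v, v ≠ PV.i → ((rounds c).run P σ).pub v = σ.pub v) ∧
      ((rounds c).run P σ).raw = σ.raw := by
  induction c generalizing σ with
  | zero => exact ⟨fun _ _ => rfl, rfl⟩
  | succ c ih =>
    obtain ⟨h1, h2⟩ := round_frame P σ
    obtain ⟨h3, h4⟩ := ih (round.run P σ)
    exact ⟨fun v hv => (h3 v hv).trans (h1 v hv), h4.trans h2⟩

theorem Holds.card_le {σ : St} {x : Fin n → ℕ} {h : HashValues n m} {tg pos : Fin n → ℕ}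
    (H : Holds σ x h tg pos) {N : ℕ} (hpos : ∀ e, tg e = 0 → pos e < N) :
    (Finset.univ.filter (fun e => tg e = 0)).card ≤ N := by
  have := Finset.card_le_card_of_injOn (s := Finset.univ.filter (fun e => tg e = 0))
    (t := Finset.range N) pos (fun e he => by simpa using hpos e (by simpa using he))
    (fun e _ e' _ h => H.inj h)
  simpa using this

theorem card_peel_le (h : HashValues n m) (tg : Fin n → ℕ) :
    (Finset.univ.filter (fun e => peel h tg e = 0)).card ≤
      (Finset.univ.filter (fun e => tg e = 0)).card :=
  Finset.card_le_card (fun e he => by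
    simp only [Finset.mem_filter, Finset.mem_univ, true_and] at he ⊢
    by_contra hne
    simp [peel, hne] at he)

theorem rounds_succ_run (P : Cmd) (c : ℕ) (σ : St) :
    (rounds (c + 1)).run P σ = (rounds c).run P (round.run P σ) := rfl

theorem rounds_spec {P : Cmd} {T : ℕ → ℕ} (hP : IsObliviousSort P T) (c : ℕ) {σ : St}
    {x : Fin n → ℕ} {h : HashValues n m} {tg pos : Fin n → ℕ} (H : Holds σ x h tg pos)
    (hN : σ.pub .N ≤ n) (hpos : ∀ e, tg e = 0 → pos e < σ.pub .N) :
    ∃ pos', Holds ((rounds (c + 1)).run P σ) x h ((peel h)^[c + 1] tg) pos' ∧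
      ∀ e, (peel h)^[c + 1] tg e = 0 →
        pos' e < (Finset.univ.filter (fun e => (peel h)^[c + 1] tg e = 0)).card := by
  obtain ⟨pos₁, h1, h2⟩ := round_spec hP H hN hpos
  have hf := (round_frame P σ).1 .N (by simp)
  have hle : (Finset.univ.filter (fun e => peel h tg e = 0)).card ≤ σ.pub .N :=
    (card_peel_le h tg).trans (H.card_le hpos)
  rw [rounds_succ_run, Function.iterate_succ_apply]
  generalize round.run P σ = σ₁ at *
  induction c generalizing σ tg pos σ₁ pos₁ with
  | zero => exact ⟨pos₁, h1, h2⟩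
  | succ c ih =>
    have hpos₁ : ∀ e, peel h tg e = 0 → pos₁ e < σ₁.pub .N := fun e he => by
      have := h2 e he; omega
    obtain ⟨pos₂, h3, h4⟩ := round_spec hP h1 (by omega) hpos₁
    have hf₁ := (round_frame P σ₁).1 .N (by simp)
    have hle₁ : (Finset.univ.filter (fun e => peel h (peel h tg) e = 0)).card ≤ σ₁.pub .N :=
      (card_peel_le h _).trans (h1.card_le hpos₁)
    rw [rounds_succ_run, Function.iterate_succ_apply]
    generalize round.run P σ₁ = σ₂ at *
    exact ih h1 (by omega) hpos₁ pos₂ h4 hle₁ σ₂ h3 hf₁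

theorem shrink_spec {P : Cmd} {T : ℕ → ℕ} (hP : IsObliviousSort P T) (c : ℕ) {σ : St}
    {x : Fin n → ℕ} {h : HashValues n m} {pos : Fin n → ℕ} (H : Holds σ x h (fun _ => 0) pos)
    (hN : σ.pub .N = n)
    (hgood : ∀ j, σ.pub .L < n / 2 ^ j → (Finset.univ.filter
      (fun e => (peel h)^[(c + 1) * (j + 1)] (fun _ => 0) e = 0)).card ≤ n / 2 ^ (j + 1)) :
    let σ' := (HL.loop .o .n (shrinkBody (c + 1))).run P σ
    σ'.raw = σ.raw ∧ (∃ j, σ'.pub .N = n / 2 ^ j) ∧ ∃ j pos',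
      Holds σ' x h ((peel h)^[(c + 1) * j] (fun _ => 0)) pos' ∧
      ∀ e, (peel h)^[(c + 1) * j] (fun _ => 0) e = 0 → pos' e < σ'.pub .N := by
  have key := HL.loop_induction P (k := .o) (N := .n) (c := shrinkBody (c + 1)) (by
      have : ∀ c, (rounds c).Wf ∧ ∀ v, v ≠ .i → v ∉ (rounds c).pmods := by
        intro c
        induction c with
        | zero => simp [rounds, HL.Wf, HL.pmods]
        | succ c ih =>
          refine ⟨⟨?_, ih.1⟩, fun v hv => ?_⟩
          · simp [round, uniq, keyBody, flagBody, decideBody, compact, rank, rankBody, permField,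
              permLoad, wordTo, HL.block, HL.Wf, HL.pmods]
          · simp [rounds, round, uniq, keyBody, flagBody, decideBody, compact, rank, rankBody,
              permField, permLoad, wordTo, HL.block, HL.pmods, hv, ih.2 v hv]
      have := this (c + 1)
      simp [HL.Wf, shrinkBody, HL.block, HL.pmods, halve, this]) σ
    (fun i σ' => σ'.raw = σ.raw ∧ σ'.pub .L = σ.pub .L ∧ ∃ j pos', σ'.pub .N = n / 2 ^ j ∧
      (j = i ∨ σ'.pub .N ≤ σ.pub .L) ∧
      Holds σ' x h ((peel h)^[(c + 1) * j] (fun _ => 0)) pos' ∧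
      ∀ e, (peel h)^[(c + 1) * j] (fun _ => 0) e = 0 → pos' e < σ'.pub .N)
    ⟨rfl, by simp, 0, pos, by simp [hN], .inl rfl, by simpa using H.setp (by simp) (by simp) 0,
      fun e _ => by simpa [hN] using H.lt e⟩ (by
    rintro i hi σ' ⟨g1, g2, j, pos', g3, g4, g5, g6⟩ hk hp
    by_cases hc : σ.pub .L < σ'.pub .N
    · have hN' : σ'.pub .N ≤ n := by rw [g3]; exact Nat.div_le_self _ _
      obtain ⟨pos₂, r1, r2⟩ := rounds_spec hP c g5 hN' g6
      obtain ⟨f1, f2⟩ := rounds_frame P (c + 1) σ'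
      have hrun : (shrinkBody (c + 1)).run P σ' = (HL.pset .N ⟨0, [.h]⟩).run P
          ((halve .N).run P ((rounds (c + 1)).run P σ')) := by
        simp [shrinkBody, HL.run, PE.ev, g2, hc]
      rw [hrun]
      generalize (rounds (c + 1)).run P σ' = σ₂ at *
      have q1 : ((halve .N).run P σ₂).pub .h = n / 2 ^ (j + 1) := by
        rw [HL.run_pub, halve_prun _ (by simp) (by simp), f1 _ (by simp), g3, Nat.div_div_eq_div_mul,
          pow_succ]
      have q2 : ∀ v, v ≠ .h → v ≠ .i → ((halve .N).run P σ₂).pub v = σ₂.pub v := fun v h1 h2 => by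
        rw [HL.run_pub, halve_frame _ _ h1 h2]
      have q3 : ((halve .N).run P σ₂).raw = σ₂.raw :=
        HL.run_raw P _ _ (by simp [halve, HL.block, HL.KeepsRaw])
      have q4 : ∀ A, ((halve .N).run P σ₂).arr A = σ₂.arr A := fun A =>
        HL.run_arr_of_notMem P _ _ _ (by simp [halve, HL.block, HL.amods])
      have it : (peel h)^[c + 1] ((peel h)^[(c + 1) * j] (fun _ => 0)) =
          (peel h)^[(c + 1) * (j + 1)] (fun _ => 0) := by
        rw [← Function.iterate_add_apply]; congr 1; ring
      rw [it] at r1 r2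
      generalize (halve .N).run P σ₂ = σ₃ at *
      refine ⟨?_, ?_, j + 1, pos₂, ?_, ?_, ?_, ?_⟩
      · simp [HL.run, q3, f2, g1]
      · simp [HL.run, q2, f1, g2]
      · simp [HL.run, PE.ev, q1]
      · rcases g4 with g4 | g4
        · left; omega
        · omega
      · refine r1.of_arr ?_ ?_ ?_ ?_ ?_ ?_ <;> simp [HL.run, q2, q4]
      · intro e he
        have h1 := r2 e he
        have h2 := hgood j (by omega)
        simp [HL.run, PE.ev, q1]
        omega
    · have hrun : (shrinkBody (c + 1)).run P σ' = σ' := by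
        simp [shrinkBody, HL.run, PE.ev, g2, hc, SC.run]
      rw [hrun]
      exact ⟨g1, by simp [g2], j, pos', by simp [g3], .inr (by simp; omega),
        g5.setp (by simp) (by simp) _, by simpa using g6⟩)
  obtain ⟨g1, -, j, pos', g3, -, g5, g6⟩ := key
  exact ⟨g1, ⟨j, g3⟩, j, pos', g5, g6⟩

theorem outPrepare_prun (p : PV → ℕ) :
    outPrepare.prun p .h = p .n / 2 ∧ outPrepare.prun p .a = p .n - p .n / 2 ∧
    outPrepare.prun p .b = max 1 (p .n / 2) ∧
    outPrepare.prun p .N = p .n - p .n / 2 + max 1 (p .n / 2) ∧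
    outPrepare.prun p .z = 2 * p .m + p .s := by
  have h1 := halve_prun .n (by simp) (by simp) p
  have h2 := fun v => halve_frame .n v (p := p)
  simp only [outPrepare, HL.block, HL.prun, PE.ev]
  generalize (halve .n).prun p = p' at *
  simp [h1, h2]
  split_ifs <;> simp [h2, h1] <;> omega

theorem outPrepare_frame (v : PV) (hv : v ∉ [PV.h, .i, .a, .b, .N, .z]) (p : PV → ℕ) :
    outPrepare.prun p v = p v := by
  simp at hv
  exact HL.prun_of_notMem _ _ _ (by simp [outPrepare, halve, HL.block, HL.pmods, hv])

theorem zero_spec (P : Cmd) (σ : St) (hz : σ.pub .z ≤ σ.base) (a : ℕ) (ha : a < σ.pub .z) :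
    ((HL.loop .i .z zeroBody).run P σ).raw a = 0 := by
  refine (HL.loop_induction P (k := .i) (N := .z) (c := zeroBody)
    (by simp [HL.Wf, HL.pmods, zeroBody]) σ
    (fun i σ' => (∀ j < i, σ'.raw j = 0) ∧ σ'.base = σ.base) (by simp) ?_).1 a ha
  rintro i hi σ' ⟨h1, h2⟩ hk hp
  have hb : i < σ.base := by omega
  refine ⟨fun j hj => ?_, by rw [St.setp_base, HL.run_base, h2]⟩
  simp [zeroBody, HL.run, PE.ev, SE.ev, hk, h2, hb]
  exact fun hne => h1 j (by omega)

theorem outBody_frame (P : Cmd) (σ : St) :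
    (∀ v, v ∉ [PV.i, .o, .c] → (outBody.run P σ).pub v = σ.pub v) ∧
    (∀ A, A ≠ .P → (outBody.run P σ).arr A = σ.arr A) := by
  refine ⟨fun v hv => ?_, fun A hA => HL.run_arr_of_notMem P _ σ A ?_⟩
  · simp at hv
    rw [HL.run_pub, HL.prun_of_notMem _ _ _ (by simp [outBody, routeBlock, itemBody, cellBody,
      scanBody, writeBody, HL.block, HL.pmods, hv])]
  · simp [outBody, routeBlock, itemBody, cellBody, scanBody, writeBody, HL.block, HL.amods, hA]

theorem outBody_spec {P : Cmd} {T : ℕ → ℕ} (hP : IsObliviousSort P T) {σ : St} {x : Fin n → ℕ}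
    {h : HashValues n m} {tg pos : Fin n → ℕ} (H : Holds σ x h tg pos) (hx : ∀ e, 0 < x e)
    (htg : Function.Injective tg) (hN : σ.pub .a + σ.pub .b = σ.pub .N)
    (ha : σ.pub .a = n - n / 2) (hh : σ.pub .h = n / 2) (hc : σ.pub .c < σ.pub .z) :
    (outBody.run P σ).pub .c = σ.pub .c + σ.pub .b ∧
    (∀ e, σ.pub .c < tg e → tg e ≤ σ.pub .c + σ.pub .b → tg e ≤ σ.base →
      (outBody.run P σ).raw (tg e - 1) = x e) ∧
    ∀ l, (∀ e, σ.pub .c < tg e → tg e ≤ σ.pub .c + σ.pub .b → tg e ≠ l + 1) →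
      (outBody.run P σ).raw l = σ.raw l := by
  set σ₁ := σ.setp .o 0 with hσ₁
  obtain ⟨f1, f2⟩ := routeBlock_frame P σ₁
  have b1 := HL.run_base P routeBlock σ₁
  have s1 := routeBlock_spec hP (H.setp (d := .o) (by simp) (by simp) 0) hx htg (by simpa using hN)
    (by simp [ha])
  rw [← hσ₁] at s1
  have H₁ : Holds (routeBlock.run P σ₁) x h tg pos :=
    (H.setp (d := .o) (by simp) (by simp) 0).of_arr (f1 _ (by simp)) (f1 _ (by simp))
      (f2 _ (by simp)) (f2 _ (by simp)) (f2 _ (by simp)) (f2 _ (by simp))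
  have hrun : outBody.run P σ = (HL.pset .c ⟨0, [.c, .b]⟩).run P (routeBlock.run P
      ((routeBlock.run P σ₁).setp .o (n / 2))) := by
    have : (routeBlock.run P σ₁).pub .h = n / 2 := by rw [f1 _ (by simp)]; simp [hσ₁, hh]
    simp [outBody, HL.run, PE.ev, hc, ← hσ₁, this]
  rw [hrun]
  generalize routeBlock.run P σ₁ = σ₂ at *
  simp only [hσ₁, St.setp_pub] at f1
  have f1' : ∀ v, v ≠ .i → v ≠ .o → σ₂.pub v = σ.pub v := fun v h1 h2 => by simp [f1 v h1, h2]
  obtain ⟨f3, f4⟩ := routeBlock_frame P (σ₂.setp .o (n / 2))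
  have s2 := routeBlock_spec hP (H₁.setp (d := .o) (by simp) (by simp) (n / 2)) hx htg
    (by simp [f1', hN]) (by simp [f1', ha]; omega)
  generalize routeBlock.run P (σ₂.setp .o (n / 2)) = σ₃ at *
  have f3' : ∀ v, v ≠ .i → v ≠ .o → σ₃.pub v = σ.pub v := fun v h1 h2 => by
    rw [f3 v h1]; simp [h2, f1' v h1 h2]
  simp [f1', hσ₁, ha, b1] at s1 s2
  refine ⟨by simp [HL.run, PE.ev, f3'], fun e h1 h2 h3 => ?_, fun l hl => ?_⟩
  · simp only [HL.run, St.setp_raw]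
    by_cases hpe : n / 2 ≤ pos e
    · exact s2.1 e hpe (by have := H.lt e; omega) h1 h2 h3
    · rw [s2.2 _ (fun e' g1 g2 g3 g4 g5 => ?_), s1.1 e (by omega) h1 h2 h3]
      have : e' = e := htg (by omega)
      subst this; exact hpe g1
  · simp only [HL.run, St.setp_raw]
    rw [s2.2 l (fun e _ _ h1 h2 => hl e h1 h2), s1.2 l (fun e _ h1 h2 => hl e h1 h2)]

theorem output_spec {P : Cmd} {T : ℕ → ℕ} (hP : IsObliviousSort P T) {σ : St} {x : Fin n → ℕ}
    {h : HashValues n m} {tg pos : Fin n → ℕ} (H : Holds σ x h tg pos) (hx : ∀ e, 0 < x e)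
    (htg : Function.Injective tg) (htg0 : ∀ e, tg e ≠ 0) {s : ℕ} (hs : σ.pub .s = s)
    (hb : 2 * m + s ≤ σ.base) :
    (∀ e, tg e ≤ 2 * m + s → (output.run P σ).raw (tg e - 1) = x e) ∧
    ∀ a < 2 * m + s, (∀ e, tg e ≠ a + 1) → (output.run P σ).raw a = 0 := by
  unfold output
  simp only [HL.run_block_cons, HL.run_block_nil]
  obtain ⟨p1, p2, p3, p4, p5⟩ := outPrepare_prun σ.pub
  have p6 := fun v hv => outPrepare_frame v hv σ.pub
  simp only [← HL.run_pub P] at p1 p2 p3 p4 p5 p6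
  have a1 : ∀ A, (outPrepare.run P σ).arr A = σ.arr A := fun A =>
    HL.run_arr_of_notMem P _ _ _ (by simp [outPrepare, halve, HL.block, HL.amods])
  have b1 := HL.run_base P outPrepare σ
  have H₁ : Holds (outPrepare.run P σ) x h tg pos := H.of_arr (p6 _ (by simp)) (p6 _ (by simp))
    (a1 _) (a1 _) (a1 _) (a1 _)
  generalize outPrepare.run P σ = σ₁ at *
  rw [H.pub_n] at p1 p2 p3 p4
  rw [H.pub_m, hs] at p5
  have z1 := zero_spec P σ₁ (by omega)
  have p7 : ∀ v, v ≠ .i → ((HL.loop .i .z zeroBody).run P σ₁).pub v = σ₁.pub v := fun v hv => by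
    rw [HL.run_pub, HL.prun_of_notMem _ _ _ (by simp [zeroBody, HL.pmods, hv])]
  have a2 : ∀ A, ((HL.loop .i .z zeroBody).run P σ₁).arr A = σ₁.arr A := fun A =>
    HL.run_arr_of_notMem P _ _ _ (by simp [zeroBody, HL.amods])
  have b2 := HL.run_base P (HL.loop .i .z zeroBody) σ₁
  have H₂ : Holds ((HL.loop .i .z zeroBody).run P σ₁) x h tg pos :=
    H₁.of_arr (p7 _ (by simp)) (p7 _ (by simp)) (a2 _) (a2 _) (a2 _) (a2 _)
  generalize (HL.loop .i .z zeroBody).run P σ₁ = σ₂ at *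
  set σ₃ := HL.run P (.pset .c ⟨0, []⟩) σ₂ with hσ₃
  have p8 : ∀ v, v ≠ .c → σ₃.pub v = σ₂.pub v := fun v hv => by simp [hσ₃, HL.run, hv]
  have p9 : σ₃.pub .c = 0 := by simp [hσ₃, HL.run, PE.ev]
  have a3 : σ₃.arr = σ₂.arr := rfl
  have r3 : σ₃.raw = σ₂.raw := rfl
  have b3 : σ₃.base = σ₂.base := rfl
  have H₃ : Holds σ₃ x h tg pos := H₂.setp (by simp) (by simp) _
  clear_value σ₃
  have hz : σ₃.pub .z = 2 * m + s := by rw [p8 _ (by simp), p7 _ (by simp), p5]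
  have h1 : σ₃.pub .h = n / 2 := by rw [p8 _ (by simp), p7 _ (by simp), p1]
  have h2 : σ₃.pub .a = n - n / 2 := by rw [p8 _ (by simp), p7 _ (by simp), p2]
  have h3 : σ₃.pub .b = max 1 (n / 2) := by rw [p8 _ (by simp), p7 _ (by simp), p3]
  have h4 : σ₃.pub .N = n - n / 2 + max 1 (n / 2) := by rw [p8 _ (by simp), p7 _ (by simp), p4]
  have key := HL.loop_induction P (k := .q) (N := .z) (c := outBody)
    (by simp [HL.Wf, outBody, routeBlock, itemBody, cellBody, scanBody, writeBody, HL.block,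
      HL.pmods]) σ₃
    (fun i σ' => Holds σ' x h tg pos ∧ (2 * m + s ≤ σ'.pub .c ∨ i ≤ σ'.pub .c) ∧
      σ'.base = σ₃.base ∧
      (∀ e, tg e ≤ 2 * m + s → tg e ≤ σ'.pub .c → σ'.raw (tg e - 1) = x e) ∧
      ∀ a < 2 * m + s, (∀ e, tg e ≠ a + 1) → σ'.raw a = 0)
    ⟨H₃.setp (by simp) (by simp) _, .inr (by omega), rfl, fun e _ he => by
      simp [p9] at he; exact absurd he (htg0 e), fun a ha _ => by
      simp [r3, z1 a (by omega)]⟩ (by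
    rintro i hi σ' ⟨g1, g2, g3, g4, g5⟩ hk hp
    have hp' : ∀ v, v ∉ [PV.q, .i, .o, .c] → σ'.pub v = σ₃.pub v := fun v hv => by
      simp at hv
      exact hp v hv.1 (by simp [outBody, routeBlock, itemBody, cellBody, scanBody, writeBody,
        HL.block, HL.pmods, hv])
    by_cases hc : σ'.pub .c < 2 * m + s
    · obtain ⟨o1, o2, o3⟩ := outBody_spec hP g1 hx htg
        (by rw [hp' _ (by simp), hp' _ (by simp), hp' _ (by simp), h2, h3, h4])
        (by rw [hp' _ (by simp), h2]) (by rw [hp' _ (by simp), h1])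
        (by rw [hp' .z (by simp), hz]; exact hc)
      obtain ⟨f1, f2⟩ := outBody_frame P σ'
      rw [hp' .b (by simp), h3] at o1 o2 o3
      refine ⟨(g1.of_arr (f1 _ (by simp)) (f1 _ (by simp)) (f2 _ (by simp)) (f2 _ (by simp))
        (f2 _ (by simp)) (f2 _ (by simp))).setp (by simp) (by simp) _, ?_, ?_, ?_, ?_⟩
      · simp [o1]; omega
      · simp [HL.run_base, g3]
      · intro e e1 e2
        simp only [St.setp_raw]
        simp [o1] at e2
        by_cases e3 : σ'.pub .c < tg e
        · exact o2 e e3 e2 (by omega)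
        · rw [o3, g4 e e1 (by omega)]
          intro e' c1 c2 c3
          have := htg0 e
          omega
      · intro a ha hae
        simp only [St.setp_raw]
        rw [o3 a (fun e _ _ => hae e), g5 a ha hae]
    · have hrun : outBody.run P σ' = σ' := by
        simp [outBody, HL.run, PE.ev, SC.run, hp', hz]; omega
      rw [hrun]
      exact ⟨g1.setp (by simp) (by simp) _, .inl (by simp; omega), by simp [g3],
        by simpa using g4, by simpa using g5⟩)
  obtain ⟨g1, g2, g3, g4, g5⟩ := key
  rw [hz] at g2
  exact ⟨fun e he => g4 e he (by omega), g5⟩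

/-- Peeling shrinks the set of unassigned items as fast as the program assumes. -/
def Good (c : ℕ) (h : HashValues n m) : Prop :=
  ∀ L j : ℕ, L ^ 4 ≤ n → n < 16 * L ^ 4 → L < n / 2 ^ j →
    (Finset.univ.filter (fun e => (peel h)^[c * (j + 1)] (fun _ => 0) e = 0)).card ≤ n / 2 ^ (j + 1)

theorem mainProgram_spec {P : Cmd} {T : ℕ → ℕ} (hP : IsObliviousSort P T) (c : ℕ) (hn : 1 ≤ n)
    {h : HashValues n m} (hgood : Good (c + 1) h) {s : ℕ} (hs : StashSuffices h s) {x : Fin n → ℕ}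
    (hx : ∀ e, 0 < x e) {σ : St} (hb : σ.base = 3 * n + 2 * m + s) (hp : σ.pub = initPub n m s)
    (hin : ∀ i : Fin n, σ.raw i = x i ∧ σ.raw (n + i) = (h i).1 ∧ σ.raw (2 * n + i) = (h i).2) :
    IsCuckooScheme x h (fun cell : Cell m s => ((mainProgram (c + 1)).run P σ).raw cell.addr) := by
  unfold mainProgram
  simp only [HL.run_block_cons, HL.run_block_nil]
  have i1 := copy_spec P σ (by simp [hp, hb, initPub]; omega)
  have p1 : ∀ v, v ≠ .i → ((HL.loop .i .n copyBody).run P σ).pub v = σ.pub v := fun v hv => by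
    rw [HL.run_pub, HL.prun_of_notMem _ _ _ (by simp [copyBody, HL.block, HL.pmods, hv])]
  have b1 := HL.run_base P (HL.loop .i .n copyBody) σ
  generalize (HL.loop .i .n copyBody).run P σ = σ₁ at *
  have hn1 : σ₁.pub .n = n := by rw [p1 _ (by simp), hp]; rfl
  have hm1 : σ₁.pub .m = m := by rw [p1 _ (by simp), hp]; rfl
  have hs1 : σ₁.pub .s = s := by rw [p1 _ (by simp), hp]; rfl
  have hpn : σ.pub .n = n := by rw [hp]; rfl
  rw [hpn] at i1
  have H₁ : Holds σ₁ x h (fun _ => 0) (fun e : Fin n => (e : ℕ)) :=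
    ⟨hn1, hm1, fun e => e.2, fun e e' hee => Fin.ext hee, fun a ha => ⟨⟨a, ha⟩, rfl⟩,
      fun e => by rw [(i1 e e.2).1, (hin e).1], fun e => by rw [(i1 e e.2).2.1, (hin e).2.1],
      fun e => by rw [(i1 e e.2).2.2.1, (hin e).2.2], fun e => (i1 e e.2).2.2.2⟩
  obtain ⟨l1, l2, -⟩ := root_prun σ₁.pub (by omega)
  rw [← HL.run_pub P, hn1] at l1 l2
  have p2 : ∀ v, v ∉ [PV.p, .L, .o] → (root.run P σ₁).pub v = σ₁.pub v := fun v hv => by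
    simp at hv
    rw [HL.run_pub, HL.prun_of_notMem _ _ _ (by simp [root, rootBody, HL.block, HL.pmods, hv])]
  have a2 : ∀ A, (root.run P σ₁).arr A = σ₁.arr A := fun A =>
    HL.run_arr_of_notMem P _ _ _ (by simp [root, rootBody, HL.block, HL.amods])
  have b2 := HL.run_base P root σ₁
  have H₂ : Holds (root.run P σ₁) x h (fun _ => 0) (fun e : Fin n => (e : ℕ)) :=
    H₁.of_arr (p2 _ (by simp)) (p2 _ (by simp)) (a2 _) (a2 _) (a2 _) (a2 _)
  generalize root.run P σ₁ = σ₂ at *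
  set σ₃ := HL.run P (.pset .N ⟨0, [.n]⟩) σ₂ with hσ₃
  have hn3 : σ₃.pub .N = n := by simp [hσ₃, HL.run, PE.ev, p2, hn1]
  have p3 : ∀ v, v ≠ .N → σ₃.pub v = σ₂.pub v := fun v hv => by simp [hσ₃, HL.run, hv]
  have b3 : σ₃.base = σ₂.base := rfl
  have H₃ : Holds σ₃ x h (fun _ => 0) (fun e : Fin n => (e : ℕ)) := H₂.setp (by simp) (by simp) _
  clear_value σ₃
  obtain ⟨-, ⟨j, hj⟩, k, pos, H₄, k2⟩ := shrink_spec hP c H₃ hn3 (fun j hj => by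
    rw [p3 _ (by simp)] at hj
    exact hgood _ j l1 l2 hj)
  have p4 : σ₃.pub .s = s := by rw [p3 _ (by simp), p2 _ (by simp), hs1]
  have b4 := HL.run_base P (HL.loop .o .n (shrinkBody (c + 1))) σ₃
  have p5 : ((HL.loop .o .n (shrinkBody (c + 1))).run P σ₃).pub .s = s := by
    rw [HL.run_pub, HL.prun_of_notMem, p4]
    have : ∀ c, PV.s ∉ (rounds c).pmods := by
      intro c
      induction c with
      | zero => simp [rounds, HL.pmods]
      | succ c ih =>
        simp [rounds, round, uniq, keyBody, flagBody, decideBody, compact, rank, rankBody,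
          permField, permLoad, wordTo, HL.block, HL.pmods, ih]
    simp [shrinkBody, halve, HL.block, HL.pmods, this]
  generalize (HL.loop .o .n (shrinkBody (c + 1))).run P σ₃ = σ₄ at *
  have inv : ∀ k, Valid h ((peel h)^[k] (fun _ => 0)) 0 ∧ Free h ((peel h)^[k] (fun _ => 0)) ∧
      Ext h s ((peel h)^[k] (fun _ => 0)) := by
    intro k
    induction k with
    | zero => exact ⟨valid_zero h, free_zero h, ext_zero hs⟩
    | succ k ih =>
      rw [Function.iterate_succ_apply']
      have := peel_preserves (s := s) ih.2.1 ih.1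
      exact ⟨this.1, free_peel ih.2.1, this.2 ih.2.2⟩
  obtain ⟨v1, v2, v3⟩ := inv ((c + 1) * k)
  obtain ⟨tg, cnt, H₅, w1, w2, w3⟩ := greedy_spec (P := P) (s := s) H₄
    (by rw [hj]; exact Nat.div_le_self _ _) k2 v1 v2
  have p6 := (greedy_frame P σ₄).1 .s (by simp)
  have b5 := HL.run_base P greedy σ₄
  generalize greedy.run P σ₄ = σ₅ at *
  obtain ⟨o1, o2⟩ := output_spec hP H₅ hx (fun e e' hee => w1.inj e e' hee (w3 e)) w3
    (s := s) (by rw [p6, p5]) (by rw [b5, b4, b3, b2, b1, hb]; omega)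
  exact isCuckooScheme_of_valid w1 (w2 v3) w3 o1 o2

end ObliviousCuckoo

namespace ObliviousCuckoo

/-! ### Running time -/

namespace HL

theorem iterCost_le_sum {α : Type*} (f : α → ℕ) (g : α → α) (I : ℕ → α → Prop) (F : ℕ → ℕ) (d : ℕ)
    (hstep : ∀ i < d, ∀ p, I i p → f p ≤ F i ∧ I (i + 1) (g p)) (p : α) (h0 : I 0 p) :
    iterCost f g d p ≤ ∑ i ∈ Finset.range d, F i := by
  induction d generalizing I F p with
  | zero => simp [iterCost]
  | succ d ih =>
    obtain ⟨h1, h2⟩ := hstep 0 (by omega) p h0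
    have := ih (fun i => I (i + 1)) (fun i => F (i + 1))
      (fun i hi p hp => hstep (i + 1) (by omega) p hp) (g p) h2
    rw [Finset.sum_range_succ']
    simp only [iterCost]
    omega

theorem cost_loop_le (T : ℕ → ℕ) {k N : PV} {c : HL} (p : PV → ℕ) (I : ℕ → (PV → ℕ) → Prop)
    (F : ℕ → ℕ) (h0 : I 0 (Function.update p k 0))
    (hstep : ∀ i < p N, ∀ p', I i p' → p' k = i → c.cost T p' ≤ F i ∧
      (c.prun p' k = i → I (i + 1) (Function.update (c.prun p') k (i + 1))))
    (hk : k ∉ c.pmods) :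
    (loop k N c).cost T p ≤ 2 + ∑ i ∈ Finset.range (p N), (F i + 3) := by
  simp only [cost]
  refine Nat.add_le_add_left (iterCost_le_sum _ _ (fun i p' => I i p' ∧ p' k = i) (fun i => F i + 3)
    _ (fun i hi p' hp' => ?_) _ ⟨h0, by simp⟩) _
  obtain ⟨h1, h2⟩ := hstep i hi p' hp'.1 hp'.2
  have hk' : c.prun p' k = i := by rw [prun_of_notMem _ _ _ hk, hp'.2]
  refine ⟨by omega, ?_, ?_⟩
  · rw [hk']; exact h2 hk'
  · simp [hk']

/-- Nested loops of depth at most `d`, all of them bounded by `N`. -/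
def Deep (N : PV) : ℕ → HL → Prop
  | d, seq c₁ c₂ => Deep N d c₁ ∧ N ∉ c₁.pmods ∧ Deep N d c₂
  | d, pif _ _ c₁ c₂ => Deep N d c₁ ∧ Deep N d c₂
  | 0, loop _ _ _ => False
  | d + 1, loop k M c => M = N ∧ k ≠ N ∧ k ∉ c.pmods ∧ N ∉ c.pmods ∧ Deep N d c
  | _, sort _ => False
  | _, _ => True

theorem Deep.cost_le (T : ℕ → ℕ) {N : PV} {d : ℕ} {c : HL} (h : Deep N d c) :
    ∃ K, ∀ p, c.cost T p ≤ K * (p N + 1) ^ d := by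
  have const : ∀ (d K : ℕ) (p : PV → ℕ), K ≤ K * (p N + 1) ^ d := fun d K p =>
    Nat.le_mul_of_pos_right _ (by positivity)
  induction c generalizing d with
  | seq c₁ c₂ h₁ h₂ =>
    simp only [Deep] at h
    obtain ⟨K₁, g₁⟩ := h₁ h.1
    obtain ⟨K₂, g₂⟩ := h₂ h.2.2
    refine ⟨K₁ + K₂, fun p => ?_⟩
    have a₁ := g₁ p
    have a₂ := g₂ (c₁.prun p)
    rw [prun_of_notMem _ _ _ h.2.1] at a₂
    simp only [cost, add_mul]
    omega
  | pif e₁ e₂ c₁ c₂ h₁ h₂ =>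
    simp only [Deep] at h
    obtain ⟨K₁, g₁⟩ := h₁ h.1
    obtain ⟨K₂, g₂⟩ := h₂ h.2
    refine ⟨e₁.cost + e₂.cost + 1 + (K₁ + K₂), fun p => ?_⟩
    have a₁ := g₁ p
    have a₂ := g₂ p
    have a₃ := const d (e₁.cost + e₂.cost + 1) p
    simp only [cost, add_mul _ (K₁ + K₂), add_mul K₁]
    split_ifs <;> omega
  | loop k M c hc =>
    cases d with
    | zero => simp [Deep] at h
    | succ d =>
      simp only [Deep] at h
      obtain ⟨rfl, hkM, hk, hM, hd⟩ := h
      obtain ⟨K, g⟩ := hc hd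
      refine ⟨2 + (K + 3), fun p => ?_⟩
      have := cost_loop_le T (k := k) (N := M) (c := c) p (fun _ p' => p' M = p M)
        (fun _ => K * (p M + 1) ^ d) (by simp [hkM.symm])
        (fun i hi p' h1 h2 => ⟨by have := g p'; rwa [h1] at this, fun _ => by
          simp [hkM.symm, prun_of_notMem _ _ _ hM, h1]⟩) hk
      refine this.trans ?_
      have h1 := const (d + 1) 2 p
      have h2 : 3 ≤ 3 * (p M + 1) ^ d := const d 3 p
      simp only [Finset.sum_const, Finset.card_range, smul_eq_mul]
      rw [add_mul 2]
      refine add_le_add h1 ?_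
      calc p M * (K * (p M + 1) ^ d + 3) ≤ (p M + 1) * (K * (p M + 1) ^ d + 3 * (p M + 1) ^ d) := by
            gcongr; omega
        _ = _ := by ring
  | sort N => cases d <;> simp [Deep] at h
  | sc c => exact ⟨c.cost, fun p => const _ _ p⟩
  | pset v e => exact ⟨_, fun p => const d (e.cost + 1) p⟩
  | psub v e₁ e₂ => exact ⟨_, fun p => const d (e₁.cost + e₂.cost + 1) p⟩
  | load v A e => exact ⟨_, fun p => const d (e.cost + 7) p⟩
  | store A e v => exact ⟨_, fun p => const d (e.cost + v.cost + 7) p⟩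
  | rload v e => exact ⟨_, fun p => const d (e.cost + 2) p⟩
  | rstore e v => exact ⟨_, fun p => const d (e.cost + v.cost + 2) p⟩

/-- Calls of the sorting program for `N` items, and loops of constant cost, bounded by variables
in `V`. -/
def Linear (N : PV) (V : List PV) : HL → Prop
  | seq c₁ c₂ => c₁.Linear N V ∧ (((∀ v ∈ N :: V, v ∉ c₁.pmods) ∧ c₂.Linear N V) ∨ Deep N 0 c₂)
  | pif _ _ c₁ c₂ => c₁.Linear N V ∧ c₂.Linear N V
  | loop _ M c => M ∈ N :: V ∧ Deep N 0 c
  | sort M => M = N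
  | _ => True

theorem Linear.cost_le {T : ℕ → ℕ} (hT : ∀ N, 1 ≤ N → N ≤ T N) {N : PV} {V : List PV} {c : HL}
    (h : c.Linear N V) :
    ∃ K, ∀ p, 1 ≤ p N → (∀ v ∈ V, p v ≤ p N) → c.cost T p ≤ K * T (p N) := by
  have const : ∀ (K : ℕ) (p : PV → ℕ), 1 ≤ p N → K ≤ K * T (p N) := fun K p hp =>
    Nat.le_mul_of_pos_right _ (hp.trans (hT _ hp))
  induction c with
  | seq c₁ c₂ h₁ h₂ =>
    simp only [Linear] at h
    obtain ⟨K₁, g₁⟩ := h₁ h.1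
    rcases h.2 with ⟨hm, h'⟩ | h'
    · obtain ⟨K₂, g₂⟩ := h₂ h'
      have hm' : ∀ v ∈ N :: V, ∀ p, c₁.prun p v = p v := fun v hv p =>
        prun_of_notMem _ _ _ (hm v hv)
      refine ⟨K₁ + K₂, fun p hp hV => ?_⟩
      have a₁ := g₁ p hp hV
      have a₂ := g₂ (c₁.prun p) (by rwa [hm' N (by simp)]) (fun v hv => by
        rw [hm' N (by simp), hm' v (by simp [hv])]; exact hV v hv)
      rw [hm' N (by simp)] at a₂
      simp only [cost, add_mul]
      omega
    · obtain ⟨K₂, g₂⟩ := h'.cost_le T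
      refine ⟨K₁ + K₂, fun p hp hV => ?_⟩
      have a₁ := g₁ p hp hV
      have a₂ := g₂ (c₁.prun p)
      have a₃ := const K₂ p hp
      simp only [cost, add_mul]
      simp at a₂
      omega
  | pif e₁ e₂ c₁ c₂ h₁ h₂ =>
    simp only [Linear] at h
    obtain ⟨K₁, g₁⟩ := h₁ h.1
    obtain ⟨K₂, g₂⟩ := h₂ h.2
    refine ⟨e₁.cost + e₂.cost + 1 + (K₁ + K₂), fun p hp hV => ?_⟩
    have a₁ := g₁ p hp hV
    have a₂ := g₂ p hp hV
    have a₃ := const (e₁.cost + e₂.cost + 1) p hp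
    simp only [cost, add_mul _ (K₁ + K₂), add_mul K₁]
    split_ifs <;> omega
  | loop k M c hc =>
    simp only [Linear] at h
    obtain ⟨K, g⟩ := h.2.cost_le T
    simp only [pow_zero, mul_one] at g
    refine ⟨2 + (K + 3), fun p hp hV => ?_⟩
    have h1 : iterCost (fun p => c.cost T p + 3)
        (fun p => Function.update (c.prun p) k (c.prun p k + 1)) (p M) (Function.update p k 0) ≤
        ∑ i ∈ Finset.range (p M), (K + 3) :=
      iterCost_le_sum _ _ (fun _ _ => True) (fun _ => K + 3) _
        (fun i _ p' _ => ⟨Nat.add_le_add_right (g p') 3, trivial⟩) _ trivial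
    simp only [Finset.sum_const, Finset.card_range, smul_eq_mul] at h1
    have h2 : p M ≤ T (p N) := by
      refine le_trans ?_ (hT _ hp)
      rcases List.mem_cons.mp h.1 with rfl | hM
      · exact le_rfl
      · exact hV M hM
    have h3 := const 2 p hp
    have h4 := Nat.mul_le_mul_right (K + 3) h2
    simp only [cost]
    rw [add_mul 2, mul_comm (K + 3)]
    omega
  | sort M =>
    simp only [Linear] at h
    subst h
    refine ⟨8 + 3, fun p hp _ => ?_⟩
    have := const 3 p hp
    simp only [cost, add_mul]; omega
  | sc c => exact ⟨c.cost, fun p hp _ => const _ p hp⟩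
  | pset v e => exact ⟨_, fun p hp _ => const (e.cost + 1) p hp⟩
  | psub v e₁ e₂ => exact ⟨_, fun p hp _ => const (e₁.cost + e₂.cost + 1) p hp⟩
  | load v A e => exact ⟨_, fun p hp _ => const (e.cost + 7) p hp⟩
  | store A e v => exact ⟨_, fun p hp _ => const (e.cost + v.cost + 7) p hp⟩
  | rload v e => exact ⟨_, fun p hp _ => const (e.cost + 2) p hp⟩
  | rstore e v => exact ⟨_, fun p hp _ => const (e.cost + v.cost + 2) p hp⟩

end HL

/-! #### Superadditive time bounds -/

theorem superadditive_mono {T : ℕ → ℕ} (hT : ∀ a b : ℕ, 1 ≤ a → 1 ≤ b → T a + T b ≤ T (a + b))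
    {a b : ℕ} (ha : 1 ≤ a) (hab : a ≤ b) : T a ≤ T b := by
  rcases hab.eq_or_lt with rfl | h
  · exact le_rfl
  · have := hT a (b - a) ha (by omega)
    rw [show a + (b - a) = b by omega] at this
    omega

theorem superadditive_mul {T : ℕ → ℕ} (hT : ∀ a b : ℕ, 1 ≤ a → 1 ≤ b → T a + T b ≤ T (a + b))
    {a : ℕ} (ha : 1 ≤ a) (k : ℕ) : (k + 1) * T a ≤ T ((k + 1) * a) := by
  induction k with
  | zero => simp
  | succ k ih =>
    have := hT ((k + 1) * a) a (by nlinarith) ha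
    rw [show (k + 1 + 1) * a = (k + 1) * a + a by ring, add_mul]
    omega

theorem le_superadditive {T : ℕ → ℕ} (hT : ∀ a b : ℕ, 1 ≤ a → 1 ≤ b → T a + T b ≤ T (a + b))
    (h1 : 1 ≤ T 1) (a : ℕ) (ha : 1 ≤ a) : a ≤ T a := by
  obtain ⟨k, rfl⟩ := Nat.exists_eq_add_of_le' ha
  have := superadditive_mul hT le_rfl k
  simp only [mul_one] at this
  nlinarith

theorem sum_halves_le {T : ℕ → ℕ} (hT : ∀ a b : ℕ, 1 ≤ a → 1 ≤ b → T a + T b ≤ T (a + b)) (n : ℕ)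
    (hn : 1 ≤ n) (d : ℕ) :
    ∑ i ∈ Finset.range d, (if 1 ≤ n / 2 ^ i then T (n / 2 ^ i) else 0) ≤ 2 * T n := by
  set g : ℕ → ℕ := fun i => if 1 ≤ n / 2 ^ i then T (n / 2 ^ i) else 0 with hg
  have hstep : ∀ i, 2 * g (i + 1) ≤ g i := by
    intro i
    simp only [hg]
    have e : n / 2 ^ (i + 1) = n / 2 ^ i / 2 := by rw [Nat.div_div_eq_div_mul, pow_succ]
    rw [e]
    generalize n / 2 ^ i = x
    split_ifs with h1 h2 h2
    · have a := hT (x / 2) (x / 2) h1 h1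
      have b := superadditive_mono hT (a := x / 2 + x / 2) (b := x) (by omega) (by omega)
      omega
    · omega
    · omega
    · omega
  have key : ∀ d, ∑ i ∈ Finset.range d, g i + 2 * g d ≤ 2 * g 0 := by
    intro d
    induction d with
    | zero => simp
    | succ d ih =>
      rw [Finset.sum_range_succ]
      have := hstep d
      omega
  have h0 : g 0 = T n := by simp [hg, hn]
  have := key d
  rw [h0] at this
  show ∑ i ∈ Finset.range d, g i ≤ _
  omega

theorem rounds_linear (c : ℕ) : (rounds c).Linear .N [] ∧ ∀ v, v ≠ .i → v ∉ (rounds c).pmods := by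
  induction c with
  | zero => simp [rounds, HL.Linear, HL.pmods]
  | succ c ih =>
    refine ⟨⟨?_, .inl ⟨?_, ih.1⟩⟩, fun v hv => ?_⟩
    · simp [round, uniq, keyBody, flagBody, decideBody, compact, rank, rankBody, permField,
        permLoad, wordTo, HL.block, HL.Linear, HL.Deep, HL.pmods]
    · simp [round, uniq, keyBody, flagBody, decideBody, compact, rank, rankBody, permField,
        permLoad, wordTo, HL.block, HL.pmods]
    · simp [rounds, round, uniq, keyBody, flagBody, decideBody, compact, rank, rankBody, permField,
        permLoad, wordTo, HL.block, HL.pmods, hv, ih.2 v hv]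

theorem shrink_cost {T : ℕ → ℕ} (hT : ∀ a b : ℕ, 1 ≤ a → 1 ≤ b → T a + T b ≤ T (a + b))
    (h1 : 1 ≤ T 1) (c : ℕ) : ∃ C, ∀ p, 1 ≤ p .n → p .N = p .n → 1 ≤ p .L →
      (HL.loop .o .n (shrinkBody c)).cost T p ≤ C * T (p .n) ∧
      (HL.loop .o .n (shrinkBody c)).prun p .N ≤ p .L := by
  obtain ⟨hl, hm⟩ := rounds_linear c
  obtain ⟨K, hK⟩ := HL.Linear.cost_le (le_superadditive hT h1) (N := .N) (V := [])
    (c := .block [rounds c, halve .N, .pset .N ⟨0, [.h]⟩]) (by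
      simp [HL.block, HL.Linear, HL.Deep, halve, HL.pmods, hl, hm])
  have hbody : ∀ p, (shrinkBody c).cost T p = 7 + if p .L < p .N then
      (HL.block [rounds c, halve .N, .pset .N ⟨0, [.h]⟩]).cost T p else 1 := by
    intro p; simp [shrinkBody, HL.cost, PE.cost, PE.ev, SC.cost]
  have hN : ∀ p, (shrinkBody c).prun p .N = if p .L < p .N then p .N / 2 else p .N := by
    intro p
    by_cases hp : p .L < p .N
    · simp [shrinkBody, HL.prun, PE.ev, HL.block, hp, halve_prun,
        HL.prun_of_notMem _ _ _ (hm .N (by simp))]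
    · simp [shrinkBody, HL.prun, PE.ev, HL.block, hp]
  have hL : ∀ p, (shrinkBody c).prun p .L = p .L := fun p =>
    HL.prun_of_notMem _ _ _ (by simp [shrinkBody, halve, HL.block, HL.pmods, hm])
  refine ⟨2 + 11 + 2 * K, fun p hn hpN hpL => ⟨?_, ?_⟩⟩
  · have := HL.cost_loop_le T (k := .o) (N := .n) (c := shrinkBody c) p
      (fun i p' => p' .L = p .L ∧ (p' .N = p .n / 2 ^ i ∨ p' .N ≤ p .L))
      (fun i => 8 + K * if 1 ≤ p .n / 2 ^ i then T (p .n / 2 ^ i) else 0) (by simp [hpN]) (by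
        rintro i hi p' ⟨h1, h2⟩ h3
        refine ⟨?_, fun _ => ?_⟩
        · rw [hbody]
          split_ifs with c1 c2 c2
          · have := hK p' (by omega) (by simp)
            rw [h2.resolve_right (by omega)] at this
            omega
          · omega
          · omega
          · omega
        · simp only [Function.update_of_ne (show PV.L ≠ .o by simp),
            Function.update_of_ne (show PV.N ≠ .o by simp), hL, hN]
          refine ⟨h1, ?_⟩
          rw [pow_succ, ← Nat.div_div_eq_div_mul]
          split_ifs with c1
          · left; rw [h2.resolve_right (by omega)]
          · right; omega) (by simp [shrinkBody, halve, HL.block, HL.pmods, hm])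
    refine this.trans ?_
    have e1 : ∑ i ∈ Finset.range (p .n), (8 + K * (if 1 ≤ p .n / 2 ^ i then T (p .n / 2 ^ i) else 0)
        + 3) = p .n * 11 + K * ∑ i ∈ Finset.range (p .n),
          (if 1 ≤ p .n / 2 ^ i then T (p .n / 2 ^ i) else 0) := by
      rw [Finset.mul_sum]
      simp only [Finset.sum_add_distrib, Finset.sum_const, Finset.card_range, smul_eq_mul]
      ring
    rw [e1]
    have e2 := Nat.mul_le_mul_left K (sum_halves_le hT (p .n) hn (p .n))
    have e3 := le_superadditive hT h1 (p .n) hn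
    nlinarith
  · have := HL.loop_prun_induction (k := .o) (N := .n) (c := shrinkBody c) (by
        have : ∀ c, (rounds c).Wf := by
          intro c
          induction c with
          | zero => simp [rounds, HL.Wf]
          | succ c ih =>
            refine ⟨?_, ih⟩
            simp [round, uniq, keyBody, flagBody, decideBody, compact, rank, rankBody, permField,
              permLoad, wordTo, HL.block, HL.Wf, HL.pmods]
        simp [HL.Wf, shrinkBody, HL.block, HL.pmods, halve, this, hm]) p
      (fun i p' => p' .L = p .L ∧ (p' .N = p .n / 2 ^ i ∨ p' .N ≤ p .L)) (by simp [hpN]) (by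
        rintro i hi p' ⟨h1, h2⟩ h3 h4
        simp only [Function.update_of_ne (show PV.L ≠ .o by simp),
          Function.update_of_ne (show PV.N ≠ .o by simp), hL, hN]
        refine ⟨h1, ?_⟩
        rw [pow_succ, ← Nat.div_div_eq_div_mul]
        split_ifs with c1
        · left; rw [h2.resolve_right (by omega)]
        · right; omega)
    rcases this.2 with h | h
    · rw [h, Nat.div_eq_of_lt Nat.lt_two_pow_self]; omega
    · exact h

theorem outLoop_cost {T : ℕ → ℕ} (hT : ∀ a b : ℕ, 1 ≤ a → 1 ≤ b → T a + T b ≤ T (a + b))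
    (h1 : 1 ≤ T 1) : ∃ C, ∀ p, 1 ≤ p .b → p .a + p .b = p .N → p .c = 0 →
      (HL.loop .q .z outBody).cost T p ≤ C * (p .z + 1 + (p .z / p .b + 1) * T (p .N)) := by
  obtain ⟨K, hK⟩ := HL.Linear.cost_le (le_superadditive hT h1) (N := .N) (V := [.a, .b])
    (c := .block [.pset .o ⟨0, []⟩, routeBlock, .pset .o ⟨0, [.h]⟩, routeBlock,
      .pset .c ⟨0, [.c, .b]⟩]) (by
      simp [HL.block, HL.Linear, HL.Deep, routeBlock, itemBody, cellBody, scanBody, writeBody,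
        HL.pmods])
  have hbody : ∀ p, outBody.cost T p = 7 + if p .c < p .z then
      (HL.block [.pset .o ⟨0, []⟩, routeBlock, .pset .o ⟨0, [.h]⟩, routeBlock,
      .pset .c ⟨0, [.c, .b]⟩]).cost T p else 1 := by
    intro p; simp [outBody, HL.cost, PE.cost, PE.ev, SC.cost]
  have hmod : ∀ v, v ∉ [PV.i, .o, .c] → ∀ p, outBody.prun p v = p v := fun v hv p => by
    simp at hv
    exact HL.prun_of_notMem _ _ _ (by simp [outBody, routeBlock, itemBody, cellBody,
      scanBody, writeBody, HL.block, HL.pmods, hv])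
  have hr : ∀ v, v ≠ .i → ∀ p, routeBlock.prun p v = p v := fun v hv p =>
    HL.prun_of_notMem _ _ _ (by simp [routeBlock, itemBody, cellBody,
      scanBody, writeBody, HL.block, HL.pmods, hv])
  have hc : ∀ p, outBody.prun p .c = if p .c < p .z then p .c + p .b else p .c := by
    intro p
    by_cases hp : p .c < p .z
    · simp [outBody, HL.prun, PE.ev, HL.block, hp, hr]
    · simp [outBody, HL.prun, PE.ev, HL.block, hp]
  refine ⟨11 + K, fun p hb hN hpc => ?_⟩
  have := HL.cost_loop_le T (k := .q) (N := .z) (c := outBody) p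
    (fun i p' => p' .b = p .b ∧ p' .a = p .a ∧ p' .N = p .N ∧ p' .z = p .z ∧
      (p .z ≤ p' .c ∨ p' .c = i * p .b))
    (fun i => 8 + if i * p .b < p .z then K * T (p .N) else 0) (by simp [hpc]) (by
      rintro i hi p' ⟨g1, g2, g3, g4, g5⟩ h3
      refine ⟨?_, fun _ => ?_⟩
      · rw [hbody, g4]
        have := hK p' (by omega) (by simp; omega)
        rw [g3] at this
        split_ifs with c1 c2 c2
        · omega
        · omega
        · omega
        · omega
      · simp only [Function.update_apply]
        simp only [reduceCtorEq, if_false, hc, g4, g1, hmod .b (by simp), hmod .a (by simp),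
          hmod .N (by simp), hmod .z (by simp), g2, g3, true_and]
        split_ifs with c1
        · rcases g5 with g5 | g5
          · omega
          · right; rw [g5]; ring
        · left; omega)
    (by simp [outBody, routeBlock, itemBody, cellBody, scanBody, writeBody, HL.block, HL.pmods])
  refine this.trans ?_
  have e1 : ∑ i ∈ Finset.range (p .z), (8 + (if i * p .b < p .z then K * T (p .N) else 0) + 3) ≤
      p .z * 11 + (p .z / p .b + 1) * (K * T (p .N)) := by
    simp only [Finset.sum_add_distrib, Finset.sum_const, Finset.card_range, smul_eq_mul]
    rw [← Finset.sum_filter, Finset.sum_const, smul_eq_mul]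
    have : ((Finset.range (p .z)).filter (fun i => i * p .b < p .z)).card ≤ p .z / p .b + 1 := by
      have := Finset.card_le_card (s := (Finset.range (p .z)).filter (fun i => i * p .b < p .z))
        (t := Finset.range (p .z / p .b + 1)) (fun i hi => by
          simp only [Finset.mem_filter, Finset.mem_range] at hi ⊢
          exact Nat.lt_succ_of_le ((Nat.le_div_iff_mul_le hb).mpr hi.2.le))
      simpa using this
    have := Nat.mul_le_mul_right (K * T (p .N)) this
    omega
  have e2 : (p .z / p .b + 1) * (K * T (p .N)) = K * ((p .z / p .b + 1) * T (p .N)) := by ring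
  nlinarith [Nat.zero_le (K * (p .z + 1)), Nat.zero_le ((p .z / p .b + 1) * T (p .N))]

end ObliviousCuckoo

namespace ObliviousCuckoo

theorem rounds_wf (c : ℕ) : (rounds c).Wf := by
  induction c with
  | zero => simp [rounds, HL.Wf]
  | succ c ih =>
    refine ⟨?_, ih⟩
    simp [round, uniq, keyBody, flagBody, decideBody, compact, rank, rankBody, permField,
      permLoad, wordTo, HL.block, HL.Wf, HL.pmods]

theorem mainProgram_wf (c : ℕ) : (mainProgram c).Wf := by
  simp [mainProgram, copyBody, root, rootBody, shrinkBody, halve, greedy, greedyPass, greedyBody,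
    greedyLoad, greedyDecide, breakBody, compareBody, output, outPrepare, zeroBody, outBody,
    routeBlock, itemBody, cellBody, scanBody, writeBody, HL.block, HL.Wf, HL.pmods, rounds_wf,
    (rounds_linear c).2]

theorem output_cost {T : ℕ → ℕ} (hT : ∀ a b : ℕ, 1 ≤ a → 1 ≤ b → T a + T b ≤ T (a + b))
    (h1 : 1 ≤ T 1) (K : ℕ) : ∃ C, ∀ p, 1 ≤ p .n → p .m ≤ K * p .n →
      output.cost T p ≤ C * T (p .n + p .s) := by
  have le := le_superadditive hT h1
  obtain ⟨C₁, k₁⟩ := HL.Deep.cost_le T (N := .n) (d := 1) (c := outPrepare)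
    (by simp [outPrepare, halve, HL.block, HL.Deep, HL.pmods])
  obtain ⟨C₂, k₂⟩ := HL.Deep.cost_le T (N := .z) (d := 1) (c := .loop .i .z zeroBody)
    (by simp [zeroBody, HL.Deep, HL.pmods])
  obtain ⟨C₃, k₃⟩ := outLoop_cost hT h1
  refine ⟨C₁ * 2 + C₂ * (2 * K + 2) + 4 + C₃ * (2 * K + 2 + (6 * K + 4 + 3) * T 2),
    fun p hn hm => ?_⟩
  obtain ⟨p1, p2, p3, p4, p5⟩ := outPrepare_prun p
  have a₁ := k₁ p
  have a₂ := k₂ (outPrepare.prun p)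
  have hz : ∀ v, v ≠ .i → (HL.loop .i .z zeroBody).prun (outPrepare.prun p) v =
      outPrepare.prun p v := fun v hv =>
    HL.prun_of_notMem _ _ _ (by simp [zeroBody, HL.pmods, hv])
  set p' := Function.update ((HL.loop .i .z zeroBody).prun (outPrepare.prun p)) .c 0 with hp'
  have q : ∀ v, v ≠ .i → v ≠ .c → p' v = outPrepare.prun p v := fun v h1 h2 => by
    rw [hp', Function.update_of_ne h2, hz v h1]
  have a₃ := k₃ p' (by rw [q _ (by simp) (by simp), p3]; omega)
    (by rw [q _ (by simp) (by simp), q _ (by simp) (by simp), q _ (by simp) (by simp), p2, p3, p4])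
    (by simp [hp'])
  rw [q _ (by simp) (by simp), q _ (by simp) (by simp), q _ (by simp) (by simp), p3, p4, p5] at a₃
  have hcost : output.cost T p = outPrepare.cost T p +
      ((HL.loop .i .z zeroBody).cost T (outPrepare.prun p) +
        (3 + ((HL.loop .q .z outBody).cost T p' + 1))) := by
    simp [output, HL.cost, HL.block, SC.cost, PE.cost, hp', HL.prun, PE.ev]
  rw [hcost]
  rw [p5] at a₂
  generalize p .n = n at *
  generalize p .m = m at *
  generalize p .s = s at *
  set X := T (n + s) with hX
  have x1 : n + s ≤ X := le _ (by omega)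
  have x2 : 2 * m + s + 1 ≤ (2 * K + 2) * X := by
    have : (2 * K + 2) * (n + s) ≤ (2 * K + 2) * X := Nat.mul_le_mul_left _ x1
    nlinarith [Nat.zero_le (K * s)]
  have x3 : T (n - n / 2 + max 1 (n / 2)) ≤ T 2 * T n := by
    have t2 := le 2 (by omega)
    have tn := le n hn
    rcases Nat.lt_or_ge n 2 with h | h
    · have : n = 1 := by omega
      subst this
      exact Nat.le_mul_of_pos_right _ (by omega)
    · rw [show n - n / 2 + max 1 (n / 2) = n by omega]
      exact Nat.le_mul_of_pos_left _ (by omega)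
  have x4 : T n ≤ X := superadditive_mono hT hn (by omega)
  have x5 : (s / n) * T n ≤ X := by
    rcases Nat.eq_zero_or_pos (s / n) with h | h
    · rw [h]; omega
    · obtain ⟨k, hk⟩ := Nat.exists_eq_add_of_le' h
      rw [hk]
      refine (superadditive_mul hT hn k).trans (superadditive_mono hT (by nlinarith) ?_)
      rw [← hk]
      have := Nat.div_mul_le_self s n
      omega
  have x6 : (2 * m + s) / max 1 (n / 2) + 1 ≤ 6 * K + 4 + 3 * (s / n) := by
    set b := max 1 (n / 2) with hb
    have hb1 : 1 ≤ b := by omega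
    have hb3 : n ≤ 3 * b := by omega
    have hs : s < n * (s / n + 1) := by
      have := Nat.div_add_mod s n
      have := Nat.mod_lt s hn
      rw [mul_add]; omega
    have : (2 * m + s) / b < 6 * K + 3 * (s / n) + 3 := by
      rw [Nat.div_lt_iff_lt_mul (by omega)]
      have y1 : n * (s / n + 1) ≤ 3 * b * (s / n + 1) := Nat.mul_le_mul_right _ hb3
      have y2 : K * n ≤ K * (3 * b) := Nat.mul_le_mul_left _ hb3
      nlinarith
    omega
  have x7 : ((2 * m + s) / max 1 (n / 2) + 1) * T (n - n / 2 + max 1 (n / 2)) ≤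
      (6 * K + 4 + 3) * T 2 * X := by
    calc _ ≤ (6 * K + 4 + 3 * (s / n)) * (T 2 * T n) := Nat.mul_le_mul x6 x3
      _ = (6 * K + 4) * T 2 * T n + 3 * T 2 * (s / n * T n) := by ring
      _ ≤ (6 * K + 4) * T 2 * X + 3 * T 2 * X := by gcongr
      _ = _ := by ring
  have y1 : C₁ * (n + 1) ^ 1 ≤ C₁ * 2 * X := by
    rw [pow_one, mul_assoc]; exact Nat.mul_le_mul_left _ (by omega)
  have y2 : C₂ * (2 * m + s + 1) ^ 1 ≤ C₂ * (2 * K + 2) * X := by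
    rw [pow_one, mul_assoc]; exact Nat.mul_le_mul_left _ x2
  have y3 := a₃.trans (Nat.mul_le_mul_left C₃ (add_le_add x2 x7))
  have y4 : 4 ≤ 4 * X := by omega
  calc _ ≤ C₁ * 2 * X + (C₂ * (2 * K + 2) * X + (3 + (C₃ * ((2 * K + 2) * X +
        (6 * K + 4 + 3) * T 2 * X) + 1))) := by gcongr <;> omega
    _ = C₁ * 2 * X + C₂ * (2 * K + 2) * X + 4 + C₃ * (2 * K + 2 + (6 * K + 4 + 3) * T 2) * X := by
      ring
    _ ≤ C₁ * 2 * X + C₂ * (2 * K + 2) * X + 4 * X + C₃ * (2 * K + 2 + (6 * K + 4 + 3) * T 2) * X := by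
      gcongr
    _ = _ := by ring

theorem mainProgram_cost {T : ℕ → ℕ} (hT : ∀ a b : ℕ, 1 ≤ a → 1 ≤ b → T a + T b ≤ T (a + b))
    (h1 : 1 ≤ T 1) (c K : ℕ) : ∃ C, ∀ n m s : ℕ, 1 ≤ n → m ≤ K * n →
      (mainProgram c).cost T (initPub n m s) + 22 ≤ C * T (n + s) := by
  have le := le_superadditive hT h1
  obtain ⟨C₁, k₁⟩ := HL.Deep.cost_le T (N := .n) (d := 1) (c := .loop .i .n copyBody)
    (by simp [copyBody, HL.block, HL.Deep, HL.pmods])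
  obtain ⟨C₂, k₂⟩ := HL.Deep.cost_le T (N := .n) (d := 1) (c := root)
    (by simp [root, rootBody, HL.block, HL.Deep, HL.pmods])
  obtain ⟨C₃, k₃⟩ := shrink_cost hT h1 c
  obtain ⟨C₄, k₄⟩ := HL.Deep.cost_le T (N := .N) (d := 3) (c := greedy)
    (by simp [greedy, greedyPass, greedyBody, greedyLoad, greedyDecide, breakBody, compareBody,
      HL.block, HL.Deep, HL.pmods])
  obtain ⟨C₅, k₅⟩ := output_cost hT h1 K
  refine ⟨C₁ * 2 + C₂ * 2 + C₃ + C₄ * 8 + C₅ + 28, fun n m s hn hm => ?_⟩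
  set p := initPub n m s with hp
  set p₁ := (HL.loop .i .n copyBody).prun p with hp₁
  set p₂ := root.prun p₁ with hp₂
  set p₃ := Function.update p₂ .N (p₂ .n) with hp₃
  set p₄ := (HL.loop .o .n (shrinkBody c)).prun p₃ with hp₄
  set p₅ := greedy.prun p₄ with hp₅
  have e1 : ∀ v, v ≠ .i → p₁ v = p v := fun v hv =>
    HL.prun_of_notMem _ _ _ (by simp [copyBody, HL.block, HL.pmods, hv])
  have e2 : ∀ v, v ∉ [PV.p, .L, .o] → p₂ v = p₁ v := fun v hv => by
    simp at hv
    exact HL.prun_of_notMem _ _ _ (by simp [root, rootBody, HL.block, HL.pmods, hv])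
  have e4 : ∀ v, v ∉ [PV.i, .h, .N, .o] → p₄ v = p₃ v := fun v hv => by
    simp at hv
    exact HL.prun_of_notMem _ _ _ (by
      simp [shrinkBody, halve, HL.block, HL.pmods, hv, (rounds_linear c).2])
  have e5 : ∀ v, v ∉ [PV.i, .j, .z] → p₅ v = p₄ v := fun v hv => by
    simp at hv
    exact HL.prun_of_notMem _ _ _ (by simp [greedy, greedyPass, greedyBody, greedyLoad,
      greedyDecide, breakBody, compareBody, HL.block, HL.pmods, hv])
  have hpn : p .n = n := rfl
  have hpm : p .m = m := rfl
  have hps : p .s = s := rfl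
  have n1 : p₁ .n = n := by rw [e1 _ (by simp), hpn]
  have n2 : p₂ .n = n := by rw [e2 _ (by simp), n1]
  have n3 : p₃ .n = n := by simp [hp₃, n2]
  have n5 : p₅ .n = n := by rw [e5 _ (by simp), e4 _ (by simp), n3]
  have m5 : p₅ .m = m := by
    rw [e5 _ (by simp), e4 _ (by simp), hp₃, Function.update_of_ne (by simp), e2 _ (by simp),
      e1 _ (by simp), hpm]
  have s5 : p₅ .s = s := by
    rw [e5 _ (by simp), e4 _ (by simp), hp₃, Function.update_of_ne (by simp), e2 _ (by simp),
      e1 _ (by simp), hps]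
  obtain ⟨l1, -, l3⟩ := root_prun p₁ (by omega)
  rw [n1] at l1
  have hL : p₃ .L = p₂ .L := by simp [hp₃]
  have a₁ := k₁ p
  have a₂ := k₂ p₁
  obtain ⟨a₃, b₃⟩ := k₃ p₃ (by omega) (by simp [hp₃]) (by rw [hL]; exact l3)
  have a₄ := k₄ p₄
  have a₅ := k₅ p₅ (by omega) (by rw [n5, m5]; exact hm)
  rw [hpn] at a₁
  rw [n1] at a₂
  rw [n3] at a₃
  rw [n5, s5] at a₅
  rw [hL] at b₃
  have hcost : (mainProgram c).cost T p = (HL.loop .i .n copyBody).cost T p + (root.cost T p₁ +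
      (4 + ((HL.loop .o .n (shrinkBody c)).cost T p₃ + (greedy.cost T p₄ +
        (output.cost T p₅ + 1))))) := by
    simp [mainProgram, HL.cost, HL.block, SC.cost, PE.cost, hp₁, hp₂, hp₃, hp₄, hp₅, HL.prun, PE.ev]
  rw [hcost]
  set X := T (n + s) with hX
  have x1 : n + s ≤ X := le _ (by omega)
  have x2 : T n ≤ X := superadditive_mono hT hn (by omega)
  have x3 : (p₄ .N + 1) ^ 3 ≤ 8 * X := by
    have h2 : (p₂ .L) ^ 3 ≤ (p₂ .L) ^ 4 := Nat.pow_le_pow_right l3 (by omega)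
    have b₃' : p₄ .N ≤ p₂ .L := b₃
    have l1' : p₂ .L ^ 4 ≤ n := l1
    have l3' : 1 ≤ p₂ .L := l3
    calc (p₄ .N + 1) ^ 3 ≤ (2 * p₂ .L) ^ 3 := Nat.pow_le_pow_left (by omega) 3
      _ = 8 * p₂ .L ^ 3 := by ring
      _ ≤ 8 * X := Nat.mul_le_mul_left 8 (by omega)
  have y1 : C₁ * (n + 1) ^ 1 ≤ C₁ * 2 * X := by
    rw [pow_one, mul_assoc]; exact Nat.mul_le_mul_left _ (by omega)
  have y2 : C₂ * (n + 1) ^ 1 ≤ C₂ * 2 * X := by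
    rw [pow_one, mul_assoc]; exact Nat.mul_le_mul_left _ (by omega)
  have y3 : C₃ * T n ≤ C₃ * X := Nat.mul_le_mul_left _ x2
  have y4 : C₄ * (p₄ .N + 1) ^ 3 ≤ C₄ * 8 * X := by
    rw [mul_assoc]; exact Nat.mul_le_mul_left _ x3
  simp only [add_mul]
  have y5 : 28 ≤ 28 * X := by omega
  omega

theorem obliviousWithin_program {P : Cmd} {T : ℕ → ℕ} (hP : IsObliviousSort P T) (c : HL)
    (hc : c.Wf) (n m s t : ℕ) (ht : c.cost T (initPub n m s) + 22 ≤ t) :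
    ObliviousWithin (c.program P) (cuckooConfigs n m s) t := by
  obtain ⟨τ, hτ⟩ := exists_sortsWithin hP
  obtain ⟨τ', h⟩ := exec_program hτ c hc n m s
  refine ⟨τ', fun κ hκ => ?_⟩
  obtain ⟨σ, -, -, -, t', ht', κ', hx, -⟩ := h κ hκ
  exact ⟨t', ht'.trans ht, κ', hx⟩

theorem constructsScheme_of_good {P : Cmd} {T : ℕ → ℕ} (hP : IsObliviousSort P T) (c : ℕ) {n m : ℕ}
    (hn : 1 ≤ n) {h : HashValues n m} (hgood : Good (c + 1) h) :
    ConstructsScheme ((mainProgram (c + 1)).program P) h := by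
  intro s hs x _ hx κ hκ hin
  obtain ⟨τ, hτ⟩ := exists_sortsWithin hP
  obtain ⟨τ', h'⟩ := exec_program hτ _ (mainProgram_wf (c + 1)) n m s
  obtain ⟨σ, hb, hp, hr, t, -, κ', hx', hrep⟩ := h' κ hκ
  refine ⟨τ', t, κ', hx', ?_⟩
  have := mainProgram_spec hP c hn hgood hs hx hb hp (fun i => by rw [hr]; exact hin i)
  have heq : (fun cell : Cell m s => κ'.mem cell.addr) =
      fun cell : Cell m s => ((mainProgram (c + 1)).run P σ).raw cell.addr := by
    funext cell
    refine hrep.raw _ ?_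
    rw [HL.run_base, hb]
    rcases cell with ⟨j, hj⟩ | ⟨j, hj⟩ | ⟨j, hj⟩ <;> simp [Cell.addr] <;> omega
  rw [heq]
  exact this

theorem one_le_of_sort {P : Cmd} {T : ℕ → ℕ} (hP : IsObliviousSort P T) : 1 ≤ T 1 := by
  obtain ⟨τ, h⟩ := (hP 1 le_rfl).1
  obtain ⟨t, ht, σ', hx⟩ := h ⟨fun _ => 1, fun _ => 0⟩ rfl
  exact hx.one_le.trans ht

end ObliviousCuckoo

namespace ObliviousCuckoo

/-! ### Averages over products of finite sets -/

section Mean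

variable {ι β : Type*} [Fintype ι] [DecidableEq ι]

/-- The average of `f` over the functions that take values in the sets `S i`. -/
noncomputable def mean (S : ι → Finset β) (f : (ι → β) → ℝ) : ℝ :=
  (∑ g ∈ Fintype.piFinset S, f g) / ∏ i, ((S i).card : ℝ)

theorem mean_mono {S : ι → Finset β} {f f' : (ι → β) → ℝ}
    (h : ∀ g ∈ Fintype.piFinset S, f g ≤ f' g) : mean S f ≤ mean S f' := by
  exact div_le_div_of_nonneg_right (Finset.sum_le_sum h)
    (Finset.prod_nonneg fun _ _ => Nat.cast_nonneg _)

theorem mean_congr {S : ι → Finset β} {f f' : (ι → β) → ℝ}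
    (h : ∀ g ∈ Fintype.piFinset S, f g = f' g) : mean S f = mean S f' := by
  unfold mean
  rw [Finset.sum_congr rfl h]

theorem mean_const_mul (S : ι → Finset β) (c : ℝ) (f : (ι → β) → ℝ) :
    mean S (fun g => c * f g) = c * mean S f := by
  unfold mean
  rw [← Finset.mul_sum, mul_div_assoc]

theorem mean_add (S : ι → Finset β) (f f' : (ι → β) → ℝ) :
    mean S (fun g => f g + f' g) = mean S f + mean S f' := by
  unfold mean
  rw [Finset.sum_add_distrib, add_div]

theorem prod_card_update (S : ι → Finset β) (x : ι) (t : Finset β) :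
    ∏ i, ((Function.update S x t i).card : ℝ) =
      t.card * ∏ i ∈ Finset.univ.erase x, ((S i).card : ℝ) := by
  rw [← Finset.mul_prod_erase _ _ (Finset.mem_univ x)]
  congr 1
  · simp
  · refine Finset.prod_congr rfl fun i hi => ?_
    rw [Function.update_of_ne (Finset.ne_of_mem_erase hi)]

variable [DecidableEq β]

theorem sum_piFinset_update (S : ι → Finset β) (x : ι) (t : Finset β) (f : (ι → β) → ℝ) :
    ∑ g ∈ Fintype.piFinset (Function.update S x t), f g =
      ∑ v ∈ t, ∑ g ∈ Fintype.piFinset (Function.update S x {v}), f g := by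
  rw [← Finset.sum_biUnion]
  · refine Finset.sum_congr ?_ fun _ _ => rfl
    ext g
    simp only [Fintype.mem_piFinset, Finset.mem_biUnion, Function.update_apply]
    constructor
    · intro h
      refine ⟨g x, by simpa using h x, fun i => ?_⟩
      have := h i
      split_ifs at this ⊢ with hi
      · simp [hi]
      · exact this
    · rintro ⟨v, hv, h⟩ i
      have := h i
      split_ifs at this ⊢ with hi
      · rw [Finset.mem_singleton.mp this]; exact hv
      · exact this
  · intro v _ v' _ hne
    rw [Function.onFun, Finset.disjoint_left]
    intro g hg hg'
    have h1 := (Fintype.mem_piFinset.mp hg) x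
    have h2 := (Fintype.mem_piFinset.mp hg') x
    simp at h1 h2
    exact hne (h1.symm.trans h2)

theorem mean_reveal (S : ι → Finset β) (x : ι) (f : (ι → β) → ℝ) :
    mean S f = (∑ v ∈ S x, mean (Function.update S x {v}) f) / (S x).card := by
  unfold mean
  have h1 := sum_piFinset_update S x (S x) f
  have h2 := prod_card_update S x (S x)
  rw [Function.update_eq_self] at h1 h2
  rw [h1, h2]
  simp only [prod_card_update, Finset.card_singleton, Nat.cast_one, one_mul]
  rw [← Finset.sum_div, div_div, mul_comm]

theorem mean_le_of_reveal {S : ι → Finset β} (x : ι) {f : (ι → β) → ℝ} {c : ℝ} (hc : 0 ≤ c)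
    (h : ∀ v ∈ S x, mean (Function.update S x {v}) f ≤ c) : mean S f ≤ c := by
  rw [mean_reveal S x]
  rcases (S x).eq_empty_or_nonempty with h0 | h0
  · simp [h0, hc]
  · rw [div_le_iff₀ (by exact_mod_cast h0.card_pos)]
    refine (Finset.sum_le_card_nsmul _ _ _ h).trans (le_of_eq ?_)
    rw [nsmul_eq_mul, mul_comm]

theorem mean_split (S : ι → Finset β) (x : ι) {u : β} (hu : u ∈ S x) (f : (ι → β) → ℝ) :
    mean S f = (mean (Function.update S x {u}) f +
      ((S x).card - 1) * mean (Function.update S x ((S x).erase u)) f) / (S x).card := by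
  rw [mean_reveal S x, ← Finset.add_sum_erase _ _ hu]
  congr 2
  set S' := Function.update S x ((S x).erase u) with hS'
  rw [mean_reveal S' x]
  have hx : S' x = (S x).erase u := by simp [hS']
  have hc : (((S x).erase u).card : ℝ) = (S x).card - 1 := by
    rw [Finset.card_erase_of_mem hu, Nat.cast_sub (Finset.card_pos.mpr ⟨u, hu⟩), Nat.cast_one]
  rw [hx, hc]
  have hup : ∀ v, Function.update S' x {v} = Function.update S x {v} := fun v => by
    simp [hS']
  simp only [hup]
  by_cases h0 : ((S x).card : ℝ) - 1 = 0
  · rw [h0, zero_mul]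
    rw [← hc] at h0
    have : (S x).erase u = ∅ := Finset.card_eq_zero.mp (by exact_mod_cast h0)
    rw [this, Finset.sum_empty]
  · rw [mul_div_cancel₀ _ h0]

end Mean

/-! ### Connected components of the cuckoo graph -/

variable {n m : ℕ}

/-- The edges of `E` that can be reached from the set `a` of vertices, where `g (e, true)` and
`g (e, false)` are the two ends of the edge `e`. -/
inductive Reach (g : Fin n × Bool → Fin m) (E : Finset (Fin n)) (a : Finset (Bool × Fin m)) :
    Fin n → Prop
  | start {e : Fin n} {σ : Bool} (he : e ∈ E) (h : (σ, g (e, σ)) ∈ a) : Reach g E a e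
  | step {e f : Fin n} {σ : Bool} (h : Reach g E a e) (hf : f ∈ E) (hσ : g (f, σ) = g (e, σ)) :
      Reach g E a f

open Classical in
noncomputable def reach (g : Fin n × Bool → Fin m) (E : Finset (Fin n))
    (a : Finset (Bool × Fin m)) : Finset (Fin n) :=
  Finset.univ.filter (Reach g E a)

def ends (g : Fin n × Bool → Fin m) (e : Fin n) : Finset (Bool × Fin m) :=
  {(true, g (e, true)), (false, g (e, false))}

theorem mem_ends {g : Fin n × Bool → Fin m} {e : Fin n} {x : Bool × Fin m} :
    x ∈ ends g e ↔ x.2 = g (e, x.1) := by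
  obtain ⟨σ, v⟩ := x
  cases σ <;> simp [ends]

theorem mem_reach {g : Fin n × Bool → Fin m} {E : Finset (Fin n)} {a : Finset (Bool × Fin m)}
    {e : Fin n} : e ∈ reach g E a ↔ Reach g E a e := by simp [reach]

theorem Reach.mem {g : Fin n × Bool → Fin m} {E : Finset (Fin n)} {a : Finset (Bool × Fin m)}
    {e : Fin n} (h : Reach g E a e) : e ∈ E := by
  cases h <;> assumption

theorem reach_subset (g : Fin n × Bool → Fin m) (E : Finset (Fin n)) (a : Finset (Bool × Fin m)) :
    reach g E a ⊆ E := fun _ h => (mem_reach.mp h).mem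

theorem Reach.mono {g : Fin n × Bool → Fin m} {E E' : Finset (Fin n)}
    {a a' : Finset (Bool × Fin m)} (hE : E ⊆ E') (ha : a ⊆ a') {e : Fin n} (h : Reach g E a e) :
    Reach g E' a' e := by
  induction h with
  | start he h => exact .start (hE he) (ha h)
  | step _ hf hσ ih => exact .step ih (hE hf) hσ

theorem Reach.congr {g g' : Fin n × Bool → Fin m} {E : Finset (Fin n)}
    {a : Finset (Bool × Fin m)} (hg : ∀ e ∈ E, ∀ σ, g (e, σ) = g' (e, σ)) {e : Fin n}
    (h : Reach g E a e) : Reach g' E a e := by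
  induction h with
  | start he h => exact .start he (by rwa [← hg _ he])
  | step h hf hσ ih => exact .step ih hf (by rw [← hg _ hf, ← hg _ h.mem]; exact hσ)

theorem reach_congr {g g' : Fin n × Bool → Fin m} {E : Finset (Fin n)}
    (a : Finset (Bool × Fin m)) (hg : ∀ e ∈ E, ∀ σ, g (e, σ) = g' (e, σ)) :
    reach g E a = reach g' E a := by
  ext e
  rw [mem_reach, mem_reach]
  exact ⟨.congr hg, .congr fun e he σ => (hg e he σ).symm⟩

theorem reach_empty (g : Fin n × Bool → Fin m) (E : Finset (Fin n)) : reach g E ∅ = ∅ := by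
  ext e
  rw [mem_reach]
  simp only [Finset.notMem_empty, iff_false]
  intro h
  induction h with
  | start _ h => simp at h
  | step _ _ _ ih => exact ih

theorem reach_insert_of_forall_ne {g : Fin n × Bool → Fin m} {E : Finset (Fin n)}
    {a : Finset (Bool × Fin m)} {σ : Bool} {u : Fin m} (h : ∀ e ∈ E, g (e, σ) ≠ u) :
    reach g E (insert (σ, u) a) = reach g E a := by
  ext e
  rw [mem_reach, mem_reach]
  refine ⟨fun hr => ?_, .mono subset_rfl (Finset.subset_insert _ _)⟩
  induction hr with
  | @start e τ he ht =>
    rcases Finset.mem_insert.mp ht with ht | ht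
    · obtain ⟨h1, h2⟩ := Prod.mk.inj ht
      subst h1
      exact absurd h2 (h e he)
    · exact .start he ht
  | step _ hf hσ ih => exact .step ih hf hσ

theorem reach_eq_insert {g : Fin n × Bool → Fin m} {E : Finset (Fin n)}
    {a : Finset (Bool × Fin m)} {e : Fin n} (he : e ∈ E) {σ : Bool} (ha : (σ, g (e, σ)) ∈ a) :
    reach g E a = insert e (reach g (E.erase e) (insert (!σ, g (e, !σ)) a)) := by
  ext f
  rw [Finset.mem_insert, mem_reach, mem_reach]
  have hτ : ∀ τ, τ = σ ∨ τ = !σ := by cases σ <;> decide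
  constructor
  · intro h
    induction h with
    | @start f τ hf ht =>
      by_cases hfe : f = e
      · exact .inl hfe
      · exact .inr (.start (Finset.mem_erase.mpr ⟨hfe, hf⟩) (Finset.mem_insert_of_mem ht))
    | @step f f' τ h hf ht ih =>
      by_cases hfe : f' = e
      · exact .inl hfe
      · have hf' := Finset.mem_erase.mpr ⟨hfe, hf⟩
        rcases ih with rfl | ih
        · refine .inr (.start (σ := τ) hf' ?_)
          rw [ht]
          rcases hτ τ with rfl | rfl
          · exact Finset.mem_insert_of_mem ha
          · exact Finset.mem_insert_self _ _
        · exact .inr (.step ih hf' ht)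
  · rintro (rfl | h)
    · exact .start he ha
    · induction h with
      | @start f τ hf ht =>
        rcases Finset.mem_insert.mp ht with ht | ht
        · simp only [Prod.mk.injEq] at ht
          obtain ⟨rfl, ht⟩ := ht
          exact .step (.start he ha) (Finset.mem_of_mem_erase hf) ht
        · exact .start (Finset.mem_of_mem_erase hf) ht
      | step _ hf hσ ih => exact .step ih (Finset.mem_of_mem_erase hf) hσ

/-- The number of edges of `S` in components with more than `r` edges. -/
noncomputable def long (g : Fin n × Bool → Fin m) (r : ℕ) (S : Finset (Fin n)) : ℕ :=
  (S.filter (fun f => r < (reach g S (ends g f)).card)).card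

theorem long_le (g : Fin n × Bool → Fin m) (r : ℕ) (E : Finset (Fin n)) (e : Fin n) :
    long g r E ≤ (if r < (reach g E (ends g e)).card then (reach g E (ends g e)).card else 0) +
      long g r (E \ reach g E (ends g e)) := by
  set C := reach g E (ends g e) with hC
  have hin : ∀ f ∈ C, reach g E (ends g f) ⊆ C := by
    intro f hf x hx
    rw [mem_reach] at hx
    rw [hC, mem_reach] at hf ⊢
    induction hx with
    | start hx h => exact .step hf hx (by simpa [mem_ends] using h)
    | step _ hx hσ ih => exact .step ih hx hσ
  have hout : ∀ f ∈ E, f ∉ C → reach g E (ends g f) ⊆ reach g (E \ C) (ends g f) := by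
    intro f hfE hf x hx
    rw [mem_reach] at hx ⊢
    have : x ∉ C ∧ Reach g (E \ C) (ends g f) x := by
      induction hx with
      | @start x σ hx h =>
        have hxC : x ∉ C := fun hxC => hf (by
          rw [hC, mem_reach] at hxC ⊢
          exact .step hxC hfE (by simpa [mem_ends, eq_comm] using h))
        exact ⟨hxC, .start (Finset.mem_sdiff.mpr ⟨hx, hxC⟩) h⟩
      | @step x y σ hx hy hσ ih =>
        have hyC : y ∉ C := fun hyC => ih.1 (by
          rw [hC, mem_reach] at hyC ⊢
          exact .step hyC hx.mem hσ.symm)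
        exact ⟨hyC, .step ih.2 (Finset.mem_sdiff.mpr ⟨hy, hyC⟩) hσ⟩
    exact this.2
  have hsub : E.filter (fun f => r < (reach g E (ends g f)).card) ⊆
      (if r < C.card then C else ∅) ∪
        (E \ C).filter (fun f => r < (reach g (E \ C) (ends g f)).card) := by
    intro f hf
    rw [Finset.mem_filter] at hf
    rw [Finset.mem_union]
    by_cases hfC : f ∈ C
    · left
      have := Finset.card_le_card (hin f hfC)
      rw [if_pos (by omega)]; exact hfC
    · right
      have := Finset.card_le_card (hout f hf.1 hfC)
      exact Finset.mem_filter.mpr ⟨Finset.mem_sdiff.mpr ⟨hf.1, hfC⟩, by omega⟩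
  refine (Finset.card_le_card hsub).trans ((Finset.card_union_le _ _).trans ?_)
  refine Nat.add_le_add_right ?_ _
  split_ifs <;> simp

/-! ### Exploration of the components -/

/-- The weight of the edges of `E`, explored from `a`. -/
noncomputable def weight (ζ w : ℝ) (r : ℕ) (E : Finset (Fin n)) (a : Finset (Bool × Fin m))
    (g : Fin n × Bool → Fin m) : ℝ :=
  ζ ^ (reach g E a).card * w ^ long g r (E \ reach g E a)

/-- The ends of the edges of `E` have not been revealed, except that they belong to `A`; the
vertices of `a` have been found but have not been explored. -/
structure Unexplored (D : ℕ) (S : Fin n × Bool → Finset (Fin m)) (E : Finset (Fin n))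
    (A : Bool → Finset (Fin m)) (a : Finset (Bool × Fin m)) : Prop where
  dom : ∀ e ∈ E, ∀ σ, S (e, σ) = A σ
  sub : ∀ x ∈ a, x.2 ∈ A x.1
  card : ∀ σ, E.card + (a.filter (fun x => x.1 = σ)).card + D ≤ (A σ).card

theorem mean_weight_vertex {D N r : ℕ} {ζ υ w Γ : ℝ} (hζ : 1 ≤ ζ) (hυ : 1 ≤ υ) (hΓ : 1 ≤ Γ)
    (hN : ∀ (S : Fin n × Bool → Finset (Fin m)) E A a, Unexplored D S E A a →
      3 * E.card + a.card ≤ N → mean S (weight ζ w r E a) ≤ υ ^ a.card * Γ ^ E.card)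
    (A : Bool → Finset (Fin m)) (σ : Bool) {u : Fin m} (hu : u ∈ A σ) (U : Finset (Fin n)) :
    ∀ (S : Fin n × Bool → Finset (Fin m)) (E : Finset (Fin n)) (a : Finset (Bool × Fin m)),
      U ⊆ E → (∀ e ∈ E, ∀ τ, S (e, τ) = if τ = σ ∧ e ∉ U then (A σ).erase u else A τ) →
      (σ, u) ∉ a → (∀ x ∈ a, x.2 ∈ A x.1) →
      (∀ τ, E.card + (a.filter (fun x => x.1 = τ)).card + D ≤
        (if τ = σ then (A σ).erase u else A τ).card) →
      3 * E.card + a.card ≤ N →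
      mean S (weight ζ w r E (insert (σ, u) a)) ≤
        υ ^ a.card * Γ ^ E.card * (((A σ).card - 1 + ζ * υ) / (A σ).card) ^ U.card := by
  have hAσ : (0 : ℝ) < (A σ).card := by exact_mod_cast Finset.card_pos.mpr ⟨u, hu⟩
  have hAσ1 : (1 : ℝ) ≤ (A σ).card := by exact_mod_cast Finset.card_pos.mpr ⟨u, hu⟩
  set ρ := ((A σ).card - 1 + ζ * υ) / ((A σ).card : ℝ) with hρ
  have hρ0 : 0 ≤ ρ := by
    rw [hρ]; apply div_nonneg _ hAσ.le
    have : 0 ≤ ζ * υ := by positivity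
    linarith
  induction U using Finset.induction with
  | empty =>
    intro S E a _ hS hua hsub hcard hle
    rw [Finset.card_empty, pow_zero, mul_one]
    refine le_trans (le_of_eq (mean_congr fun g hg => ?_))
      (hN S E (fun τ => if τ = σ then (A σ).erase u else A τ) a ⟨fun e he τ => ?_, fun x hx => ?_,
        hcard⟩ hle)
    · unfold weight
      rw [reach_insert_of_forall_ne]
      intro e he heq
      have := Fintype.mem_piFinset.mp hg (e, σ)
      rw [hS e he σ, if_pos ⟨rfl, Finset.notMem_empty e⟩, heq] at this
      simp at this
    · rw [hS e he τ]; simp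
    · by_cases hx1 : x.1 = σ
      · rw [if_pos hx1, Finset.mem_erase, ← hx1]
        refine ⟨?_, hsub x hx⟩
        rintro rfl
        exact hua (by rw [← hx1]; exact hx)
      · rw [if_neg hx1]; exact hsub x hx
  | insert e U heU ih =>
    intro S E a hUE hS hua hsub hcard hle
    have heE : e ∈ E := hUE (Finset.mem_insert_self _ _)
    have hUE' : U ⊆ E := (Finset.subset_insert _ _).trans hUE
    have hSe : S (e, σ) = A σ := by rw [hS e heE]; simp
    have hSe' : S (e, !σ) = A !σ := by rw [hS e heE]; simp
    have hEpos : 0 < E.card := Finset.card_pos.mpr ⟨e, heE⟩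
    have hcardE : (E.erase e).card = E.card - 1 := Finset.card_erase_of_mem heE
    set X := υ ^ a.card * Γ ^ E.card * ρ ^ U.card with hX
    have hX0 : 0 ≤ X := by positivity
    rw [mean_split S (e, σ) (by rw [hSe]; exact hu), hSe]
    have hmiss : mean (Function.update S (e, σ) ((A σ).erase u))
        (weight ζ w r E (insert (σ, u) a)) ≤ X := by
      refine ih _ E a hUE' (fun f hf τ => ?_) hua hsub hcard hle
      rw [Function.update_apply]
      by_cases hfe : f = e
      · subst hfe
        by_cases hτ : τ = σ
        · subst hτ; simp [heU]
        · simp [hτ, hS f hf τ]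
      · simp [hfe, hS f hf τ]
    have hhit : mean (Function.update S (e, σ) {u}) (weight ζ w r E (insert (σ, u) a)) ≤
        ζ * υ * X := by
      refine mean_le_of_reveal (e, !σ) (by positivity) fun v hv => ?_
      rw [Function.update_of_ne (by simp), hSe'] at hv
      have hbound := ih (Function.update (Function.update S (e, σ) {u}) (e, !σ) {v}) (E.erase e)
        (insert (!σ, v) a) (fun f hf => Finset.mem_erase.mpr ⟨fun h => heU (h ▸ hf), hUE' hf⟩)
        (fun f hf τ => by
          obtain ⟨hfe, hf⟩ := Finset.mem_erase.mp hf
          rw [Function.update_of_ne (by simp [hfe]), Function.update_of_ne (by simp [hfe]),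
            hS f hf τ]
          simp [hfe])
        (by simp [hua])
        (fun x hx => by
          rcases Finset.mem_insert.mp hx with rfl | hx
          · exact hv
          · exact hsub x hx)
        (fun τ => by
          have h1 := hcard τ
          have h2 : ((insert (!σ, v) a).filter (fun x => x.1 = τ)).card ≤
              (a.filter (fun x => x.1 = τ)).card + 1 := by
            rw [Finset.filter_insert]
            split_ifs
            · exact Finset.card_insert_le _ _
            · omega
          omega)
        (by
          have := Finset.card_insert_le (!σ, v) a
          omega)
      have hcongr : mean (Function.update (Function.update S (e, σ) {u}) (e, !σ) {v})
          (weight ζ w r E (insert (σ, u) a)) =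
          mean (Function.update (Function.update S (e, σ) {u}) (e, !σ) {v})
          (fun g => ζ * weight ζ w r (E.erase e) (insert (σ, u) (insert (!σ, v) a)) g) := by
        refine mean_congr fun g hg => ?_
        have g1 : g (e, σ) = u := by
          have := Fintype.mem_piFinset.mp hg (e, σ)
          rw [Function.update_of_ne (by simp), Function.update_self] at this
          exact Finset.mem_singleton.mp this
        have g2 : g (e, !σ) = v := by
          have := Fintype.mem_piFinset.mp hg (e, !σ)
          rw [Function.update_self] at this
          exact Finset.mem_singleton.mp this
        have hr := reach_eq_insert (g := g) (a := insert (σ, u) a) heE (σ := σ) (by simp [g1])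
        rw [g2, Finset.insert_comm] at hr
        unfold weight
        set R := reach g (E.erase e) (insert (σ, u) (insert (!σ, v) a)) with hR
        have heR : e ∉ R := fun h => by
          have := reach_subset _ _ _ h
          simp at this
        have hd : E \ insert e R = E.erase e \ R := by
          ext x; simp only [Finset.mem_sdiff, Finset.mem_insert, Finset.mem_erase]; tauto
        rw [hr, Finset.card_insert_of_notMem heR, hd, pow_succ]
        ring
      rw [hcongr, mean_const_mul, mul_assoc]
      refine mul_le_mul_of_nonneg_left (hbound.trans ?_) (by positivity)
      rw [hX, hcardE]
      have h1 : υ ^ (insert (!σ, v) a).card ≤ υ * υ ^ a.card := by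
        rw [← pow_succ']
        exact pow_le_pow_right₀ hυ (Finset.card_insert_le _ _)
      have h2 : Γ ^ (E.card - 1) ≤ Γ ^ E.card := pow_le_pow_right₀ hΓ (by omega)
      calc υ ^ (insert (!σ, v) a).card * Γ ^ (E.card - 1) * ρ ^ U.card ≤
            υ * υ ^ a.card * Γ ^ E.card * ρ ^ U.card := by gcongr
        _ = _ := by ring
    rw [Finset.card_insert_of_notMem heU, pow_succ, ← mul_assoc, ← hX, div_le_iff₀ hAσ]
    have hA1 : (0 : ℝ) ≤ (A σ).card - 1 := by linarith
    calc _ ≤ ζ * υ * X + ((A σ).card - 1) * X := by gcongr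
      _ = X * (((A σ).card - 1 + ζ * υ) / (A σ).card) * (A σ).card := by field_simp; ring
      _ = _ := by rw [hρ]

/-- The average number of edges in large components has exponential moments. -/
theorem mean_weight_le {D r : ℕ} {δ y w Γ : ℝ} (hδ : 0 ≤ δ) (hw : 1 ≤ w) (hy : 1 ≤ y)
    (hyw : Real.exp (δ * (w ^ 2 * y - 1)) ≤ y) (hΓ : Γ = 1 + w ^ 2 * y ^ 2 / w ^ r)
    (hD : ∀ k ≤ n, (k : ℝ) ≤ δ * (k + D : ℕ)) (N : ℕ) :
    ∀ (S : Fin n × Bool → Finset (Fin m)) E A a, Unexplored D S E A a → 3 * E.card + a.card ≤ N →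
      ∀ ζ υ : ℝ, 1 ≤ ζ → 1 ≤ υ → Real.exp (δ * (ζ * υ - 1)) ≤ υ →
      mean S (weight ζ w r E a) ≤ υ ^ a.card * Γ ^ E.card := by
  have hΓ1 : 1 ≤ Γ := by rw [hΓ]; have : 0 ≤ w ^ 2 * y ^ 2 / w ^ r := by positivity
                         linarith
  induction N with
  | zero =>
    intro S E A a hI hle ζ υ hζ hυ hexp
    have hE : E = ∅ := Finset.card_eq_zero.mp (by omega)
    have ha : a = ∅ := Finset.card_eq_zero.mp (by omega)
    subst hE ha
    have : ∀ g, weight ζ w r (∅ : Finset (Fin n)) (∅ : Finset (Bool × Fin m)) g = 1 := by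
      intro g; simp [weight, reach_empty, long]
    simp only [Finset.card_empty, pow_zero, mul_one]
    unfold mean
    simp only [this]
    rw [Finset.sum_const, nsmul_eq_mul, mul_one, Fintype.card_piFinset, Nat.cast_prod]
    exact div_self_le_one _
  | succ N ih =>
    intro S E A a hI hle ζ υ hζ hυ hexp
    rcases a.eq_empty_or_nonempty with rfl | ⟨⟨σ, u⟩, hua⟩
    · rcases E.eq_empty_or_nonempty with rfl | ⟨e, he⟩
      · exact ih S ∅ A ∅ hI (by simp) ζ υ hζ hυ hexp
      · have hEpos : 0 < E.card := Finset.card_pos.mpr ⟨e, he⟩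
        have hcardE : (E.erase e).card = E.card - 1 := Finset.card_erase_of_mem he
        rw [Finset.card_empty, pow_zero, one_mul]
        refine mean_le_of_reveal (e, true) (by positivity) fun u hu => ?_
        refine mean_le_of_reveal (e, false) (by positivity) fun v hv => ?_
        rw [Function.update_of_ne (by simp), hI.dom e he] at hv
        rw [hI.dom e he] at hu
        set S' := Function.update (Function.update S (e, true) {u}) (e, false) {v} with hS'
        set a' : Finset (Bool × Fin m) := {(true, u), (false, v)} with ha'
        have hca : a'.card ≤ 2 := Finset.card_le_two
        have hI' : Unexplored D S' (E.erase e) A a' := by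
          refine ⟨fun f hf τ => ?_, fun x hx => ?_, fun τ => ?_⟩
          · obtain ⟨hfe, hf⟩ := Finset.mem_erase.mp hf
            rw [hS', Function.update_of_ne (by simp [hfe]), Function.update_of_ne (by simp [hfe]),
              hI.dom f hf]
          · simp only [ha', Finset.mem_insert, Finset.mem_singleton] at hx
            rcases hx with rfl | rfl
            · exact hu
            · exact hv
          · have h1 := hI.card τ
            have h2 : (a'.filter (fun x => x.1 = τ)).card ≤ 1 := by
              rw [Finset.card_le_one]
              intro x hx x' hx'
              simp only [ha', Finset.mem_filter, Finset.mem_insert, Finset.mem_singleton] at hx hx'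
              obtain ⟨rfl | rfl, h⟩ := hx <;> obtain ⟨rfl | rfl, h'⟩ := hx' <;> simp_all
            omega
        have hle' : 3 * (E.erase e).card + a'.card ≤ N := by
          simp only [Finset.card_empty] at hle; omega
        have b1 := ih S' (E.erase e) A a' hI' hle' 1 1 le_rfl le_rfl (by simp)
        have b2 := ih S' (E.erase e) A a' hI' hle' (w ^ 2) y (one_le_pow₀ hw) hy hyw
        have hpt : mean S' (weight ζ w r E ∅) ≤ mean S' (fun g =>
            weight 1 w r (E.erase e) a' g +
              w ^ 2 / w ^ r * weight (w ^ 2) w r (E.erase e) a' g) := by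
          refine mean_mono fun g hg => ?_
          have g1 : g (e, true) = u := by
            have := Fintype.mem_piFinset.mp hg (e, true)
            rw [hS', Function.update_of_ne (by simp), Function.update_self] at this
            exact Finset.mem_singleton.mp this
          have g2 : g (e, false) = v := by
            have := Fintype.mem_piFinset.mp hg (e, false)
            rw [hS', Function.update_self] at this
            exact Finset.mem_singleton.mp this
          have hends : ends g e = a' := by rw [ends, g1, g2]
          have hr := reach_eq_insert (g := g) (a := a') he (σ := true) (by simp [ha', g1])
          have hins : insert (!true, g (e, !true)) a' = a' := by
            simp [ha', g2]
          rw [hins] at hr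
          have hlong := long_le g r E e
          rw [hends, hr] at hlong
          unfold weight
          simp only [reach_empty, Finset.card_empty, pow_zero, one_mul, Finset.sdiff_empty, one_pow]
          set R := reach g (E.erase e) a' with hR
          have heR : e ∉ R := fun h => by
            have := reach_subset _ _ _ h
            simp at this
          have hd : E \ insert e R = E.erase e \ R := by
            ext x; simp only [Finset.mem_sdiff, Finset.mem_insert, Finset.mem_erase]; tauto
          rw [Finset.card_insert_of_notMem heR, hd] at hlong
          have h0 : (w : ℝ) ^ long g r E ≤ w ^ ((if r < R.card + 1 then R.card + 1 else 0) +
              long g r (E.erase e \ R)) := pow_le_pow_right₀ hw hlong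
          refine h0.trans ?_
          rw [pow_add]
          have hwr : (0 : ℝ) < w ^ r := by positivity
          have hcoef : w ^ (if r < R.card + 1 then R.card + 1 else 0) ≤
              1 + w ^ 2 / w ^ r * (w ^ 2) ^ R.card := by
            split_ifs with hc
            · have : w ^ (R.card + 1) ≤ w ^ 2 / w ^ r * (w ^ 2) ^ R.card := by
                rw [div_mul_eq_mul_div, le_div_iff₀ hwr, ← pow_add, ← pow_mul, ← pow_add]
                exact pow_le_pow_right₀ hw (by omega)
              linarith
            · rw [pow_zero]
              have : 0 ≤ w ^ 2 / w ^ r * (w ^ 2) ^ R.card := by positivity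
              linarith
          calc _ ≤ (1 + w ^ 2 / w ^ r * (w ^ 2) ^ R.card) * w ^ long g r (E.erase e \ R) := by gcongr
            _ = _ := by ring
        refine hpt.trans ?_
        rw [mean_add, mean_const_mul]
        rw [one_pow, one_mul] at b1
        have hya : y ^ a'.card ≤ y ^ 2 := pow_le_pow_right₀ hy hca
        have hwr : (0 : ℝ) ≤ w ^ 2 / w ^ r := by positivity
        calc _ ≤ Γ ^ (E.erase e).card + w ^ 2 / w ^ r * (y ^ 2 * Γ ^ (E.erase e).card) := by
              gcongr
              exact b2.trans (by gcongr)
          _ = Γ ^ (E.card - 1) * Γ := by rw [hcardE, hΓ]; ring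
          _ = Γ ^ E.card := by rw [← pow_succ]; congr 1; omega
    · have hsplit : insert (σ, u) (a.erase (σ, u)) = a := Finset.insert_erase hua
      have huA : u ∈ A σ := hI.sub _ hua
      have hca : (a.erase (σ, u)).card = a.card - 1 := Finset.card_erase_of_mem hua
      have hapos : 0 < a.card := Finset.card_pos.mpr ⟨_, hua⟩
      have key := mean_weight_vertex hζ hυ hΓ1 (N := N)
        (fun S E A a h1 h2 => ih S E A a h1 h2 ζ υ hζ hυ hexp) A σ huA E S E (a.erase (σ, u))
        subset_rfl (fun e he τ => by rw [hI.dom e he]; simp [he]) (by simp)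
        (fun x hx => hI.sub x (Finset.mem_of_mem_erase hx))
        (fun τ => by
          have h1 := hI.card τ
          split_ifs with hτ
          · subst hτ
            rw [Finset.card_erase_of_mem huA, Finset.filter_erase, Finset.card_erase_of_mem
              (by simp [hua])]
            have : 0 < (a.filter (fun x => x.1 = τ)).card :=
              Finset.card_pos.mpr ⟨(τ, u), by simpa using hua⟩
            omega
          · have := Finset.card_le_card (Finset.filter_subset_filter (fun x => x.1 = τ)
              (Finset.erase_subset (σ, u) a))
            omega)
        (by omega)
      rw [hsplit] at key
      refine key.trans ?_
      have hA0 : (0 : ℝ) < (A σ).card := by exact_mod_cast Finset.card_pos.mpr ⟨u, huA⟩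
      have hE : (E.card : ℝ) ≤ δ * (A σ).card := by
        refine (hD E.card (by simpa using Finset.card_le_univ E)).trans ?_
        gcongr
        have := hI.card σ
        omega
      have hζυ : 0 ≤ ζ * υ - 1 := by nlinarith
      have hρ : (((A σ).card - 1 + ζ * υ) / (A σ).card : ℝ) ^ E.card ≤ υ := by
        refine le_trans ?_ hexp
        have h1 : ((A σ).card - 1 + ζ * υ) / (A σ).card ≤ Real.exp ((ζ * υ - 1) / (A σ).card) := by
          have := Real.add_one_le_exp ((ζ * υ - 1) / ((A σ).card : ℝ))
          refine le_trans (le_of_eq ?_) this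
          field_simp; ring
        have h0 : 0 ≤ (((A σ).card : ℝ) - 1 + ζ * υ) / (A σ).card :=
          div_nonneg (by linarith) hA0.le
        refine (pow_le_pow_left₀ h0 h1 _).trans ?_
        rw [← Real.exp_nat_mul]
        apply Real.exp_le_exp.mpr
        rw [mul_div_assoc', div_le_iff₀ hA0]
        calc (E.card : ℝ) * (ζ * υ - 1) ≤ δ * (A σ).card * (ζ * υ - 1) := by gcongr
          _ = _ := by ring
      have hpow : υ ^ a.card = υ ^ (a.erase (σ, u)).card * υ := by
        rw [← pow_succ]; congr 1; omega
      rw [hpow]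
      calc _ ≤ υ ^ (a.erase (σ, u)).card * Γ ^ E.card * υ := by gcongr
        _ = _ := by ring

end ObliviousCuckoo

namespace ObliviousCuckoo

variable {n m : ℕ}

/-! ### Items that survive the peeling -/

/-- The hash values given by the ends of the edges. -/
def hashOf (g : Fin n × Bool → Fin m) : HashValues n m := fun e => (g (e, true), g (e, false))

theorem Reach.trans {g : Fin n × Bool → Fin m} {E : Finset (Fin n)} {e f x : Fin n}
    (hf : Reach g E (ends g e) f) (hx : Reach g E (ends g f) x) : Reach g E (ends g e) x := by
  induction hx with
  | start hx h => exact .step hf hx (by simpa [mem_ends] using h)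
  | step _ hx hσ ih => exact .step ih hx hσ

theorem Reach.symm {g : Fin n × Bool → Fin m} {e f : Fin n}
    (h : Reach g Finset.univ (ends g e) f) : Reach g Finset.univ (ends g f) e := by
  induction h with
  | @start f σ _ h =>
    exact .start (σ := σ) (Finset.mem_univ _) (by simpa [mem_ends, eq_comm] using h)
  | @step x y σ _ _ hσ ih =>
    exact .trans (.start (σ := σ) (Finset.mem_univ _) (by simp [mem_ends, hσ])) ih

/-- The component of the edge `e`. -/
noncomputable def component (g : Fin n × Bool → Fin m) (e : Fin n) : Finset (Fin n) :=
  reach g Finset.univ (ends g e)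

theorem self_mem_component (g : Fin n × Bool → Fin m) (e : Fin n) : e ∈ component g e :=
  mem_reach.mpr (.start (σ := true) (Finset.mem_univ _) (by simp [mem_ends]))

theorem exists_stall {α : Type*} (T : ℕ → Finset α) (hT : ∀ t, T (t + 1) ⊆ T t) {R : ℕ}
    (hR : (T 0).card ≤ R) (hne : (T R).Nonempty) : ∃ t, (T t).Nonempty ∧ T (t + 1) = T t := by
  by_contra! hcon
  have hanti : Antitone T := antitone_nat_of_succ_le hT
  have key : ∀ t ≤ R, (T t).card + t ≤ (T 0).card := by
    intro t ht
    induction t with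
    | zero => simp
    | succ t ih =>
      have h1 := hcon t (hne.mono (hanti (by omega)))
      have h2 := Finset.card_lt_card ((hT t).ssubset_of_ne h1)
      have := ih (by omega)
      omega
  have := key R le_rfl
  have := hne.card_pos
  omega

/-- The edge `f` connects its left end to a vertex of the component that this end has in the graph
of the smaller edges. -/
def Closing (g : Fin n × Bool → Fin m) (f : Fin n) : Prop :=
  ∃ e ∈ reach g (Finset.univ.filter (· < f)) {(true, g (f, true))}, g (f, false) = g (e, false)

/-- A graph without closing edges is a forest. -/
theorem card_lt_of_forall_not_closing {g : Fin n × Bool → Fin m} (T : Finset (Fin n))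
    (hne : T.Nonempty) (hT : ∀ f ∈ T, ¬ Closing g f) :
    T.card < (T.image (fun e => g (e, true))).card + (T.image (fun e => g (e, false))).card := by
  induction hk : T.card using Nat.strong_induction_on generalizing T with
  | _ k ih =>
  subst hk
  set f := T.max' hne with hf
  have hfT : f ∈ T := T.max'_mem hne
  set T' := T.erase f with hT'
  have hins : insert f T' = T := Finset.insert_erase hfT
  have hcard : T'.card + 1 = T.card := Finset.card_erase_add_one hfT
  have hlt : T' ⊆ Finset.univ.filter (· < f) := fun e he => by
    obtain ⟨h1, h2⟩ := Finset.mem_erase.mp he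
    exact Finset.mem_filter.mpr ⟨Finset.mem_univ _, lt_of_le_of_ne (T.le_max' e h2) h1⟩
  have himg : ∀ (σ : Bool) (S : Finset (Fin n)), S ⊆ T →
      (S.image (fun e => g (e, σ))).card ≤ (T.image (fun e => g (e, σ))).card :=
    fun σ S hS => Finset.card_le_card (Finset.image_subset_image hS)
  have himg' : ∀ σ, (∀ e ∈ T', g (e, σ) ≠ g (f, σ)) →
      (T'.image (fun e => g (e, σ))).card + 1 ≤ (T.image (fun e => g (e, σ))).card := by
    intro σ h
    rw [← hins, Finset.image_insert, Finset.card_insert_of_notMem]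
    intro hmem
    obtain ⟨e, he, heq⟩ := Finset.mem_image.mp hmem
    exact h e he heq
  have hsub : T' ⊆ T := Finset.erase_subset _ _
  have hleft := himg true T' hsub
  have hright := himg false T' hsub
  rcases T'.eq_empty_or_nonempty with h0 | h0
  · have h1 := himg' true (by simp [h0])
    have h2 := himg' false (by simp [h0])
    rw [h0] at hcard
    simp only [Finset.card_empty] at hcard
    omega
  have hrec := ih T'.card (by omega) T' h0 (fun e he => hT e (hsub he)) rfl
  set R := reach g T' {(true, g (f, true))} with hR
  have hRT : R ⊆ T' := reach_subset _ _ _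
  have hRr : ∀ e ∈ R, g (e, false) ≠ g (f, false) := fun e he heq =>
    hT f hfT ⟨e, mem_reach.mpr ((mem_reach.mp he).mono hlt subset_rfl), heq.symm⟩
  have hstart : ∀ e ∈ T', g (e, true) = g (f, true) → e ∈ R := fun e he h =>
    mem_reach.mpr (.start (σ := true) he (by simp [h]))
  rcases R.eq_empty_or_nonempty with hR0 | hR0
  · have := himg' true (fun e he h => by simpa [hR0] using hstart e he h)
    omega
  rcases (T' \ R).eq_empty_or_nonempty with hQ0 | hQ0
  · have := himg' false (fun e he => hRr e (Finset.sdiff_eq_empty_iff_subset.mp hQ0 he))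
    omega
  have hcR : R.card < T'.card :=
    Finset.card_lt_card (hRT.ssubset_of_ne (by rintro h; simp [h] at hQ0))
  have hcQ : (T' \ R).card + R.card = T'.card := Finset.card_sdiff_add_card_eq_card hRT
  have hR1 : 0 < R.card := hR0.card_pos
  have h1 := ih R.card (by omega) R hR0 (fun e he => hT e (hsub (hRT he))) rfl
  have h2 := ih (T' \ R).card (by omega) (T' \ R) hQ0
    (fun e he => hT e (hsub (Finset.sdiff_subset he))) rfl
  have hdisj : ∀ σ, (R.image (fun e => g (e, σ))).card + ((T' \ R).image (fun e => g (e, σ))).card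
      ≤ (T.image (fun e => g (e, σ))).card := by
    intro σ
    rw [← Finset.card_union_of_disjoint]
    · rw [← Finset.image_union, Finset.union_sdiff_of_subset hRT]
      exact himg σ T' hsub
    · rw [Finset.disjoint_left]
      intro v hv hv'
      obtain ⟨e, he, rfl⟩ := Finset.mem_image.mp hv
      obtain ⟨e', he', heq⟩ := Finset.mem_image.mp hv'
      obtain ⟨h3, h4⟩ := Finset.mem_sdiff.mp he'
      exact h4 (mem_reach.mpr (.step (mem_reach.mp he) h3 heq))
  have h3 := hdisj true
  have h4 := hdisj false
  omega

theorem exists_closing {g : Fin n × Bool → Fin m} {T : Finset (Fin n)} (hne : T.Nonempty)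
    (hT : ∀ f ∈ T, ∀ σ, ∃ f' ∈ T, f' ≠ f ∧ g (f', σ) = g (f, σ)) : ∃ f ∈ T, Closing g f := by
  by_contra! hcon
  have h0 := card_lt_of_forall_not_closing T hne hcon
  have h1 : ∀ σ, 2 * (T.image (fun e => g (e, σ))).card ≤ T.card := fun σ => by
    refine Finset.mul_card_image_le_card T 2 fun v hv => ?_
    obtain ⟨f, hf, rfl⟩ := Finset.mem_image.mp hv
    obtain ⟨f', hf', hff, heq⟩ := hT f hf σ
    exact Finset.one_lt_card.mpr ⟨f', by simp [hf', heq], f, by simp [hf], hff⟩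
  have := h1 true
  have := h1 false
  omega

theorem exists_closing_of_survives {g : Fin n × Bool → Fin m} {R : ℕ} {e : Fin n}
    (he : (peel (hashOf g))^[R] (fun _ => 0) e = 0) (hc : (component g e).card ≤ R) :
    ∃ f ∈ component g e, Closing g f := by
  set tg : ℕ → Fin n → ℕ := fun t => (peel (hashOf g))^[t] (fun _ => 0) with htg
  have hsucc : ∀ t, tg (t + 1) = peel (hashOf g) (tg t) := fun t =>
    Function.iterate_succ_apply' _ _ _
  obtain ⟨t, hne, ht⟩ := exists_stall (fun t => (component g e).filter (fun f => tg t f = 0))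
    (fun t f hf => by
      simp only [Finset.mem_filter] at hf ⊢
      refine ⟨hf.1, ?_⟩
      by_contra hne
      have := hf.2
      rw [hsucc] at this
      simp [peel, hne] at this) (R := R)
    ((Finset.card_filter_le _ _).trans hc)
    ⟨e, Finset.mem_filter.mpr ⟨self_mem_component g e, he⟩⟩
  obtain ⟨f, hf, hcl⟩ := exists_closing hne (g := g) (fun f hf σ => by
    have hf' := hf
    rw [← ht] at hf'
    obtain ⟨hfc, hf0⟩ := Finset.mem_filter.mp hf
    have hf1 := (Finset.mem_filter.mp hf').2
    rw [hsucc] at hf1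
    have hex : ∃ f', f' ≠ f ∧ tg t f' = 0 ∧ g (f', σ) = g (f, σ) := by
      rcases peel_cases (hashOf g) (tg t) f with ⟨h1, -⟩ | ⟨-, -, h3⟩ | ⟨-, -, h3⟩ | ⟨-, h1, h2, -⟩
      · exact absurd hf0 h1
      · rw [h3] at hf1; simp [code₁] at hf1
      · rw [h3] at hf1; simp [code₂] at hf1
      · cases σ
        · unfold Alone₂ at h2; push Not at h2; exact h2
        · unfold Alone₁ at h1; push Not at h1; exact h1
    obtain ⟨f', h1, h2, h3⟩ := hex
    exact ⟨f', Finset.mem_filter.mpr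
      ⟨mem_reach.mpr (.step (mem_reach.mp hfc) (Finset.mem_univ _) h3), h2⟩, h1, h3⟩)
  exact ⟨f, (Finset.mem_filter.mp hf).1, hcl⟩

open Classical in
theorem card_survivors_le {g : Fin n × Bool → Fin m} {B : ℕ}
    (hB : ∀ e, (component g e).card ≤ B) (R : ℕ) :
    (Finset.univ.filter (fun e => (peel (hashOf g))^[R] (fun _ => 0) e = 0)).card ≤
      long g R Finset.univ + (Finset.univ.filter (Closing g)).card * B := by
  have hsub : Finset.univ.filter (fun e => (peel (hashOf g))^[R] (fun _ => 0) e = 0) ⊆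
      Finset.univ.filter (fun f => R < (component g f).card) ∪
        (Finset.univ.filter (Closing g)).biUnion (component g) := by
    intro e he
    rw [Finset.mem_filter] at he
    rw [Finset.mem_union]
    by_cases hc : (component g e).card ≤ R
    · obtain ⟨f, hf, hcl⟩ := exists_closing_of_survives he.2 hc
      exact .inr (Finset.mem_biUnion.mpr ⟨f, by simpa using hcl,
        mem_reach.mpr (mem_reach.mp hf).symm⟩)
    · exact .inl (by simpa using hc)
  refine (Finset.card_le_card hsub).trans ((Finset.card_union_le _ _).trans ?_)
  exact Nat.add_le_add le_rfl (Finset.card_biUnion_le_card_mul _ _ _ fun f _ => hB f)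

end ObliviousCuckoo

namespace ObliviousCuckoo

/-! ### The number of closing edges -/

section Resample

variable {ι β : Type*} [Fintype ι] [DecidableEq ι] [Fintype β]

theorem sum_resample (x : ι) (f : (ι → β) → ℝ) :
    ∑ g, ∑ v, f (Function.update g x v) = Fintype.card β * ∑ g, f g := by
  have hinv : Function.Involutive
      (fun p : (ι → β) × β => (Function.update p.1 x p.2, p.1 x)) := by
    rintro ⟨g, v⟩
    simp
  have := Equiv.sum_comp hinv.toPerm (fun p : (ι → β) × β => f p.1)
  rw [Fintype.sum_prod_type, Fintype.sum_prod_type] at this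
  simp only [Function.Involutive.coe_toPerm, Finset.sum_const, Finset.card_univ,
    nsmul_eq_mul] at this
  rw [this, Finset.mul_sum]

end Resample

variable {n m : ℕ}

/-- The average of a function of the ends of the edges. -/
noncomputable def avg (f : (Fin n × Bool → Fin m) → ℝ) : ℝ := mean (fun _ => Finset.univ) f

theorem avg_eq (f : (Fin n × Bool → Fin m) → ℝ) :
    avg f = (∑ g, f g) / (m : ℝ) ^ (n * 2) := by
  simp [avg, mean]

theorem avg_mono {f f' : (Fin n × Bool → Fin m) → ℝ} (h : ∀ g, f g ≤ f' g) : avg f ≤ avg f' :=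
  mean_mono fun g _ => h g

theorem avg_resample (hm : 0 < m) (x : Fin n × Bool) (f : (Fin n × Bool → Fin m) → ℝ) :
    avg f = avg (fun g => (∑ v, f (Function.update g x v)) / m) := by
  have : (m : ℝ) ≠ 0 := by positivity
  rw [avg_eq, avg_eq, ← Finset.sum_div, sum_resample, Fintype.card_fin, mul_div_cancel_left₀ _ this]

/-- The edges with a number less than `k`. -/
def below (n k : ℕ) : Finset (Fin n) := Finset.univ.filter (fun e => e.val < k)

theorem mem_below {k : ℕ} {e : Fin n} : e ∈ below n k ↔ e.val < k := by simp [below]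

theorem closing_iff {g : Fin n × Bool → Fin m} {f : Fin n} :
    Closing g f ↔ ∃ e ∈ reach g (below n f) {(true, g (f, true))},
      g (f, false) = g (e, false) := Iff.rfl

theorem Closing.congr {g g' : Fin n × Bool → Fin m} {f : Fin n}
    (hg : ∀ e ≤ f, ∀ σ, g (e, σ) = g' (e, σ)) (h : Closing g f) : Closing g' f := by
  obtain ⟨e, he, heq⟩ := closing_iff.mp h
  have hef := reach_subset _ _ _ he
  rw [mem_below] at hef
  rw [reach_congr _ (fun e he σ => hg e (Fin.le_def.mpr (mem_below.mp he).le) σ),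
    hg f le_rfl] at he
  exact ⟨e, he, by rw [← hg f le_rfl, ← hg e (Fin.le_def.mpr hef.le), heq]⟩

/-- The components of the graph of the first `k` edges have at most `B` edges. -/
def Small (g : Fin n × Bool → Fin m) (B k : ℕ) : Prop :=
  ∀ e ∈ below n k, (reach g (below n k) (ends g e)).card ≤ B

theorem Small.congr {g g' : Fin n × Bool → Fin m} {B k : ℕ}
    (hg : ∀ e ∈ below n k, ∀ σ, g (e, σ) = g' (e, σ)) (h : Small g B k) : Small g' B k := by
  intro e he
  have := h e he
  rwa [reach_congr _ hg, ends, hg e he, hg e he] at this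

open Classical in
/-- The exponential of the number of closing edges among the first `k` ones, as long as the
components are small. -/
noncomputable def closingWeight (B k : ℕ) (g : Fin n × Bool → Fin m) : ℝ :=
  if Small g B k then 3 ^ ((below n k).filter (Closing g)).card else 0

theorem closingWeight_nonneg (B k : ℕ) (g : Fin n × Bool → Fin m) : 0 ≤ closingWeight B k g := by
  unfold closingWeight
  split_ifs <;> positivity

theorem closingWeight_congr {g g' : Fin n × Bool → Fin m} {B k : ℕ}
    (hg : ∀ e ∈ below n k, ∀ σ, g (e, σ) = g' (e, σ)) :
    closingWeight B k g = closingWeight B k g' := by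
  classical
  have hg' : ∀ e ∈ below n k, ∀ σ, g' (e, σ) = g (e, σ) := fun e he σ => (hg e he σ).symm
  have h1 : Small g B k ↔ Small g' B k := ⟨.congr hg, .congr hg'⟩
  have hle : ∀ f ∈ below n k, ∀ e ≤ f, e ∈ below n k := fun f hf e he =>
    mem_below.mpr ((Fin.le_def.mp he).trans_lt (mem_below.mp hf))
  have h2 : (below n k).filter (Closing g) = (below n k).filter (Closing g') :=
    Finset.filter_congr fun f hf => ⟨.congr fun e he => hg e (hle f hf e he),
      .congr fun e he => hg' e (hle f hf e he)⟩
  unfold closingWeight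
  rw [h2]
  simp only [h1]

open Classical in
theorem closingWeight_succ_le {B k : ℕ} (hk : k < n) (g : Fin n × Bool → Fin m) :
    closingWeight B (k + 1) g ≤
      closingWeight B k g * (1 + 2 * if Closing g ⟨k, hk⟩ then 1 else 0) := by
  have hins : below n (k + 1) = insert ⟨k, hk⟩ (below n k) := by
    ext e
    rw [Finset.mem_insert, mem_below, mem_below, Fin.ext_iff]
    simp only
    omega
  have hsub : below n k ⊆ below n (k + 1) := by rw [hins]; exact Finset.subset_insert _ _
  by_cases h : Small g B (k + 1)
  · have h' : Small g B k := fun e he => (Finset.card_le_card (fun f hf =>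
      mem_reach.mpr ((mem_reach.mp hf).mono hsub subset_rfl))).trans (h e (hsub he))
    unfold closingWeight
    rw [if_pos h, if_pos h', hins, Finset.filter_insert]
    split_ifs with hc
    · rw [Finset.card_insert_of_notMem (by simp [mem_below]), pow_succ]
      norm_num
    · simp
  · rw [closingWeight, if_neg h]
    have := closingWeight_nonneg B k g
    split_ifs <;> positivity

open Classical in
theorem card_closing_le {B : ℕ} {f : Fin n} {g : Fin n × Bool → Fin m} (h : Small g B f) :
    (Finset.univ.filter (fun v => Closing (Function.update g (f, false) v) f)).card ≤ B := by
  set R := reach g (below n f) {(true, g (f, true))} with hR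
  have hsub : Finset.univ.filter (fun v => Closing (Function.update g (f, false) v) f) ⊆
      R.image (fun e => g (e, false)) := by
    intro v hv
    obtain ⟨e, he, heq⟩ := closing_iff.mp (Finset.mem_filter.mp hv).2
    have hne : ∀ e ∈ below n f, ∀ σ, Function.update g (f, false) v (e, σ) = g (e, σ) := by
      intro e he σ
      refine Function.update_of_ne ?_ _ _
      rintro h
      obtain ⟨rfl, -⟩ := Prod.mk.inj h
      simp [mem_below] at he
    rw [reach_congr _ hne, Function.update_of_ne (by simp)] at he
    rw [Function.update_self, hne e (reach_subset _ _ _ he)] at heq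
    exact Finset.mem_image.mpr ⟨e, he, heq.symm⟩
  refine (Finset.card_le_card hsub).trans (Finset.card_image_le.trans ?_)
  have hstart : ∀ e ∈ R, ∃ e' ∈ below n f, g (e', true) = g (f, true) := fun e he => by
    rw [hR, mem_reach] at he
    induction he with
    | @start e σ he h =>
      obtain ⟨rfl, h⟩ := Prod.mk.inj (Finset.mem_singleton.mp h)
      exact ⟨e, he, h⟩
    | step _ _ _ ih => exact ih
  rcases R.eq_empty_or_nonempty with h0 | ⟨e, he⟩
  · simp [h0]
  · obtain ⟨e', he', heq⟩ := hstart e he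
    refine (Finset.card_le_card fun x hx => ?_).trans (h e' he')
    exact mem_reach.mpr ((mem_reach.mp hx).mono subset_rfl (by simp [mem_ends, heq]))

theorem avg_closingWeight_le (hm : 0 < m) (B : ℕ) {k : ℕ} (hk : k ≤ n) :
    avg (closingWeight (n := n) (m := m) B k) ≤ (1 + 2 * B / m) ^ k := by
  classical
  have hm' : (0 : ℝ) < m := by positivity
  induction k with
  | zero =>
    have : ∀ g : Fin n × Bool → Fin m, closingWeight B 0 g ≤ 1 := fun g => by
      unfold closingWeight
      split_ifs <;> simp [below]
    refine (avg_mono this).trans ?_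
    rw [avg_eq]
    simp [hm'.ne', pow_mul, mul_comm n]
  | succ k ih =>
    refine (avg_mono (closingWeight_succ_le hk)).trans ?_
    rw [avg_resample hm (⟨k, hk⟩, false), pow_succ, mul_comm ((1 + 2 * (B : ℝ) / m) ^ k)]
    refine le_trans ?_ (mul_le_mul_of_nonneg_left (ih (by omega)) (by positivity))
    rw [avg, avg, ← mean_const_mul]
    refine avg_mono fun g => ?_
    have hup : ∀ v, closingWeight B k (Function.update g (⟨k, hk⟩, false) v) =
        closingWeight B k g := fun v => by
      refine closingWeight_congr fun e he σ => Function.update_of_ne ?_ _ _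
      rintro h
      obtain ⟨rfl, -⟩ := Prod.mk.inj h
      simp [mem_below] at he
    simp only [hup]
    rw [← Finset.mul_sum, Finset.sum_add_distrib, ← Finset.mul_sum, Finset.sum_boole,
      div_le_iff₀ hm']
    by_cases hs : Small g B k
    · have := card_closing_le (f := ⟨k, hk⟩) hs
      have hc : ((Finset.univ.filter (fun v => Closing (Function.update g (⟨k, hk⟩, false) v)
        ⟨k, hk⟩)).card : ℝ) ≤ B := by exact_mod_cast this
      have h0 := closingWeight_nonneg B k g
      simp only [Finset.sum_const, Finset.card_univ, Fintype.card_fin, nsmul_eq_mul, mul_one]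
      calc _ ≤ closingWeight B k g * (m + 2 * B) := by gcongr
        _ = _ := by field_simp
    · simp [closingWeight, hs]

end ObliviousCuckoo

namespace ObliviousCuckoo

variable {n m : ℕ}

/-! ### The hash values are good with very high probability -/

/-- The average number of edges in components with more than `r` edges decreases exponentially
with `r`. -/
theorem exists_avg_pow_long_le {ε : ℝ} (hε₀ : 0 < ε) (hε₁ : ε < 1) : ∃ w κ : ℝ, 1 < w ∧ 0 < κ ∧
    ∀ n m : ℕ, (n : ℝ) ≤ (1 - ε) * m → ∀ r : ℕ,
      avg (fun g : Fin n × Bool → Fin m => w ^ long g r Finset.univ) ≤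
        Real.exp (n * κ / w ^ r) := by
  obtain ⟨x, hx⟩ : ∃ x, x = ε / 2 := ⟨_, rfl⟩
  have hx0 : 0 < x := by linarith
  have hz : 1 < (1 + x + x ^ 2) / (1 + x) := by
    rw [lt_div_iff₀ (by linarith)]
    nlinarith
  set z := (1 + x + x ^ 2) / (1 + x) with hzdef
  have hw1 : 1 < √z := by
    rw [Real.lt_sqrt (by norm_num)]
    simpa using hz
  have hw2 : √z ^ 2 = z := Real.sq_sqrt (by linarith)
  refine ⟨√z, √z ^ 2 * (1 + x) ^ 2, hw1, by positivity, fun n m hnm r => ?_⟩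
  set w := √z with hw
  have hm : n ≤ m := by
    have : (0 : ℝ) ≤ m := Nat.cast_nonneg _
    exact_mod_cast (show (n : ℝ) ≤ m by nlinarith)
  have hwr : 0 < w ^ r := by positivity
  have key := mean_weight_le (n := n) (m := m) (D := m - n) (r := r) (δ := 1 - ε) (y := 1 + x)
    (w := w) (by linarith) hw1.le (by linarith) (by
      rw [hw2, hzdef, div_mul_cancel₀ _ (by linarith)]
      have h1 : (1 - ε) * (1 + x + x ^ 2 - 1) ≤ x - x ^ 2 := by
        have : ε = 2 * x := by linarith
        rw [this]
        nlinarith [pow_pos hx0 3]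
      have h2 := Real.one_sub_le_exp_neg (x - x ^ 2)
      have h3 : 0 < 1 - (x - x ^ 2) := by nlinarith
      refine (Real.exp_le_exp.mpr h1).trans ?_
      rw [Real.exp_neg] at h2
      have h4 : Real.exp (x - x ^ 2) ≤ (1 - (x - x ^ 2))⁻¹ := by
        rw [le_inv_comm₀ (Real.exp_pos _) h3]
        exact h2
      refine h4.trans ?_
      rw [inv_le_iff_one_le_mul₀ h3]
      nlinarith [pow_pos hx0 3])
    rfl (fun k hk => by
      have hk' : (k : ℝ) ≤ n := by exact_mod_cast hk
      push_cast [Nat.cast_sub hm]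
      nlinarith)
    (3 * n) (fun _ => Finset.univ) Finset.univ (fun _ => Finset.univ) ∅
    ⟨fun _ _ _ => rfl, by simp, fun σ => by simp; omega⟩ (by simp) 1 1 le_rfl le_rfl (by simp)
  have hweight : weight (n := n) (m := m) 1 w r Finset.univ ∅ =
      fun g => w ^ long g r Finset.univ := by
    funext g
    simp [weight, reach_empty]
  rw [hweight] at key
  refine key.trans ?_
  rw [one_pow, one_mul, Finset.card_univ, Fintype.card_fin, mul_div_assoc (n : ℝ),
    Real.exp_nat_mul]
  refine pow_le_pow_left₀ (by positivity) ?_ _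
  rw [add_comm]
  exact Real.add_one_le_exp _

theorem avg_sum {α : Type*} (s : Finset α) (f : α → (Fin n × Bool → Fin m) → ℝ) :
    avg (fun g => ∑ j ∈ s, f j g) = ∑ j ∈ s, avg (f j) := by
  simp only [avg_eq]
  rw [Finset.sum_comm, Finset.sum_div]

/-- The two descriptions of the hash values. -/
def hashEquiv (n m : ℕ) : (Fin n × Bool → Fin m) ≃ HashValues n m where
  toFun := hashOf
  invFun h p := if p.2 then (h p.1).1 else (h p.1).2
  left_inv g := by
    funext ⟨e, σ⟩
    cases σ <;> rfl
  right_inv _ := rfl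

open Classical in
theorem uniformProb_eq_avg (p : HashValues n m → Prop) :
    uniformProb {h | p h} = avg (fun g : Fin n × Bool → Fin m => if p (hashOf g) then 1 else 0) := by
  rw [avg_eq, uniformProb, Finset.sum_boole]
  congr 1
  · rw [← Set.ncard_image_of_injective _ (hashEquiv n m).symm.injective, ← Set.ncard_coe_finset]
    congr 2
    ext g
    rw [Equiv.image_symm_eq_preimage]
    rw [Finset.coe_filter, Set.mem_preimage]
    simp only [Finset.mem_univ, true_and]
    exact Iff.rfl
  · simp only [Fintype.card_fun, Fintype.card_prod, Fintype.card_fin]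
    push_cast
    ring

theorem avg_one (hm : 0 < m) : avg (fun _ : Fin n × Bool → Fin m => 1) = 1 := by
  have : (m : ℝ) ≠ 0 := by positivity
  rw [avg_eq]
  simp [this, pow_mul, mul_comm n]

open Classical in
theorem avg_exists_component_le {B : ℕ} {w κ : ℝ} (hm : 0 < m) (hw : 1 < w) (hκ : 0 < κ)
    (h : avg (fun g : Fin n × Bool → Fin m => w ^ long g B Finset.univ) ≤
      Real.exp (n * κ / w ^ B)) :
    avg (fun g : Fin n × Bool → Fin m => if ∃ e, B < (component g e).card then 1 else 0) ≤
      (1 + 2 / (w - 1)) * (n * κ / w ^ B) := by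
  have hw1 : 0 < w - 1 := by linarith
  set t := n * κ / w ^ B with ht
  have ht0 : 0 ≤ t := by positivity
  rcases le_or_gt 1 t with h1 | h1
  · refine (avg_mono (f' := fun _ => 1) fun g => ?_).trans ?_
    · split_ifs <;> norm_num
    · rw [avg_one hm]
      have : 0 ≤ 2 / (w - 1) * t := by positivity
      linarith
  · have hpt : ∀ g : Fin n × Bool → Fin m, (if ∃ e, B < (component g e).card then (1 : ℝ) else 0) ≤
        (w - 1)⁻¹ * (w ^ long g B Finset.univ + -1 * 1) := fun g => by
      have h0 : 1 ≤ w ^ long g B Finset.univ := one_le_pow₀ hw.le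
      split_ifs with hc
      · obtain ⟨e, he⟩ := hc
        have : long g B Finset.univ ≠ 0 := Finset.card_ne_zero.mpr
          ⟨e, Finset.mem_filter.mpr ⟨Finset.mem_univ _, he⟩⟩
        have := le_self_pow₀ hw.le this
        rw [le_inv_mul_iff₀ hw1]
        linarith
      · have : 0 ≤ w ^ long g B Finset.univ + -1 * 1 := by linarith
        positivity
    refine (avg_mono hpt).trans ?_
    rw [avg, mean_const_mul, mean_add, mean_const_mul]
    have h2 := avg_one (n := n) hm
    rw [avg] at h h2
    rw [h2, inv_mul_le_iff₀ hw1]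
    have h3 := Real.abs_exp_sub_one_le (x := t) (by rw [abs_of_nonneg ht0]; exact h1.le)
    rw [abs_of_nonneg ht0] at h3
    have h4 := (abs_le.mp h3).2
    have h5 : (w - 1) * ((1 + 2 / (w - 1)) * t) = (w - 1) * t + 2 * t := by
      field_simp
    rw [h5]
    have : 0 ≤ (w - 1) * t := by positivity
    linarith

open Classical in
theorem good_hashOf {g : Fin n × Bool → Fin m} {c B : ℕ} (hB : 16 * (24 * B ^ 2) ^ 4 ≤ n)
    (hsmall : ∀ e, (component g e).card ≤ B)
    (hclosing : ((below n n).filter (Closing g)).card ≤ 3 * B)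
    (hlong : ∀ j < n, 24 * B ^ 2 < n / 2 ^ j →
      4 * long g (c * (j + 1)) Finset.univ < n / 2 ^ j) : Good c (hashOf g) := by
  intro L j _ hL hj
  have hBL : 24 * B ^ 2 < L := lt_of_pow_lt_pow_left₀ 4 (Nat.zero_le _) (by omega)
  have hpow : 2 ^ j ≤ n := by
    by_contra hcon
    rw [Nat.div_eq_of_lt (by omega)] at hj
    omega
  have h1 := hlong j (j.lt_two_pow_self.trans_le hpow) (hBL.trans hj)
  have h2 := card_survivors_le hsmall (c * (j + 1))
  have hu : below n n = Finset.univ := by ext e; simp [mem_below]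
  rw [hu] at hclosing
  have h3 := Nat.mul_le_mul_right B hclosing
  have h4 : 3 * B * B = 3 * B ^ 2 := by ring
  rw [pow_succ, ← Nat.div_div_eq_div_mul]
  omega

theorem exists_pow_large {w : ℝ} (hw : 1 < w) (a : ℝ) : ∃ c : ℕ, 2 ≤ w ^ (c + 1) ∧
    a ≤ w ^ (c + 1) := by
  obtain ⟨c, hc⟩ := pow_unbounded_of_one_lt (max 2 a) hw
  have : w ^ c ≤ w ^ (c + 1) := pow_le_pow_right₀ hw.le (by omega)
  exact ⟨c, (le_max_left _ _).trans (hc.le.trans this), (le_max_right _ _).trans (hc.le.trans this)⟩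

theorem avg_long_le {w κ : ℝ} {c j B : ℕ} (hw : 1 < w) (hκ : 0 < κ)
    (hc : 2 ≤ w ^ (c + 1)) (hc' : 16 * κ / Real.log w ≤ w ^ (c + 1))
    (h : avg (fun g : Fin n × Bool → Fin m => w ^ long g ((c + 1) * (j + 1)) Finset.univ) ≤
      Real.exp (n * κ / w ^ ((c + 1) * (j + 1)))) (hB : 24 * B ^ 2 < n / 2 ^ j) :
    avg (fun g : Fin n × Bool → Fin m =>
      if n / 2 ^ j ≤ 4 * long g ((c + 1) * (j + 1)) Finset.univ then 1 else 0) ≤ w⁻¹ ^ B := by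
  set N := n / 2 ^ j with hN
  set ℓ := Real.log w with hℓ
  have hℓ0 : 0 < ℓ := Real.log_pos hw
  have hexp : ∀ k : ℕ, w ^ k = Real.exp (k * ℓ) := fun k => by
    rw [Real.exp_nat_mul, hℓ, Real.exp_log (by linarith)]
  have hpt : ∀ g : Fin n × Bool → Fin m,
      (if N ≤ 4 * long g ((c + 1) * (j + 1)) Finset.univ then (1 : ℝ) else 0) ≤
        Real.exp (-(N / 4 * ℓ)) * w ^ long g ((c + 1) * (j + 1)) Finset.univ := fun g => by
    split_ifs with hc
    · rw [hexp, ← Real.exp_add]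
      apply Real.one_le_exp
      have : (N : ℝ) ≤ 4 * long g ((c + 1) * (j + 1)) Finset.univ := by exact_mod_cast hc
      nlinarith
    · positivity
  refine (avg_mono hpt).trans ?_
  rw [avg, mean_const_mul]
  refine (mul_le_mul_of_nonneg_left h (Real.exp_pos _).le).trans ?_
  rw [← Real.exp_add, inv_pow, hexp B, ← Real.exp_neg]
  apply Real.exp_le_exp.mpr
  have hn : (n : ℝ) ≤ 2 * N * 2 ^ j := by
    have h1 : n < (N + 1) * 2 ^ j := by
      rw [← Nat.div_lt_iff_lt_mul (by positivity)]
      omega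
    have h2 : (N + 1) * 2 ^ j ≤ 2 * N * 2 ^ j := Nat.mul_le_mul_right _ (by omega)
    exact_mod_cast h1.le.trans h2
  have hQ : w ^ (c + 1) * 2 ^ j ≤ w ^ ((c + 1) * (j + 1)) := by
    rw [mul_add, mul_one, pow_add _ ((c + 1) * j), mul_comm, pow_mul]
    gcongr
  have hQ' : 16 * κ * 2 ^ j ≤ ℓ * w ^ ((c + 1) * (j + 1)) := by
    rw [div_le_iff₀ hℓ0] at hc'
    calc _ ≤ w ^ (c + 1) * ℓ * 2 ^ j := by gcongr
      _ = ℓ * (w ^ (c + 1) * 2 ^ j) := by ring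
      _ ≤ _ := by gcongr
  have hmain : n * κ / w ^ ((c + 1) * (j + 1)) ≤ N / 8 * ℓ := by
    rw [div_le_iff₀ (by positivity)]
    calc (n : ℝ) * κ ≤ 2 * N * 2 ^ j * κ := by gcongr
      _ = N / 8 * (16 * κ * 2 ^ j) := by ring
      _ ≤ N / 8 * (ℓ * w ^ ((c + 1) * (j + 1))) := by gcongr
      _ = _ := by ring
  have hBN : (B : ℝ) * 8 ≤ N := by
    have : B * 8 ≤ N := by nlinarith [Nat.zero_le B, Nat.le_self_pow (two_ne_zero) B]
    exact_mod_cast this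
  nlinarith

open Classical in
theorem indicator_not_good_le {c B : ℕ} (hB : 16 * (24 * B ^ 2) ^ 4 ≤ n)
    (g : Fin n × Bool → Fin m) :
    (if ¬ Good c (hashOf g) then (1 : ℝ) else 0) ≤
      (if ∃ e, B < (component g e).card then 1 else 0) +
      ((27 ^ B)⁻¹ * closingWeight B n g +
      ∑ j ∈ (Finset.range n).filter (fun j => 24 * B ^ 2 < n / 2 ^ j),
        if n / 2 ^ j ≤ 4 * long g (c * (j + 1)) Finset.univ then 1 else 0) := by
  have h0 := closingWeight_nonneg B n g
  have h0' : (0 : ℝ) ≤ (27 ^ B)⁻¹ * closingWeight B n g := by positivity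
  have h1 : (0 : ℝ) ≤ ∑ j ∈ (Finset.range n).filter (fun j => 24 * B ^ 2 < n / 2 ^ j),
      if n / 2 ^ j ≤ 4 * long g (c * (j + 1)) Finset.univ then 1 else 0 :=
    Finset.sum_nonneg fun j _ => by split_ifs <;> norm_num
  by_cases hs : ∃ e, B < (component g e).card
  · rw [if_pos hs]
    split_ifs <;> linarith
  rw [if_neg hs]
  push Not at hs
  by_cases hcl : ((below n n).filter (Closing g)).card ≤ 3 * B
  · by_cases hl : ∀ j < n, 24 * B ^ 2 < n / 2 ^ j →
        4 * long g (c * (j + 1)) Finset.univ < n / 2 ^ j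
    · rw [if_neg (not_not.mpr (good_hashOf hB hs hcl hl))]
      linarith
    · push Not at hl
      obtain ⟨j, hj, hBj, hjl⟩ := hl
      have := Finset.single_le_sum (f := fun j =>
        if n / 2 ^ j ≤ 4 * long g (c * (j + 1)) Finset.univ then (1 : ℝ) else 0)
        (fun j _ => by split_ifs <;> norm_num)
        (show j ∈ (Finset.range n).filter (fun j => 24 * B ^ 2 < n / 2 ^ j) from
          Finset.mem_filter.mpr ⟨Finset.mem_range.mpr hj, hBj⟩)
      simp only [if_pos hjl] at this
      split_ifs <;> linarith
  · have hsm : Small g B n := fun e _ => by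
      have hu : below n n = Finset.univ := by ext e; simp [mem_below]
      rw [hu]
      exact hs e
    have : 1 ≤ ((27 : ℝ) ^ B)⁻¹ * closingWeight B n g := by
      rw [closingWeight, if_pos hsm, le_inv_mul_iff₀ (by positivity), mul_one]
      calc (27 : ℝ) ^ B = 3 ^ (3 * B) := by rw [pow_mul]; norm_num
        _ ≤ _ := pow_le_pow_right₀ (by norm_num) (by omega)
    split_ifs <;> linarith

theorem inv_mul_avg_closingWeight_le (hm : 0 < m) (hnm : n ≤ m) (B : ℕ) :
    (27 ^ B)⁻¹ * avg (closingWeight (n := n) (m := m) B n) ≤ (8 / 9) ^ B := by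
  have hm' : (0 : ℝ) < m := by positivity
  have hnm' : (n : ℝ) ≤ m := by exact_mod_cast hnm
  have h1 : (1 + 2 * (B : ℝ) / m) ^ n ≤ Real.exp 2 ^ B := by
    have h2 : 1 + 2 * (B : ℝ) / m ≤ Real.exp (2 * B / m) := by
      rw [add_comm]
      exact Real.add_one_le_exp _
    refine (pow_le_pow_left₀ (by positivity) h2 n).trans ?_
    rw [← Real.exp_nat_mul, ← Real.exp_nat_mul]
    apply Real.exp_le_exp.mpr
    rw [mul_div_assoc', div_le_iff₀ hm']
    have : (0 : ℝ) ≤ B := Nat.cast_nonneg _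
    nlinarith
  have h2 : Real.exp 2 ≤ 24 := by
    have h3 := Real.exp_one_lt_d9
    have h4 : Real.exp 2 = Real.exp 1 ^ 2 := by rw [← Real.exp_nat_mul]; norm_num
    rw [h4]
    have := Real.exp_pos 1
    nlinarith
  calc _ ≤ ((27 : ℝ) ^ B)⁻¹ * 24 ^ B := by
        gcongr
        exact (avg_closingWeight_le hm B le_rfl).trans (h1.trans (by gcongr))
    _ = _ := by rw [← inv_pow, ← mul_pow]; norm_num

theorem exists_scale (n : ℕ) : ∃ B : ℕ, 16 * (24 * B ^ 2) ^ 4 ≤ n ∧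
    n < 16 * (24 * (B + 1) ^ 2) ^ 4 := by
  have hex : ∃ B : ℕ, n < 16 * (24 * (B + 1) ^ 2) ^ 4 := ⟨n, by
    calc n < n + 1 := by omega
      _ ≤ (n + 1) ^ 8 := Nat.le_self_pow (by norm_num) _
      _ ≤ 16 * 24 ^ 4 * (n + 1) ^ 8 := Nat.le_mul_of_pos_left _ (by norm_num)
      _ = _ := by ring⟩
  classical
  refine ⟨Nat.find hex, ?_, Nat.find_spec hex⟩
  rcases h : Nat.find hex with _ | B
  · simp
  · have := Nat.find_min hex (m := B) (by omega)
    omega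

theorem exists_pow_mul_le {q : ℝ} (hq₀ : 0 < q) (hq₁ : q < 1) (p : ℕ) :
    ∃ D : ℝ, 0 ≤ D ∧ ∀ B n : ℕ, n < 16 * (24 * (B + 1) ^ 2) ^ 4 → (n : ℝ) ^ p * q ^ B ≤ D := by
  obtain ⟨M, hM⟩ := (tendsto_pow_const_mul_const_pow_of_abs_lt_one (8 * p)
    (by rwa [abs_of_pos hq₀])).bddAbove_range
  refine ⟨(16 * 24 ^ 4) ^ p * max M 0 / q, by positivity, fun B n hn => ?_⟩
  have h1 : (n : ℝ) ≤ 16 * 24 ^ 4 * (B + 1 : ℕ) ^ 8 := by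
    have : n ≤ 16 * 24 ^ 4 * (B + 1) ^ 8 := hn.le.trans (le_of_eq (by ring))
    exact_mod_cast this
  have h2 : ((B + 1 : ℕ) : ℝ) ^ (8 * p) * q ^ (B + 1) ≤ max M 0 :=
    (hM ⟨B + 1, rfl⟩).trans (le_max_left _ _)
  rw [le_div_iff₀ hq₀]
  calc (n : ℝ) ^ p * q ^ B * q ≤ (16 * 24 ^ 4 * (B + 1 : ℕ) ^ 8) ^ p * q ^ B * q := by gcongr
    _ = (16 * 24 ^ 4) ^ p * (((B + 1 : ℕ) : ℝ) ^ (8 * p) * q ^ (B + 1)) := by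
        rw [mul_pow, pow_mul, pow_succ]; ring
    _ ≤ _ := by gcongr

theorem exists_good (ε : ℝ) (hε₀ : 0 < ε) (hε₁ : ε < 1) : ∃ c : ℕ, ∀ α : ℕ, ∃ D : ℝ,
    ∀ n m : ℕ, 1 ≤ n → (n : ℝ) ≤ (1 - ε) * m →
      uniformProb {h : HashValues n m | ¬ Good (c + 1) h} ≤ D / (n : ℝ) ^ α := by
  classical
  obtain ⟨w, κ, hw, hκ, hmain⟩ := exists_avg_pow_long_le hε₀ hε₁
  obtain ⟨c, hc, hc'⟩ := exists_pow_large hw (16 * κ / Real.log w)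
  refine ⟨c, fun α => ?_⟩
  have hw0 : 0 < w - 1 := by linarith
  set q := max w⁻¹ (8 / 9) with hq
  have hq1 : q < 1 := max_lt (inv_lt_one_of_one_lt₀ hw) (by norm_num)
  have hq0 : 0 < q := lt_max_of_lt_right (by norm_num)
  obtain ⟨D, hD0, hD⟩ := exists_pow_mul_le hq0 hq1 (α + 1)
  set C := (1 + 2 / (w - 1)) * κ + 2 with hC
  have hC0 : 0 ≤ C := by positivity
  refine ⟨C * D, fun n m hn hnm => ?_⟩
  have hn1 : (1 : ℝ) ≤ n := by exact_mod_cast hn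
  have hm0 : 0 < m := by
    rcases Nat.eq_zero_or_pos m with rfl | h
    · simp at hnm; omega
    · exact h
  have hnm' : n ≤ m := by
    have : (0 : ℝ) ≤ m := Nat.cast_nonneg _
    exact_mod_cast (show (n : ℝ) ≤ m by nlinarith)
  obtain ⟨B, hB, hB'⟩ := exists_scale n
  have hwq : w⁻¹ ^ B ≤ q ^ B := by gcongr; exact le_max_left _ _
  have h1 := avg_exists_component_le hm0 hw hκ (hmain n m hnm B)
  have h2 := inv_mul_avg_closingWeight_le hm0 hnm' B
  have h3 : ∑ j ∈ (Finset.range n).filter (fun j => 24 * B ^ 2 < n / 2 ^ j),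
      avg (fun g : Fin n × Bool → Fin m =>
        if n / 2 ^ j ≤ 4 * long g ((c + 1) * (j + 1)) Finset.univ then 1 else 0) ≤ n * q ^ B := by
    refine (Finset.sum_le_card_nsmul _ _ (q ^ B) fun j hj =>
      (avg_long_le hw hκ hc hc' (hmain n m hnm _) (Finset.mem_filter.mp hj).2).trans hwq).trans ?_
    rw [nsmul_eq_mul]
    gcongr
    simpa using Finset.card_filter_le (Finset.range n) (fun j => 24 * B ^ 2 < n / 2 ^ j)
  have hsum : uniformProb {h : HashValues n m | ¬ Good (c + 1) h} ≤ C * n * q ^ B := by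
    rw [uniformProb_eq_avg]
    refine (avg_mono fun g => le_of_eq_of_le (by congr) (indicator_not_good_le hB g)).trans ?_
    rw [avg, mean_add, mean_add, mean_const_mul]
    have h4 := avg_sum (n := n) (m := m)
      ((Finset.range n).filter (fun j => 24 * B ^ 2 < n / 2 ^ j))
      (fun j g => if n / 2 ^ j ≤ 4 * long g ((c + 1) * (j + 1)) Finset.univ then 1 else 0)
    unfold avg at h1 h2 h3 h4
    rw [h4]
    have h5 : (8 / 9 : ℝ) ^ B ≤ n * q ^ B := by
      have : (8 / 9 : ℝ) ^ B ≤ q ^ B := by gcongr; exact le_max_right _ _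
      have : 0 ≤ q ^ B := by positivity
      nlinarith
    have h6 : (1 + 2 / (w - 1)) * (n * κ / w ^ B) ≤ (1 + 2 / (w - 1)) * κ * (n * q ^ B) := by
      rw [div_eq_mul_inv (n * κ), ← inv_pow]
      calc _ ≤ (1 + 2 / (w - 1)) * (n * κ * q ^ B) := by gcongr
        _ = _ := by ring
    calc _ ≤ (1 + 2 / (w - 1)) * κ * (n * q ^ B) + (n * q ^ B + n * q ^ B) :=
          add_le_add (h1.trans h6) (add_le_add (h2.trans h5) h3)
      _ = _ := by rw [hC]; ring
  refine hsum.trans ?_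
  rw [le_div_iff₀ (by positivity)]
  calc C * n * q ^ B * n ^ α = C * (n ^ (α + 1) * q ^ B) := by ring
    _ ≤ _ := by gcongr; exact hD B n hB'

end ObliviousCuckoo

open ObliviousCuckoo in
theorem mainTheorem3 (T : ℕ → ℕ)
    (hT : ∀ a b : ℕ, 1 ≤ a → 1 ≤ b → T a + T b ≤ T (a + b))
    (P : Cmd) (hP : IsObliviousSort P T)
    (ε : ℝ) (hε₀ : 0 < ε) (hε₁ : ε < 1) (K : ℕ) :
    ∃ Q : Cmd,
      (∃ C : ℕ, ∀ n m s : ℕ, 1 ≤ n → (n : ℝ) ≤ (1 - ε) * m → m ≤ K * n →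
        ObliviousWithin Q (cuckooConfigs n m s) (C * T (n + s))) ∧
      (∀ α : ℕ, ∃ D : ℝ, ∀ n m : ℕ, 1 ≤ n → (n : ℝ) ≤ (1 - ε) * m → m ≤ K * n →
        uniformProb {h : HashValues n m | ¬ ConstructsScheme Q h} ≤ D / (n : ℝ) ^ α) := by
  obtain ⟨c, hc⟩ := exists_good ε hε₀ hε₁
  obtain ⟨C, hC⟩ := mainProgram_cost hT (one_le_of_sort hP) (c + 1) K
  refine ⟨(mainProgram (c + 1)).program P, ⟨C, fun n m s hn _ hm =>
    obliviousWithin_program hP _ (mainProgram_wf _) n m s _ (hC n m s hn hm)⟩, fun α => ?_⟩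
  obtain ⟨D, hD⟩ := hc α
  refine ⟨D, fun n m hn hm _ => le_trans ?_ (hD n m hn hm)⟩
  unfold uniformProb
  gcongr
  · exact Set.toFinite _
  · exact constructsScheme_of_good hP c hn
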